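/- **Setting.** Let $\alpha\in\mathbb{N}$, $\alpha\ge 1$, and $\tau>0$. Let $\Gamma$ be a connected compact metric graph with finitely many vertices and finitely many edges, each edge $e$ identified with $[0,\ell_e]$, $0<\ell_e<\infty$ (loops and multiple edges are allowed). Let $a:\Gamma\to\mathbb{R}$ be positive and Lipschitz, and let $\kappa\in L^\infty(\Gamma)$ with $\operatorname{ess\,inf}\kappa>0$; if $\alpha\ge 3$, assume moreover that on each edge $\kappa_e\in C^{\alpha-3,1}([0,\ell_e])$ and $a_e\in C^{\alpha-2,1}([0,\ell_e])$. On each edge put $Lf=-(a_ef')'+\kappa_e^2f$, and let $L$ also denote the self-adjoint operator in $L_2(\Gamma)=\bigoplus_e L_2(0,\ell_e)$ with domain the functions that are in $H^2$ on each edge, continuous on $\Gamma$, and whose outward derivatives sum to $0$ at every vertex. Powers of $L$ are taken in the spectral sense, and $\dot H^s_L(\Gamma)=D(L^{s/2})$. Let $\mathcal W$ be Gaussian white noise on $L_2(\Gamma)$ and let $u$ be a generalized Whittle–Matérn field, i.e. a measurable, square integrable, mean-square continuous random field on $\Gamma$ solving $L^{\alpha/2}(\tau u)=\mathcal W$, in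 the sense that $(\tau u,L^{\alpha/2}\varphi)_{L_2(\Gamma)}=\mathcal W(\varphi)$ a.s. for all $\varphi\in D(L^{\alpha/2})$. Let $H(\Gamma)$ be the closed span in $L_2(\Omega)$ of the variables $u(s)$, $s\in\Gamma$. A curve $X:[0,\ell_e]\to H(\Gamma)$ has weak derivative $X'(t)\in H(\Gamma)$ in the $L_2(\Omega)$ sense if $\mathbb{E}\big[w\,(X(r)-X(t))/(r-t)\big]\to\mathbb{E}[wX'(t)]$ as $r\to t$ for all $w\in H(\Gamma)$; higher derivatives are defined inductively. Fix an edge $e$. For a sufficiently differentiable function or field $f$ on $e$ put $$B^\alpha f=\big(f(0),f'(0),\dots,f^{(\alpha-1)}(0),f(\ell_e),f'(\ell_e),\dots,f^{(\alpha-1)}(\ell_e)\big)^\top,$$ with weak $L_2(\Omega)$ derivatives for fields, and let $\mathcal F^u_{\alpha,I}(\partial e)$ be the $\sigma$-algebra generated by $u_e^{(k)}(s)$, $0\le k\le\alpha-1$, $s\in\{0,\ell_e\}$ (derivatives taken along $e$). Let $\dot H^\alpha_{0,L}(e)$ be the closure in $H^\alpha(0,\ell_e)$ of the set $C_c(e)\cap\dot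 H^\alpha_L(e)$ of restrictions to $e$ of elements of $\dot H^\alpha_L(\Gamma)$ which on $e$ are continuous with compact support in the open edge, and let $(\cdot,\cdot)_{\alpha,e}$ be the continuous bilinear form on $\dot H^\alpha_{0,L}(e)$ with $(f,g)_{\alpha,e}=(f,L^\alpha g)_{L_2(e)}$ for $g\in C_c(e)\cap\dot H^{2\alpha}_L(e)$. **Theorem.** There exist linearly independent functions $G_1,\dots,G_{2\alpha}\in H^\alpha(0,\ell_e)$ with $L^\alpha G_j=0$ on $e$ and $B^\alpha G_j=e_j$ (the $j$th canonical vector), such that the following holds. The field $u_e$ has weak $L_2(\Omega)$ derivatives of orders $1,\dots,\alpha-1$ on $[0,\ell_e]$, weakly continuous together with $u_e$, and there is a centred Gaussian field $v_{\alpha,0}$ on $[0,\ell_e]$ such that for every $t\in[0,\ell_e]$, almost surely, $$u_e(t)=v_{\alpha,0}(t)+\sum_{j=1}^{2\alpha}G_j(t)\,(B^\alpha u_e)_j=v_{\alpha,0}(t)+\mathbf G(t)^\top B^\alpha u_e .$$ Here: 1. $B^\alpha u_e$ is $\mathcal F^u_{\alpha,I}(\partial e)$-measurable. 2. The form $(\cdot,\cdot)_{\alpha,e}$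 exists, and the Cameron–Martin space of $v_{\alpha,0}$ is $\dot H^\alpha_{0,L}(e)$ with inner product $\tau^2(\cdot,\cdot)_{\alpha,e}$ (so $(\cdot,\cdot)_{\alpha,e}$ if $\tau=1$). 3. $v_{\alpha,0}$ is independent of $\mathcal F^u_{\alpha,I}(\partial e)$. 4. $v_{\alpha,0}$ takes values in $H(\Gamma)$, is $\alpha-1$ times weakly differentiable in the $L_2(\Omega)$ sense, and $v_{\alpha,0}$ and these derivatives are weakly continuous in the $L_2(\Omega)$ sense. 5. $B^\alpha v_{\alpha,0}=\mathbf 0$. 6. The functions $G_j$ and the law $\nu$ of $v_{\alpha,0}$ can be chosen to depend only on $\alpha$, $\tau$, $\ell_e$, $a_e$ and $\kappa_e$, not on the rest of the graph. Consequently, for all $t_1,\dots,t_n\in[0,\ell_e]$, the conditional law of $(u_e(t_1),\dots,u_e(t_n))$ given $B^\alpha u_e=y$ is, for almost every $y$ with respect to the law of $B^\alpha u_e$, the law of $\big(x(t_i)+\mathbf G(t_i)^\top y\big)_{i\le n}$ with $x$ distributed according to $\nu$; in particular it does not depend on the rest of the graph. -/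

import Mathlib

open MeasureTheory ProbabilityTheory Set Filter Topology
open scoped NNReal ENNReal InnerProductSpace

noncomputable section

namespace GraphField

/-! ### Sobolev spaces on an interval `[0, ℓ]` -/

/-- `f` belongs to the Sobolev space `H^k(0, ℓ)`. For `k ≥ 1` the function `f` is the (absolutely)
continuous representative: `f t = f 0 + ∫_0^t g` on `[0, ℓ]` with `g` in `H^{k-1}(0, ℓ)`. Only the
values of `f` on `[0, ℓ]` matter. -/
def MemSobolev : ℕ → ℝ → (ℝ → ℝ) → Prop
  | 0, ℓ, f => MemLp f 2 (volume.restrict (Icc 0 ℓ))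
  | k + 1, ℓ, f => ∃ g : ℝ → ℝ, MemSobolev k ℓ g ∧
      ∀ t ∈ Icc (0 : ℝ) ℓ, f t = f 0 + ∫ s in (0 : ℝ)..t, g s

/-- The norm of `H^k(0, ℓ)`. For `f` in `H^k(0, ℓ)` the derivatives of order `< k` exist at every
point of `[0, ℓ]` and the one of order `k` exists almost everywhere. -/
def sobolevNorm (k : ℕ) (ℓ : ℝ) (f : ℝ → ℝ) : ℝ :=
  Real.sqrt (∑ j ∈ Finset.range (k + 1),
    ∫ t in (0 : ℝ)..ℓ, (iteratedDerivWithin j f (Icc 0 ℓ) t) ^ 2)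

/-- `f` is of class `C^{k,1}` on `[0, ℓ]`: `k` continuous derivatives, the `k`-th one Lipschitz. -/
def IsCkLipschitz (k : ℕ) (ℓ : ℝ) (f : ℝ → ℝ) : Prop :=
  ContDiffOn ℝ k f (Icc 0 ℓ) ∧
    ∃ K : ℝ≥0, LipschitzOnWith K (iteratedDerivWithin k f (Icc 0 ℓ)) (Icc 0 ℓ)

/-- Index set of the `2α` boundary data of an edge: `inl k` is the `k`-th derivative at `0`,
`inr k` is the `k`-th derivative at `ℓ`. -/
abbrev BdryIndex (α : ℕ) : Type := Fin α ⊕ Fin α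

/-- The boundary operator `B^α` on functions:
`(f(0), …, f^{(α-1)}(0), f(ℓ), …, f^{(α-1)}(ℓ))`. -/
def bdryData (α : ℕ) (ℓ : ℝ) (f : ℝ → ℝ) : BdryIndex α → ℝ
  | Sum.inl k => iteratedDerivWithin k f (Icc 0 ℓ) 0
  | Sum.inr k => iteratedDerivWithin k f (Icc 0 ℓ) ℓ

/-! ### The differential operator on an edge -/

/-- Assumptions on the coefficients on an edge `[0, ℓ]` for the exponent `α`: `κ` is bounded and
essentially bounded below by a positive constant, `a` is positive and Lipschitz and, if `α ≥ 3`,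
`κ` is of class `C^{α-3,1}` and `a` of class `C^{α-2,1}`. -/
structure EdgeCoeff (α : ℕ) (ℓ : ℝ) (a κ : ℝ → ℝ) : Prop where
  kappa_bdd : MemLp κ ∞ (volume.restrict (Icc 0 ℓ))
  kappa_pos : ∃ κ₀ : ℝ, 0 < κ₀ ∧ ∀ᵐ t ∂(volume.restrict (Icc 0 ℓ)), κ₀ ≤ κ t
  a_lip : ∃ K : ℝ≥0, LipschitzOnWith K a (Icc 0 ℓ)
  a_pos : ∀ t ∈ Icc (0 : ℝ) ℓ, 0 < a t
  kappa_reg : 3 ≤ α → IsCkLipschitz (α - 3) ℓ κ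
  a_reg : 3 ≤ α → IsCkLipschitz (α - 2) ℓ a

/-- `f` belongs to `H^2(0, ℓ)` and `L f = -(a f')' + κ² f = g` almost everywhere on `[0, ℓ]`. -/
def EdgeOp (ℓ : ℝ) (a κ : ℝ → ℝ) (f g : ℝ → ℝ) : Prop :=
  MemSobolev 2 ℓ f ∧ MemSobolev 0 ℓ g ∧
    ∀ᵐ t ∂(volume.restrict (Icc 0 ℓ)),
      g t = -(derivWithin (fun s => a s * derivWithin f (Icc 0 ℓ) s) (Icc 0 ℓ) t)
        + κ t ^ 2 * f t

/-- `L^n f = g` on the edge, for the differential operator `L` without boundary conditions: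
`f, L f, …, L^{n-1} f` all belong to `H^2(0, ℓ)` and `L^n f = g` almost everywhere. -/
def EdgePow (ℓ : ℝ) (a κ : ℝ → ℝ) : ℕ → (ℝ → ℝ) → (ℝ → ℝ) → Prop
  | 0, f, g => f =ᵐ[volume.restrict (Icc 0 ℓ)] g
  | n + 1, f, g => ∃ h : ℝ → ℝ, EdgeOp ℓ a κ f h ∧ EdgePow ℓ a κ n h g

/-! ### Compact metric graphs -/

/-- A compact metric graph (with finitely many vertices `V` and edges `E`): the edge `e` is a copy
of `[0, len e]` which starts at the vertex `src e` and ends at `tgt e`. Loops and multiple edges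
are allowed; the graph is connected. -/
structure MetricGraph (V E : Type*) where
  src : E → V
  tgt : E → V
  len : E → ℝ
  len_pos : ∀ e, 0 < len e
  connected : ∀ v w : V, Relation.EqvGen (fun x y => ∃ e, src e = x ∧ tgt e = y) v w

namespace MetricGraph

variable {V E : Type*} (Γ : MetricGraph V E)

/-- A family of functions on the edges is a function on the graph: it has one value at each
vertex. -/
def VertexCompatible {β : Type*} (f : E → ℝ → β) : Prop :=
  ∃ c : V → β, ∀ e, f e 0 = c (Γ.src e) ∧ f e (Γ.len e) = c (Γ.tgt e)

/-- Assumptions on the coefficients on the graph. A function which is single valued at the vertices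
is Lipschitz for the geodesic metric iff it is Lipschitz on every edge. -/
def Coeff (α : ℕ) (a κ : E → ℝ → ℝ) : Prop :=
  Γ.VertexCompatible a ∧ ∀ e, EdgeCoeff α (Γ.len e) (a e) (κ e)

variable [Fintype E]

/-- `L_2(Γ)`, the Hilbert direct sum of the spaces `L_2(0, len e)`. -/
abbrev L2 : Type _ :=
  PiLp 2 (fun e : E => Lp ℝ 2 (volume.restrict (Icc 0 (Γ.len e)) : Measure ℝ))

open Classical in
/-- Kirchhoff condition: at every vertex the outward directional derivatives sum to zero. -/
def Kirchhoff (f : E → ℝ → ℝ) : Prop :=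
  ∀ v : V, ∑ e : E,
    ((if Γ.src e = v then derivWithin (f e) (Icc 0 (Γ.len e)) 0 else 0)
      - (if Γ.tgt e = v then derivWithin (f e) (Icc 0 (Γ.len e)) (Γ.len e) else 0)) = 0

/-- The graph of the operator `L` in `L_2(Γ)`: `f` lies in `D(L)` (it is in `H^2` on every edge,
continuous on the graph and satisfies the Kirchhoff conditions) and `L f = g`. -/
def Op (a κ : E → ℝ → ℝ) (f g : Γ.L2) : Prop :=
  ∃ F : E → ℝ → ℝ,
    (∀ e, F e =ᵐ[volume.restrict (Icc 0 (Γ.len e))] (f e : ℝ → ℝ)) ∧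
    (∀ e, EdgeOp (Γ.len e) (a e) (κ e) (F e) (g e : ℝ → ℝ)) ∧
    Γ.VertexCompatible F ∧ Γ.Kirchhoff F

/-- `L^s f = g` in the spectral sense: `(g, φ) = λ^s (f, φ)` for every eigenpair `L φ = λ φ`.
(As `L` has a complete orthonormal system of eigenvectors `e_k` with eigenvalues `λ_k > 0`, this
says `g = ∑ λ_k^s (f, e_k) e_k`.) -/
def SpectralPow (a κ : E → ℝ → ℝ) (s : ℝ) (f g : Γ.L2) : Prop :=
  ∀ (lam : ℝ) (φ : Γ.L2), Γ.Op a κ φ (lam • φ) → ⟪g, φ⟫_ℝ = lam ^ s * ⟪f, φ⟫_ℝ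

/-- The space `Ḣ^s_L(Γ) = D(L^{s/2})`; that is, `∑ λ_k^s (f, e_k)² < ∞`. -/
def MemHdot (a κ : E → ℝ → ℝ) (s : ℝ) (f : Γ.L2) : Prop :=
  ∃ g : Γ.L2, Γ.SpectralPow a κ (s / 2) f g

/-- `f` is continuous on the edge `e`, with compact support in the interior of `e`, and is the
restriction to `e` of an element of `Ḣ^s_L(Γ)`; that is, `f ∈ C_c(e) ∩ Ḣ^s_L(e)`. -/
def MemHdotCompact (a κ : E → ℝ → ℝ) (s : ℝ) (e : E) (f : ℝ → ℝ) : Prop :=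
  ContinuousOn f (Icc 0 (Γ.len e)) ∧
  (∃ δ > 0, ∀ t ∈ Icc 0 (Γ.len e), t < δ ∨ Γ.len e - δ < t → f t = 0) ∧
  ∃ g : Γ.L2, Γ.MemHdot a κ s g ∧
    f =ᵐ[volume.restrict (Icc 0 (Γ.len e))] (g e : ℝ → ℝ)

/-- The space `Ḣ^α_{0,L}(e)`, the completion of `C_c(e) ∩ Ḣ^α_L(e)` for the norm of `H^α(e)`,
realised as its closure in `H^α(e)`. -/
def MemHdotZero (a κ : E → ℝ → ℝ) (α : ℕ) (e : E) (f : ℝ → ℝ) : Prop :=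
  MemSobolev α (Γ.len e) f ∧
  ∀ ε > 0, ∃ φ : ℝ → ℝ, Γ.MemHdotCompact a κ α e φ ∧ MemSobolev α (Γ.len e) φ ∧
    sobolevNorm α (Γ.len e) (fun t => f t - φ t) < ε

/-- `b` is a form `(·,·)_{α,e}` on `Ḣ^α_{0,L}(e)`: a bilinear form, continuous for the norm of
`H^α(e)`, with `b f g = (f, L^α g)_{L_2(e)}` if `g ∈ C_c(e) ∩ Ḣ^{2α}_L(e)`. -/
structure IsEdgeForm (a κ : E → ℝ → ℝ) (α : ℕ) (e : E) (b : (ℝ → ℝ) → (ℝ → ℝ) → ℝ) : Prop where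
  lin_left : ∀ f₁ f₂ g : ℝ → ℝ, ∀ r : ℝ, Γ.MemHdotZero a κ α e f₁ → Γ.MemHdotZero a κ α e f₂ →
    Γ.MemHdotZero a κ α e g → b (fun t => r * f₁ t + f₂ t) g = r * b f₁ g + b f₂ g
  lin_right : ∀ f g₁ g₂ : ℝ → ℝ, ∀ r : ℝ, Γ.MemHdotZero a κ α e f → Γ.MemHdotZero a κ α e g₁ →
    Γ.MemHdotZero a κ α e g₂ → b f (fun t => r * g₁ t + g₂ t) = r * b f g₁ + b f g₂
  bounded : ∃ C : ℝ, ∀ f g : ℝ → ℝ, Γ.MemHdotZero a κ α e f → Γ.MemHdotZero a κ α e g →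
    |b f g| ≤ C * sobolevNorm α (Γ.len e) f * sobolevNorm α (Γ.len e) g
  extends_core : ∀ f g : ℝ → ℝ, Γ.MemHdotZero a κ α e f →
    Γ.MemHdotCompact a κ (2 * α) e g →
    ∃ h : ℝ → ℝ, EdgePow (Γ.len e) (a e) (κ e) α g h ∧
      b f g = ∫ t in (0 : ℝ)..(Γ.len e), f t * h t

end MetricGraph

/-! ### Gaussian spaces and random fields -/

section Prob

variable {Ω : Type*} [MeasurableSpace Ω] (P : Measure Ω)

open Classical in
/-- The class of a random variable in `L_2(Ω)` (used only for square integrable ones). -/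
def toL2 (X : Ω → ℝ) : Lp ℝ 2 P :=
  if h : MemLp X 2 P then h.toLp X else 0

variable {P}

/-- The closed linear span in `L_2(Ω)` of a family of random variables. -/
def gaussianSpace {ι : Type*} (X : ι → Lp ℝ 2 P) : Submodule ℝ (Lp ℝ 2 P) :=
  (Submodule.span ℝ (range X)).topologicalClosure

/-- The function `i ↦ E(X_i w)`. -/
def cmFun {ι : Type*} (X : ι → Lp ℝ 2 P) (w : Lp ℝ 2 P) : ι → ℝ :=
  fun i => ⟪X i, w⟫_ℝ

/-- The Cameron–Martin space of a centred Gaussian field: the functions `i ↦ E(X_i w)` with `w` in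
the Gaussian space. Its inner product is `⟨cmFun X w₁, cmFun X w₂⟩ = E(w₁ w₂)`. -/
def cameronMartin {ι : Type*} (X : ι → Lp ℝ 2 P) : Set (ι → ℝ) :=
  cmFun X '' (gaussianSpace X : Set (Lp ℝ 2 P))

/-- `X : [0, ℓ] → H` has weak derivatives `D 1, …, D n` in the `L_2(Ω)` sense, with values in the
Gaussian space `H`, and `X = D 0, D 1, …, D n` are weakly continuous: difference quotients and
limits are tested against every `w ∈ H`. -/
structure HasWeakDerivs (H : Submodule ℝ (Lp ℝ 2 P)) (ℓ : ℝ) (n : ℕ)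
    (X : ℝ → Lp ℝ 2 P) (D : ℕ → ℝ → Lp ℝ 2 P) : Prop where
  zero : ∀ t ∈ Icc (0 : ℝ) ℓ, D 0 t = X t
  mem : ∀ k ≤ n, ∀ t ∈ Icc (0 : ℝ) ℓ, D k t ∈ H
  deriv : ∀ k < n, ∀ t ∈ Icc (0 : ℝ) ℓ, ∀ w ∈ H,
    HasDerivWithinAt (fun r => ⟪w, D k r⟫_ℝ) ⟪w, D (k + 1) t⟫_ℝ (Icc 0 ℓ) t
  cont : ∀ k ≤ n, ∀ w ∈ H, ContinuousOn (fun t => ⟪w, D k t⟫_ℝ) (Icc 0 ℓ)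

/-- The boundary vector `B^α` of a curve with weak derivatives `D`. -/
def bdryVec (α : ℕ) (ℓ : ℝ) (D : ℕ → ℝ → Lp ℝ 2 P) : BdryIndex α → Lp ℝ 2 P
  | Sum.inl k => D k 0
  | Sum.inr k => D k ℓ

/-- The `σ`-algebra of the inner boundary of an edge, generated by the weak derivatives of order
`0, …, α - 1` along the edge at its two end points. -/
@[reducible]
def innerSigma (α : ℕ) (ℓ : ℝ) (D : ℕ → ℝ → Lp ℝ 2 P) : MeasurableSpace Ω :=
  ⨆ k : Fin α, ⨆ s ∈ ({0, ℓ} : Set ℝ),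
    MeasurableSpace.comap (D k s : Ω → ℝ) inferInstance

namespace MetricGraph

variable {V E : Type*} [Fintype E] (Γ : MetricGraph V E)

/-- Gaussian white noise on `L_2(Γ)`: centred Gaussian variables with
`E(W(h) W(g)) = (h, g)_{L_2(Γ)}`. -/
structure IsWhiteNoise (P : Measure Ω) (W : Γ.L2 → Ω → ℝ) : Prop where
  gaussian : ∀ h, HasGaussianLaw (W h) P
  mean : ∀ h, ∫ ω, W h ω ∂P = 0
  cov : ∀ h g, ∫ ω, W h ω * W g ω ∂P = ⟪h, g⟫_ℝ

/-- `u` is a generalized Whittle–Matérn field: a square integrable, measurable random field on `Γ`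
which is continuous in `L_2(Ω)` and solves `L^{α/2} (τ u) = W`, that is
`(τ u, L^{α/2} φ)_{L_2(Γ)} = W(φ)` almost surely for every `φ ∈ D(L^{α/2})`. -/
structure IsWhittleMatern (a κ : E → ℝ → ℝ) (τ α : ℝ) (P : Measure Ω) (W : Γ.L2 → Ω → ℝ)
    (u : E → ℝ → Ω → ℝ) : Prop where
  vertex : Γ.VertexCompatible u
  memLp : ∀ e, ∀ t ∈ Icc 0 (Γ.len e), MemLp (u e t) 2 P
  meas : ∀ e, AEMeasurable (fun p : ℝ × Ω => u e p.1 p.2)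
    ((volume.restrict (Icc 0 (Γ.len e))).prod P)
  cont : ∀ e, ContinuousOn (fun t => toL2 P (u e t)) (Icc 0 (Γ.len e))
  solves : ∀ φ ψ : Γ.L2, Γ.SpectralPow a κ (α / 2) φ ψ →
    ∀ᵐ ω ∂P, ∑ e, ∫ t in (0 : ℝ)..(Γ.len e), τ * u e t ω * (ψ e : ℝ → ℝ) t = W φ ω

/-- The Gaussian space `H(Γ)` of a field on `Γ`. -/
def fieldSpace (P : Measure Ω) (u : E → ℝ → Ω → ℝ) : Submodule ℝ (Lp ℝ 2 P) :=
  gaussianSpace (fun s : (e : E) × Icc 0 (Γ.len e) => toL2 P (u s.1 s.2))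

end MetricGraph

end Prob

end GraphField

end

open MeasureTheory ProbabilityTheory Set Filter Topology
open scoped NNReal ENNReal InnerProductSpace

noncomputable section

namespace GraphField

/-! ### Absolutely continuous functions with square integrable derivative -/

/-! Put `B = L^{-1/2}`. White noise is an isometry `J` from `L_2(Γ)` onto a space of centred
Gaussian variables. The equation for `u` says that `u_e(t) = τ⁻¹ J(T 0 t)`, where `T k t` is the
Riesz representative of the functional `φ ↦ (B^α φ)^{(k)}(t)` on the edge. Every probabilistic claim
thereby becomes a statement of Hilbert space geometry in `L_2(Γ)`: independence is orthogonality, a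
Gaussian space is a closed subspace, and weak derivatives are derivatives of `B^α φ`.

The decisive subspace is `bridgeSpace`: all `φ` such that `B^α φ` vanishes off `e` and is an `H^α`
function with zero boundary data on `e`. The elements giving the boundary data of `u` are orthogonal
to it by construction. The bridge element `T 0 t - ∑ G_j(t) (boundary element j)` lies in it
(`bridgeElt_mem`). Indeed, if `ψ` is orthogonal to `bridgeSpace`, then `B^α ψ` on `e` is orthogonal
to `L^α q` for every compactly supported `q`. It is therefore a solution of `L^α x = 0`
(`exists_homogeneous_of_orthogonal`), and since such solutions are determined by their boundary data
it equals `∑ (boundary datum j) G_j`. This is a Markov property along the edge. The bridge field is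
`J` applied to these elements times `τ⁻¹`; they span `bridgeSpace` (`span_bridgeElt`), which gives
the Cameron–Martin space. Its inner product is the edge form, because `⟪φ, B^α η⟫` is the integral
of `B^α φ` against `η = L^α q` (`inner_core`) and compactly supported `q` are dense
(`exists_core_approx`).

The covariance of the bridge is a reproducing kernel characterised by conditions on the edge alone
(`IsBridgeKernel`), so its law does not see the rest of the graph. The conditional law then follows
from independence.

The coefficients are too rough to expand `L^α f` in ordinary derivatives. The proof works with the
quasi-derivatives `f, a f', L f, a (L f)', …`, which solve a first order system with bounded
coefficients. `exists_change_of_chain` shows that, up to order `α`, they are equivalent to ordinary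
derivatives under exactly the regularity assumed. Green's identity in quasi-derivatives
(`green_partial`) yields uniqueness for the Dirichlet problem, and hence the functions `G_j`. On the
graph, `L` is inverted by a finite-dimensional matching argument and an energy estimate, `B` comes
from the spectral theorem for the compact inverse, and extension by zero from the edge is shown to
land in the range of `B^α` (`exists_preimage`). -/

/-- Lebesgue measure on the edge `[0, ℓ]`. -/
abbrev edgeVol (ℓ : ℝ) : Measure ℝ := volume.restrict (Icc 0 ℓ)

/-- `f` is absolutely continuous on `[0, ℓ]` with derivative `g` in `L_2`. -/
def HasL2Deriv (ℓ : ℝ) (f g : ℝ → ℝ) : Prop :=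
  MemLp g 2 (edgeVol ℓ) ∧ ∀ t ∈ Icc (0 : ℝ) ℓ, f t = f 0 + ∫ s in (0 : ℝ)..t, g s

section Calculus

variable {ℓ : ℝ} {f g f₁ g₁ f₂ g₂ : ℝ → ℝ}

theorem intervalIntegrable_of_memLp (hg : MemLp g 2 (edgeVol ℓ)) {s t : ℝ}
    (hs : s ∈ Icc 0 ℓ) (ht : t ∈ Icc 0 ℓ) : IntervalIntegrable g volume s t := by
  have h1 : IntegrableOn g (Icc 0 ℓ) := hg.integrable (by norm_num)
  refine (h1.mono_set ?_).intervalIntegrable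
  exact uIcc_subset_Icc hs ht

theorem memLp_two_of_top (hg : MemLp g ∞ (edgeVol ℓ)) : MemLp g 2 (edgeVol ℓ) :=
  hg.mono_exponent le_top

theorem ContinuousOn.memLp_top_edge (hf : ContinuousOn f (Icc 0 ℓ)) : MemLp f ∞ (edgeVol ℓ) := by
  obtain ⟨C, hC⟩ := isCompact_Icc.exists_bound_of_continuousOn hf
  refine memLp_top_of_bound (hf.aestronglyMeasurable measurableSet_Icc) C ?_
  exact (ae_restrict_iff' measurableSet_Icc).2 (Eventually.of_forall hC)

theorem ContinuousOn.memLp_two_edge (hf : ContinuousOn f (Icc 0 ℓ)) : MemLp f 2 (edgeVol ℓ) :=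
  memLp_two_of_top (ContinuousOn.memLp_top_edge hf)

theorem integral_congr_edge (h : g₁ =ᵐ[edgeVol ℓ] g₂) {s t : ℝ} (hs : s ∈ Icc 0 ℓ)
    (ht : t ∈ Icc 0 ℓ) : ∫ x in s..t, g₁ x = ∫ x in s..t, g₂ x := by
  refine intervalIntegral.integral_congr_ae ?_
  have := (ae_restrict_iff' measurableSet_Icc).1 h
  filter_upwards [this] with x hx hxs
  exact hx (uIcc_subset_Icc hs ht (uIoc_subset_uIcc hxs))

/-- The end points are null. In the open interval one-sided derivatives are two-sided and local
arguments apply. -/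
theorem ae_edge_iff_Ioo {p : ℝ → Prop} :
    (∀ᵐ t ∂edgeVol ℓ, p t) ↔ ∀ᵐ t, t ∈ Ioo 0 ℓ → p t := by
  rw [← ae_restrict_iff' measurableSet_Ioo, edgeVol, ← restrict_Ioo_eq_restrict_Icc]

/-- Two continuous functions on the edge which agree almost everywhere agree. -/
theorem eqOn_of_ae_eq (hℓ : 0 < ℓ) (hf : ContinuousOn f₁ (Icc 0 ℓ)) (hg : ContinuousOn f₂ (Icc 0 ℓ))
    (h : f₁ =ᵐ[edgeVol ℓ] f₂) : EqOn f₁ f₂ (Icc 0 ℓ) :=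
  Measure.eqOn_Icc_of_ae_eq volume hℓ.ne h hf hg

namespace HasL2Deriv

theorem memLp (h : HasL2Deriv ℓ f g) : MemLp g 2 (edgeVol ℓ) := h.1

theorem eq (h : HasL2Deriv ℓ f g) {t : ℝ} (ht : t ∈ Icc 0 ℓ) :
    f t = f 0 + ∫ s in (0 : ℝ)..t, g s := h.2 t ht

theorem congr (h : HasL2Deriv ℓ f₁ g₁) (hf : EqOn f₁ f₂ (Icc 0 ℓ)) (hg : g₁ =ᵐ[edgeVol ℓ] g₂) :
    HasL2Deriv ℓ f₂ g₂ := by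
  refine ⟨(memLp_congr_ae hg).1 h.1, fun t ht => ?_⟩
  have h0 : (0 : ℝ) ∈ Icc 0 ℓ := ⟨le_rfl, ht.1.trans ht.2⟩
  rw [← hf ht, ← hf h0, h.2 t ht, integral_congr_edge hg h0 ht]

theorem absolutelyContinuous (h : MemLp g 2 (edgeVol ℓ)) {t c : ℝ} (ht : t ∈ Icc 0 ℓ) :
    AbsolutelyContinuousOnInterval (fun t => c + ∫ s in (0 : ℝ)..t, g s) 0 t := by
  have h0 : (0 : ℝ) ∈ Icc 0 ℓ := ⟨le_rfl, ht.1.trans ht.2⟩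
  have h1 : AbsolutelyContinuousOnInterval (fun _ : ℝ => c) 0 t :=
    ((LipschitzWith.const c).lipschitzOnWith).absolutelyContinuousOnInterval
  exact h1.add ((intervalIntegrable_of_memLp h h0 ht).absolutelyContinuousOnInterval_intervalIntegral
    (by simp))

theorem continuousOn (h : HasL2Deriv ℓ f g) : ContinuousOn f (Icc 0 ℓ) := by
  rcases le_or_gt 0 ℓ with h0 | h0
  · have h1 := (absolutelyContinuous (c := f 0) h.1 (right_mem_Icc.2 h0)).continuousOn
    rw [uIcc_of_le h0] at h1
    exact h1.congr fun t ht => h.2 t ht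
  · simp [h0]

theorem memLp_top (h : HasL2Deriv ℓ f g) : MemLp f ∞ (edgeVol ℓ) :=
  ContinuousOn.memLp_top_edge h.continuousOn

theorem memLp_two (h : HasL2Deriv ℓ f g) : MemLp f 2 (edgeVol ℓ) :=
  ContinuousOn.memLp_two_edge h.continuousOn

theorem ae_hasDerivAt (h : HasL2Deriv ℓ f g) : ∀ᵐ t ∂edgeVol ℓ, HasDerivAt f (g t) t := by
  rcases le_or_gt 0 ℓ with h0 | h0
  · rw [ae_edge_iff_Ioo]
    have h1 := (intervalIntegrable_of_memLp h.1 (left_mem_Icc.2 h0)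
      (right_mem_Icc.2 h0)).ae_hasDerivAt_integral
    filter_upwards [h1] with t ht hts
    have h2 := (ht (by rw [uIcc_of_le h0]; exact Ioo_subset_Icc_self hts) 0 (by simp)).const_add (f 0)
    refine h2.congr_of_eventuallyEq ?_
    filter_upwards [Icc_mem_nhds hts.1 hts.2] with s hs using h.2 s hs
  · simp [edgeVol, h0]

theorem ae_derivWithin (h : HasL2Deriv ℓ f g) :
    ∀ᵐ t ∂edgeVol ℓ, derivWithin f (Icc 0 ℓ) t = g t := by
  have h1 := ae_edge_iff_Ioo.1 h.ae_hasDerivAt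
  rw [ae_edge_iff_Ioo]
  filter_upwards [h1] with t ht hts
  rw [derivWithin_of_mem_nhds (Icc_mem_nhds hts.1 hts.2), (ht hts).deriv]

/-- The derivative is determined by the almost everywhere class of the function. -/
theorem deriv_unique (h₁ : HasL2Deriv ℓ f₁ g₁) (h₂ : HasL2Deriv ℓ f₂ g₂)
    (h : f₁ =ᵐ[edgeVol ℓ] f₂) : g₁ =ᵐ[edgeVol ℓ] g₂ := by
  rcases le_or_gt ℓ 0 with h0 | h0
  · have : edgeVol ℓ = 0 := by
      simp [edgeVol, Measure.restrict_eq_zero, h0]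
    simp [this, Filter.EventuallyEq]
  have he := eqOn_of_ae_eq h0 h₁.continuousOn h₂.continuousOn h
  have e1 := ae_edge_iff_Ioo.1 h₁.ae_hasDerivAt
  have e2 := ae_edge_iff_Ioo.1 h₂.ae_hasDerivAt
  refine ae_edge_iff_Ioo.2 ?_
  filter_upwards [e1, e2] with t ht1 ht2 hts
  refine (ht1 hts).unique ((ht2 hts).congr_of_eventuallyEq ?_)
  filter_upwards [Icc_mem_nhds hts.1 hts.2] with s hs using he hs

theorem const (c : ℝ) : HasL2Deriv ℓ (fun _ => c) (fun _ => 0) :=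
  ⟨by simp, by simp⟩

theorem add (h₁ : HasL2Deriv ℓ f₁ g₁) (h₂ : HasL2Deriv ℓ f₂ g₂) :
    HasL2Deriv ℓ (fun t => f₁ t + f₂ t) (fun t => g₁ t + g₂ t) := by
  refine ⟨h₁.1.add h₂.1, fun t ht => ?_⟩
  have h0 : (0 : ℝ) ∈ Icc 0 ℓ := ⟨le_rfl, ht.1.trans ht.2⟩
  dsimp only
  rw [intervalIntegral.integral_add (intervalIntegrable_of_memLp h₁.1 h0 ht)
    (intervalIntegrable_of_memLp h₂.1 h0 ht), h₁.2 t ht, h₂.2 t ht]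
  ring

theorem const_mul (h : HasL2Deriv ℓ f g) (c : ℝ) :
    HasL2Deriv ℓ (fun t => c * f t) (fun t => c * g t) := by
  refine ⟨h.1.const_mul c, fun t ht => ?_⟩
  dsimp only
  rw [intervalIntegral.integral_const_mul, h.2 t ht]
  ring

theorem neg (h : HasL2Deriv ℓ f g) : HasL2Deriv ℓ (fun t => -f t) (fun t => -g t) := by
  simpa using h.const_mul (-1)

theorem sub (h₁ : HasL2Deriv ℓ f₁ g₁) (h₂ : HasL2Deriv ℓ f₂ g₂) :
    HasL2Deriv ℓ (fun t => f₁ t - f₂ t) (fun t => g₁ t - g₂ t) := by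
  simpa [sub_eq_add_neg] using h₁.add h₂.neg

theorem sum {ι : Type*} (s : Finset ι) {F G : ι → ℝ → ℝ} (h : ∀ i ∈ s, HasL2Deriv ℓ (F i) (G i)) :
    HasL2Deriv ℓ (fun t => ∑ i ∈ s, F i t) (fun t => ∑ i ∈ s, G i t) := by
  classical
  induction s using Finset.induction_on with
  | empty => simpa using const 0
  | insert i s hi ih =>
    simp only [Finset.sum_insert hi]
    exact (h i (by simp)).add (ih fun j hj => h j (by simp [hj]))

/-- Integration by parts for absolutely continuous functions. The boundary terms in Green's identity
and in the weak formulation on the graph all originate here. -/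
theorem integral_mul (h₁ : HasL2Deriv ℓ f₁ g₁) (h₂ : HasL2Deriv ℓ f₂ g₂) {t : ℝ}
    (ht : t ∈ Icc 0 ℓ) :
    ∫ s in (0 : ℝ)..t, (g₁ s * f₂ s + f₁ s * g₂ s) = f₁ t * f₂ t - f₁ 0 * f₂ 0 := by
  have h0 : (0 : ℝ) ∈ Icc 0 ℓ := ⟨le_rfl, ht.1.trans ht.2⟩
  have hs : uIcc 0 t ⊆ Icc 0 ℓ := uIcc_subset_Icc h0 ht
  have := (absolutelyContinuous (c := f₁ 0) h₁.1 ht).integral_deriv_mul_eq_sub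
    (absolutelyContinuous (c := f₂ 0) h₂.1 ht)
  simp only [intervalIntegral.integral_same, add_zero] at this
  rw [h₁.2 t ht, h₂.2 t ht, ← this]
  refine intervalIntegral.integral_congr_ae ?_
  have e1 := (intervalIntegrable_of_memLp h₁.1 h0 ht).ae_hasDerivAt_integral
  have e2 := (intervalIntegrable_of_memLp h₂.1 h0 ht).ae_hasDerivAt_integral
  filter_upwards [e1, e2] with s hs1 hs2 hst
  have hst' := uIoc_subset_uIcc hst
  rw [((hs1 hst' 0 (by simp)).const_add (f₁ 0)).deriv,
    ((hs2 hst' 0 (by simp)).const_add (f₂ 0)).deriv, h₁.2 s (hs hst'), h₂.2 s (hs hst')]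

theorem mul (h₁ : HasL2Deriv ℓ f₁ g₁) (h₂ : HasL2Deriv ℓ f₂ g₂) :
    HasL2Deriv ℓ (fun t => f₁ t * f₂ t) (fun t => g₁ t * f₂ t + f₁ t * g₂ t) := by
  refine ⟨(h₂.memLp_top.mul h₁.1).add (h₂.1.mul h₁.memLp_top), fun t ht => ?_⟩
  rw [h₁.integral_mul h₂ ht]
  ring

theorem of_continuousOn (hg : ContinuousOn g (Icc 0 ℓ))
    (h : ∀ t ∈ Icc 0 ℓ, HasDerivWithinAt f (g t) (Icc 0 ℓ) t) : HasL2Deriv ℓ f g := by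
  refine ⟨ContinuousOn.memLp_two_edge hg, fun t ht => ?_⟩
  have h0 : (0 : ℝ) ∈ Icc 0 ℓ := ⟨le_rfl, ht.1.trans ht.2⟩
  have hs : Icc 0 t ⊆ Icc 0 ℓ := Icc_subset_Icc_right ht.2
  rw [intervalIntegral.integral_eq_sub_of_hasDeriv_right_of_le ht.1
    (fun s hs' => (h s (hs hs')).continuousWithinAt.mono hs) (f' := g)]
  · ring
  · intro s hs'
    have := (h s (hs (Ioo_subset_Icc_self hs'))).mono hs
    exact (this.hasDerivAt (Icc_mem_nhds hs'.1 hs'.2)).hasDerivWithinAt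
  · exact intervalIntegrable_of_memLp (ContinuousOn.memLp_two_edge hg) h0 ht

theorem hasDerivWithinAt (h : HasL2Deriv ℓ f g) (hg : ContinuousOn g (Icc 0 ℓ)) {t : ℝ}
    (ht : t ∈ Icc 0 ℓ) : HasDerivWithinAt f (g t) (Icc 0 ℓ) t := by
  have h0 : (0 : ℝ) ∈ Icc 0 ℓ := ⟨le_rfl, ht.1.trans ht.2⟩
  have : Fact (t ∈ Icc 0 ℓ) := ⟨ht⟩
  have h1 : HasDerivWithinAt (fun u => ∫ x in (0 : ℝ)..u, g x) (g t) (Icc 0 ℓ) t :=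
    intervalIntegral.integral_hasDerivWithinAt_right
      (intervalIntegrable_of_memLp h.1 h0 ht)
      (hg.stronglyMeasurableAtFilter_nhdsWithin measurableSet_Icc t) (hg t ht)
  exact (h1.const_add (f 0)).congr (fun s hs => h.2 s hs) (h.2 t ht)

/-- A Lipschitz function is absolutely continuous, and its derivative is bounded by the Lipschitz
constant. -/
theorem of_lipschitzOnWith {K : ℝ≥0} (h : LipschitzOnWith K f (Icc 0 ℓ)) :
    ∃ g, MemLp g ∞ (edgeVol ℓ) ∧ HasL2Deriv ℓ f g := by
  rcases lt_or_ge ℓ 0 with h0 | h0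
  · exact ⟨0, by simp, by simp, by simp [h0]⟩
  have hac : ∀ t ∈ Icc 0 ℓ, AbsolutelyContinuousOnInterval f 0 t := fun t ht => by
    refine (h.mono ?_).absolutelyContinuousOnInterval
    exact uIcc_subset_Icc (left_mem_Icc.2 h0) ht
  have hb : MemLp (deriv f) ∞ (edgeVol ℓ) := by
    have hm : AEStronglyMeasurable (deriv f) (edgeVol ℓ) := by
      have := (hac ℓ (right_mem_Icc.2 h0)).intervalIntegrable_deriv.aestronglyMeasurable
      rwa [edgeVol, ← restrict_Ioc_eq_restrict_Icc]
    refine memLp_top_of_bound hm K ?_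
    refine ae_edge_iff_Ioo.2 (Eventually.of_forall fun t ht => ?_)
    exact norm_deriv_le_of_lipschitzOn (Icc_mem_nhds ht.1 ht.2) h
  refine ⟨deriv f, hb, memLp_two_of_top hb, fun t ht => ?_⟩
  rw [(hac t ht).integral_deriv_eq_sub]
  ring

end HasL2Deriv

end Calculus

/-! ### The spaces `W^{k,∞}` -/

/-- `f` belongs to `W^{k,∞}(0, ℓ)`, with the same conventions as `MemSobolev`. -/
def WInf : ℕ → ℝ → (ℝ → ℝ) → Prop
  | 0, ℓ, f => MemLp f ∞ (edgeVol ℓ)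
  | k + 1, ℓ, f => ∃ g, WInf k ℓ g ∧ HasL2Deriv ℓ f g

namespace WInf

variable {ℓ : ℝ} {f f₁ f₂ : ℝ → ℝ}

theorem of_succ : ∀ {k : ℕ} {f : ℝ → ℝ}, WInf (k + 1) ℓ f → WInf k ℓ f
  | 0, _, ⟨_, _, h⟩ => h.memLp_top
  | _ + 1, _, ⟨g, hg, h⟩ => ⟨g, of_succ hg, h⟩

theorem mono {j k : ℕ} (hjk : j ≤ k) (h : WInf k ℓ f) : WInf j ℓ f := by
  induction hjk with
  | refl => exact h
  | step _ ih => exact ih h.of_succ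

theorem memLp {k : ℕ} (h : WInf k ℓ f) : MemLp f ∞ (edgeVol ℓ) := h.mono (Nat.zero_le k)

theorem const (c : ℝ) : ∀ k, WInf k ℓ (fun _ => c)
  | 0 => memLp_const c
  | k + 1 => ⟨fun _ => 0, by
      induction k with
      | zero => exact memLp_const 0
      | succ k ih => exact ⟨fun _ => 0, ih, HasL2Deriv.const 0⟩, HasL2Deriv.const c⟩

theorem add : ∀ {k : ℕ} {f₁ f₂ : ℝ → ℝ}, WInf k ℓ f₁ → WInf k ℓ f₂ →
    WInf k ℓ (fun t => f₁ t + f₂ t)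
  | 0, _, _, h₁, h₂ => MemLp.add h₁ h₂
  | _ + 1, _, _, ⟨_, hg₁, h₁⟩, ⟨_, hg₂, h₂⟩ => ⟨_, hg₁.add hg₂, h₁.add h₂⟩

theorem mul : ∀ {k : ℕ} {f₁ f₂ : ℝ → ℝ}, WInf k ℓ f₁ → WInf k ℓ f₂ →
    WInf k ℓ (fun t => f₁ t * f₂ t)
  | 0, _, _, h₁, h₂ => MemLp.mul h₂ h₁
  | _ + 1, _, _, h₁, h₂ => by
    obtain ⟨g₁, hg₁, hd₁⟩ := h₁
    obtain ⟨g₂, hg₂, hd₂⟩ := h₂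
    exact ⟨_, (hg₁.mul (of_succ ⟨g₂, hg₂, hd₂⟩)).add ((of_succ ⟨g₁, hg₁, hd₁⟩).mul hg₂),
      hd₁.mul hd₂⟩

theorem neg {k : ℕ} (h : WInf k ℓ f) : WInf k ℓ (fun t => -f t) := by
  simpa using (const (-1) k).mul h

theorem of_lipschitzOnWith {K : ℝ≥0} (h : LipschitzOnWith K f (Icc 0 ℓ)) : WInf 1 ℓ f :=
  HasL2Deriv.of_lipschitzOnWith h

end WInf

/-! ### Reciprocals and `C^{k,1}` functions in the scale `W^{k,∞}` -/

section

variable {ℓ : ℝ} {f : ℝ → ℝ}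

theorem exists_lower_bound (hf : ContinuousOn f (Icc 0 ℓ)) (hpos : ∀ t ∈ Icc 0 ℓ, 0 < f t) :
    ∃ m > 0, ∀ t ∈ Icc 0 ℓ, m ≤ f t := by
  rcases (Icc (0 : ℝ) ℓ).eq_empty_or_nonempty with h | h
  · exact ⟨1, one_pos, by simp [h]⟩
  · obtain ⟨t, ht, hmin⟩ := isCompact_Icc.exists_isMinOn h hf
    exact ⟨f t, hpos t ht, fun s hs => hmin hs⟩

theorem LipschitzOnWith.inv_edge {K : ℝ≥0} (h : LipschitzOnWith K f (Icc 0 ℓ))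
    (hpos : ∀ t ∈ Icc 0 ℓ, 0 < f t) :
    ∃ K' : ℝ≥0, LipschitzOnWith K' (fun t => (f t)⁻¹) (Icc 0 ℓ) := by
  obtain ⟨m, hm, hmf⟩ := exists_lower_bound h.continuousOn hpos
  refine ⟨⟨K / m ^ 2, by positivity⟩, LipschitzOnWith.of_dist_le_mul fun x hx y hy => ?_⟩
  have h1 := h.dist_le_mul x hx y hy
  have hfx := hpos x hx
  have hfy := hpos y hy
  have e : (f x)⁻¹ - (f y)⁻¹ = -((f x - f y) / (f x * f y)) := by
    field_simp
    ring
  rw [Real.dist_eq] at h1 ⊢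
  rw [e, abs_neg, abs_div, abs_of_pos (mul_pos hfx hfy)]
  have h2 : m ^ 2 ≤ f x * f y := by
    nlinarith [hmf x hx, hmf y hy]
  have h3 : 0 ≤ K * dist x y := by positivity
  calc |f x - f y| / (f x * f y) ≤ (K * dist x y) / m ^ 2 := by gcongr
    _ = K / m ^ 2 * dist x y := by ring

/-- The reciprocal is Lipschitz, so it has some derivative; differentiating `f · f⁻¹ = 1` identifies
it as `-f' f⁻²`. One order less for `f⁻¹`, known by induction, controls this product. -/
theorem WInf.inv {K : ℝ≥0} (hK : LipschitzOnWith K f (Icc 0 ℓ))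
    (hpos : ∀ t ∈ Icc 0 ℓ, 0 < f t) : ∀ {k : ℕ}, WInf k ℓ f → WInf k ℓ (fun t => (f t)⁻¹)
  | 0, _ => by
    obtain ⟨K', hK'⟩ := LipschitzOnWith.inv_edge hK hpos
    exact (WInf.of_lipschitzOnWith hK').memLp
  | k + 1, h => by
    have ih := WInf.inv hK hpos h.of_succ
    obtain ⟨g, hg, hd⟩ := h
    obtain ⟨K', hK'⟩ := LipschitzOnWith.inv_edge hK hpos
    obtain ⟨b, -, hb⟩ := HasL2Deriv.of_lipschitzOnWith hK'
    refine ⟨fun t => -(g t * ((f t)⁻¹ * (f t)⁻¹)), (hg.mul (ih.mul ih)).neg,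
      hb.congr (fun _ _ => rfl) ?_⟩
    have h1 := (hd.mul hb).deriv_unique (HasL2Deriv.const 1) ((ae_restrict_iff' measurableSet_Icc).2
      (Eventually.of_forall fun t ht => mul_inv_cancel₀ (hpos t ht).ne'))
    have h2 : ∀ᵐ t ∂edgeVol ℓ, t ∈ Icc 0 ℓ := ae_restrict_mem measurableSet_Icc
    filter_upwards [h1, h2] with t ht hts
    have hf := (hpos t hts).ne'
    field_simp at ht ⊢
    linarith

theorem IsCkLipschitz.wInf (hℓ : 0 < ℓ) : ∀ {k : ℕ} {f : ℝ → ℝ}, IsCkLipschitz k ℓ f →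
    WInf (k + 1) ℓ f
  | 0, f, ⟨_, K, hK⟩ => WInf.of_lipschitzOnWith (K := K) (by simpa using hK)
  | k + 1, f, ⟨h, K, hK⟩ => by
    have hu : UniqueDiffOn ℝ (Icc 0 ℓ) := uniqueDiffOn_Icc hℓ
    have h1 : ContDiffOn ℝ k (derivWithin f (Icc 0 ℓ)) (Icc 0 ℓ) :=
      ((contDiffOn_succ_iff_derivWithin hu).1 (by exact_mod_cast h)).2.2
    have h2 : DifferentiableOn ℝ f (Icc 0 ℓ) := h.differentiableOn (by simp)
    refine ⟨derivWithin f (Icc 0 ℓ), IsCkLipschitz.wInf hℓ ⟨h1, K, ?_⟩,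
      HasL2Deriv.of_continuousOn h1.continuousOn fun t ht => (h2 t ht).hasDerivWithinAt⟩
    rwa [iteratedDerivWithin_succ'] at hK

end

/-! ### First order systems in chain form -/

/-- `x_k' = c_k x_{k+1} + d_k x_{k-1}` on `[0, ℓ]` for `k < n`, with `x_n` in `L_2`. -/
structure IsSys (ℓ : ℝ) (c d : ℕ → ℝ → ℝ) (n : ℕ) (x : ℕ → ℝ → ℝ) : Prop where
  top : MemLp (x n) 2 (edgeVol ℓ)
  -- For `k = 0` the truncated index `k - 1` is again `0`. This is harmless, because both chains
  -- used below have `d 0 = 0`.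
  deriv : ∀ k < n, HasL2Deriv ℓ (x k) (fun t => c k t * x (k + 1) t + d k t * x (k - 1) t)

/-- `Φ` is a linear combination of the first `k + 1` components with coefficients in `W^{j,∞}`. -/
def IsComb (ℓ : ℝ) (k j : ℕ) (Φ : (ℕ → ℝ → ℝ) → ℝ → ℝ) : Prop :=
  ∃ m : ℕ → ℝ → ℝ, (∀ i, WInf j ℓ (m i)) ∧
    ∀ x t, Φ x t = ∑ i ∈ Finset.range (k + 1), m i t * x i t

namespace IsComb

variable {ℓ : ℝ} {k j : ℕ} {Φ Ψ : (ℕ → ℝ → ℝ) → ℝ → ℝ}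

theorem zero : IsComb ℓ k j (fun _ _ => 0) :=
  ⟨fun _ _ => 0, fun _ => WInf.const 0 j, by simp⟩

theorem add (h₁ : IsComb ℓ k j Φ) (h₂ : IsComb ℓ k j Ψ) :
    IsComb ℓ k j (fun x t => Φ x t + Ψ x t) := by
  obtain ⟨m₁, hm₁, e₁⟩ := h₁
  obtain ⟨m₂, hm₂, e₂⟩ := h₂
  refine ⟨fun i t => m₁ i t + m₂ i t, fun i => (hm₁ i).add (hm₂ i), fun x t => ?_⟩
  simp only [e₁, e₂, add_mul, Finset.sum_add_distrib]

theorem mul_left {r : ℝ → ℝ} (hr : WInf j ℓ r) (h : IsComb ℓ k j Φ) :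
    IsComb ℓ k j (fun x t => r t * Φ x t) := by
  obtain ⟨m, hm, e⟩ := h
  refine ⟨fun i t => r t * m i t, fun i => hr.mul (hm i), fun x t => ?_⟩
  simp only [e, Finset.mul_sum, mul_assoc]

theorem proj {i : ℕ} (hi : i ≤ k) : IsComb ℓ k j (fun x t => x i t) := by
  refine ⟨fun l _ => if l = i then 1 else 0, fun l => WInf.const _ j, fun x t => ?_⟩
  simp [Finset.sum_ite_eq', hi]

theorem sum {ι : Type*} (s : Finset ι) {F : ι → (ℕ → ℝ → ℝ) → ℝ → ℝ}
    (h : ∀ i ∈ s, IsComb ℓ k j (F i)) : IsComb ℓ k j (fun x t => ∑ i ∈ s, F i x t) := by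
  classical
  induction s using Finset.induction_on with
  | empty => simpa using zero
  | insert i s hi ih =>
    simp only [Finset.sum_insert hi]
    exact (h i (by simp)).add (ih fun j hj => h j (by simp [hj]))

theorem mono {k' j' : ℕ} (hk : k ≤ k') (hj : j' ≤ j) (h : IsComb ℓ k j Φ) :
    IsComb ℓ k' j' Φ := by
  obtain ⟨m, hm, e⟩ := h
  have : Φ = fun x t => ∑ i ∈ Finset.range (k + 1), m i t * x i t := by
    funext x t
    exact e x t
  rw [this]
  refine sum _ fun i hi => ((proj ?_).mul_left ((hm i).mono hj))
  have := Finset.mem_range.1 hi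
  omega

end IsComb

/-! ### Chain systems: linearity, uniqueness and change of chain -/

section Systems

variable {ℓ : ℝ} {c d c' d' : ℕ → ℝ → ℝ} {n : ℕ} {x y : ℕ → ℝ → ℝ}

namespace IsSys

theorem memLp (h : IsSys ℓ c d n x) {k : ℕ} (hk : k ≤ n) : MemLp (x k) 2 (edgeVol ℓ) := by
  rcases hk.lt_or_eq with hk | rfl
  · exact (h.deriv k hk).memLp_two
  · exact h.top

theorem continuousOn (h : IsSys ℓ c d n x) {k : ℕ} (hk : k < n) :
    ContinuousOn (x k) (Icc 0 ℓ) := (h.deriv k hk).continuousOn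

theorem lincomb (hx : IsSys ℓ c d n x) (hy : IsSys ℓ c d n y) (r : ℝ) :
    IsSys ℓ c d n (fun k t => r * x k t + y k t) := by
  refine ⟨(hx.top.const_mul r).add hy.top, fun k hk => ?_⟩
  refine (((hx.deriv k hk).const_mul r).add (hy.deriv k hk)).congr (fun _ _ => rfl) ?_
  exact Eventually.of_forall fun t => by ring

theorem sum_smul {ι : Type*} (s : Finset ι) {X : ι → ℕ → ℝ → ℝ} (r : ι → ℝ)
    (h : ∀ i ∈ s, IsSys ℓ c d n (X i)) :
    IsSys ℓ c d n (fun k t => ∑ i ∈ s, r i * X i k t) := by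
  classical
  induction s using Finset.induction_on with
  | empty =>
    refine ⟨by simp, fun k _ => ?_⟩
    simpa using HasL2Deriv.const 0
  | insert i s hi ih =>
    simp only [Finset.sum_insert hi]
    exact (h i (by simp)).lincomb (ih fun j hj => h j (by simp [hj])) (r i)

theorem congr (h : IsSys ℓ c d n x) (he : ∀ k < n, EqOn (x k) (y k) (Icc 0 ℓ))
    (ht : x n =ᵐ[edgeVol ℓ] y n) : IsSys ℓ c d n y := by
  have hae : ∀ k ≤ n, x k =ᵐ[edgeVol ℓ] y k := fun k hk => by
    rcases hk.lt_or_eq with hk | rfl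
    · exact (ae_restrict_iff' measurableSet_Icc).2 (Eventually.of_forall (he k hk))
    · exact ht
  refine ⟨(memLp_congr_ae ht).1 h.top, fun k hk => (h.deriv k hk).congr (he k hk) ?_⟩
  filter_upwards [hae (k + 1) hk, hae (k - 1) (by omega)] with t h1 h2
  rw [h1, h2]

theorem truncate {j : ℕ} (h : IsSys ℓ c d n x) (hj : j ≤ n) : IsSys ℓ c d j x :=
  ⟨h.memLp hj, fun k hk => h.deriv k (hk.trans_le hj)⟩

/-- A solution is determined by its first component. -/
theorem eq_of_zero_eq (hℓ : 0 < ℓ) (hx : IsSys ℓ c d n x) (hy : IsSys ℓ c d n y)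
    (hc : ∀ k < n, ∀ᵐ t ∂edgeVol ℓ, c k t ≠ 0)
    (h0 : x 0 =ᵐ[edgeVol ℓ] y 0) :
    (∀ k < n, EqOn (x k) (y k) (Icc 0 ℓ)) ∧ ∀ k ≤ n, x k =ᵐ[edgeVol ℓ] y k := by
  -- Two neighbouring components are carried along: to solve the equation of `x k` for `x (k + 1)`,
  -- the component `x (k - 1)` must be known as well.
  have hae : ∀ k, k ≤ n → (x k =ᵐ[edgeVol ℓ] y k ∧ x (k - 1) =ᵐ[edgeVol ℓ] y (k - 1)) := by
    intro k
    induction k with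
    | zero => exact fun _ => ⟨h0, h0⟩
    | succ k ih =>
      intro hk
      obtain ⟨h1, h2⟩ := ih (by omega)
      refine ⟨?_, h1⟩
      filter_upwards [(hx.deriv k hk).deriv_unique (hy.deriv k hk) h1, hc k hk, h2]
        with t ht hct ht2
      rw [ht2] at ht
      exact mul_left_cancel₀ hct (by linarith)
  exact ⟨fun k hk => eqOn_of_ae_eq hℓ (hx.continuousOn hk) (hy.continuousOn hk) (hae k hk.le).1,
    fun k hk => (hae k hk).1⟩

end IsSys

/-- Change of chain: a solution of one system is turned into a solution of another one with the same
first component by a triangular transformation. -/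
theorem exists_change_of_chain (ci : ℕ → ℝ → ℝ)
    (hc : ∀ k < n, WInf (n - (k + 1)) ℓ (c k)) (hd : ∀ k < n, WInf (n - (k + 1)) ℓ (d k))
    (hci : ∀ k < n, WInf (n - (k + 1)) ℓ (ci k)) (hd' : ∀ k < n, WInf (n - (k + 1)) ℓ (d' k))
    (hinv : ∀ k < n, ∀ᵐ t ∂edgeVol ℓ, c' k t * ci k t = 1) :
    ∃ Φ : ℕ → (ℕ → ℝ → ℝ) → ℝ → ℝ, (∀ k ≤ n, IsComb ℓ k (n - k) (Φ k)) ∧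
      (∀ x, Φ 0 x = x 0) ∧
      ∀ x, IsSys ℓ c d n x → IsSys ℓ c' d' n (fun k => Φ k x) := by
  -- The new components are built one at a time. Differentiating `Φ j = ∑ m_i x_i` with the old
  -- system gives a combination of one more component, at the price of one order of smoothness of
  -- the `m_i`; hence the order `n - k` at stage `k`.
  have key : ∀ j ≤ n, ∃ Φ : ℕ → (ℕ → ℝ → ℝ) → ℝ → ℝ, (∀ k ≤ j, IsComb ℓ k (n - k) (Φ k)) ∧
      (∀ x, Φ 0 x = x 0) ∧
      ∀ x, IsSys ℓ c d n x → ∀ k < j,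
        HasL2Deriv ℓ (Φ k x) (fun t => c' k t * Φ (k + 1) x t + d' k t * Φ (k - 1) x t) := by
    intro j
    induction j with
    | zero =>
      refine fun _ => ⟨fun _ x => x 0, fun k hk => ?_, fun _ => rfl, by simp⟩
      exact IsComb.proj (Nat.zero_le k)
    | succ j ih =>
      intro hj
      obtain ⟨Φ, hΦ, hΦ0, hder⟩ := ih (by omega)
      obtain ⟨m, hm, em⟩ := hΦ j le_rfl
      have hnj : n - j = n - (j + 1) + 1 := by omega
      rw [hnj] at hm
      choose m' hm' hmd using hm
      let Ψ : (ℕ → ℝ → ℝ) → ℝ → ℝ := fun x t => ∑ i ∈ Finset.range (j + 1),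
        (m' i t * x i t + m i t * (c i t * x (i + 1) t + d i t * x (i - 1) t))
      have hΨ : IsComb ℓ (j + 1) (n - (j + 1)) Ψ := by
        refine IsComb.sum _ fun i hi => ?_
        have hi' : i ≤ j := by
          have := Finset.mem_range.1 hi
          omega
        have hle : n - (j + 1) ≤ n - (i + 1) := by omega
        refine ((IsComb.proj (by omega)).mul_left (hm' i)).add (IsComb.mul_left ?_ ?_)
        · exact WInf.of_succ ⟨m' i, hm' i, hmd i⟩
        · exact ((IsComb.proj (by omega)).mul_left ((hc i (by omega)).mono hle)).add
            ((IsComb.proj (by omega)).mul_left ((hd i (by omega)).mono hle))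
      -- `Ψ` is the derivative of `Φ j`, and `Θ` solves the required equation `Ψ = c' j * Θ + d' j *
      -- Φ (j - 1)` for the next component.
      let Θ : (ℕ → ℝ → ℝ) → ℝ → ℝ := fun x t =>
        ci j t * (Ψ x t + (-(d' j t)) * Φ (j - 1) x t)
      have hΘ : IsComb ℓ (j + 1) (n - (j + 1)) Θ := by
        refine IsComb.mul_left (hci j hj) (hΨ.add (IsComb.mul_left (hd' j hj).neg ?_))
        exact (hΦ (j - 1) (by omega)).mono (by omega) (by omega)
      refine ⟨fun k => if k = j + 1 then Θ else Φ k, fun k hk => ?_, fun x => ?_, fun x hx k hk => ?_⟩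
      · by_cases hkj : k = j + 1
        · subst hkj
          simpa using hΘ
        · simpa [hkj] using hΦ k (by omega)
      · simpa using hΦ0 x
      · have e1 : k ≠ j + 1 := by omega
        have e2 : k - 1 ≠ j + 1 := by omega
        rcases (Nat.lt_succ_iff.1 hk).lt_or_eq with hkj | rfl
        · simpa [e1, e2, hkj.ne] using hder x hx k hkj
        · simp only [e1, e2, if_false, if_true]
          have hsum : HasL2Deriv ℓ (fun t => ∑ i ∈ Finset.range (k + 1), m i t * x i t) (Ψ x) :=
            HasL2Deriv.sum _ fun i hi => (hmd i).mul (hx.deriv i (by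
              have := Finset.mem_range.1 hi
              omega))
          refine hsum.congr (fun t _ => (em x t).symm) ?_
          filter_upwards [hinv k hj] with t ht
          simp only [Θ]
          linear_combination (-(Ψ x t + (-(d' k t)) * Φ (k - 1) x t)) * ht
  obtain ⟨Φ, hΦ, hΦ0, hder⟩ := key n le_rfl
  refine ⟨Φ, hΦ, hΦ0, fun x hx => ⟨?_, hder x hx⟩⟩
  obtain ⟨m, hm, em⟩ := hΦ n le_rfl
  have : Φ n x = fun t => ∑ i ∈ Finset.range (n + 1), m i t * x i t := funext fun t => em x t
  rw [this]
  refine memLp_finsetSum _ fun i hi => ?_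
  exact (hx.memLp (by have := Finset.mem_range.1 hi; omega)).mul (hm i).memLp

end Systems

/-! ### Linear systems with bounded measurable coefficients -/

section LinearSystem

variable {ℓ : ℝ} {ι : Type*} [Fintype ι] {M : ι → ι → ℝ → ℝ} {g : ι → ℝ → ℝ}

theorem exists_ae_bound {f : ℝ → ℝ} (h : MemLp f ∞ (edgeVol ℓ)) :
    ∃ C, 0 ≤ C ∧ ∀ᵐ t ∂edgeVol ℓ, |f t| ≤ C := by
  refine ⟨(eLpNorm f ∞ (edgeVol ℓ)).toReal, ENNReal.toReal_nonneg, ?_⟩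
  filter_upwards [ae_le_eLpNormEssSup (f := f) (μ := edgeVol ℓ)] with t ht
  rw [← eLpNorm_exponent_top] at ht
  have := ENNReal.toReal_mono h.eLpNorm_ne_top ht
  simpa using this

theorem exists_ae_bound_family {κ : Type*} [Finite κ] {f : κ → ℝ → ℝ}
    (h : ∀ i, MemLp (f i) ∞ (edgeVol ℓ)) :
    ∃ C, 0 ≤ C ∧ ∀ i, ∀ᵐ t ∂edgeVol ℓ, |f i t| ≤ C := by
  cases nonempty_fintype κ
  choose C hC0 hC using fun i => exists_ae_bound (h i)
  refine ⟨∑ i, C i, Finset.sum_nonneg fun i _ => hC0 i, fun i => ?_⟩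
  filter_upwards [hC i] with t ht
  exact ht.trans (Finset.single_le_sum (f := C) (fun i _ => hC0 i) (Finset.mem_univ i))

/-- The right-hand side of a linear system evaluated along the curve `exp (lam t) z t`. -/
def linearField (hℓ : 0 ≤ ℓ) (M : ι → ι → ℝ → ℝ) (g : ι → ℝ → ℝ) (lam : ℝ)
    (z : C(Icc 0 ℓ, ι → ℝ)) (i : ι) (s : ℝ) : ℝ :=
  ∑ j, M i j s * (Real.exp (lam * s) * z (projIcc 0 ℓ hℓ s) j) + g i s

theorem linearField_memLp (hℓ : 0 ≤ ℓ) (hM : ∀ i j, MemLp (M i j) ∞ (edgeVol ℓ))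
    (hg : ∀ i, MemLp (g i) 2 (edgeVol ℓ)) (lam : ℝ) (z : C(Icc 0 ℓ, ι → ℝ)) (i : ι) :
    MemLp (linearField hℓ M g lam z i) 2 (edgeVol ℓ) := by
  refine MemLp.add (memLp_finsetSum _ fun j _ => ?_) (hg i)
  have hc : Continuous fun s => Real.exp (lam * s) * z (projIcc 0 ℓ hℓ s) j := by
    have : Continuous fun s => z (projIcc 0 ℓ hℓ s) := z.continuous.comp continuous_projIcc
    fun_prop
  exact (ContinuousOn.memLp_two_edge hc.continuousOn).mul (hM i j)

/-- The weighted Volterra operator of a linear system. -/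
def volterraMap (hℓ : 0 ≤ ℓ) (hM : ∀ i j, MemLp (M i j) ∞ (edgeVol ℓ))
    (hg : ∀ i, MemLp (g i) 2 (edgeVol ℓ)) (x₀ : ι → ℝ) (lam : ℝ) (z : C(Icc 0 ℓ, ι → ℝ)) :
    C(Icc 0 ℓ, ι → ℝ) where
  toFun t := fun i => Real.exp (-(lam * t)) *
    (x₀ i + ∫ s in (0 : ℝ)..t, linearField hℓ M g lam z i s)
  continuous_toFun := by
    refine continuous_pi fun i => ?_
    have h : HasL2Deriv ℓ (fun t => x₀ i + ∫ s in (0 : ℝ)..t, linearField hℓ M g lam z i s)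
        (linearField hℓ M g lam z i) :=
      ⟨linearField_memLp hℓ hM hg lam z i, fun t _ => by simp⟩
    have h2 := continuousOn_iff_continuous_domRestrict.1 h.continuousOn
    have h3 : Continuous fun t : Icc 0 ℓ => Real.exp (-(lam * t)) := by fun_prop
    exact h3.mul h2

theorem integral_exp_weight {lam : ℝ} (hlam : 0 < lam) (t : ℝ) :
    ∫ s in (0 : ℝ)..t, Real.exp (lam * s) = (Real.exp (lam * t) - 1) / lam := by
  have h : ∀ s ∈ uIcc 0 t, HasDerivAt (fun s => Real.exp (lam * s) / lam)
      (Real.exp (lam * s)) s := fun s _ => by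
    have h1 : HasDerivAt (fun s : ℝ => lam * s) lam s := by
      simpa using (hasDerivAt_id s).const_mul lam
    have := (h1.exp).div_const lam
    rwa [mul_div_assoc, div_self hlam.ne', mul_one] at this
  rw [intervalIntegral.integral_eq_sub_of_hasDerivAt h
    (Continuous.intervalIntegrable (by fun_prop) _ _)]
  simp
  ring

/-- In the unknown `z = e^{-λ t} x` the Volterra operator has Lipschitz constant at most `N C / λ`,
where `N` is the number of equations and `C` bounds the matrix. Thus `λ = 2 N C + 1` gives `1 / 2`
without any restriction on the length, and the extra `1` keeps `λ` positive. The choice does not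
involve the inhomogeneity or the initial value. -/
theorem volterraMap_contracting (hℓ : 0 ≤ ℓ) (hM : ∀ i j, MemLp (M i j) ∞ (edgeVol ℓ)) :
    ∃ lam : ℝ, ∀ (g : ι → ℝ → ℝ) (hg : ∀ i, MemLp (g i) 2 (edgeVol ℓ)) (x₀ : ι → ℝ),
      ContractingWith (1 / 2) (volterraMap hℓ hM hg x₀ lam) := by
  obtain ⟨C, hC0, hC⟩ := exists_ae_bound_family (f := fun p : ι × ι => M p.1 p.2)
    fun p => hM p.1 p.2
  obtain ⟨N, hN⟩ : ∃ N : ℝ, N = (Fintype.card ι : ℝ) := ⟨_, rfl⟩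
  have hN0 : 0 ≤ N := hN ▸ Nat.cast_nonneg _
  set lam : ℝ := 2 * (N * C) + 1 with hlam
  have hlam0 : 0 < lam := by positivity
  refine ⟨lam, fun g hg x₀ => ⟨by rw [← NNReal.coe_lt_coe]; norm_num, ?_⟩⟩
  refine LipschitzWith.of_dist_le_mul fun z w => ?_
  have hd0 : 0 ≤ dist z w := dist_nonneg
  rw [ContinuousMap.dist_le (by positivity)]
  intro t
  rw [dist_pi_le_iff (by positivity)]
  intro i
  have h0 : (0 : ℝ) ∈ Icc 0 ℓ := left_mem_Icc.2 hℓ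
  have ht := t.2
  have i1 := intervalIntegrable_of_memLp (linearField_memLp hℓ hM hg lam z i) h0 ht
  have i2 := intervalIntegrable_of_memLp (linearField_memLp hℓ hM hg lam w i) h0 ht
  have e : (volterraMap hℓ hM hg x₀ lam z) t i - (volterraMap hℓ hM hg x₀ lam w) t i
      = Real.exp (-(lam * t)) * ∫ s in (0 : ℝ)..t,
        (linearField hℓ M g lam z i s - linearField hℓ M g lam w i s) := by
    rw [intervalIntegral.integral_sub i1 i2]
    simp only [volterraMap, ContinuousMap.coe_mk]
    ring
  rw [Real.dist_eq, e, abs_mul, abs_of_pos (Real.exp_pos _)]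
  have hb : ‖∫ s in (0 : ℝ)..t, (linearField hℓ M g lam z i s - linearField hℓ M g lam w i s)‖
      ≤ |∫ s in (0 : ℝ)..t, (N * C * dist z w) * Real.exp (lam * s)| := by
    refine intervalIntegral.norm_integral_le_abs_of_norm_le ?_
      (Continuous.intervalIntegrable (by fun_prop) _ _)
    have hall : ∀ᵐ s ∂edgeVol ℓ, ∀ j, |M i j s| ≤ C := ae_all_iff.2 fun j => hC (i, j)
    have hsub : uIoc 0 (t : ℝ) ⊆ Icc 0 ℓ :=
      uIoc_subset_uIcc.trans (uIcc_subset_Icc h0 ht)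
    filter_upwards [ae_restrict_of_ae_restrict_of_subset hsub hall] with s hs
    have e2 : linearField hℓ M g lam z i s - linearField hℓ M g lam w i s
        = ∑ j, M i j s * (Real.exp (lam * s) *
          (z (projIcc 0 ℓ hℓ s) j - w (projIcc 0 ℓ hℓ s) j)) := by
      simp only [linearField]
      rw [add_sub_add_right_eq_sub, ← Finset.sum_sub_distrib]
      exact Finset.sum_congr rfl fun j _ => by ring
    rw [e2]
    refine (norm_sum_le _ _).trans ?_
    have : ∀ j ∈ Finset.univ, ‖M i j s * (Real.exp (lam * s) *
        (z (projIcc 0 ℓ hℓ s) j - w (projIcc 0 ℓ hℓ s) j))‖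
        ≤ C * (Real.exp (lam * s) * dist z w) := fun j _ => by
      rw [norm_mul, norm_mul, Real.norm_eq_abs, Real.norm_of_nonneg (Real.exp_pos _).le]
      have h1 : ‖z (projIcc 0 ℓ hℓ s) j - w (projIcc 0 ℓ hℓ s) j‖ ≤ dist z w := by
        rw [← dist_eq_norm]
        exact (dist_le_pi_dist _ _ j).trans (ContinuousMap.dist_apply_le_dist _)
      have := hs j
      gcongr
    refine (Finset.sum_le_sum this).trans (le_of_eq ?_)
    rw [Finset.sum_const, nsmul_eq_mul, Finset.card_univ, ← hN]
    ring
  rw [Real.norm_eq_abs] at hb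
  rw [intervalIntegral.integral_const_mul, integral_exp_weight hlam0] at hb
  have hexp : 1 ≤ Real.exp (lam * t) := Real.one_le_exp (mul_nonneg hlam0.le ht.1)
  have hnn : 0 ≤ N * C * dist z w * ((Real.exp (lam * t) - 1) / lam) :=
    mul_nonneg (by positivity) (div_nonneg (by linarith) hlam0.le)
  rw [abs_of_nonneg hnn] at hb
  have hmul : Real.exp (-(lam * t)) * Real.exp (lam * t) = 1 := by
    rw [← Real.exp_add]
    simp
  have hle : Real.exp (-(lam * t)) * (Real.exp (lam * t) - 1) ≤ 1 := by
    have := Real.exp_pos (-(lam * t))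
    nlinarith
  calc _ ≤ Real.exp (-(lam * t)) * (N * C * dist z w * ((Real.exp (lam * t) - 1) / lam)) := by
        gcongr
    _ = (N * C * dist z w) / lam * (Real.exp (-(lam * t)) * (Real.exp (lam * t) - 1)) := by ring
    _ ≤ (N * C * dist z w) / lam * 1 := by gcongr
    _ ≤ ((1 / 2 : ℝ≥0) : ℝ) * dist z w := by
      rw [mul_one, div_le_iff₀ hlam0]
      push_cast
      have : 0 ≤ N * C := by positivity
      nlinarith

theorem exists_linear_system (hℓ : 0 ≤ ℓ) (hM : ∀ i j, MemLp (M i j) ∞ (edgeVol ℓ))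
    (hg : ∀ i, MemLp (g i) 2 (edgeVol ℓ)) (x₀ : ι → ℝ) :
    ∃ x : ι → ℝ → ℝ, ∀ i, x i 0 = x₀ i ∧
      HasL2Deriv ℓ (x i) (fun t => ∑ j, M i j t * x j t + g i t) := by
  obtain ⟨lam, hc⟩ := volterraMap_contracting hℓ hM
  set z := (hc g hg x₀).fixedPoint with hz
  have hfix : volterraMap hℓ hM hg x₀ lam z = z := (hc g hg x₀).fixedPoint_isFixedPt
  let x : ι → ℝ → ℝ := fun i t => x₀ i + ∫ s in (0 : ℝ)..t, linearField hℓ M g lam z i s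
  have hx : ∀ i, ∀ t ∈ Icc 0 ℓ, x i t = Real.exp (lam * t) * z (projIcc 0 ℓ hℓ t) i := by
    intro i t ht
    have h1 : z (projIcc 0 ℓ hℓ t) i = Real.exp (-(lam * t)) * x i t := by
      conv_lhs => rw [← hfix]
      simp only [volterraMap, ContinuousMap.coe_mk, projIcc_of_mem hℓ ht, x]
    rw [h1, ← mul_assoc, ← Real.exp_add]
    simp
  refine ⟨x, fun i => ⟨by simp [x], ?_⟩⟩
  have h : HasL2Deriv ℓ (x i) (linearField hℓ M g lam z i) :=
    ⟨linearField_memLp hℓ hM hg lam z i, fun t _ => by simp [x]⟩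
  refine h.congr (fun _ _ => rfl) ?_
  filter_upwards [ae_restrict_mem measurableSet_Icc] with t ht
  simp only [linearField]
  congr 1
  exact Finset.sum_congr rfl fun j _ => by rw [hx j t ht]

/-- The weighted solution and `0` are fixed points of the same contraction. -/
theorem linear_system_unique (hℓ : 0 ≤ ℓ) (hM : ∀ i j, MemLp (M i j) ∞ (edgeVol ℓ))
    {x : ι → ℝ → ℝ} (hx : ∀ i, HasL2Deriv ℓ (x i) (fun t => ∑ j, M i j t * x j t))
    (h0 : ∀ i, x i 0 = 0) : ∀ i, ∀ t ∈ Icc 0 ℓ, x i t = 0 := by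
  obtain ⟨lam, hc⟩ := volterraMap_contracting hℓ hM
  have hg : ∀ i : ι, MemLp ((fun _ _ => 0 : ι → ℝ → ℝ) i) 2 (edgeVol ℓ) := fun i => by simp
  have hcon := hc (fun _ _ => 0) hg 0
  let z : C(Icc 0 ℓ, ι → ℝ) := ⟨fun t i => Real.exp (-(lam * t)) * x i t, by
    refine continuous_pi fun i => ?_
    have h2 := continuousOn_iff_continuous_domRestrict.1 (hx i).continuousOn
    have h3 : Continuous fun t : Icc 0 ℓ => Real.exp (-(lam * t)) := by fun_prop
    exact h3.mul h2⟩
  have hz : ∀ s ∈ Icc 0 ℓ, ∀ j, Real.exp (lam * s) * z (projIcc 0 ℓ hℓ s) j = x j s := by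
    intro s hs j
    simp only [z, ContinuousMap.coe_mk, projIcc_of_mem hℓ hs]
    rw [← mul_assoc, ← Real.exp_add]
    simp
  have hl0 : (0 : ℝ) ∈ Icc 0 ℓ := left_mem_Icc.2 hℓ
  have h1 : Function.IsFixedPt (volterraMap hℓ hM hg 0 lam) z := by
    ext t i
    simp only [volterraMap, ContinuousMap.coe_mk, Pi.zero_apply, zero_add, z]
    congr 1
    rw [(hx i).eq t.2, h0 i, zero_add]
    refine integral_congr_edge ?_ hl0 t.2
    filter_upwards [ae_restrict_mem measurableSet_Icc] with s hs
    simp only [linearField, add_zero]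
    exact Finset.sum_congr rfl fun j _ => by rw [← hz s hs j]
  have h2 : Function.IsFixedPt (volterraMap hℓ hM hg 0 lam) 0 := by
    ext t i
    simp [volterraMap, linearField]
  have h3 : z = 0 := hcon.fixedPoint_unique' h1 h2
  intro i t ht
  rw [← hz t ht i, h3]
  simp

end LinearSystem

/-! ### Existence and uniqueness for chain systems -/

section SystemExistence

variable {ℓ : ℝ} {c d : ℕ → ℝ → ℝ} {n : ℕ}

/-- The matrix of a chain system of length `n`. -/
def chainMatrix (c d : ℕ → ℝ → ℝ) (n : ℕ) (i j : Fin n) (t : ℝ) : ℝ :=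
  (if (j : ℕ) = i + 1 then c i t else 0) + (if (j : ℕ) = i - 1 then d i t else 0)

theorem chainMatrix_memLp (hc : ∀ k < n, MemLp (c k) ∞ (edgeVol ℓ))
    (hd : ∀ k < n, MemLp (d k) ∞ (edgeVol ℓ)) (i j : Fin n) :
    MemLp (chainMatrix c d n i j) ∞ (edgeVol ℓ) := by
  refine MemLp.add ?_ ?_
  · by_cases h : (j : ℕ) = i + 1
    · simpa [h] using hc i i.2
    · simp [h]
  · by_cases h : (j : ℕ) = i - 1
    · simpa [h] using hd i i.2
    · simp [h]

/-- The top component `x n` is prescribed rather than unknown. The matrix therefore leaves out its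
term in the last row, where it becomes the inhomogeneity. -/
theorem chainMatrix_sum (x : ℕ → ℝ → ℝ) (i : Fin n) (t : ℝ) :
    ∑ j, chainMatrix c d n i j t * x j t + (if (i : ℕ) + 1 = n then c i t * x n t else 0)
      = c i t * x (i + 1) t + d i t * x (i - 1) t := by
  simp only [chainMatrix, add_mul, Finset.sum_add_distrib, ite_mul, zero_mul]
  have e2 : ∑ j : Fin n, (if (j : ℕ) = i - 1 then d i t * x j t else 0)
      = d i t * x (i - 1) t := by
    rw [Finset.sum_eq_single ⟨i - 1, by have := i.2; omega⟩]
    · simp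
    · intro b _ hb
      rw [if_neg]
      intro h
      exact hb (Fin.ext h)
    · simp
  rw [e2]
  by_cases h : (i : ℕ) + 1 = n
  · have e1 : ∑ j : Fin n, (if (j : ℕ) = i + 1 then c i t * x j t else 0) = 0 :=
      Finset.sum_eq_zero fun j _ => if_neg (by have := j.2; omega)
    rw [e1, if_pos h, h]
    ring
  · have e1 : ∑ j : Fin n, (if (j : ℕ) = i + 1 then c i t * x j t else 0)
        = c i t * x (i + 1) t := by
      rw [Finset.sum_eq_single ⟨i + 1, by have := i.2; omega⟩]
      · simp
      · intro b _ hb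
        rw [if_neg]
        intro h
        exact hb (Fin.ext h)
      · simp
    rw [e1, if_neg h]
    ring

theorem IsSys.exists_solution (hℓ : 0 ≤ ℓ) (hc : ∀ k < n, MemLp (c k) ∞ (edgeVol ℓ))
    (hd : ∀ k < n, MemLp (d k) ∞ (edgeVol ℓ)) (x₀ : Fin n → ℝ) {h : ℝ → ℝ}
    (hh : MemLp h 2 (edgeVol ℓ)) :
    ∃ x, IsSys ℓ c d n x ∧ x n = h ∧ ∀ k : Fin n, x k 0 = x₀ k := by
  obtain ⟨y, hy⟩ := exists_linear_system hℓ (chainMatrix_memLp hc hd)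
    (g := fun (i : Fin n) t => if (i : ℕ) + 1 = n then c i t * h t else 0) (fun i => by
      by_cases hi : (i : ℕ) + 1 = n
      · simp only [hi, if_true]
        exact hh.mul (hc i i.2)
      · simp [hi]) x₀
  refine ⟨fun k => if hk : k < n then y ⟨k, hk⟩ else h, ⟨by simpa using hh, fun k hk => ?_⟩,
    by simp, fun k => by simp [(hy k).1]⟩
  have := (hy ⟨k, hk⟩).2
  simp only [hk, dite_true]
  refine this.congr (fun _ _ => rfl) (Eventually.of_forall fun t => ?_)
  have e := chainMatrix_sum (c := c) (d := d)
    (fun k => if hk : k < n then y ⟨k, hk⟩ else h) ⟨k, hk⟩ t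
  simp only [Fin.is_lt, dite_true, lt_irrefl, dite_false, Fin.eta] at e
  exact e

theorem IsSys.eq_zero (hℓ : 0 ≤ ℓ) (hc : ∀ k < n, MemLp (c k) ∞ (edgeVol ℓ))
    (hd : ∀ k < n, MemLp (d k) ∞ (edgeVol ℓ)) {x : ℕ → ℝ → ℝ} (hx : IsSys ℓ c d n x)
    (h0 : ∀ k < n, x k 0 = 0) (hn : x n =ᵐ[edgeVol ℓ] 0) :
    ∀ k < n, ∀ t ∈ Icc 0 ℓ, x k t = 0 := by
  have := linear_system_unique hℓ (chainMatrix_memLp hc hd) (x := fun i => x i) (fun i => by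
    refine (hx.deriv i i.2).congr (fun _ _ => rfl) ?_
    filter_upwards [hn] with t ht
    rw [← chainMatrix_sum x i t, ht]
    simp) fun i => h0 i i.2
  exact fun k hk t ht => this ⟨k, hk⟩ t ht

end SystemExistence

/-! ### Chains of derivatives and of quasi-derivatives -/

/-- The chain of derivatives of a function of the Sobolev space `H^n`. -/
abbrev IsSobChain (ℓ : ℝ) (n : ℕ) (x : ℕ → ℝ → ℝ) : Prop :=
  IsSys ℓ (fun _ _ => 1) (fun _ _ => 0) n x

/-- The superdiagonal coefficients of the chain of quasi-derivatives. -/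
def quasiC (a : ℝ → ℝ) (k : ℕ) (t : ℝ) : ℝ := if Even k then (a t)⁻¹ else -1

/-- The subdiagonal coefficients of the chain of quasi-derivatives. -/
def quasiD (κ : ℝ → ℝ) (k : ℕ) (t : ℝ) : ℝ := if Even k then 0 else κ t ^ 2

/-- The reciprocals of `quasiC`. -/
def quasiCInv (a : ℝ → ℝ) (k : ℕ) (t : ℝ) : ℝ := if Even k then a t else -1

/-- The chain `f, a f', L f, a (L f)', L² f, …` of quasi-derivatives. -/
abbrev IsQuasiChain (ℓ : ℝ) (a κ : ℝ → ℝ) (n : ℕ) (q : ℕ → ℝ → ℝ) : Prop :=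
  IsSys ℓ (quasiC a) (quasiD κ) n q

/-- The `H^n` norm computed from a chain. -/
def chainNorm (ℓ : ℝ) (n : ℕ) (x : ℕ → ℝ → ℝ) : ℝ :=
  Real.sqrt (∑ j ∈ Finset.range (n + 1), ∫ t in (0 : ℝ)..ℓ, (x j t) ^ 2)

section Chains

variable {ℓ : ℝ} {a κ f g : ℝ → ℝ} {n : ℕ} {x q : ℕ → ℝ → ℝ}

theorem memSobolev_iff : ∀ {n : ℕ} {f : ℝ → ℝ},
    MemSobolev n ℓ f ↔ ∃ x, IsSobChain ℓ n x ∧ x 0 = f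
  | 0, f => ⟨fun h => ⟨fun _ => f, ⟨h, by simp⟩, rfl⟩, fun ⟨_, hx, e⟩ => e ▸ hx.top⟩
  | n + 1, f => by
    constructor
    · rintro ⟨g, hg, h⟩
      obtain ⟨x, hx, rfl⟩ := memSobolev_iff.1 hg
      refine ⟨fun k => if k = 0 then f else x (k - 1), ⟨by simpa using hx.top, fun k hk => ?_⟩, rfl⟩
      rcases Nat.eq_zero_or_pos k with rfl | hk0
      · simpa using! ⟨hx.memLp (Nat.zero_le n), h⟩
      · have := hx.deriv (k - 1) (by omega)
        rw [show k - 1 + 1 = k by omega] at this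
        simpa [hk0.ne'] using this
    · rintro ⟨x, hx, rfl⟩
      have h0 := hx.deriv 0 (Nat.succ_pos n)
      refine ⟨x 1, memSobolev_iff.2 ⟨fun k => x (k + 1), ⟨hx.top, fun k hk => ?_⟩, rfl⟩, ?_⟩
      · simpa using hx.deriv (k + 1) (by omega)
      · simpa using h0.2

theorem IsSobChain.iteratedDerivWithin_eq (hℓ : 0 < ℓ) (hx : IsSobChain ℓ n x) {k : ℕ}
    (hk : k < n) : EqOn (iteratedDerivWithin k (x 0) (Icc 0 ℓ)) (x k) (Icc 0 ℓ) := by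
  induction k with
  | zero => intro t _; simp
  | succ k ih =>
    intro t ht
    have hu := uniqueDiffOn_Icc hℓ t ht
    rw [iteratedDerivWithin_succ, derivWithin_congr (ih (by omega)) (ih (by omega) ht)]
    have h1 := hx.deriv k (by omega)
    simp only [one_mul, zero_mul, add_zero] at h1
    exact (h1.hasDerivWithinAt (hx.continuousOn hk) ht).derivWithin hu

theorem IsSobChain.iteratedDerivWithin_ae (hℓ : 0 < ℓ) (hx : IsSobChain ℓ n x) {k : ℕ}
    (hk : k ≤ n) : iteratedDerivWithin k (x 0) (Icc 0 ℓ) =ᵐ[edgeVol ℓ] x k := by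
  rcases Nat.eq_zero_or_pos k with rfl | hk0
  · simp
  obtain ⟨j, rfl⟩ := Nat.exists_eq_succ_of_ne_zero hk0.ne'
  have h1 := hx.deriv j (by omega)
  simp only [one_mul, zero_mul, add_zero] at h1
  filter_upwards [h1.ae_derivWithin, ae_restrict_mem measurableSet_Icc] with t ht hts
  have he := IsSobChain.iteratedDerivWithin_eq hℓ hx (k := j) (by omega)
  rw [Nat.succ_eq_add_one, iteratedDerivWithin_succ, derivWithin_congr he (he hts), ht]

theorem sobolevNorm_congr {f₁ f₂ : ℝ → ℝ} (h : EqOn f₁ f₂ (Icc 0 ℓ)) (hℓ : 0 ≤ ℓ) :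
    sobolevNorm n ℓ f₁ = sobolevNorm n ℓ f₂ := by
  unfold sobolevNorm
  congr 1
  refine Finset.sum_congr rfl fun j _ => intervalIntegral.integral_congr fun t ht => ?_
  rw [uIcc_of_le hℓ] at ht
  rw [iteratedDerivWithin_congr h ht]

theorem IsSobChain.sobolevNorm_eq (hℓ : 0 < ℓ) (hx : IsSobChain ℓ n x) :
    sobolevNorm n ℓ (x 0) = chainNorm ℓ n x := by
  unfold sobolevNorm chainNorm
  congr 1
  refine Finset.sum_congr rfl fun j hj => ?_
  refine integral_congr_edge ?_ (left_mem_Icc.2 hℓ.le) (right_mem_Icc.2 hℓ.le)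
  have hj' : j ≤ n := Nat.lt_succ_iff.1 (Finset.mem_range.1 hj)
  filter_upwards [IsSobChain.iteratedDerivWithin_ae hℓ hx hj'] with t ht
  rw [ht]

theorem MemLp.intervalIntegrable_sq (hℓ : 0 ≤ ℓ) (hf : MemLp f 2 (edgeVol ℓ)) :
    IntervalIntegrable (fun t => f t ^ 2) volume 0 ℓ := by
  have : IntegrableOn (fun t => f t ^ 2) (Icc 0 ℓ) := hf.integrable_sq
  exact (this.mono_set (uIcc_of_le hℓ).subset).intervalIntegrable

theorem MemLp.intervalIntegrable_mul (hℓ : 0 ≤ ℓ) (hf : MemLp f 2 (edgeVol ℓ))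
    (hg : MemLp g 2 (edgeVol ℓ)) : IntervalIntegrable (fun t => f t * g t) volume 0 ℓ := by
  have : IntegrableOn (fun t => f t * g t) (Icc 0 ℓ) := hf.integrable_mul hg
  exact (this.mono_set (uIcc_of_le hℓ).subset).intervalIntegrable

theorem integral_sq_nonneg (hℓ : 0 ≤ ℓ) (f : ℝ → ℝ) : 0 ≤ ∫ t in (0 : ℝ)..ℓ, f t ^ 2 :=
  intervalIntegral.integral_nonneg hℓ fun _ _ => sq_nonneg _

theorem intervalIntegral_mono_ae (hℓ : 0 ≤ ℓ) (hf : IntervalIntegrable f volume 0 ℓ)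
    (hg : IntervalIntegrable g volume 0 ℓ) (h : ∀ᵐ t ∂edgeVol ℓ, f t ≤ g t) :
    ∫ t in (0 : ℝ)..ℓ, f t ≤ ∫ t in (0 : ℝ)..ℓ, g t :=
  intervalIntegral.integral_mono_ae_restrict hℓ hf hg h

theorem chainNorm_nonneg : 0 ≤ chainNorm ℓ n x := Real.sqrt_nonneg _

theorem chainNorm_sq (hℓ : 0 ≤ ℓ) :
    chainNorm ℓ n x ^ 2 = ∑ j ∈ Finset.range (n + 1), ∫ t in (0 : ℝ)..ℓ, (x j t) ^ 2 :=
  Real.sq_sqrt (Finset.sum_nonneg fun _ _ => integral_sq_nonneg hℓ _)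

theorem integral_sq_le_chainNorm (hℓ : 0 ≤ ℓ) {k : ℕ} (hk : k ≤ n) :
    ∫ t in (0 : ℝ)..ℓ, (x k t) ^ 2 ≤ chainNorm ℓ n x ^ 2 := by
  rw [chainNorm_sq hℓ]
  exact Finset.single_le_sum (f := fun j => ∫ t in (0 : ℝ)..ℓ, (x j t) ^ 2)
    (fun j _ => integral_sq_nonneg hℓ _) (Finset.mem_range.2 (by omega))

theorem IsComb.integral_sq_le (hℓ : 0 ≤ ℓ) {k j : ℕ} (hk : k ≤ n)
    {Φ : (ℕ → ℝ → ℝ) → ℝ → ℝ} (h : IsComb ℓ k j Φ) :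
    ∃ C, 0 ≤ C ∧ ∀ x : ℕ → ℝ → ℝ, (∀ i ≤ n, MemLp (x i) 2 (edgeVol ℓ)) →
      ∫ t in (0 : ℝ)..ℓ, (Φ x t) ^ 2 ≤ C * chainNorm ℓ n x ^ 2 := by
  obtain ⟨m, hm, em⟩ := h
  obtain ⟨C, hC0, hC⟩ := exists_ae_bound_family (κ := Fin (k + 1)) fun i => (hm i).memLp
  refine ⟨(k + 1) * C ^ 2, by positivity, fun x hx => ?_⟩
  have hmem : ∀ i ∈ Finset.range (k + 1), MemLp (x i) 2 (edgeVol ℓ) := fun i hi =>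
    hx i (by have := Finset.mem_range.1 hi; omega)
  have hΦ : MemLp (Φ x) 2 (edgeVol ℓ) := by
    have : Φ x = fun t => ∑ i ∈ Finset.range (k + 1), m i t * x i t := funext (em x)
    rw [this]
    exact memLp_finsetSum _ fun i hi => (hmem i hi).mul (hm i).memLp
  have hint : ∀ i ∈ Finset.range (k + 1), IntervalIntegrable (fun t => x i t ^ 2) volume 0 ℓ :=
    fun i hi => MemLp.intervalIntegrable_sq hℓ (hmem i hi)
  have hsum : IntervalIntegrable (fun t => ∑ i ∈ Finset.range (k + 1), x i t ^ 2) volume 0 ℓ := by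
    have := IntervalIntegrable.sum _ hint
    rwa [Finset.sum_fn] at this
  have h1 : ∫ t in (0 : ℝ)..ℓ, (Φ x t) ^ 2 ≤
      ∫ t in (0 : ℝ)..ℓ, ((k + 1) * C ^ 2) * ∑ i ∈ Finset.range (k + 1), x i t ^ 2 := by
    refine intervalIntegral_mono_ae hℓ (MemLp.intervalIntegrable_sq hℓ hΦ)
      (hsum.const_mul _) ?_
    · have hall : ∀ᵐ t ∂edgeVol ℓ, ∀ i : Fin (k + 1), |m i t| ≤ C := ae_all_iff.2 hC
      filter_upwards [hall] with t ht
      rw [em x t]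
      have e1 := Finset.sum_mul_sq_le_sq_mul_sq (Finset.range (k + 1)) (fun i => m i t)
        (fun i => x i t)
      have e2 : ∑ i ∈ Finset.range (k + 1), m i t ^ 2 ≤ (k + 1) * C ^ 2 := by
        have : ∀ i ∈ Finset.range (k + 1), m i t ^ 2 ≤ C ^ 2 := fun i hi =>
          sq_le_sq' (abs_le.1 (ht ⟨i, Finset.mem_range.1 hi⟩)).1
            (abs_le.1 (ht ⟨i, Finset.mem_range.1 hi⟩)).2
        refine (Finset.sum_le_sum this).trans (le_of_eq ?_)
        simp
      refine e1.trans (mul_le_mul_of_nonneg_right e2 (Finset.sum_nonneg fun i _ => sq_nonneg _))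
  refine h1.trans ?_
  rw [intervalIntegral.integral_const_mul, intervalIntegral.integral_finsetSum hint, chainNorm_sq hℓ]
  refine mul_le_mul_of_nonneg_left ?_ (by positivity)
  exact Finset.sum_le_sum_of_subset_of_nonneg (Finset.range_subset_range.2 (by omega))
    fun i _ _ => integral_sq_nonneg hℓ _

theorem exists_chainNorm_le (hℓ : 0 ≤ ℓ) {Φ : ℕ → (ℕ → ℝ → ℝ) → ℝ → ℝ}
    (h : ∀ k ≤ n, IsComb ℓ k (n - k) (Φ k)) :
    ∃ C, 0 ≤ C ∧ ∀ x : ℕ → ℝ → ℝ, (∀ i ≤ n, MemLp (x i) 2 (edgeVol ℓ)) →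
      chainNorm ℓ n (fun k => Φ k x) ≤ C * chainNorm ℓ n x := by
  choose C hC0 hC using fun k : Fin (n + 1) =>
    (h k (Nat.lt_succ_iff.1 k.2)).integral_sq_le hℓ (n := n) (Nat.lt_succ_iff.1 k.2)
  refine ⟨Real.sqrt (∑ k, C k), Real.sqrt_nonneg _, fun x hx => ?_⟩
  have hn : 0 ≤ chainNorm ℓ n x := chainNorm_nonneg
  rw [← Real.sqrt_sq hn, ← Real.sqrt_mul (Finset.sum_nonneg fun k _ => hC0 k)]
  refine Real.sqrt_le_sqrt ?_
  rw [Finset.sum_range, Finset.sum_mul]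
  exact Finset.sum_le_sum fun k _ => hC k x hx

theorem IsComb.eq_zero_of_forall {k j : ℕ} {Φ : (ℕ → ℝ → ℝ) → ℝ → ℝ} (h : IsComb ℓ k j Φ) {t : ℝ}
    (hx : ∀ i ≤ k, x i t = 0) : Φ x t = 0 := by
  obtain ⟨m, -, em⟩ := h
  rw [em]
  exact Finset.sum_eq_zero fun i hi => by
    rw [hx i (by have := Finset.mem_range.1 hi; omega), mul_zero]

end Chains

/-! ### Regularity of the coefficients; derivatives versus quasi-derivatives -/

section QuasiCoefficients

variable {ℓ : ℝ} {a κ : ℝ → ℝ} {α : ℕ}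

theorem EdgeCoeff.wInf_one (h : EdgeCoeff α ℓ a κ) : WInf 1 ℓ a := by
  obtain ⟨K, hK⟩ := h.a_lip
  exact WInf.of_lipschitzOnWith hK

/-- `C^{α-2,1}` embeds in `W^{α-1,∞}`. For `α ≤ 2` the Lipschitz hypothesis already supplies the
order needed. -/
theorem EdgeCoeff.wInf_a (hℓ : 0 < ℓ) (h : EdgeCoeff α ℓ a κ) : WInf (α - 1) ℓ a := by
  by_cases hα : 3 ≤ α
  · have := (h.a_reg hα).wInf hℓ
    rwa [show α - 2 + 1 = α - 1 by omega] at this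
  · exact h.wInf_one.mono (by omega)

theorem EdgeCoeff.wInf_kappa (hℓ : 0 < ℓ) (h : EdgeCoeff α ℓ a κ) : WInf (α - 2) ℓ κ := by
  by_cases hα : 3 ≤ α
  · have := (h.kappa_reg hα).wInf hℓ
    rwa [show α - 3 + 1 = α - 2 by omega] at this
  · rw [show α - 2 = 0 by omega]
    exact h.kappa_bdd

theorem EdgeCoeff.wInf_inv {k : ℕ} (h : EdgeCoeff α ℓ a κ) (ha : WInf k ℓ a) :
    WInf k ℓ (fun t => (a t)⁻¹) := by
  obtain ⟨K, hK⟩ := h.a_lip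
  exact ha.inv hK h.a_pos

theorem EdgeCoeff.quasiC_wInf (hℓ : 0 < ℓ) (h : EdgeCoeff α ℓ a κ) (k : ℕ) :
    WInf (α - (k + 1)) ℓ (quasiC a k) := by
  unfold quasiC
  by_cases hk : Even k
  · simp only [hk, if_true]
    exact (h.wInf_inv (h.wInf_a hℓ)).mono (by omega)
  · simpa only [hk, if_false] using WInf.const (-1) _

theorem EdgeCoeff.quasiCInv_wInf (hℓ : 0 < ℓ) (h : EdgeCoeff α ℓ a κ) (k : ℕ) :
    WInf (α - (k + 1)) ℓ (quasiCInv a k) := by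
  unfold quasiCInv
  by_cases hk : Even k
  · simp only [hk, if_true]
    exact (h.wInf_a hℓ).mono (by omega)
  · simpa only [hk, if_false] using WInf.const (-1) _

/-- `κ` has one order less than `a`, which suffices because `κ²` occurs only at odd `k`: there `k ≥
1`, so the order `α - (k + 1)` is at most `α - 2`. -/
theorem EdgeCoeff.quasiD_wInf (hℓ : 0 < ℓ) (h : EdgeCoeff α ℓ a κ) (k : ℕ) :
    WInf (α - (k + 1)) ℓ (quasiD κ k) := by
  unfold quasiD
  by_cases hk : Even k
  · simpa only [hk, if_true] using WInf.const 0 _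
  · simp only [hk, if_false]
    have hk1 : 1 ≤ k := by
      rcases Nat.eq_zero_or_pos k with rfl | h
      · simp at hk
      · exact h
    have := ((h.wInf_kappa hℓ).mul (h.wInf_kappa hℓ)).mono (j := α - (k + 1)) (by omega)
    simpa only [sq] using this

theorem EdgeCoeff.quasiC_memLp (h : EdgeCoeff α ℓ a κ) (k : ℕ) :
    MemLp (quasiC a k) ∞ (edgeVol ℓ) := by
  unfold quasiC
  by_cases hk : Even k
  · simpa only [hk, if_true] using (h.wInf_inv h.wInf_one).memLp
  · simpa only [hk, if_false] using memLp_const _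

theorem EdgeCoeff.quasiD_memLp (h : EdgeCoeff α ℓ a κ) (k : ℕ) :
    MemLp (quasiD κ k) ∞ (edgeVol ℓ) := by
  unfold quasiD
  by_cases hk : Even k
  · simp [hk]
  · have hκ : WInf 0 ℓ κ := h.kappa_bdd
    simpa only [hk, if_false, sq] using (hκ.mul hκ).memLp

theorem EdgeCoeff.quasiC_ne_zero (h : EdgeCoeff α ℓ a κ) (k : ℕ) :
    ∀ᵐ t ∂edgeVol ℓ, quasiC a k t ≠ 0 := by
  filter_upwards [ae_restrict_mem measurableSet_Icc] with t ht
  have := (h.a_pos t ht).ne'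
  unfold quasiC
  split_ifs <;> simp [this]

theorem EdgeCoeff.quasiC_mul_inv (h : EdgeCoeff α ℓ a κ) (k : ℕ) :
    ∀ᵐ t ∂edgeVol ℓ, quasiC a k t * quasiCInv a k t = 1 := by
  filter_upwards [ae_restrict_mem measurableSet_Icc] with t ht
  have := (h.a_pos t ht).ne'
  unfold quasiC quasiCInv
  split_ifs <;> simp [this]

/-- Passing between derivatives and quasi-derivatives: every function in `H^α` has both chains, they
vanish at the same points and their norms are equivalent. -/
theorem EdgeCoeff.exists_quasi_of_sob (hℓ : 0 < ℓ) (h : EdgeCoeff α ℓ a κ) :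
    ∃ C, 0 ≤ C ∧ ∀ x, IsSobChain ℓ α x → ∃ q, IsQuasiChain ℓ a κ α q ∧ q 0 = x 0 ∧
      (∀ t, (∀ k < α, x k t = 0) → ∀ k < α, q k t = 0) ∧
      chainNorm ℓ α q ≤ C * chainNorm ℓ α x := by
  obtain ⟨Φ, hΦ, hΦ0, hΦs⟩ := exists_change_of_chain (ℓ := ℓ) (n := α) (c := fun _ _ => 1)
    (d := fun _ _ => 0) (c' := quasiC a) (d' := quasiD κ) (quasiCInv a)
    (fun k _ => WInf.const 1 _) (fun k _ => WInf.const 0 _) (fun k _ => h.quasiCInv_wInf hℓ k)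
    (fun k _ => h.quasiD_wInf hℓ k) (fun k _ => h.quasiC_mul_inv k)
  obtain ⟨C, hC0, hC⟩ := exists_chainNorm_le hℓ.le hΦ
  refine ⟨C, hC0, fun x hx => ⟨fun k => Φ k x, hΦs x hx, hΦ0 x, fun t ht k hk => ?_,
    hC x fun i hi => hx.memLp hi⟩⟩
  exact (hΦ k hk.le).eq_zero_of_forall fun i hi => ht i (by omega)

theorem EdgeCoeff.exists_sob_of_quasi (hℓ : 0 < ℓ) (h : EdgeCoeff α ℓ a κ) :
    ∃ C, 0 ≤ C ∧ ∀ q, IsQuasiChain ℓ a κ α q → ∃ x, IsSobChain ℓ α x ∧ x 0 = q 0 ∧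
      (∀ t, (∀ k < α, q k t = 0) → ∀ k < α, x k t = 0) ∧
      chainNorm ℓ α x ≤ C * chainNorm ℓ α q := by
  obtain ⟨Φ, hΦ, hΦ0, hΦs⟩ := exists_change_of_chain (ℓ := ℓ) (n := α) (c := quasiC a)
    (d := quasiD κ) (c' := fun _ _ => 1) (d' := fun _ _ => 0) (fun _ _ => 1)
    (fun k _ => h.quasiC_wInf hℓ k) (fun k _ => h.quasiD_wInf hℓ k) (fun k _ => WInf.const 1 _)
    (fun k _ => WInf.const 0 _) (fun k _ => by simp)
  obtain ⟨C, hC0, hC⟩ := exists_chainNorm_le hℓ.le hΦ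
  refine ⟨C, hC0, fun x hx => ⟨fun k => Φ k x, hΦs x hx, hΦ0 x, fun t ht k hk => ?_,
    hC x fun i hi => hx.memLp hi⟩⟩
  exact (hΦ k hk.le).eq_zero_of_forall fun i hi => ht i (by omega)

theorem EdgeCoeff.quasi_unique {n : ℕ} (hℓ : 0 < ℓ) (h : EdgeCoeff α ℓ a κ) {q q' : ℕ → ℝ → ℝ}
    (hq : IsQuasiChain ℓ a κ n q) (hq' : IsQuasiChain ℓ a κ n q')
    (h0 : q 0 =ᵐ[edgeVol ℓ] q' 0) :
    (∀ k < n, EqOn (q k) (q' k) (Icc 0 ℓ)) ∧ ∀ k ≤ n, q k =ᵐ[edgeVol ℓ] q' k :=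
  hq.eq_of_zero_eq hℓ hq' (fun k _ => h.quasiC_ne_zero k) h0

theorem sob_unique {n : ℕ} (hℓ : 0 < ℓ) {x y : ℕ → ℝ → ℝ} (hx : IsSobChain ℓ n x)
    (hy : IsSobChain ℓ n y) (h0 : x 0 =ᵐ[edgeVol ℓ] y 0) :
    (∀ k < n, EqOn (x k) (y k) (Icc 0 ℓ)) ∧ ∀ k ≤ n, x k =ᵐ[edgeVol ℓ] y k :=
  hx.eq_of_zero_eq hℓ hy (fun k _ => by simp) h0

end QuasiCoefficients

/-! ### Powers of `L` on an edge as chains of quasi-derivatives -/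

section EdgeOperator

variable {ℓ : ℝ} {a κ f g : ℝ → ℝ} {α : ℕ}

theorem IsQuasiChain.deriv_even {n k : ℕ} {q : ℕ → ℝ → ℝ} (h : IsQuasiChain ℓ a κ n q)
    (hk : 2 * k < n) : HasL2Deriv ℓ (q (2 * k)) (fun t => (a t)⁻¹ * q (2 * k + 1) t) := by
  simpa [quasiC, quasiD] using h.deriv (2 * k) hk

theorem IsQuasiChain.deriv_odd {n k : ℕ} {q : ℕ → ℝ → ℝ} (h : IsQuasiChain ℓ a κ n q)
    (hk : 2 * k + 1 < n) :
    HasL2Deriv ℓ (q (2 * k + 1)) (fun t => κ t ^ 2 * q (2 * k) t - q (2 * k + 2) t) := by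
  have := h.deriv (2 * k + 1) hk
  simp only [quasiC, quasiD, Nat.not_even_bit1, if_false, Nat.add_sub_cancel] at this
  refine this.congr (fun _ _ => rfl) (Eventually.of_forall fun t => ?_)
  dsimp only
  rw [show 2 * k + 1 + 1 = 2 * k + 2 by omega]
  ring

theorem isQuasiChain_of_deriv {n : ℕ} {q : ℕ → ℝ → ℝ} (ht : MemLp (q n) 2 (edgeVol ℓ))
    (he : ∀ k, 2 * k < n → HasL2Deriv ℓ (q (2 * k)) (fun t => (a t)⁻¹ * q (2 * k + 1) t))
    (ho : ∀ k, 2 * k + 1 < n →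
      HasL2Deriv ℓ (q (2 * k + 1)) (fun t => κ t ^ 2 * q (2 * k) t - q (2 * k + 2) t)) :
    IsQuasiChain ℓ a κ n q := by
  refine ⟨ht, fun k hk => ?_⟩
  rcases Nat.even_or_odd' k with ⟨j, rfl | rfl⟩
  · simpa [quasiC, quasiD] using he j hk
  · refine (ho j hk).congr (fun _ _ => rfl) (Eventually.of_forall fun t => ?_)
    simp only [quasiC, quasiD, Nat.not_even_bit1, if_false, Nat.add_sub_cancel]
    rw [show 2 * j + 1 + 1 = 2 * j + 2 by omega]
    ring

/-- With `p = a f'` the second order equation becomes a first order system whose coefficients `1 /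
a` and `κ²` are never differentiated. That `f` is in `H^2` then follows because `1 / a` is
Lipschitz. -/
theorem EdgeCoeff.edgeOp_iff (hℓ : 0 < ℓ) (h : EdgeCoeff α ℓ a κ) :
    EdgeOp ℓ a κ f g ↔ MemLp g 2 (edgeVol ℓ) ∧ ∃ p, HasL2Deriv ℓ f (fun t => (a t)⁻¹ * p t) ∧
      HasL2Deriv ℓ p (fun t => κ t ^ 2 * f t - g t) := by
  obtain ⟨a', -, ha'⟩ := h.wInf_one
  obtain ⟨b', -, hb'⟩ := h.wInf_inv h.wInf_one
  constructor
  · rintro ⟨hf, hg, he⟩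
    obtain ⟨x, hx, rfl⟩ := memSobolev_iff.1 hf
    have h0 := hx.deriv 0 (by norm_num)
    have h1 := hx.deriv 1 (by norm_num)
    simp only [one_mul, zero_mul, add_zero] at h0 h1
    have hd : EqOn (derivWithin (x 0) (Icc 0 ℓ)) (x 1) (Icc 0 ℓ) := fun t ht =>
      (h0.hasDerivWithinAt h1.continuousOn ht).derivWithin (uniqueDiffOn_Icc hℓ t ht)
    have hp := ha'.mul h1
    refine ⟨hg, fun t => a t * x 1 t, h0.congr (fun _ _ => rfl) ?_, hp.congr (fun _ _ => rfl) ?_⟩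
    · filter_upwards [ae_restrict_mem measurableSet_Icc] with t ht
      have := (h.a_pos t ht).ne'
      field_simp
    · filter_upwards [ae_restrict_mem measurableSet_Icc, hp.ae_derivWithin, he] with t ht h1 h2
      rw [h2, derivWithin_congr (f := fun t => a t * x 1 t) _ _, h1]
      · ring
      · intro s hs
        dsimp only
        rw [hd hs]
      · rw [hd ht]
  · rintro ⟨hg, p, hf, hp⟩
    have hx1 := hb'.mul hp
    have hd : EqOn (derivWithin f (Icc 0 ℓ)) (fun t => (a t)⁻¹ * p t) (Icc 0 ℓ) := fun t ht =>
      (hf.hasDerivWithinAt hx1.continuousOn ht).derivWithin (uniqueDiffOn_Icc hℓ t ht)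
    refine ⟨⟨_, ⟨_, hx1.memLp, hx1.2⟩, hf.2⟩, hg, ?_⟩
    filter_upwards [ae_restrict_mem measurableSet_Icc, hp.ae_derivWithin] with t ht h1
    have e : EqOn (fun s => a s * derivWithin f (Icc 0 ℓ) s) p (Icc 0 ℓ) := fun s hs => by
      dsimp only
      rw [hd hs]
      have := (h.a_pos s hs).ne'
      field_simp
    rw [derivWithin_congr e (e ht), h1]
    ring

/-- Each application of `L` accounts for two links of the chain. Square integrability is a
hypothesis because `EdgePow` at `n = 0` is only almost everywhere equality and does not provide it.
-/
theorem EdgeCoeff.edgePow_iff (hℓ : 0 < ℓ) (h : EdgeCoeff α ℓ a κ) :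
    ∀ {n : ℕ} {f : ℝ → ℝ}, MemLp f 2 (edgeVol ℓ) →
      (EdgePow ℓ a κ n f g ↔ ∃ q, IsQuasiChain ℓ a κ (2 * n) q ∧ q 0 = f ∧
        q (2 * n) =ᵐ[edgeVol ℓ] g)
  | 0, f, hf => ⟨fun e => ⟨fun _ => f, ⟨hf, by simp⟩, rfl, e⟩, fun ⟨q, _, e, hq⟩ => e ▸ hq⟩
  | n + 1, f, hf => by
    constructor
    · rintro ⟨h₁, hop, hpow⟩
      obtain ⟨hm, p, hfp, hpp⟩ := (h.edgeOp_iff hℓ).1 hop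
      obtain ⟨q, hq, rfl, hqn⟩ := (h.edgePow_iff hℓ hm).1 hpow
      refine ⟨fun k => if k = 0 then f else if k = 1 then p else q (k - 2),
        isQuasiChain_of_deriv ?_ (fun k hk => ?_) (fun k hk => ?_), rfl, ?_⟩
      · have e : 2 * (n + 1) - 2 = 2 * n := by omega
        simpa [e] using hq.top
      · rcases Nat.eq_zero_or_pos k with rfl | hk0
        · simpa using hfp
        · obtain ⟨j, rfl⟩ := Nat.exists_eq_succ_of_ne_zero hk0.ne'
          have := IsQuasiChain.deriv_even hq (k := j) (by omega)
          have e1 : 2 * (j + 1) - 2 = 2 * j := by omega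
          have e2 : 2 * (j + 1) + 1 - 2 = 2 * j + 1 := by omega
          have e3 : 2 * (j + 1) ≠ 1 := by omega
          simpa [e1, e2, e3] using this
      · rcases Nat.eq_zero_or_pos k with rfl | hk0
        · simpa using hpp
        · obtain ⟨j, rfl⟩ := Nat.exists_eq_succ_of_ne_zero hk0.ne'
          have := IsQuasiChain.deriv_odd hq (k := j) (by omega)
          have e1 : 2 * (j + 1) - 2 = 2 * j := by omega
          have e2 : 2 * (j + 1) + 1 - 2 = 2 * j + 1 := by omega
          have e3 : 2 * (j + 1) ≠ 1 := by omega
          have e4 : 2 * (j + 1) + 2 - 2 = 2 * j + 2 := by omega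
          have e5 : 2 * (j + 1) + 2 ≠ 1 := by omega
          have e6 : 2 * (j + 1) = 2 * j + 2 := by omega
          simpa [e1, e2, e3, e4, e5, e6] using this
      · have e : 2 * (n + 1) - 2 = 2 * n := by omega
        have e3 : 2 * (n + 1) ≠ 1 := by omega
        simpa [e, e3] using hqn
    · rintro ⟨q, hq, rfl, hqn⟩
      refine ⟨q 2, (h.edgeOp_iff hℓ).2 ⟨hq.memLp (by omega), q 1, ?_, ?_⟩,
        (h.edgePow_iff hℓ (hq.memLp (by omega))).2 ⟨fun k => q (k + 2),
          isQuasiChain_of_deriv ?_ (fun k hk => ?_) (fun k hk => ?_), rfl, ?_⟩⟩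
      · simpa using IsQuasiChain.deriv_even hq (k := 0) (by omega)
      · simpa using IsQuasiChain.deriv_odd hq (k := 0) (by omega)
      · simpa [mul_add] using hq.top
      · simpa [mul_add] using IsQuasiChain.deriv_even hq (k := k + 1) (by omega)
      · simpa [mul_add] using IsQuasiChain.deriv_odd hq (k := k + 1) (by omega)
      · simpa [mul_add] using hqn

theorem IsQuasiChain.congr_coeff {a' κ' : ℝ → ℝ} {n : ℕ} {q : ℕ → ℝ → ℝ}
    (ha : EqOn a a' (Icc 0 ℓ)) (hκ : κ =ᵐ[edgeVol ℓ] κ') (h : IsQuasiChain ℓ a κ n q) :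
    IsQuasiChain ℓ a' κ' n q := by
  refine ⟨h.top, fun k hk => (h.deriv k hk).congr (fun _ _ => rfl) ?_⟩
  filter_upwards [ae_restrict_mem measurableSet_Icc, hκ] with t ht h2
  simp only [quasiC, quasiD, ha ht, h2]

end EdgeOperator

/-! ### Homogeneous solutions on an edge -/

/-- The symplectic pairing of two vectors of `2 α` quasi-derivatives. -/
def bdryPairing (α : ℕ) (y q : ℕ → ℝ) : ℝ :=
  ∑ i ∈ Finset.range α, (y (2 * (α - 1 - i)) * q (2 * i + 1) - y (2 * (α - 1 - i) + 1) * q (2 * i))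

theorem bdryPairing_zero_left {α : ℕ} {y q : ℕ → ℝ} (h : ∀ k < 2 * α, y k = 0) :
    bdryPairing α y q = 0 :=
  Finset.sum_eq_zero fun i hi => by
    have := Finset.mem_range.1 hi
    rw [h (2 * (α - 1 - i)) (by omega), h (2 * (α - 1 - i) + 1) (by omega)]
    ring

theorem bdryPairing_zero_right {α : ℕ} {y q : ℕ → ℝ} (h : ∀ k < 2 * α, q k = 0) :
    bdryPairing α y q = 0 :=
  Finset.sum_eq_zero fun i hi => by
    have := Finset.mem_range.1 hi
    rw [h (2 * i) (by omega), h (2 * i + 1) (by omega)]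
    ring

theorem bdryPairing_symm (α : ℕ) (y q : ℕ → ℝ) : bdryPairing α y q = -bdryPairing α q y := by
  unfold bdryPairing
  rw [← Finset.sum_range_reflect, ← Finset.sum_neg_distrib]
  refine Finset.sum_congr rfl fun i hi => ?_
  have := Finset.mem_range.1 hi
  rw [show α - 1 - (α - 1 - i) = i by omega]
  ring

theorem bdryPairing_single_even {α : ℕ} (y : ℕ → ℝ) {i : ℕ} (hi : i < α) :
    bdryPairing α y (Pi.single (2 * i) 1) = -y (2 * (α - 1 - i) + 1) := by
  unfold bdryPairing
  rw [Finset.sum_eq_single_of_mem i (Finset.mem_range.2 hi)]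
  · simp
  · intro j _ hj
    have h1 : 2 * j + 1 ≠ 2 * i := by omega
    have h2 : 2 * j ≠ 2 * i := by omega
    simp [h1, hj]

theorem bdryPairing_single_odd {α : ℕ} (y : ℕ → ℝ) {i : ℕ} (hi : i < α) :
    bdryPairing α y (Pi.single (2 * i + 1) 1) = y (2 * (α - 1 - i)) := by
  unfold bdryPairing
  rw [Finset.sum_eq_single_of_mem i (Finset.mem_range.2 hi)]
  · simp
  · intro j _ hj
    have h2 : 2 * j ≠ 2 * i + 1 := by omega
    simp [hj, h2]

theorem bdryPairing_congr_right {α : ℕ} (y : ℕ → ℝ) {q q' : ℕ → ℝ} (h : ∀ k < 2 * α, q k = q' k) :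
    bdryPairing α y q = bdryPairing α y q' :=
  Finset.sum_congr rfl fun i hi => by
    have := Finset.mem_range.1 hi
    rw [h (2 * i) (by omega), h (2 * i + 1) (by omega)]

/-- The pairing is nondegenerate. -/
theorem eq_zero_of_bdryPairing {α : ℕ} {y : ℕ → ℝ}
    (h : ∀ l < 2 * α, bdryPairing α y (Pi.single l 1) = 0) : ∀ k < 2 * α, y k = 0 := by
  intro k hk
  rcases Nat.even_or_odd' k with ⟨j, rfl | rfl⟩
  · have := h (2 * (α - 1 - j) + 1) (by omega)
    rwa [bdryPairing_single_odd y (by omega), show α - 1 - (α - 1 - j) = j by omega] at this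
  · have := h (2 * (α - 1 - j)) (by omega)
    rw [bdryPairing_single_even y (by omega), show α - 1 - (α - 1 - j) = j by omega] at this
    linarith

/-! ### Green's identity, fundamental systems and compactly supported chains -/

section Green

variable {ℓ : ℝ} {a κ : ℝ → ℝ} {α : ℕ} {y q : ℕ → ℝ → ℝ}

/-- Green's identity for the first `J` integrations by parts. -/
theorem green_partial (hy : IsQuasiChain ℓ a κ (2 * α) y) (hq : IsQuasiChain ℓ a κ (2 * α) q)
    {J : ℕ} (hJ : J ≤ α) {s : ℝ} (hs : s ∈ Icc 0 ℓ) :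
    (∫ t in (0 : ℝ)..s, q 0 t * y (2 * α) t) - ∫ t in (0 : ℝ)..s, q (2 * J) t * y (2 * (α - J)) t
      = ∑ i ∈ Finset.range J,
        ((y (2 * (α - 1 - i)) s * q (2 * i + 1) s - y (2 * (α - 1 - i) + 1) s * q (2 * i) s)
        - (y (2 * (α - 1 - i)) 0 * q (2 * i + 1) 0 - y (2 * (α - 1 - i) + 1) 0 * q (2 * i) 0)) := by
  induction J with
  | zero => simp
  | succ J ih =>
    rw [Finset.sum_range_succ, ← ih (by omega)]
    obtain ⟨j, rfl⟩ : ∃ j, α = J + 1 + j := ⟨α - (J + 1), by omega⟩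
    have e1 : J + 1 + j - 1 - J = j := by omega
    have e2 : J + 1 + j - (J + 1) = j := by omega
    have e3 : 2 * (J + 1 + j - J) = 2 * j + 2 := by omega
    have e4 : 2 * (J + 1) = 2 * J + 2 := by omega
    rw [e1, e2, e3, e4]
    have y0 := hy.deriv_even (k := j) (by omega)
    have y1 := hy.deriv_odd (k := j) (by omega)
    have q0 := hq.deriv_even (k := J) (by omega)
    have q1 := hq.deriv_odd (k := J) (by omega)
    -- In the derivative of `y_{2j} q_{2J+1} - y_{2j+1} q_{2J}` the terms with `1 / a` and those
    -- with `κ²` cancel. What remains is `q_{2J} y_{2j+2} - q_{2J+2} y_{2j}`, which moves one factor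
    -- `L` from `y` to `q`.
    have key := ((y0.mul q1).sub (y1.mul q0)).eq hs
    have h0 : (0 : ℝ) ∈ Icc 0 ℓ := ⟨le_rfl, hs.1.trans hs.2⟩
    have hint : ∀ {u v : ℝ → ℝ}, MemLp u 2 (edgeVol ℓ) → MemLp v 2 (edgeVol ℓ) →
        IntervalIntegrable (fun t => u t * v t) volume 0 s := fun {u v} hu hv => by
      have : IntegrableOn (fun t => u t * v t) (Icc 0 ℓ) := hu.integrable_mul hv
      exact (this.mono_set (uIcc_subset_Icc h0 hs)).intervalIntegrable
    have hsub := intervalIntegral.integral_sub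
      (hint (hq.memLp (k := 2 * J) (by omega)) (hy.memLp (k := 2 * j + 2) (by omega)))
      (hint (hq.memLp (k := 2 * J + 2) (by omega)) (hy.memLp (k := 2 * j) (by omega)))
    have e : ∫ t in (0 : ℝ)..s, ((a t)⁻¹ * y (2 * j + 1) t * q (2 * J + 1) t +
          y (2 * j) t * (κ t ^ 2 * q (2 * J) t - q (2 * J + 2) t) -
          ((κ t ^ 2 * y (2 * j) t - y (2 * j + 2) t) * q (2 * J) t +
            y (2 * j + 1) t * ((a t)⁻¹ * q (2 * J + 1) t)))
        = ∫ t in (0 : ℝ)..s, (q (2 * J) t * y (2 * j + 2) t - q (2 * J + 2) t * y (2 * j) t) := by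
      refine intervalIntegral.integral_congr fun t _ => ?_
      ring
    rw [e, hsub] at key
    linarith

theorem green (hy : IsQuasiChain ℓ a κ (2 * α) y) (hq : IsQuasiChain ℓ a κ (2 * α) q)
    {s : ℝ} (hs : s ∈ Icc 0 ℓ) :
    (∫ t in (0 : ℝ)..s, q 0 t * y (2 * α) t) - ∫ t in (0 : ℝ)..s, q (2 * α) t * y 0 t
      = bdryPairing α (fun k => y k s) (fun k => q k s)
        - bdryPairing α (fun k => y k 0) (fun k => q k 0) := by
  have := green_partial hy hq le_rfl hs
  rw [Nat.sub_self, mul_zero] at this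
  rw [this, Finset.sum_sub_distrib]
  rfl

theorem ae_eq_zero_of_integral_sq {f : ℝ → ℝ} (hℓ : 0 ≤ ℓ) (hf : MemLp f 2 (edgeVol ℓ))
    (h : ∫ t in (0 : ℝ)..ℓ, f t ^ 2 = 0) : f =ᵐ[edgeVol ℓ] 0 := by
  rw [intervalIntegral.integral_of_le hℓ, ← integral_Icc_eq_integral_Ioc] at h
  have := (integral_eq_zero_iff_of_nonneg (fun t => sq_nonneg (f t)) hf.integrable_sq).1 h
  filter_upwards [this] with t ht
  exact pow_eq_zero_iff two_ne_zero |>.1 ht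

/-- A homogeneous solution with zero Dirichlet data of order `α` at both ends vanishes. -/
theorem EdgeCoeff.homogeneous_eq_zero (hα : 1 ≤ α) (hℓ : 0 < ℓ) (h : EdgeCoeff α ℓ a κ)
    (hq : IsQuasiChain ℓ a κ (2 * α) q) (htop : q (2 * α) =ᵐ[edgeVol ℓ] 0)
    (h0 : ∀ k < α, q k 0 = 0) (h1 : ∀ k < α, q k ℓ = 0) :
    ∀ k < 2 * α, ∀ t ∈ Icc 0 ℓ, q k t = 0 := by
  have hl0 : (0 : ℝ) ∈ Icc 0 ℓ := left_mem_Icc.2 hℓ.le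
  have hl1 : ℓ ∈ Icc 0 ℓ := right_mem_Icc.2 hℓ.le
  -- Stopping halfway produces boundary terms each with a factor `q_{2i}` or `q_{2i+1}`, `i < α /
  -- 2`, of index below `α`, so the Dirichlet data kill them.
  have hG := green_partial hq hq (J := α / 2) (by omega) hl1
  have z1 : ∫ t in (0 : ℝ)..ℓ, q 0 t * q (2 * α) t = 0 := by
    rw [integral_congr_edge (g₂ := fun _ => 0) _ hl0 hl1]
    · simp
    · filter_upwards [htop] with t ht
      simp [ht]
  rw [z1, Finset.sum_eq_zero, zero_sub, neg_eq_zero] at hG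
  swap
  · intro i hi
    have := Finset.mem_range.1 hi
    rw [h0 (2 * i) (by omega), h0 (2 * i + 1) (by omega), h1 (2 * i) (by omega),
      h1 (2 * i + 1) (by omega)]
    ring
  have hmid : q α =ᵐ[edgeVol ℓ] 0 := by
    rcases Nat.even_or_odd' α with ⟨J, hJ | hJ⟩
    · rw [show α / 2 = J by omega, show 2 * (α - J) = α by omega, ← hJ] at hG
      exact ae_eq_zero_of_integral_sq hℓ.le (hq.memLp (by omega)) (by simpa only [sq] using hG)
    -- For odd `α = 2 J + 1` half a step is missing. One more integration by parts turns the
    -- integral of `q_{2J} L q_{2J}` into that of `q_{2J+1}² / a + κ² q_{2J}²`.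
    · rw [show α / 2 = J by omega, show 2 * (α - J) = 2 * J + 2 by omega] at hG
      have q0 := hq.deriv_even (k := J) (by omega)
      have q1 := hq.deriv_odd (k := J) (by omega)
      have hb := q0.integral_mul q1 hl1
      rw [h0 (2 * J) (by omega), h1 (2 * J) (by omega), zero_mul, zero_mul, sub_zero] at hb
      have i1 := MemLp.intervalIntegrable_mul hℓ.le q0.memLp (hq.memLp (k := 2 * J + 1) (by omega))
      have i2 := MemLp.intervalIntegrable_mul hℓ.le (hq.memLp (k := 2 * J) (by omega)) q1.memLp
      have i3 := MemLp.intervalIntegrable_mul hℓ.le (hq.memLp (k := 2 * J) (by omega))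
        (hq.memLp (k := 2 * J + 2) (by omega))
      have hs : ∫ t in (0 : ℝ)..ℓ, ((a t)⁻¹ * q (2 * J + 1) t * q (2 * J + 1) t +
          q (2 * J) t * (κ t ^ 2 * q (2 * J) t - q (2 * J + 2) t) +
          q (2 * J) t * q (2 * J + 2) t) = 0 := by
        rw [intervalIntegral.integral_add (i1.add i2) i3, hb, hG, add_zero]
      rw [intervalIntegral.integral_of_le hℓ.le, ← integral_Icc_eq_integral_Ioc] at hs
      have hii := ((intervalIntegrable_iff_integrableOn_Icc_of_le hℓ.le).1 ((i1.add i2).add i3))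
      have := (integral_eq_zero_iff_of_nonneg_ae ?_ hii).1 hs
      · rw [hJ]
        filter_upwards [this, ae_restrict_mem measurableSet_Icc] with t ht hts
        have ha := inv_pos.2 (h.a_pos t hts)
        have e : (a t)⁻¹ * q (2 * J + 1) t ^ 2 + (κ t * q (2 * J) t) ^ 2 = 0 := by
          rw [Pi.zero_apply] at ht
          rw [← ht]
          ring
        have e1 : (a t)⁻¹ * q (2 * J + 1) t ^ 2 = 0 := by
          have := mul_nonneg ha.le (sq_nonneg (q (2 * J + 1) t))
          nlinarith [sq_nonneg (κ t * q (2 * J) t)]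
        simpa [ha.ne', (h.a_pos t hts).ne'] using e1
      · filter_upwards [ae_restrict_mem measurableSet_Icc] with t hts
        have ha := inv_pos.2 (h.a_pos t hts)
        have := mul_nonneg ha.le (sq_nonneg (q (2 * J + 1) t))
        rw [Pi.zero_apply]
        nlinarith [sq_nonneg (κ t * q (2 * J) t)]
  -- Once `q_α = 0`, the chain truncated at `α` is a homogeneous initial value problem with zero
  -- data. So `q_0` vanishes, and it determines the whole chain.
  have hz := IsSys.eq_zero hℓ.le (fun k _ => h.quasiC_memLp k) (fun k _ => h.quasiD_memLp k)
    (hq.truncate (j := α) (by omega)) h0 hmid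
  have hzero : IsQuasiChain ℓ a κ (2 * α) (fun _ _ => 0) :=
    ⟨by simp, fun k _ => by simpa using HasL2Deriv.const 0⟩
  have := h.quasi_unique hℓ hq hzero ((ae_restrict_iff' measurableSet_Icc).2
    (Eventually.of_forall fun t ht => hz 0 (by omega) t ht))
  exact fun k hk t ht => this.1 k hk ht

/-- A fundamental system of solutions of `L^α y = 0`, normalised at the left end point. -/
structure IsFundamental (ℓ : ℝ) (a κ : ℝ → ℝ) (α : ℕ) (S : Fin (2 * α) → ℕ → ℝ → ℝ) : Prop where
  chain : ∀ i, IsQuasiChain ℓ a κ (2 * α) (S i)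
  top : ∀ i, S i (2 * α) = 0
  init : ∀ i k : Fin (2 * α), S i k 0 = if k = i then 1 else 0

theorem EdgeCoeff.exists_fundamental (hℓ : 0 < ℓ) (h : EdgeCoeff α ℓ a κ) :
    ∃ S, IsFundamental ℓ a κ α S := by
  choose S hS htop hinit using fun i : Fin (2 * α) => IsSys.exists_solution (n := 2 * α) hℓ.le
    (fun k _ => h.quasiC_memLp k) (fun k _ => h.quasiD_memLp k) (Pi.single i 1) (h := 0) (by simp)
  exact ⟨S, hS, htop, fun i k => by simp [hinit, Pi.single_apply]⟩

namespace IsFundamental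

variable {S : Fin (2 * α) → ℕ → ℝ → ℝ}

theorem comb (hS : IsFundamental ℓ a κ α S) (r : Fin (2 * α) → ℝ) :
    IsQuasiChain ℓ a κ (2 * α) (fun k t => ∑ i, r i * S i k t) :=
  IsSys.sum_smul _ r fun i _ => hS.chain i

theorem comb_top (hS : IsFundamental ℓ a κ α S) (r : Fin (2 * α) → ℝ) (t : ℝ) :
    ∑ i, r i * S i (2 * α) t = 0 := by simp [hS.top]

theorem comb_init (hS : IsFundamental ℓ a κ α S) (r : Fin (2 * α) → ℝ) (k : Fin (2 * α)) :
    ∑ i, r i * S i k 0 = r k := by simp [hS.init]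

/-- The data of homogeneous solutions at any point of the edge are arbitrary. -/
theorem exists_data (hS : IsFundamental ℓ a κ α S) {s : ℝ} (hs : s ∈ Icc 0 ℓ) (l : ℕ) :
    ∃ r : Fin (2 * α) → ℝ, ∀ k < 2 * α, ∑ i, r i * S i k s = (Pi.single l 1 : ℕ → ℝ) k := by
  let T : (Fin (2 * α) → ℝ) →ₗ[ℝ] (Fin (2 * α) → ℝ) :=
    { toFun := fun r k => ∑ i, r i * S i k s
      map_add' := fun r r' => by
        ext k
        simp [add_mul, Finset.sum_add_distrib]
      map_smul' := fun c r => by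
        ext k
        simp [Finset.mul_sum, mul_assoc] }
  have hinj : Function.Injective T := by
    rw [← LinearMap.ker_eq_bot, LinearMap.ker_eq_bot']
    intro r hr
    have hr' : ∀ k < 2 * α, ∑ i, r i * S i k s = 0 := fun k hk => congrFun hr ⟨k, hk⟩
    -- The pairing of two homogeneous solutions is constant in the point. If the data vanish at `s`,
    -- the pairing with each `S l` vanishes also at `0`, where `S l` has canonical data.
    have key : ∀ l < 2 * α,
        bdryPairing α (fun k => ∑ i, r i * S i k 0) (Pi.single l 1) = 0 := by
      intro l hl
      have hG := green (hS.comb r) (hS.chain ⟨l, hl⟩) hs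
      simp only [hS.top, Finset.sum_const_zero, mul_zero, Pi.zero_apply, zero_mul,
        intervalIntegral.integral_zero, sub_zero] at hG
      rw [bdryPairing_zero_left hr', zero_sub, eq_comm, neg_eq_zero] at hG
      refine (bdryPairing_congr_right _ fun k hk => ?_).trans hG
      have := hS.init ⟨l, hl⟩ ⟨k, hk⟩
      simp only [Fin.mk.injEq] at this
      rw [this, Pi.single_apply]
    have h0 := eq_zero_of_bdryPairing key
    ext k
    rw [← hS.comb_init r k]
    exact h0 k k.2
  obtain ⟨r, hr⟩ := LinearMap.injective_iff_surjective.1 hinj (fun k => (Pi.single l 1 : ℕ → ℝ) k)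
  exact ⟨r, fun k hk => congrFun hr ⟨k, hk⟩⟩

end IsFundamental

/-- A chain of length `2 α` with compact support in the open edge. -/
def IsCoreChain (ℓ : ℝ) (a κ : ℝ → ℝ) (α : ℕ) (q : ℕ → ℝ → ℝ) : Prop :=
  IsQuasiChain ℓ a κ (2 * α) q ∧
    ∃ δ > 0, ∀ t ∈ Icc 0 ℓ, t < δ ∨ ℓ - δ < t → ∀ k < 2 * α, q k t = 0

theorem IsCoreChain.left (hℓ : 0 < ℓ) (h : IsCoreChain ℓ a κ α q) : ∀ k < 2 * α, q k 0 = 0 := by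
  obtain ⟨-, δ, hδ, h⟩ := h
  exact h 0 (left_mem_Icc.2 hℓ.le) (Or.inl hδ)

theorem IsCoreChain.right (hℓ : 0 < ℓ) (h : IsCoreChain ℓ a κ α q) : ∀ k < 2 * α, q k ℓ = 0 := by
  obtain ⟨-, δ, hδ, h⟩ := h
  exact h ℓ (right_mem_Icc.2 hℓ.le) (Or.inr (by linarith))

/-- Solve `L^α q = h` with zero data at `0`. Green's identity against a homogeneous solution with
canonical data at `s` expresses a component of `q` at `s` by integrals of `S i 0 * h` over `[0, s]`.
These vanish for `s < δ` since `h` does, and for `s > ℓ - δ` since they are then the full integrals,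
which are zero by assumption. -/
theorem exists_coreChain_of_orthogonal {S : Fin (2 * α) → ℕ → ℝ → ℝ} (hℓ : 0 < ℓ)
    (hco : EdgeCoeff α ℓ a κ) (hS : IsFundamental ℓ a κ α S) {h : ℝ → ℝ}
    (hh : MemLp h 2 (edgeVol ℓ)) {δ : ℝ} (hδ : 0 < δ)
    (hsupp : ∀ᵐ t ∂edgeVol ℓ, t < δ ∨ ℓ - δ < t → h t = 0)
    (horth : ∀ i, ∫ t in (0 : ℝ)..ℓ, S i 0 t * h t = 0) :
    ∃ q, IsCoreChain ℓ a κ α q ∧ q (2 * α) = h := by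
  obtain ⟨q, hq, hqt, hq0⟩ := IsSys.exists_solution (n := 2 * α) hℓ.le
    (fun k _ => hco.quasiC_memLp k) (fun k _ => hco.quasiD_memLp k) 0 hh
  have hq0' : ∀ k < 2 * α, q k 0 = 0 := fun k hk => hq0 ⟨k, hk⟩
  have hl0 : (0 : ℝ) ∈ Icc 0 ℓ := left_mem_Icc.2 hℓ.le
  have hl1 : ℓ ∈ Icc 0 ℓ := right_mem_Icc.2 hℓ.le
  refine ⟨q, ⟨hq, δ, hδ, fun s hs hsδ => ?_⟩, hqt⟩
  have hint : ∀ i, IntegrableOn (fun t => S i 0 t * h t) (Icc 0 ℓ) := fun i =>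
    ((hS.chain i).memLp (Nat.zero_le _)).integrable_mul hh
  have hzero : ∀ i, ∫ t in (0 : ℝ)..s, S i 0 t * h t = 0 := by
    intro i
    rcases hsδ with hsδ | hsδ
    · refine intervalIntegral.integral_zero_ae ?_
      filter_upwards [(ae_restrict_iff' measurableSet_Icc).1 hsupp] with t ht hts
      rw [uIoc_of_le hs.1] at hts
      rw [ht ⟨hts.1.le, hts.2.trans hs.2⟩ (Or.inl (hts.2.trans_lt hsδ)), mul_zero]
    · have e := intervalIntegral.integral_add_adjacent_intervals
        (((hint i).mono_set (uIcc_subset_Icc hl0 hs)).intervalIntegrable)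
        (((hint i).mono_set (uIcc_subset_Icc hs hl1)).intervalIntegrable)
      have e2 : ∫ t in s..ℓ, S i 0 t * h t = 0 := by
        refine intervalIntegral.integral_zero_ae ?_
        filter_upwards [(ae_restrict_iff' measurableSet_Icc).1 hsupp] with t ht hts
        rw [uIoc_of_le hs.2] at hts
        rw [ht ⟨hs.1.trans hts.1.le, hts.2⟩ (Or.inr (hsδ.trans hts.1)), mul_zero]
      rw [horth i, e2, add_zero] at e
      exact e
  refine eq_zero_of_bdryPairing fun l hl => ?_
  obtain ⟨r, hr⟩ := hS.exists_data hs l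
  have hG := green (hS.comb r) hq hs
  rw [bdryPairing_zero_right hq0', sub_zero, bdryPairing_symm,
    bdryPairing_congr_right _ (fun k hk => hr k hk)] at hG
  have z1 : ∫ t in (0 : ℝ)..s, q 0 t * ∑ i, r i * S i (2 * α) t = 0 := by
    simp [hS.comb_top]
  have z2 : ∫ t in (0 : ℝ)..s, q (2 * α) t * ∑ i, r i * S i 0 t = 0 := by
    have e : ∀ t, q (2 * α) t * ∑ i, r i * S i 0 t = ∑ i, r i * (S i 0 t * h t) := fun t => by
      rw [hqt, Finset.mul_sum]
      exact Finset.sum_congr rfl fun i _ => by ring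
    simp only [e]
    rw [intervalIntegral.integral_finsetSum fun i _ => ((((hint i).mono_set
      (uIcc_subset_Icc hl0 hs)).intervalIntegrable).const_mul (r i))]
    exact Finset.sum_eq_zero fun i _ => by
      rw [intervalIntegral.integral_const_mul, hzero i, mul_zero]
  rw [z1, z2] at hG
  linarith

end Green

/-! ### Orthogonality to compactly supported chains and the boundary data of solutions -/

/-- Square integrable functions which vanish near the end points of the edge. -/
def compactL2 (ℓ : ℝ) : Submodule ℝ (ℝ → ℝ) where
  carrier := {h | MemLp h 2 (edgeVol ℓ) ∧ ∃ δ > 0, ∀ᵐ t ∂edgeVol ℓ, t < δ ∨ ℓ - δ < t → h t = 0}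
  add_mem' := by
    rintro f g ⟨hf, δ, hδ, hf'⟩ ⟨hg, ε, hε, hg'⟩
    refine ⟨hf.add hg, min δ ε, lt_min hδ hε, ?_⟩
    filter_upwards [hf', hg'] with t h1 h2 ht
    have a1 : t < δ ∨ ℓ - δ < t := ht.imp (fun h => h.trans_le (min_le_left _ _))
      fun h => by linarith [min_le_left δ ε]
    have a2 : t < ε ∨ ℓ - ε < t := ht.imp (fun h => h.trans_le (min_le_right _ _))
      fun h => by linarith [min_le_right δ ε]
    simp [h1 a1, h2 a2]
  zero_mem' := ⟨by simp, 1, one_pos, by simp⟩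
  smul_mem' := by
    rintro c f ⟨hf, δ, hδ, hf'⟩
    refine ⟨hf.const_smul c, δ, hδ, ?_⟩
    filter_upwards [hf'] with t h1 ht
    simp [h1 ht]

/-- Integration against a square integrable function. -/
def compactPairing {ℓ : ℝ} (hℓ : 0 ≤ ℓ) {x : ℝ → ℝ} (hx : MemLp x 2 (edgeVol ℓ)) :
    compactL2 ℓ →ₗ[ℝ] ℝ where
  toFun h := ∫ t in (0 : ℝ)..ℓ, x t * (h : ℝ → ℝ) t
  map_add' f g := by
    rw [← intervalIntegral.integral_add (MemLp.intervalIntegrable_mul hℓ hx f.2.1)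
      (MemLp.intervalIntegrable_mul hℓ hx g.2.1)]
    simp [mul_add]
  map_smul' c f := by
    rw [RingHom.id_apply, smul_eq_mul, ← intervalIntegral.integral_const_mul]
    simp [mul_left_comm]

/-- The truncations of `x` to `[1/(n+1), ℓ - 1/(n+1)]` are themselves admissible test functions. -/
theorem ae_eq_zero_of_compactPairing {ℓ : ℝ} (hℓ : 0 ≤ ℓ) {x : ℝ → ℝ}
    (hx : MemLp x 2 (edgeVol ℓ)) (h : ∀ f ∈ compactL2 ℓ, ∫ t in (0 : ℝ)..ℓ, x t * f t = 0) :
    x =ᵐ[edgeVol ℓ] 0 := by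
  have key : ∀ n : ℕ, ∀ᵐ t ∂edgeVol ℓ,
      t ∈ Icc (1 / ((n : ℝ) + 1)) (ℓ - 1 / ((n : ℝ) + 1)) → x t = 0 := by
    intro n
    set δ : ℝ := 1 / ((n : ℝ) + 1)
    have hδ : 0 < δ := by positivity
    have hm : MemLp ((Icc δ (ℓ - δ)).indicator x) 2 (edgeVol ℓ) := hx.indicator measurableSet_Icc
    have h0 := h ((Icc δ (ℓ - δ)).indicator x) ⟨hm, δ, hδ, Eventually.of_forall fun t ht => by
      rw [indicator_of_notMem]
      rintro ⟨h1, h2⟩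
      rcases ht with ht | ht <;> linarith⟩
    have e : ∀ t, x t * (Icc δ (ℓ - δ)).indicator x t = ((Icc δ (ℓ - δ)).indicator x t) ^ 2 := by
      intro t
      by_cases ht : t ∈ Icc δ (ℓ - δ)
      · simp only [indicator_of_mem ht, sq]
      · simp only [indicator_of_notMem ht]
        ring
    simp only [e] at h0
    filter_upwards [ae_eq_zero_of_integral_sq hℓ hm h0] with t ht hts
    rwa [indicator_of_mem hts] at ht
  refine ae_edge_iff_Ioo.2 ?_
  have key' := ae_edge_iff_Ioo.1 (ae_all_iff.2 key)
  filter_upwards [key'] with t ht hts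
  obtain ⟨n, hn⟩ := exists_nat_one_div_lt (lt_min hts.1 (sub_pos.2 hts.2))
  have h1 := hn.trans_le (min_le_left _ _)
  have h2 := hn.trans_le (min_le_right _ _)
  exact ht hts n ⟨h1.le, by linarith⟩

section CoreOrthogonality

variable {ℓ : ℝ} {a κ : ℝ → ℝ} {α : ℕ} {S : Fin (2 * α) → ℕ → ℝ → ℝ}

/-- A function orthogonal to `L^α g` for all compactly supported `g` solves `L^α x = 0`. -/
theorem exists_homogeneous_of_orthogonal (hℓ : 0 < ℓ) (hco : EdgeCoeff α ℓ a κ)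
    (hS : IsFundamental ℓ a κ α S) {x : ℝ → ℝ} (hx : MemLp x 2 (edgeVol ℓ))
    (H : ∀ q, IsCoreChain ℓ a κ α q → ∫ t in (0 : ℝ)..ℓ, x t * q (2 * α) t = 0) :
    ∃ r : Fin (2 * α) → ℝ, x =ᵐ[edgeVol ℓ] fun t => ∑ i, r i * S i 0 t := by
  have hS0 : ∀ i, MemLp (S i 0) 2 (edgeVol ℓ) := fun i => (hS.chain i).memLp (Nat.zero_le _)
  -- A compactly supported `f` annihilated by all `S i 0` is some `L^α q` with `q` in the core,
  -- hence is annihilated by `x`. A functional vanishing on the common kernel of finitely many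
  -- functionals is a combination of them, so no regularity of `x` has to be proved.
  have hker : ⨅ i, LinearMap.ker (compactPairing hℓ.le (hS0 i)) ≤
      LinearMap.ker (compactPairing hℓ.le hx) := by
    intro f hf
    simp only [Submodule.mem_iInf, LinearMap.mem_ker] at hf ⊢
    obtain ⟨hm, δ, hδ, hsupp⟩ := f.2
    obtain ⟨q, hq, hqt⟩ := exists_coreChain_of_orthogonal hℓ hco hS hm hδ hsupp hf
    have := H q hq
    rwa [hqt] at this
  have hspan := mem_span_of_iInf_ker_le_ker hker
  obtain ⟨r, hr⟩ := (Submodule.mem_span_range_iff_exists_fun ℝ).1 hspan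
  refine ⟨r, ?_⟩
  have hsum : MemLp (fun t => ∑ i, r i * S i 0 t) 2 (edgeVol ℓ) :=
    memLp_finsetSum _ fun i _ => (hS0 i).const_mul (r i)
  have h0 := ae_eq_zero_of_compactPairing hℓ.le (hx.sub hsum) fun f hf => by
    have e := LinearMap.congr_fun hr ⟨f, hf⟩
    simp only [LinearMap.sum_apply, LinearMap.smul_apply, compactPairing, LinearMap.coe_mk,
      AddHom.coe_mk, smul_eq_mul] at e
    have e2 : ∀ t, (x - fun t => ∑ i, r i * S i 0 t) t * f t
        = x t * f t - ∑ i, r i * (S i 0 t * f t) := fun t => by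
      simp only [Pi.sub_apply, sub_mul, Finset.sum_mul, mul_assoc]
    have hi : ∀ i ∈ Finset.univ, IntervalIntegrable (fun t => r i * (S i 0 t * f t)) volume 0 ℓ :=
      fun i _ => (MemLp.intervalIntegrable_mul hℓ.le (hS0 i) hf.1).const_mul (r i)
    have hsi : IntervalIntegrable (fun t => ∑ i, r i * (S i 0 t * f t)) volume 0 ℓ := by
      have := IntervalIntegrable.sum _ hi
      rwa [Finset.sum_fn] at this
    simp only [e2]
    rw [intervalIntegral.integral_sub (MemLp.intervalIntegrable_mul hℓ.le hx hf.1) hsi,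
      intervalIntegral.integral_finsetSum hi, ← e]
    simp
  filter_upwards [h0] with t ht
  simp only [Pi.sub_apply, Pi.zero_apply] at ht
  linarith

end CoreOrthogonality

/-- Functions of `H^α` on the edge with vanishing boundary data. -/
def MemSobolevZero (α : ℕ) (ℓ : ℝ) (f : ℝ → ℝ) : Prop :=
  MemSobolev α ℓ f ∧ bdryData α ℓ f = 0

/-! ### Boundary data and the solutions `G_j` -/

section BoundaryData

variable {ℓ : ℝ} {a κ f g : ℝ → ℝ} {α : ℕ} {x q : ℕ → ℝ → ℝ}

theorem IsSobChain.bdryData_inl (hℓ : 0 < ℓ) (hx : IsSobChain ℓ α x) (k : Fin α) :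
    bdryData α ℓ (x 0) (Sum.inl k) = x k 0 :=
  IsSobChain.iteratedDerivWithin_eq hℓ hx k.2 (left_mem_Icc.2 hℓ.le)

theorem IsSobChain.bdryData_inr (hℓ : 0 < ℓ) (hx : IsSobChain ℓ α x) (k : Fin α) :
    bdryData α ℓ (x 0) (Sum.inr k) = x k ℓ :=
  IsSobChain.iteratedDerivWithin_eq hℓ hx k.2 (right_mem_Icc.2 hℓ.le)

theorem IsSobChain.bdryData_eq_zero_iff (hℓ : 0 < ℓ) (hx : IsSobChain ℓ α x) :
    bdryData α ℓ (x 0) = 0 ↔ (∀ k < α, x k 0 = 0) ∧ ∀ k < α, x k ℓ = 0 := by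
  constructor
  · intro h
    exact ⟨fun k hk => (IsSobChain.bdryData_inl hℓ hx ⟨k, hk⟩).symm.trans (congrFun h _),
      fun k hk => (IsSobChain.bdryData_inr hℓ hx ⟨k, hk⟩).symm.trans (congrFun h _)⟩
  · rintro ⟨h0, h1⟩
    ext (k | k)
    · exact (IsSobChain.bdryData_inl hℓ hx k).trans (h0 k k.2)
    · exact (IsSobChain.bdryData_inr hℓ hx k).trans (h1 k k.2)

theorem bdryData_congr (hℓ : 0 ≤ ℓ) (h : EqOn f g (Icc 0 ℓ)) : bdryData α ℓ f = bdryData α ℓ g := by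
  ext (k | k)
  · exact iteratedDerivWithin_congr h (left_mem_Icc.2 hℓ)
  · exact iteratedDerivWithin_congr h (right_mem_Icc.2 hℓ)

theorem MemSobolev.sum_smul {ι : Type*} (s : Finset ι) {F : ι → ℝ → ℝ} (r : ι → ℝ)
    (h : ∀ i ∈ s, MemSobolev α ℓ (F i)) : MemSobolev α ℓ (fun t => ∑ i ∈ s, r i * F i t) := by
  choose! X hX hX0 using fun i hi => memSobolev_iff.1 (h i hi)
  refine memSobolev_iff.2 ⟨_, IsSys.sum_smul s r hX, ?_⟩
  funext t
  exact Finset.sum_congr rfl fun i hi => by rw [hX0 i hi]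

theorem MemSobolev.lincomb (hf : MemSobolev α ℓ f) (hg : MemSobolev α ℓ g) (r : ℝ) :
    MemSobolev α ℓ (fun t => r * f t + g t) := by
  obtain ⟨x, hx, rfl⟩ := memSobolev_iff.1 hf
  obtain ⟨y, hy, rfl⟩ := memSobolev_iff.1 hg
  exact memSobolev_iff.2 ⟨_, hx.lincomb hy r, rfl⟩

theorem iteratedDerivWithin_sum_smul {ι : Type*} (hℓ : 0 < ℓ) (s : Finset ι) {F : ι → ℝ → ℝ}
    (r : ι → ℝ) (h : ∀ i ∈ s, MemSobolev α ℓ (F i)) {k : ℕ} (hk : k < α) {t : ℝ}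
    (ht : t ∈ Icc 0 ℓ) :
    iteratedDerivWithin k (fun t => ∑ i ∈ s, r i * F i t) (Icc 0 ℓ) t
      = ∑ i ∈ s, r i * iteratedDerivWithin k (F i) (Icc 0 ℓ) t := by
  choose! X hX hX0 using fun i hi => memSobolev_iff.1 (h i hi)
  have h1 := IsSobChain.iteratedDerivWithin_eq hℓ (IsSys.sum_smul s r hX) hk ht
  have e : (fun t => ∑ i ∈ s, r i * X i 0 t) = fun t => ∑ i ∈ s, r i * F i t := by
    funext t
    exact Finset.sum_congr rfl fun i hi => by rw [hX0 i hi]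
  rw [e] at h1
  rw [h1]
  refine Finset.sum_congr rfl fun i hi => ?_
  rw [← hX0 i hi, IsSobChain.iteratedDerivWithin_eq hℓ (hX i hi) hk ht]

theorem bdryData_sum_smul {ι : Type*} (hℓ : 0 < ℓ) (s : Finset ι) {F : ι → ℝ → ℝ}
    (r : ι → ℝ) (h : ∀ i ∈ s, MemSobolev α ℓ (F i)) :
    bdryData α ℓ (fun t => ∑ i ∈ s, r i * F i t) = fun j => ∑ i ∈ s, r i * bdryData α ℓ (F i) j := by
  ext (k | k)
  · exact iteratedDerivWithin_sum_smul hℓ s r h k.2 (left_mem_Icc.2 hℓ.le)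
  · exact iteratedDerivWithin_sum_smul hℓ s r h k.2 (right_mem_Icc.2 hℓ.le)

theorem bdryData_lincomb (hℓ : 0 < ℓ) (hf : MemSobolev α ℓ f) (hg : MemSobolev α ℓ g) (r : ℝ) :
    bdryData α ℓ (fun t => r * f t + g t) = r • bdryData α ℓ f + bdryData α ℓ g := by
  have := bdryData_sum_smul hℓ Finset.univ (F := ![f, g]) ![r, 1] (by
    intro i _
    fin_cases i
    exacts [hf, hg])
  simp only [Fin.sum_univ_two, Matrix.cons_val_zero, Matrix.cons_val_one, one_mul] at this
  rw [this]
  rfl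

/-- `H^α` functions with zero boundary data in terms of quasi-derivatives. -/
theorem EdgeCoeff.memSobolevZero_iff (hℓ : 0 < ℓ) (h : EdgeCoeff α ℓ a κ) :
    MemSobolevZero α ℓ f ↔ ∃ q, IsQuasiChain ℓ a κ α q ∧ q 0 = f ∧ (∀ k < α, q k 0 = 0) ∧
      ∀ k < α, q k ℓ = 0 := by
  constructor
  · rintro ⟨hf, hb⟩
    obtain ⟨x, hx, rfl⟩ := memSobolev_iff.1 hf
    obtain ⟨C, -, hC⟩ := h.exists_quasi_of_sob hℓ
    obtain ⟨q, hq, hq0, hz, -⟩ := hC x hx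
    obtain ⟨h0, h1⟩ := (IsSobChain.bdryData_eq_zero_iff hℓ hx).1 hb
    exact ⟨q, hq, hq0, hz 0 h0, hz ℓ h1⟩
  · rintro ⟨q, hq, rfl, h0, h1⟩
    obtain ⟨C, -, hC⟩ := h.exists_sob_of_quasi hℓ
    obtain ⟨x, hx, hx0, hz, -⟩ := hC q hq
    rw [← hx0]
    exact ⟨memSobolev_iff.2 ⟨x, hx, rfl⟩, (IsSobChain.bdryData_eq_zero_iff hℓ hx).2
      ⟨hz 0 h0, hz ℓ h1⟩⟩

theorem EdgeCoeff.memSobolev_of_quasi (hℓ : 0 < ℓ) (h : EdgeCoeff α ℓ a κ)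
    (hq : IsQuasiChain ℓ a κ α q) : MemSobolev α ℓ (q 0) := by
  obtain ⟨C, -, hC⟩ := h.exists_sob_of_quasi hℓ
  obtain ⟨x, hx, hx0, -⟩ := hC q hq
  exact memSobolev_iff.2 ⟨x, hx, hx0⟩

theorem EdgeCoeff.homogeneous_eq_zero_of_bdryData (hα : 1 ≤ α) (hℓ : 0 < ℓ)
    (h : EdgeCoeff α ℓ a κ) (hq : IsQuasiChain ℓ a κ (2 * α) q)
    (htop : q (2 * α) =ᵐ[edgeVol ℓ] 0) (hb : bdryData α ℓ (q 0) = 0) :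
    ∀ k < 2 * α, ∀ t ∈ Icc 0 ℓ, q k t = 0 := by
  have hqα := hq.truncate (j := α) (by omega)
  obtain ⟨p, hp, hp0, h0, h1⟩ := (h.memSobolevZero_iff hℓ).1
    ⟨h.memSobolev_of_quasi hℓ hqα, hb⟩
  have he := (h.quasi_unique hℓ hqα hp (by rw [hp0])).1
  exact h.homogeneous_eq_zero hα hℓ hq htop
    (fun k hk => (he k hk (left_mem_Icc.2 hℓ.le)).trans (h0 k hk))
    fun k hk => (he k hk (right_mem_Icc.2 hℓ.le)).trans (h1 k hk)

/-- The solutions of `L^α G = 0` with canonical boundary data. -/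
theorem EdgeCoeff.exists_bdryBasis (hα : 1 ≤ α) (hℓ : 0 < ℓ) (h : EdgeCoeff α ℓ a κ) :
    ∃ Q : BdryIndex α → ℕ → ℝ → ℝ, ∀ j, IsQuasiChain ℓ a κ (2 * α) (Q j) ∧ Q j (2 * α) = 0 ∧
      bdryData α ℓ (Q j 0) = Pi.single j 1 := by
  obtain ⟨S, hS⟩ := h.exists_fundamental hℓ
  have hS0 : ∀ i, MemSobolev α ℓ (S i 0) := fun i =>
    h.memSobolev_of_quasi hℓ ((hS.chain i).truncate (by omega))
  let T : (Fin (2 * α) → ℝ) →ₗ[ℝ] (BdryIndex α → ℝ) :=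
    { toFun := fun r j => ∑ i, r i * bdryData α ℓ (S i 0) j
      map_add' := fun r r' => by
        ext k
        simp [add_mul, Finset.sum_add_distrib]
      map_smul' := fun c r => by
        ext k
        simp [Finset.mul_sum, mul_assoc] }
  have hT : ∀ r, T r = bdryData α ℓ (fun t => ∑ i, r i * S i 0 t) := fun r =>
    (bdryData_sum_smul hℓ Finset.univ r fun i _ => hS0 i).symm
  have hinj : Function.Injective T := by
    rw [← LinearMap.ker_eq_bot, LinearMap.ker_eq_bot']
    intro r hr
    rw [hT] at hr
    have hz := h.homogeneous_eq_zero_of_bdryData hα hℓ (hS.comb r)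
      (Eventually.of_forall fun t => hS.comb_top r t) hr
    ext k
    rw [← hS.comb_init r k]
    exact hz k k.2 0 (left_mem_Icc.2 hℓ.le)
  -- Both sides have dimension `2 α`, so uniqueness for the boundary value problem gives
  -- solvability.
  have hdim : Module.finrank ℝ (Fin (2 * α) → ℝ) = Module.finrank ℝ (BdryIndex α → ℝ) := by
    simp
    omega
  have hsurj := (LinearMap.injective_iff_surjective_of_finrank_eq_finrank hdim).1 hinj
  choose r hr using fun j : BdryIndex α => hsurj (Pi.single j 1)
  refine ⟨fun j k t => ∑ i, r j i * S i k t, fun j => ⟨hS.comb (r j), ?_, ?_⟩⟩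
  · ext t
    exact hS.comb_top (r j) t
  · rw [← hT, hr]

theorem linearIndependent_of_bdryData (hℓ : 0 < ℓ) {G : BdryIndex α → ℝ → ℝ}
    (hG : ∀ j, MemSobolev α ℓ (G j)) (hb : ∀ j, bdryData α ℓ (G j) = Pi.single j 1) :
    LinearIndependent ℝ (fun j => (Icc (0 : ℝ) ℓ).domRestrict (G j)) := by
  rw [Fintype.linearIndependent_iff]
  intro c hc j
  have h0 : EqOn (fun t => ∑ j, c j * G j t) (fun _ => 0) (Icc 0 ℓ) := fun t ht => by
    have := congrFun hc ⟨t, ht⟩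
    simpa using this
  have h1 := bdryData_sum_smul hℓ Finset.univ c fun j _ => hG j
  rw [bdryData_congr hℓ.le h0] at h1
  have h2 : bdryData α ℓ (fun _ : ℝ => (0 : ℝ)) = 0 := by
    have hz : IsSobChain ℓ α (fun _ _ => 0) := ⟨by simp, fun k _ => by simpa using HasL2Deriv.const 0⟩
    exact (IsSobChain.bdryData_eq_zero_iff hℓ hz).2 ⟨fun _ _ => rfl, fun _ _ => rfl⟩
  rw [h2] at h1
  have h3 := congrFun h1 j
  simp only [hb, Pi.zero_apply] at h3
  rw [Finset.sum_eq_single j] at h3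
  · simpa using h3.symm
  · intro i _ hi
    simp [hi.symm]
  · simp

end BoundaryData

/-! ### The Kirchhoff Laplacian and its inverse -/

namespace MetricGraph

variable {V E : Type*} {Γ : MetricGraph V E} {α : ℕ} {a κ : E → ℝ → ℝ}

theorem left_mem (Γ : MetricGraph V E) (e : E) : (0 : ℝ) ∈ Icc 0 (Γ.len e) :=
  left_mem_Icc.2 (Γ.len_pos e).le

theorem right_mem (Γ : MetricGraph V E) (e : E) : Γ.len e ∈ Icc 0 (Γ.len e) :=
  right_mem_Icc.2 (Γ.len_pos e).le

section Flux

variable [Fintype E]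

open Classical in
/-- The fluxes `p` balance at every vertex. -/
def FluxBalance (Γ : MetricGraph V E) (p : E → ℝ → ℝ) : Prop :=
  ∀ v : V, ∑ e : E, ((if Γ.src e = v then p e 0 else 0)
    - (if Γ.tgt e = v then p e (Γ.len e) else 0)) = 0

/-- `F` is a function in the domain of `L`, with quasi-derivative `p = a F'`, and `L F = g`. -/
structure OpRep (Γ : MetricGraph V E) (a κ F p g : E → ℝ → ℝ) : Prop where
  dF : ∀ e, HasL2Deriv (Γ.len e) (F e) (fun t => (a e t)⁻¹ * p e t)
  dp : ∀ e, HasL2Deriv (Γ.len e) (p e) (fun t => κ e t ^ 2 * F e t - g e t)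
  vertex : Γ.VertexCompatible F
  flux : Γ.FluxBalance p

/-- Since `a` has one value at each vertex, the sum of fluxes `a F'` there is this value times the
Kirchhoff sum. -/
theorem kirchhoff_iff_fluxBalance {F p : E → ℝ → ℝ} (hco : Γ.Coeff α a κ)
    (h0 : ∀ e, p e 0 = a e 0 * derivWithin (F e) (Icc 0 (Γ.len e)) 0)
    (h1 : ∀ e, p e (Γ.len e) = a e (Γ.len e) * derivWithin (F e) (Icc 0 (Γ.len e)) (Γ.len e)) :
    Γ.Kirchhoff F ↔ Γ.FluxBalance p := by
  classical
  obtain ⟨⟨c, hc⟩, hpos⟩ := hco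
  have key : ∀ v, (∑ e : E, ((if Γ.src e = v then p e 0 else 0)
      - (if Γ.tgt e = v then p e (Γ.len e) else 0))) = c v * ∑ e : E,
      ((if Γ.src e = v then derivWithin (F e) (Icc 0 (Γ.len e)) 0 else 0)
      - (if Γ.tgt e = v then derivWithin (F e) (Icc 0 (Γ.len e)) (Γ.len e) else 0)) := by
    intro v
    rw [Finset.mul_sum]
    refine Finset.sum_congr rfl fun e _ => ?_
    rw [mul_sub, mul_ite, mul_ite, mul_zero]
    congr 1
    · split_ifs with h
      · rw [h0, (hc e).1, h]
      · rfl
    · split_ifs with h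
      · rw [h1, (hc e).2, h]
      · rfl
  constructor
  · intro h v
    exact (key v).trans ((congrArg (c v * ·) (h v)).trans (mul_zero _))
  · intro h v
    by_cases hv : ∃ e, Γ.src e = v ∨ Γ.tgt e = v
    · obtain ⟨e, he⟩ := hv
      have hcv : c v ≠ 0 := by
        rcases he with rfl | rfl
        · rw [← (hc e).1]
          exact ((hpos e).a_pos 0 (Γ.left_mem e)).ne'
        · rw [← (hc e).2]
          exact ((hpos e).a_pos _ (Γ.right_mem e)).ne'
      refine (mul_eq_zero.1 (Eq.trans ?_ (h v))).resolve_left hcv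
      convert (key v).symm
    -- At a vertex meeting no edge, `a` provides no positive value to divide by, but every summand
    -- is zero.
    · push Not at hv
      exact Finset.sum_eq_zero fun e _ => by simp [(hv e).1, (hv e).2]

theorem op_iff (hco : Γ.Coeff α a κ) {f g : Γ.L2} :
    Γ.Op a κ f g ↔ ∃ F p : E → ℝ → ℝ, Γ.OpRep a κ F p (fun e => g e) ∧
      ∀ e, F e =ᵐ[edgeVol (Γ.len e)] f e := by
  have hpd : ∀ {F p : E → ℝ → ℝ} {g : E → ℝ → ℝ},
      (∀ e, HasL2Deriv (Γ.len e) (F e) (fun t => (a e t)⁻¹ * p e t)) →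
      (∀ e, HasL2Deriv (Γ.len e) (p e) (g e)) →
      ∀ e, ∀ t ∈ Icc 0 (Γ.len e), p e t = a e t * derivWithin (F e) (Icc 0 (Γ.len e)) t := by
    intro F p g hF hp e t ht
    have hi : ContinuousOn (fun t => (a e t)⁻¹) (Icc 0 (Γ.len e)) := by
      obtain ⟨b, -, hb⟩ := (hco.2 e).wInf_inv (hco.2 e).wInf_one
      exact hb.continuousOn
    rw [((hF e).hasDerivWithinAt (hi.mul (hp e).continuousOn) ht).derivWithin
      (uniqueDiffOn_Icc (Γ.len_pos e) t ht), mul_inv_cancel_left₀ ((hco.2 e).a_pos t ht).ne']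
  constructor
  · rintro ⟨F, hF, hop, hv, hK⟩
    have hop' := fun e => (((hco.2 e).edgeOp_iff (Γ.len_pos e)).1 (hop e)).2
    choose p hp hpp using hop'
    refine ⟨F, p, ⟨hp, hpp, hv, ?_⟩, hF⟩
    exact (kirchhoff_iff_fluxBalance hco (fun e => hpd hp hpp e _ (Γ.left_mem e))
      fun e => hpd hp hpp e _ (Γ.right_mem e)).1 hK
  · rintro ⟨F, p, ⟨hp, hpp, hv, hK⟩, hF⟩
    refine ⟨F, hF, fun e => ((hco.2 e).edgeOp_iff (Γ.len_pos e)).2 ⟨Lp.memLp _, p e, hp e, hpp e⟩,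
      hv, ?_⟩
    exact (kirchhoff_iff_fluxBalance hco (fun e => hpd hp hpp e _ (Γ.left_mem e))
      fun e => hpd hp hpp e _ (Γ.right_mem e)).2 hK

/-- Regrouped by vertices, the end point terms are the common value of `η` times the balanced flux.
-/
theorem sum_boundary_eq_zero [Finite V] {p η : E → ℝ → ℝ} (hp : Γ.FluxBalance p)
    (hη : Γ.VertexCompatible η) :
    ∑ e, (p e (Γ.len e) * η e (Γ.len e) - p e 0 * η e 0) = 0 := by
  classical
  cases nonempty_fintype V
  obtain ⟨c, hc⟩ := hη
  have h : ∑ v : V, c v * ∑ e : E, ((if Γ.src e = v then p e 0 else 0)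
      - (if Γ.tgt e = v then p e (Γ.len e) else 0)) = 0 :=
    Finset.sum_eq_zero fun v _ => by
      have := hp v
      rw [show (∑ e : E, ((if Γ.src e = v then p e 0 else 0)
        - (if Γ.tgt e = v then p e (Γ.len e) else 0))) = 0 by convert this, mul_zero]
  simp only [Finset.mul_sum] at h
  rw [Finset.sum_comm] at h
  simp only [mul_sub, mul_ite, mul_zero, Finset.sum_sub_distrib, Finset.sum_ite_eq,
    Finset.mem_univ, if_true] at h
  rw [Finset.sum_sub_distrib]
  have e1 : ∀ e, p e (Γ.len e) * η e (Γ.len e) = c (Γ.tgt e) * p e (Γ.len e) := fun e => by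
    rw [(hc e).2, mul_comm]
  have e0 : ∀ e, p e 0 * η e 0 = c (Γ.src e) * p e 0 := fun e => by
    rw [(hc e).1, mul_comm]
  simp only [e1, e0]
  linarith

/-- The weak formulation of `L F = g`. -/
theorem OpRep.weak [Finite V] (hco : Γ.Coeff α a κ) {F p g η η' : E → ℝ → ℝ}
    (h : Γ.OpRep a κ F p g) (hη : ∀ e, HasL2Deriv (Γ.len e) (η e) (η' e))
    (hv : Γ.VertexCompatible η) :
    ∑ e, ∫ t in (0 : ℝ)..Γ.len e, η e t * g e t
      = ∑ e, ∫ t in (0 : ℝ)..Γ.len e, (p e t * η' e t + κ e t ^ 2 * F e t * η e t) := by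
  have hb := sum_boundary_eq_zero h.flux hv
  have key : ∀ e, (∫ t in (0 : ℝ)..Γ.len e, (p e t * η' e t + κ e t ^ 2 * F e t * η e t))
      - ∫ t in (0 : ℝ)..Γ.len e, η e t * g e t
      = p e (Γ.len e) * η e (Γ.len e) - p e 0 * η e 0 := by
    intro e
    have hl := (Γ.len_pos e).le
    rw [← (h.dp e).integral_mul (hη e) (Γ.right_mem e)]
    have hκ : MemLp (fun t => κ e t ^ 2 * F e t) 2 (edgeVol (Γ.len e)) := by
      have hκ : WInf 0 (Γ.len e) (κ e) := (hco.2 e).kappa_bdd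
      simp only [sq]
      exact (h.dF e).memLp_two.mul (hκ.mul hκ).memLp
    have hg : MemLp (g e) 2 (edgeVol (Γ.len e)) := by
      have := hκ.sub (h.dp e).memLp
      refine (memLp_congr_ae (Eventually.of_forall fun t => ?_)).1 this
      simp
    have i1 := MemLp.intervalIntegrable_mul hl (h.dp e).memLp_two (hη e).memLp
    have i2 := MemLp.intervalIntegrable_mul hl hκ (hη e).memLp_two
    have i3 := MemLp.intervalIntegrable_mul hl (hη e).memLp_two hg
    rw [← intervalIntegral.integral_sub (i1.add i2) i3]
    refine intervalIntegral.integral_congr fun t _ => ?_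
    ring
  have := Finset.sum_congr rfl fun e (_ : e ∈ Finset.univ) => key e
  rw [hb, Finset.sum_sub_distrib] at this
  linarith

/-- Coercivity of the energy form. -/
theorem exists_coercive (hco : Γ.Coeff α a κ) : ∃ c > 0, ∀ e, ∀ F p : ℝ → ℝ,
    HasL2Deriv (Γ.len e) F (fun t => (a e t)⁻¹ * p t) → MemLp p 2 (edgeVol (Γ.len e)) →
    c * ((∫ t in (0 : ℝ)..Γ.len e, F t ^ 2) + ∫ t in (0 : ℝ)..Γ.len e, ((a e t)⁻¹ * p t) ^ 2)
      ≤ ∫ t in (0 : ℝ)..Γ.len e, (p t * ((a e t)⁻¹ * p t) + κ e t ^ 2 * F t * F t) := by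
  have hex : ∀ e, ∃ c > 0, ∀ᵐ t ∂edgeVol (Γ.len e), c ≤ a e t ∧ c ≤ κ e t ^ 2 := by
    intro e
    obtain ⟨K, hK⟩ := (hco.2 e).a_lip
    obtain ⟨m, hm, hma⟩ := exists_lower_bound hK.continuousOn (hco.2 e).a_pos
    obtain ⟨k₀, hk₀, hk⟩ := (hco.2 e).kappa_pos
    refine ⟨min m (k₀ ^ 2), lt_min hm (by positivity), ?_⟩
    filter_upwards [ae_restrict_mem measurableSet_Icc, hk] with t ht h2
    exact ⟨(min_le_left _ _).trans (hma t ht), (min_le_right _ _).trans (by gcongr)⟩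
  choose c hc hcb using hex
  have hmin : ∃ c₀ > 0, ∀ e, c₀ ≤ c e := by
    rcases isEmpty_or_nonempty E with hE | hE
    · exact ⟨1, one_pos, fun e => (hE.false e).elim⟩
    · obtain ⟨e₀, he₀⟩ := Finite.exists_min c
      exact ⟨c e₀, hc e₀, he₀⟩
  obtain ⟨c₀, hc₀, hle⟩ := hmin
  refine ⟨c₀, hc₀, fun e F p hF hp => ?_⟩
  have hl := (Γ.len_pos e).le
  have hκ : MemLp (fun t => κ e t ^ 2 * F t) 2 (edgeVol (Γ.len e)) := by
    have hκ : WInf 0 (Γ.len e) (κ e) := (hco.2 e).kappa_bdd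
    simp only [sq]
    exact hF.memLp_two.mul (hκ.mul hκ).memLp
  rw [← intervalIntegral.integral_add (MemLp.intervalIntegrable_sq hl hF.memLp_two)
    (MemLp.intervalIntegrable_sq hl hF.memLp), ← intervalIntegral.integral_const_mul]
  refine intervalIntegral_mono_ae hl (((MemLp.intervalIntegrable_sq hl hF.memLp_two).add
    (MemLp.intervalIntegrable_sq hl hF.memLp)).const_mul _)
    ((MemLp.intervalIntegrable_mul hl hp hF.memLp).add
      (MemLp.intervalIntegrable_mul hl hκ hF.memLp_two)) ?_
  filter_upwards [ae_restrict_mem measurableSet_Icc, hcb e] with t ht hb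
  have hat := (hco.2 e).a_pos t ht
  have e1 : p t * ((a e t)⁻¹ * p t) = a e t * ((a e t)⁻¹ * p t) ^ 2 := by
    field_simp
  rw [e1, mul_add, add_comm]
  have h1 : c₀ * ((a e t)⁻¹ * p t) ^ 2 ≤ a e t * ((a e t)⁻¹ * p t) ^ 2 :=
    mul_le_mul_of_nonneg_right ((hle e).trans hb.1) (sq_nonneg _)
  have h2 : c₀ * F t ^ 2 ≤ κ e t ^ 2 * F t ^ 2 :=
    mul_le_mul_of_nonneg_right ((hle e).trans hb.2) (sq_nonneg _)
  nlinarith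

theorem OpRep.memLp_p {F p g : E → ℝ → ℝ} (h : Γ.OpRep a κ F p g) (e : E) :
    MemLp (p e) 2 (edgeVol (Γ.len e)) := (h.dp e).memLp_two

theorem exists_energy_le [Finite V] (hco : Γ.Coeff α a κ) : ∃ c > 0, ∀ F p g : E → ℝ → ℝ,
    Γ.OpRep a κ F p g →
    c * ∑ e, ((∫ t in (0 : ℝ)..Γ.len e, F e t ^ 2)
        + ∫ t in (0 : ℝ)..Γ.len e, ((a e t)⁻¹ * p e t) ^ 2)
      ≤ ∑ e, ∫ t in (0 : ℝ)..Γ.len e, F e t * g e t := by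
  obtain ⟨c, hc, h⟩ := exists_coercive hco
  refine ⟨c, hc, fun F p g hr => ?_⟩
  rw [hr.weak hco hr.dF hr.vertex, Finset.mul_sum]
  exact Finset.sum_le_sum fun e _ => h e (F e) (p e) (hr.dF e) (hr.memLp_p e)

theorem OpRep.eq_zero [Finite V] (hco : Γ.Coeff α a κ) {F p : E → ℝ → ℝ}
    (h : Γ.OpRep a κ F p (fun _ _ => 0)) (e : E) :
    (∀ t ∈ Icc 0 (Γ.len e), F e t = 0) ∧ ∀ t ∈ Icc 0 (Γ.len e), p e t = 0 := by
  obtain ⟨c, hc, hle⟩ := exists_energy_le hco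
  have h1 := hle F p _ h
  simp only [mul_zero, intervalIntegral.integral_zero, Finset.sum_const_zero] at h1
  have hnn : ∀ e, 0 ≤ (∫ t in (0 : ℝ)..Γ.len e, F e t ^ 2)
      + ∫ t in (0 : ℝ)..Γ.len e, ((a e t)⁻¹ * p e t) ^ 2 := fun e =>
    add_nonneg (integral_sq_nonneg (Γ.len_pos e).le _) (integral_sq_nonneg (Γ.len_pos e).le _)
  have h2 : ∑ e, ((∫ t in (0 : ℝ)..Γ.len e, F e t ^ 2)
      + ∫ t in (0 : ℝ)..Γ.len e, ((a e t)⁻¹ * p e t) ^ 2) = 0 :=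
    le_antisymm (nonpos_of_mul_nonpos_right h1 hc) (Finset.sum_nonneg fun e _ => hnn e)
  have h3 := (Finset.sum_eq_zero_iff_of_nonneg fun e _ => hnn e).1 h2 e (Finset.mem_univ e)
  have hl := Γ.len_pos e
  have n1 := integral_sq_nonneg hl.le (F e)
  have n2 := integral_sq_nonneg hl.le (fun t => (a e t)⁻¹ * p e t)
  have z1 := ae_eq_zero_of_integral_sq hl.le (h.dF e).memLp_two (by linarith)
  have z2 := ae_eq_zero_of_integral_sq hl.le (h.dF e).memLp (by linarith)
  refine ⟨eqOn_of_ae_eq hl (h.dF e).continuousOn continuousOn_const z1,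
    eqOn_of_ae_eq hl (h.dp e).continuousOn continuousOn_const ?_⟩
  filter_upwards [z2, ae_restrict_mem measurableSet_Icc] with t ht hts
  have := (hco.2 e).a_pos t hts
  simpa [this.ne'] using ht

theorem OpRep.lincomb {F p g F' p' g' : E → ℝ → ℝ} (h : Γ.OpRep a κ F p g)
    (h' : Γ.OpRep a κ F' p' g') (r : ℝ) :
    Γ.OpRep a κ (fun e t => r * F e t + F' e t) (fun e t => r * p e t + p' e t)
      (fun e t => r * g e t + g' e t) := by
  refine ⟨fun e => (((h.dF e).const_mul r).add (h'.dF e)).congr (fun _ _ => rfl)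
    (Eventually.of_forall fun t => by ring),
    fun e => (((h.dp e).const_mul r).add (h'.dp e)).congr (fun _ _ => rfl)
    (Eventually.of_forall fun t => by ring), ?_, fun v => ?_⟩
  · obtain ⟨c, hc⟩ := h.vertex
    obtain ⟨c', hc'⟩ := h'.vertex
    exact ⟨fun v => r * c v + c' v, fun e => by simp [(hc e).1, (hc e).2, (hc' e).1, (hc' e).2]⟩
  · have h1 := h.flux v
    have h2 := h'.flux v
    have h3 := congrArg₂ (fun u w => r * u + w) h1 h2
    simp only [mul_zero, add_zero] at h3
    rw [Finset.mul_sum, ← Finset.sum_add_distrib] at h3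
    refine Eq.trans (Finset.sum_congr rfl fun e _ => ?_) h3
    split_ifs <;> ring

theorem OpRep.congr_right {F p g g' : E → ℝ → ℝ} (h : Γ.OpRep a κ F p g)
    (hg : ∀ e, g e =ᵐ[edgeVol (Γ.len e)] g' e) : Γ.OpRep a κ F p g' := by
  refine ⟨h.dF, fun e => (h.dp e).congr (fun _ _ => rfl) ?_, h.vertex, h.flux⟩
  filter_upwards [hg e] with t ht
  rw [ht]

end Flux

end MetricGraph

/-! ### Solvability of `L F = g` and the bounded inverse -/

namespace MetricGraph

variable {V E : Type*} {Γ : MetricGraph V E} {α : ℕ} {a κ : E → ℝ → ℝ} [Fintype E]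

theorem exists_edge_solution {ℓ : ℝ} {a κ h : ℝ → ℝ} (hℓ : 0 ≤ ℓ) (hco : EdgeCoeff α ℓ a κ)
    (hh : MemLp h 2 (edgeVol ℓ)) (x y : ℝ) :
    ∃ F p : ℝ → ℝ, HasL2Deriv ℓ F (fun t => (a t)⁻¹ * p t) ∧
      HasL2Deriv ℓ p (fun t => κ t ^ 2 * F t - h t) ∧ F 0 = x ∧ p 0 = y := by
  obtain ⟨q, hq, hqt, hq0⟩ := IsSys.exists_solution (n := 2) hℓ
    (fun k _ => hco.quasiC_memLp k) (fun k _ => hco.quasiD_memLp k) ![x, y] hh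
  refine ⟨q 0, q 1, ?_, ?_, hq0 0, hq0 1⟩
  · simpa using IsQuasiChain.deriv_even hq (k := 0) (by norm_num)
  · have := IsQuasiChain.deriv_odd hq (k := 0) (by norm_num)
    simpa [hqt] using this

/-- The equation `L F = g` is solvable for every square integrable `g`. -/
theorem exists_opRep [Finite V] (hco : Γ.Coeff α a κ) (e₀ : E) {g : E → ℝ → ℝ}
    (hg : ∀ e, MemLp (g e) 2 (edgeVol (Γ.len e))) : ∃ F p, Γ.OpRep a κ F p g := by
  classical
  have hz : ∀ e, MemLp (fun _ : ℝ => (0 : ℝ)) 2 (edgeVol (Γ.len e)) := fun e => by simp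
  choose F₀ p₀ hF₀ hp₀ hF₀i hp₀i using fun e =>
    exists_edge_solution (Γ.len_pos e).le (hco.2 e) (hg e) 0 0
  choose F₁ p₁ hF₁ hp₁ hF₁i hp₁i using fun e =>
    exists_edge_solution (Γ.len_pos e).le (hco.2 e) (hz e) 1 0
  choose F₂ p₂ hF₂ hp₂ hF₂i hp₂i using fun e =>
    exists_edge_solution (Γ.len_pos e).le (hco.2 e) (hz e) 0 1
  -- The unknowns are `F(0)` and `p(0)` on each edge and a value at each vertex. The equations are
  -- continuity at the two ends of each edge and flux balance at each vertex. The system is square,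
  -- so injectivity suffices.
  let T : ((E → ℝ) × (E → ℝ) × (V → ℝ)) →ₗ[ℝ] ((E → ℝ) × (E → ℝ) × (V → ℝ)) :=
    { toFun := fun z => (fun e => z.1 e - z.2.2 (Γ.src e),
        fun e => z.1 e * F₁ e (Γ.len e) + z.2.1 e * F₂ e (Γ.len e) - z.2.2 (Γ.tgt e),
        fun v => ∑ e, ((if Γ.src e = v then z.2.1 e else 0) - (if Γ.tgt e = v then
          z.1 e * p₁ e (Γ.len e) + z.2.1 e * p₂ e (Γ.len e) else 0)))
      map_add' := fun z w => by
        refine Prod.ext ?_ (Prod.ext ?_ ?_)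
        · ext e
          simp only [Prod.fst_add, Prod.snd_add, Pi.add_apply]
          ring
        · ext e
          simp only [Prod.fst_add, Prod.snd_add, Pi.add_apply]
          ring
        · ext v
          simp only [Prod.fst_add, Prod.snd_add, Pi.add_apply]
          rw [← Finset.sum_add_distrib]
          refine Finset.sum_congr rfl fun e _ => ?_
          split_ifs <;> ring
      map_smul' := fun c z => by
        refine Prod.ext ?_ (Prod.ext ?_ ?_)
        · ext e
          simp only [Prod.smul_fst, Prod.smul_snd, Pi.smul_apply, smul_eq_mul, RingHom.id_apply]
          ring
        · ext e
          simp only [Prod.smul_fst, Prod.smul_snd, Pi.smul_apply, smul_eq_mul, RingHom.id_apply]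
          ring
        · ext v
          simp only [Prod.smul_fst, Prod.smul_snd, Pi.smul_apply, smul_eq_mul, RingHom.id_apply]
          rw [Finset.mul_sum]
          refine Finset.sum_congr rfl fun e _ => ?_
          split_ifs <;> ring }
  have hhom : ∀ x y : E → ℝ,
      (∀ e, HasL2Deriv (Γ.len e) (fun t => x e * F₁ e t + y e * F₂ e t)
        (fun t => (a e t)⁻¹ * (x e * p₁ e t + y e * p₂ e t))) ∧
      ∀ e, HasL2Deriv (Γ.len e) (fun t => x e * p₁ e t + y e * p₂ e t)
        (fun t => κ e t ^ 2 * (x e * F₁ e t + y e * F₂ e t) - 0) := fun x y =>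
    ⟨fun e => (((hF₁ e).const_mul (x e)).add ((hF₂ e).const_mul (y e))).congr (fun _ _ => rfl)
      (Eventually.of_forall fun t => by ring),
    fun e => (((hp₁ e).const_mul (x e)).add ((hp₂ e).const_mul (y e))).congr (fun _ _ => rfl)
      (Eventually.of_forall fun t => by ring)⟩
  have hinj : Function.Injective T := by
    rw [← LinearMap.ker_eq_bot, LinearMap.ker_eq_bot']
    rintro ⟨x, y, c⟩ hT
    have t1 : ∀ e, x e - c (Γ.src e) = 0 := fun e => congrFun (congrArg Prod.fst hT) e
    have t2 : ∀ e, x e * F₁ e (Γ.len e) + y e * F₂ e (Γ.len e) - c (Γ.tgt e) = 0 := fun e =>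
      congrFun (congrArg (fun z => z.2.1) hT) e
    have t3 := fun v => congrFun (congrArg (fun z => z.2.2) hT) v
    have hrep : Γ.OpRep a κ (fun e t => x e * F₁ e t + y e * F₂ e t)
        (fun e t => x e * p₁ e t + y e * p₂ e t) (fun _ _ => 0) := by
      refine ⟨(hhom x y).1, (hhom x y).2, ⟨c, fun e => ⟨?_, ?_⟩⟩, fun v => ?_⟩
      · simp only [hF₁i, hF₂i]
        linarith [t1 e]
      · linarith [t2 e]
      · refine Eq.trans (Finset.sum_congr rfl fun e _ => ?_) (t3 v)
        simp [hp₁i, hp₂i]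
    have hx : ∀ e, x e = 0 := fun e => by
      have := (hrep.eq_zero hco e).1 0 (Γ.left_mem e)
      simpa [hF₁i, hF₂i] using this
    have hy : ∀ e, y e = 0 := fun e => by
      have := (hrep.eq_zero hco e).2 0 (Γ.left_mem e)
      simpa [hp₁i, hp₂i] using this
    have hs : ∀ e, c (Γ.src e) = 0 := fun e => by linarith [t1 e, hx e]
    have ht : ∀ e, c (Γ.tgt e) = 0 := fun e => by
      have := t2 e
      rw [hx e, hy e] at this
      linarith
    -- The energy estimate makes the vertex values vanish only at ends of edges. Connectedness and
    -- the existence of the edge `e₀` extend this to all vertices.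
    have hc : ∀ v w, Relation.EqvGen (fun x y => ∃ e, Γ.src e = x ∧ Γ.tgt e = y) v w →
        c v = c w := by
      intro v w h
      induction h with
      | rel _ _ h =>
        obtain ⟨e, rfl, rfl⟩ := h
        rw [hs, ht]
      | refl => rfl
      | symm _ _ _ ih => exact ih.symm
      | trans _ _ _ _ _ ih₁ ih₂ => exact ih₁.trans ih₂
    refine Prod.ext (funext hx) (Prod.ext (funext hy) (funext fun v => ?_))
    exact (hc v (Γ.src e₀) (Γ.connected _ _)).trans (hs e₀)
  obtain ⟨⟨x, y, c⟩, hT⟩ := LinearMap.injective_iff_surjective.1 hinj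
    (0, fun e => -F₀ e (Γ.len e), fun v => ∑ e, if Γ.tgt e = v then p₀ e (Γ.len e) else 0)
  have t1 : ∀ e, x e - c (Γ.src e) = 0 := fun e => congrFun (congrArg Prod.fst hT) e
  have t2 : ∀ e, x e * F₁ e (Γ.len e) + y e * F₂ e (Γ.len e) - c (Γ.tgt e) = -F₀ e (Γ.len e) :=
    fun e => congrFun (congrArg (fun z => z.2.1) hT) e
  have t3 := fun v => congrFun (congrArg (fun z => z.2.2) hT) v
  refine ⟨fun e t => F₀ e t + (x e * F₁ e t + y e * F₂ e t),
    fun e t => p₀ e t + (x e * p₁ e t + y e * p₂ e t),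
    fun e => ((hF₀ e).add ((hhom x y).1 e)).congr (fun _ _ => rfl)
      (Eventually.of_forall fun t => by ring),
    fun e => ((hp₀ e).add ((hhom x y).2 e)).congr (fun _ _ => rfl)
      (Eventually.of_forall fun t => by ring), ⟨c, fun e => ⟨?_, ?_⟩⟩, fun v => ?_⟩
  · simp only [hF₀i, hF₁i, hF₂i]
    linarith [t1 e]
  · linarith [t2 e]
  · have h3 := sub_eq_zero.2 (t3 v)
    simp only [T, LinearMap.coe_mk, AddHom.coe_mk] at h3
    rw [← Finset.sum_sub_distrib] at h3
    refine Eq.trans (Finset.sum_congr rfl fun e _ => ?_) h3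
    simp only [hp₀i, hp₁i, hp₂i]
    split_ifs <;> ring

theorem integral_edgeVol {ℓ : ℝ} (hℓ : 0 ≤ ℓ) (f : ℝ → ℝ) :
    ∫ t, f t ∂edgeVol ℓ = ∫ t in (0 : ℝ)..ℓ, f t := by
  rw [intervalIntegral.integral_of_le hℓ, ← integral_Icc_eq_integral_Ioc]

theorem inner_eq (f g : Γ.L2) :
    ⟪f, g⟫_ℝ = ∑ e, ∫ t in (0 : ℝ)..Γ.len e, (f e : ℝ → ℝ) t * (g e : ℝ → ℝ) t := by
  rw [PiLp.inner_apply]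
  refine Finset.sum_congr rfl fun e _ => ?_
  rw [L2.inner_def, ← integral_edgeVol (Γ.len_pos e).le]
  simp [mul_comm]

theorem norm_sq_edge {ℓ : ℝ} (hℓ : 0 ≤ ℓ) (f : Lp ℝ 2 (edgeVol ℓ)) :
    ‖f‖ ^ 2 = ∫ t in (0 : ℝ)..ℓ, ((f : ℝ → ℝ) t) ^ 2 := by
  rw [← real_inner_self_eq_norm_sq, L2.inner_def, ← integral_edgeVol hℓ]
  simp [sq]

theorem OpRep.unique [Finite V] (hco : Γ.Coeff α a κ) {F p g F' p' g' : E → ℝ → ℝ}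
    (h : Γ.OpRep a κ F p g) (h' : Γ.OpRep a κ F' p' g')
    (hg : ∀ e, g e =ᵐ[edgeVol (Γ.len e)] g' e) (e : E) :
    EqOn (F e) (F' e) (Icc 0 (Γ.len e)) ∧ EqOn (p e) (p' e) (Icc 0 (Γ.len e)) := by
  have h1 : Γ.OpRep a κ _ _ (fun _ _ => 0) := (h'.lincomb h (-1)).congr_right fun e => by
    filter_upwards [hg e] with t ht
    rw [ht]
    ring
  obtain ⟨hF, hp⟩ := h1.eq_zero hco e
  exact ⟨fun t ht => by linarith [hF t ht], fun t ht => by linarith [hp t ht]⟩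

theorem OpRep.symm [Finite V] (hco : Γ.Coeff α a κ) {F p g F' p' g' : E → ℝ → ℝ}
    (h : Γ.OpRep a κ F p g) (h' : Γ.OpRep a κ F' p' g') :
    ∑ e, ∫ t in (0 : ℝ)..Γ.len e, F e t * g' e t = ∑ e, ∫ t in (0 : ℝ)..Γ.len e, F' e t * g e t := by
  rw [h.weak hco h'.dF h'.vertex, h'.weak hco h.dF h.vertex]
  refine Finset.sum_congr rfl fun e _ => intervalIntegral.integral_congr fun t _ => ?_
  ring

/-- The inverse of `L`, with the operators giving the derivative along each edge. -/
structure IsResolvent (Γ : MetricGraph V E) (a κ : E → ℝ → ℝ) (K : Γ.L2 →L[ℝ] Γ.L2)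
    (D : (e : E) → Γ.L2 →L[ℝ] Lp ℝ 2 (edgeVol (Γ.len e))) (C : ℝ) : Prop where
  op_iff : ∀ f g, Γ.Op a κ f g ↔ f = K g
  symm : ∀ f g, ⟪K f, g⟫_ℝ = ⟪f, K g⟫_ℝ
  inj : ∀ f, K f = 0 → f = 0
  nonneg : ∀ f, 0 ≤ ⟪K f, f⟫_ℝ
  rep : ∀ g, ∃ F p : E → ℝ → ℝ, Γ.OpRep a κ F p (fun e => g e) ∧
    (∀ e, F e =ᵐ[edgeVol (Γ.len e)] K g e) ∧
    ∀ e, (fun t => (a e t)⁻¹ * p e t) =ᵐ[edgeVol (Γ.len e)] D e g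
  const_nonneg : 0 ≤ C
  bound : ∀ e g, ‖D e g‖ ^ 2 ≤ C * ⟪K g, g⟫_ℝ

/-- Solutions depend linearly on `g` by uniqueness, and the solution operator is symmetric and
defined everywhere, hence bounded. The energy estimate bounds the derivative by `⟪K g, g⟫`, and not
merely by `‖g‖²`. This form is `‖L^{-1/2} g‖²`, and the stronger bound is what lets the derivative
be extended to the range of `L^{-1/2}`. -/
theorem exists_resolvent [Finite V] (hco : Γ.Coeff α a κ) (e₀ : E) :
    ∃ K D C, Γ.IsResolvent a κ K D C := by
  choose F p hFp using fun g : Γ.L2 => exists_opRep hco e₀ (g := fun e => g e) fun e => Lp.memLp _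
  have hadd : ∀ (g g' : Γ.L2) e, EqOn (F (g + g') e) (fun t => F g e t + F g' e t) (Icc 0 (Γ.len e)) ∧
      EqOn (p (g + g') e) (fun t => p g e t + p g' e t) (Icc 0 (Γ.len e)) := fun g g' e => by
    have := (hFp (g + g')).unique hco ((hFp g).lincomb (hFp g') 1) (fun e => by
      filter_upwards [Lp.coeFn_add (g e) (g' e)] with t ht
      rw [PiLp.add_apply, ht, Pi.add_apply, one_mul]) e
    simpa using this
  have hzero : Γ.OpRep a κ (fun _ _ => 0) (fun _ _ => 0) (fun _ _ => 0) :=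
    ⟨fun e => by simpa using HasL2Deriv.const 0, fun e => by simpa using HasL2Deriv.const 0,
      ⟨0, by simp⟩, fun v => by simp⟩
  have hsmul : ∀ (r : ℝ) (g : Γ.L2) e, EqOn (F (r • g) e) (fun t => r * F g e t) (Icc 0 (Γ.len e)) ∧
      EqOn (p (r • g) e) (fun t => r * p g e t) (Icc 0 (Γ.len e)) := fun r g e => by
    have := (hFp (r • g)).unique hco ((hFp g).lincomb hzero r) (fun e => by
      filter_upwards [Lp.coeFn_smul r (g e)] with t ht
      rw [PiLp.smul_apply, ht, Pi.smul_apply, smul_eq_mul, add_zero]) e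
    simpa using this
  have hae : ∀ {e : E} {f₁ f₂ : ℝ → ℝ}, EqOn f₁ f₂ (Icc 0 (Γ.len e)) → f₁ =ᵐ[edgeVol (Γ.len e)] f₂ :=
    fun h => (ae_restrict_iff' measurableSet_Icc).2 (Eventually.of_forall h)
  let K₀ : Γ.L2 →ₗ[ℝ] Γ.L2 :=
    { toFun := fun g => WithLp.toLp 2 fun e => ((hFp g).dF e).memLp_two.toLp (F g e)
      map_add' := fun g g' => by
        refine PiLp.ext fun e => ?_
        rw [PiLp.add_apply]
        exact (MemLp.toLp_congr ((hFp (g + g')).dF e).memLp_two _ (hae (hadd g g' e).1)).trans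
          (MemLp.toLp_add ((hFp g).dF e).memLp_two ((hFp g').dF e).memLp_two)
      map_smul' := fun r g => by
        refine PiLp.ext fun e => ?_
        rw [PiLp.smul_apply, RingHom.id_apply]
        exact (MemLp.toLp_congr ((hFp (r • g)).dF e).memLp_two _ (hae (hsmul r g e).1)).trans
          (MemLp.toLp_const_smul r ((hFp g).dF e).memLp_two) }
  have hK₀ : ∀ g e, F g e =ᵐ[edgeVol (Γ.len e)] K₀ g e := fun g e =>
    (((hFp g).dF e).memLp_two.coeFn_toLp).symm
  have hinner : ∀ f g, ⟪K₀ f, g⟫_ℝ = ∑ e, ∫ t in (0 : ℝ)..Γ.len e, F f e t * (g e : ℝ → ℝ) t := by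
    intro f g
    rw [inner_eq]
    refine Finset.sum_congr rfl fun e _ => integral_congr_edge ?_ (Γ.left_mem e) (Γ.right_mem e)
    filter_upwards [hK₀ f e] with t ht
    rw [ht]
  have hsymm : K₀.IsSymmetric := fun f g => by
    rw [hinner, real_inner_comm, hinner]
    exact (hFp f).symm hco (hFp g)
  let K : Γ.L2 →L[ℝ] Γ.L2 := ⟨K₀, hsymm.continuous⟩
  obtain ⟨c, hc, hE⟩ := exists_energy_le hco
  have hE' : ∀ g e, (∫ t in (0 : ℝ)..Γ.len e, ((a e t)⁻¹ * p g e t) ^ 2) ≤ c⁻¹ * ⟪K g, g⟫_ℝ := by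
    intro g e
    have h1 := hE _ _ _ (hFp g)
    rw [← hinner] at h1
    have h2 : (∫ t in (0 : ℝ)..Γ.len e, ((a e t)⁻¹ * p g e t) ^ 2) ≤
        ∑ e, ((∫ t in (0 : ℝ)..Γ.len e, F g e t ^ 2)
        + ∫ t in (0 : ℝ)..Γ.len e, ((a e t)⁻¹ * p g e t) ^ 2) := by
      refine le_trans ?_ (Finset.single_le_sum (f := fun e => (∫ t in (0 : ℝ)..Γ.len e, F g e t ^ 2)
        + ∫ t in (0 : ℝ)..Γ.len e, ((a e t)⁻¹ * p g e t) ^ 2) (fun e _ => add_nonneg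
        (integral_sq_nonneg (Γ.len_pos e).le _) (integral_sq_nonneg (Γ.len_pos e).le _))
        (Finset.mem_univ e))
      have := integral_sq_nonneg (Γ.len_pos e).le (F g e)
      linarith
    rw [← div_eq_inv_mul, le_div_iff₀ hc, mul_comm]
    exact (mul_le_mul_of_nonneg_left h2 hc.le).trans h1
  have hnn : ∀ g, 0 ≤ ⟪K g, g⟫_ℝ := fun g => by
    have h1 := hE' g e₀
    have h2 := integral_sq_nonneg (Γ.len_pos e₀).le (fun t => (a e₀ t)⁻¹ * p g e₀ t)
    have := h2.trans h1
    exact nonneg_of_mul_nonneg_right this (inv_pos.2 hc)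
  let D₀ : (e : E) → Γ.L2 →ₗ[ℝ] Lp ℝ 2 (edgeVol (Γ.len e)) := fun e =>
    { toFun := fun g => ((hFp g).dF e).memLp.toLp (fun t => (a e t)⁻¹ * p g e t)
      map_add' := fun g g' => by
        refine (MemLp.toLp_congr ((hFp (g + g')).dF e).memLp _ (hae fun t ht => ?_)).trans
          (MemLp.toLp_add ((hFp g).dF e).memLp ((hFp g').dF e).memLp)
        simp only [(hadd g g' e).2 ht, Pi.add_apply, mul_add]
      map_smul' := fun r g => by
        rw [RingHom.id_apply]
        refine (MemLp.toLp_congr ((hFp (r • g)).dF e).memLp _ (hae fun t ht => ?_)).trans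
          (MemLp.toLp_const_smul r ((hFp g).dF e).memLp)
        simp only [(hsmul r g e).2 ht, Pi.smul_apply, smul_eq_mul]
        ring }
  have hD₀ : ∀ e g, (fun t => (a e t)⁻¹ * p g e t) =ᵐ[edgeVol (Γ.len e)] D₀ e g := fun e g =>
    (((hFp g).dF e).memLp.coeFn_toLp).symm
  have hbound : ∀ e g, ‖D₀ e g‖ ^ 2 ≤ c⁻¹ * ⟪K g, g⟫_ℝ := fun e g => by
    refine le_trans (le_of_eq ?_) (hE' g e)
    rw [norm_sq_edge (Γ.len_pos e).le]
    refine integral_congr_edge ?_ (Γ.left_mem e) (Γ.right_mem e)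
    filter_upwards [hD₀ e g] with t ht
    rw [ht]
  have hDb : ∀ e g, ‖D₀ e g‖ ≤ Real.sqrt (c⁻¹ * ‖K‖) * ‖g‖ := fun e g => by
    rw [← Real.sqrt_sq (norm_nonneg g), ← Real.sqrt_mul (by positivity),
      Real.le_sqrt (norm_nonneg _) (by positivity)]
    refine (hbound e g).trans ?_
    have h1 : ⟪K g, g⟫_ℝ ≤ ‖K‖ * ‖g‖ ^ 2 := by
      refine (real_inner_le_norm _ _).trans ?_
      have := K.le_opNorm g
      nlinarith [norm_nonneg g]
    calc c⁻¹ * ⟪K g, g⟫_ℝ ≤ c⁻¹ * (‖K‖ * ‖g‖ ^ 2) := by gcongr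
      _ = c⁻¹ * ‖K‖ * ‖g‖ ^ 2 := by ring
  have hext : ∀ {f f' : Γ.L2}, (∀ e, (f e : ℝ → ℝ) =ᵐ[edgeVol (Γ.len e)] f' e) → f = f' :=
    fun {f f'} h => PiLp.ext fun e => Lp.ext (h e)
  refine ⟨K, fun e => (D₀ e).mkContinuous _ (hDb e), c⁻¹, ⟨fun f g => ?_, hsymm, fun f hf => ?_,
    hnn, fun g => ⟨F g, p g, hFp g, hK₀ g, fun e => hD₀ e g⟩, (inv_pos.2 hc).le, hbound⟩⟩
  · rw [MetricGraph.op_iff hco]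
    constructor
    · rintro ⟨F', p', h', hf⟩
      refine hext fun e => (hf e).symm.trans ?_
      exact (hae (h'.unique hco (hFp g) (fun _ => ae_eq_refl _) e).1).trans (hK₀ g e)
    · rintro rfl
      exact ⟨F g, p g, hFp g, hK₀ g⟩
  · refine hext fun e => ?_
    have hz : ∀ e, F f e =ᵐ[edgeVol (Γ.len e)] (fun _ => 0) := fun e => by
      have h1 := hK₀ f e
      have h2 : K₀ f = 0 := hf
      rw [h2] at h1
      exact h1.trans (Lp.coeFn_zero _ _ _)
    have h1 := ((hFp f).dF e).deriv_unique (HasL2Deriv.const 0) (hz e)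
    have hp0 : p f e =ᵐ[edgeVol (Γ.len e)] fun _ => 0 := by
      filter_upwards [h1, ae_restrict_mem measurableSet_Icc] with t ht hts
      have := (hco.2 e).a_pos t hts
      simpa [this.ne'] using ht
    have h2 := ((hFp f).dp e).deriv_unique (HasL2Deriv.const 0) hp0
    refine EventuallyEq.trans ?_ (Lp.coeFn_zero _ _ _).symm
    filter_upwards [h2, hz e] with t ht hzt
    rw [hzt] at ht
    simpa using ht

end MetricGraph

/-! ### The square root of a compact positive operator -/

section SquareRoot

variable {H : Type*} [NormedAddCommGroup H] [InnerProductSpace ℝ H] [CompleteSpace H]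
  {K : H →L[ℝ] H}

/-- Eigenvectors of a compact symmetric operator span a dense subspace. Operator identities can thus
be tested on eigenvectors alone. -/
theorem eq_zero_of_inner_eigenvector (hK : IsCompactOperator K)
    (hs : (K : H →ₗ[ℝ] H).IsSymmetric) {x : H}
    (h : ∀ (μ : ℝ) (v : H), K v = μ • v → ⟪x, v⟫_ℝ = 0) : x = 0 := by
  have h1 := ContinuousLinearMap.orthogonalComplement_iSup_eigenspaces_eq_bot hK hs
  rw [← Submodule.mem_bot ℝ, ← h1, ← Submodule.iInf_orthogonal, Submodule.mem_iInf]
  intro μ v hv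
  rw [real_inner_comm]
  exact h μ v (Module.End.mem_eigenspace_iff.1 hv)

/-- A bounded function of a compact symmetric operator. -/
theorem exists_symmetric_of_eigenvalues (hK : IsCompactOperator K)
    (hs : (K : H →ₗ[ℝ] H).IsSymmetric) {c : ℝ → ℝ} {M : ℝ}
    (hc : ∀ (μ : ℝ) (v : H), v ≠ 0 → K v = μ • v → |c μ| ≤ M) :
    ∃ B : H →L[ℝ] H, (B : H →ₗ[ℝ] H).IsSymmetric ∧
      ∀ (μ : ℝ) (v : H), K v = μ • v → B v = c μ • v := by
  classical
  let F : ℝ → Submodule ℝ H := fun μ => Module.End.eigenspace (K : H →ₗ[ℝ] H) μ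
  have hF : ∀ μ, CompleteSpace (F μ) := fun μ => by
    have : IsClosed (F μ : Set H) := by
      have h : (F μ : Set H) = {v | K v = μ • v} := by
        ext v
        exact Module.End.mem_eigenspace_iff
      rw [h]
      exact isClosed_eq K.continuous (continuous_const_smul μ)
    exact this.completeSpace_coe
  -- The sum is indexed by all reals. The summand is trivial unless `μ` is an eigenvalue, so the
  -- bound on `c` is needed at eigenvalues only.
  have hsum : IsHilbertSum ℝ (fun μ => F μ) fun μ => (F μ).subtypeₗᵢ := by
    refine IsHilbertSum.mkInternal F hs.orthogonalFamily_eigenspaces ?_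
    rw [top_le_iff, Submodule.topologicalClosure_eq_top_iff]
    exact ContinuousLinearMap.orthogonalComplement_iSup_eigenspaces_eq_bot hK hs
  let Φ := hsum.linearIsometryEquiv
  have hle : ∀ (μ : ℝ) (w : F μ), ‖c μ • w‖ ≤ |M| * ‖w‖ := fun μ w => by
    rcases eq_or_ne w 0 with rfl | hw
    · simp
    · rw [norm_smul, Real.norm_eq_abs]
      exact mul_le_mul_of_nonneg_right ((hc μ w (fun h => hw (Subtype.ext h))
        (Module.End.mem_eigenspace_iff.1 w.2)).trans (le_abs_self M)) (norm_nonneg _)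
  have hmem : ∀ z : lp (fun μ => F μ) 2, Memℓp (fun μ => c μ • z μ) 2 := fun z => by
    refine memℓp_gen ?_
    have h1 := ((lp.memℓp z).summable (by norm_num)).mul_left (|M| ^ (2 : ℝ≥0∞).toReal)
    refine Summable.of_nonneg_of_le (fun μ => by positivity) (fun μ => ?_) h1
    rw [← Real.mul_rpow (abs_nonneg _) (norm_nonneg _)]
    exact Real.rpow_le_rpow (norm_nonneg _) (hle μ _) (by norm_num)
  let m : lp (fun μ => F μ) 2 →ₗ[ℝ] lp (fun μ => F μ) 2 :=
    { toFun := fun z => ⟨fun μ => c μ • z μ, hmem z⟩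
      map_add' := fun z w => by
        ext1
        funext μ
        exact smul_add _ _ _
      map_smul' := fun r z => by
        ext1
        funext μ
        exact smul_comm (c μ) r (z μ) }
  have hm : ∀ z w, ⟪m z, w⟫_ℝ = ⟪z, m w⟫_ℝ := fun z w => by
    rw [lp.inner_eq_tsum, lp.inner_eq_tsum]
    refine tsum_congr fun μ => ?_
    change ⟪c μ • z μ, w μ⟫_ℝ = ⟪z μ, c μ • w μ⟫_ℝ
    rw [real_inner_smul_left, real_inner_smul_right]
  let B₀ : H →ₗ[ℝ] H := Φ.symm.toLinearEquiv.toLinearMap ∘ₗ m ∘ₗ Φ.toLinearEquiv.toLinearMap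
  have hB₀ : B₀.IsSymmetric := fun x y => by
    have h1 : ⟪Φ.symm (m (Φ x)), y⟫_ℝ = ⟪m (Φ x), Φ y⟫_ℝ := by
      rw [← Φ.inner_map_map, Φ.apply_symm_apply]
    have h2 : ⟪x, Φ.symm (m (Φ y))⟫_ℝ = ⟪Φ x, m (Φ y)⟫_ℝ := by
      rw [← Φ.inner_map_map, Φ.apply_symm_apply]
    exact h1.trans ((hm _ _).trans h2.symm)
  refine ⟨⟨B₀, hB₀.continuous⟩, hB₀, fun μ v hv => ?_⟩
  let w : F μ := ⟨v, Module.End.mem_eigenspace_iff.2 hv⟩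
  have hw : Φ.symm (lp.single (E := fun μ => F μ) 2 μ w) = v := hsum.linearIsometryEquiv_symm_apply_single w
  have hw' : Φ v = lp.single (E := fun μ => F μ) 2 μ w := by rw [← hw, Φ.apply_symm_apply]
  have h1 : m (lp.single (E := fun μ => F μ) 2 μ w) = lp.single 2 μ (c μ • w) := by
    ext1
    funext ν
    change c ν • lp.single (E := fun μ => F μ) 2 μ w ν = _
    rw [lp.single_apply, lp.single_apply]
    rcases eq_or_ne ν μ with rfl | h
    · rw [Pi.single_eq_same, Pi.single_eq_same]
    · rw [Pi.single_eq_of_ne h, Pi.single_eq_of_ne h, smul_zero]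
  change Φ.symm (m (Φ v)) = _
  rw [hw', h1]
  exact hsum.linearIsometryEquiv_symm_apply_single _

/-- Positivity leaves only nonnegative eigenvalues, on which `√μ * √μ = μ`; this gives `B² = K` on
eigenvectors and hence everywhere. -/
theorem exists_sqrt (hK : IsCompactOperator K) (hs : (K : H →ₗ[ℝ] H).IsSymmetric)
    (hpos : ∀ x, 0 ≤ ⟪K x, x⟫_ℝ) :
    ∃ B : H →L[ℝ] H, (B : H →ₗ[ℝ] H).IsSymmetric ∧ (∀ x, B (B x) = K x) ∧
      ∀ (μ : ℝ) (v : H), K v = μ • v → B v = √μ • v := by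
  have hμ : ∀ (μ : ℝ) (v : H), v ≠ 0 → K v = μ • v → 0 ≤ μ := fun μ v hv h => by
    have h1 := hpos v
    rw [h, real_inner_smul_left, real_inner_self_eq_norm_sq] at h1
    exact nonneg_of_mul_nonneg_left h1 (by positivity)
  obtain ⟨B, hB, hBv⟩ := exists_symmetric_of_eigenvalues hK hs (c := Real.sqrt) (M := √‖K‖)
    fun μ v hv h => by
      rw [abs_of_nonneg (Real.sqrt_nonneg _)]
      refine Real.sqrt_le_sqrt ?_
      have h1 := K.le_opNorm v
      rw [h, norm_smul] at h1
      exact (le_abs_self μ).trans (le_of_mul_le_mul_right h1 (norm_pos_iff.2 hv))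
  refine ⟨B, hB, fun x => ?_, hBv⟩
  rw [← sub_eq_zero]
  refine eq_zero_of_inner_eigenvector hK hs fun μ v h => ?_
  have h1 : ⟪B (B x), v⟫_ℝ = ⟪x, B (B v)⟫_ℝ := (hB _ _).trans (hB _ _)
  have h2 : ⟪K x, v⟫_ℝ = ⟪x, K v⟫_ℝ := hs _ _
  rw [inner_sub_left, h1, h2, hBv μ v h, map_smul, hBv μ v h, h, smul_smul]
  rcases eq_or_ne v 0 with rfl | hv
  · simp
  · rw [Real.mul_self_sqrt (hμ μ v hv h), sub_self]

end SquareRoot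

/-! ### The Volterra operator -/

section Volterra

variable {ℓ : ℝ}

theorem integral_eq_inner (g : Lp ℝ 2 (edgeVol ℓ)) {s t : ℝ} (hs : s ∈ Icc 0 ℓ)
    (ht : t ∈ Icc 0 ℓ) (hst : s ≤ t) : ∫ x in s..t, g x =
      ⟪indicatorConstLp 2 measurableSet_Ioc (measure_ne_top (edgeVol ℓ) (Ioc s t)) (1 : ℝ), g⟫_ℝ := by
  rw [L2.inner_indicatorConstLp_one, intervalIntegral.integral_of_le hst,
    Measure.restrict_restrict measurableSet_Ioc, inter_eq_left.2
      (Ioc_subset_Icc_self.trans (Icc_subset_Icc hs.1 ht.2))]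

theorem abs_integral_le (g : Lp ℝ 2 (edgeVol ℓ)) {s t : ℝ} (hs : s ∈ Icc 0 ℓ)
    (ht : t ∈ Icc 0 ℓ) (hst : s ≤ t) : |∫ x in s..t, g x| ≤ √(t - s) * ‖g‖ := by
  rw [integral_eq_inner g hs ht hst]
  refine (abs_real_inner_le_norm _ _).trans (mul_le_mul_of_nonneg_right ?_ (norm_nonneg _))
  rw [norm_indicatorConstLp (by norm_num) (by norm_num), Measure.real,
    Measure.restrict_apply measurableSet_Ioc, inter_eq_left.2
      (Ioc_subset_Icc_self.trans (Icc_subset_Icc hs.1 ht.2)), Real.volume_Ioc,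
    ENNReal.toReal_ofReal (by linarith), norm_one, one_mul, Real.sqrt_eq_rpow]
  norm_num

theorem hasL2Deriv_integral {g : ℝ → ℝ} (hg : MemLp g 2 (edgeVol ℓ)) :
    HasL2Deriv ℓ (fun t => ∫ s in (0 : ℝ)..t, g s) g :=
  ⟨hg, fun t _ => by simp⟩

theorem norm_le_of_abs_le {f : Lp ℝ 2 (edgeVol ℓ)} (hℓ : 0 ≤ ℓ) {C : ℝ} (hC : 0 ≤ C)
    (h : ∀ᵐ t ∂edgeVol ℓ, |f t| ≤ C) : ‖f‖ ≤ √ℓ * C := by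
  refine (Lp.norm_le_of_ae_bound hC h).trans (le_of_eq ?_)
  have : measureUnivNNReal (edgeVol ℓ) = ℓ.toNNReal := by
    rw [measureUnivNNReal, Measure.restrict_apply_univ, Real.volume_Icc, sub_zero]
    rfl
  rw [this, Real.coe_toNNReal _ hℓ, Real.sqrt_eq_rpow]
  norm_num

/-- The operator of integration from `0`. -/
theorem exists_volterra (hℓ : 0 ≤ ℓ) : ∃ J : Lp ℝ 2 (edgeVol ℓ) →L[ℝ] Lp ℝ 2 (edgeVol ℓ),
    ∀ g, J g =ᵐ[edgeVol ℓ] fun t => ∫ s in (0 : ℝ)..t, g s := by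
  have h0 : (0 : ℝ) ∈ Icc 0 ℓ := left_mem_Icc.2 hℓ
  have hm : ∀ g : Lp ℝ 2 (edgeVol ℓ), MemLp (fun t => ∫ s in (0 : ℝ)..t, g s) 2 (edgeVol ℓ) :=
    fun g => (hasL2Deriv_integral (Lp.memLp g)).memLp_two
  let J₀ : Lp ℝ 2 (edgeVol ℓ) →ₗ[ℝ] Lp ℝ 2 (edgeVol ℓ) :=
    { toFun := fun g => (hm g).toLp _
      map_add' := fun g g' => by
        refine (MemLp.toLp_congr (hm (g + g')) _ ?_).trans (MemLp.toLp_add (hm g) (hm g'))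
        filter_upwards [ae_restrict_mem measurableSet_Icc] with t ht
        simp only [Pi.add_apply]
        rw [← intervalIntegral.integral_add (intervalIntegrable_of_memLp (Lp.memLp g) h0 ht)
          (intervalIntegrable_of_memLp (Lp.memLp g') h0 ht)]
        exact integral_congr_edge (Lp.coeFn_add g g') h0 ht
      map_smul' := fun r g => by
        refine (MemLp.toLp_congr (hm (r • g)) _ ?_).trans (MemLp.toLp_const_smul r (hm g))
        filter_upwards [ae_restrict_mem measurableSet_Icc] with t ht
        simp only [Pi.smul_apply]
        rw [← intervalIntegral.integral_smul]
        exact integral_congr_edge (Lp.coeFn_smul r g) h0 ht }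
  have hJ₀ : ∀ g, J₀ g =ᵐ[edgeVol ℓ] fun t => ∫ s in (0 : ℝ)..t, g s := fun g => (hm g).coeFn_toLp
  refine ⟨J₀.mkContinuous (√ℓ * √ℓ) fun g => ?_, hJ₀⟩
  rw [mul_assoc]
  refine norm_le_of_abs_le hℓ (by positivity) ?_
  filter_upwards [hJ₀ g, ae_restrict_mem measurableSet_Icc] with t ht hts
  rw [ht]
  refine (abs_integral_le g h0 hts hts.1).trans (mul_le_mul_of_nonneg_right ?_ (norm_nonneg _))
  exact Real.sqrt_le_sqrt (by linarith [hts.2])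

theorem isCompactOperator_rankOne {H H' : Type*} [NormedAddCommGroup H] [NormedSpace ℝ H]
    [NormedAddCommGroup H'] [NormedSpace ℝ H'] (f : H →L[ℝ] ℝ) (x : H') :
    IsCompactOperator (f.smulRight x) :=
  (isCompactOperator_of_locallyCompactSpace_dom f).clm_comp
    (ContinuousLinearMap.toSpanSingleton ℝ x)

theorem isCompactOperator_sum {ι H H' : Type*} [NormedAddCommGroup H] [NormedSpace ℝ H]
    [NormedAddCommGroup H'] [NormedSpace ℝ H'] (s : Finset ι) (f : ι → H →L[ℝ] H')
    (hf : ∀ i ∈ s, IsCompactOperator (f i)) : IsCompactOperator (∑ i ∈ s, f i : H →L[ℝ] H') := by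
  classical
  induction s using Finset.induction_on with
  | empty => simpa using! (isCompactOperator_zero : IsCompactOperator (0 : H → H'))
  | insert i s hi ih =>
    rw [Finset.sum_insert hi]
    exact (hf i (Finset.mem_insert_self _ _)).add
      (ih fun j hj => hf j (Finset.mem_insert_of_mem hj))

/-- Replacing the upper limit `t` by the left end of its cell in a uniform grid gives a finite rank
operator. By Cauchy–Schwarz the error in operator norm is at most `√ℓ √(ℓ/(n+1))`. -/
theorem isCompactOperator_volterra (hℓ : 0 < ℓ) {J : Lp ℝ 2 (edgeVol ℓ) →L[ℝ] Lp ℝ 2 (edgeVol ℓ)}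
    (hJ : ∀ g, J g =ᵐ[edgeVol ℓ] fun t => ∫ s in (0 : ℝ)..t, g s) : IsCompactOperator J := by
  let χ : ℝ → ℝ → Lp ℝ 2 (edgeVol ℓ) := fun s t =>
    indicatorConstLp 2 measurableSet_Ioc (measure_ne_top (edgeVol ℓ) (Ioc s t)) (1 : ℝ)
  let q : ℕ → ℕ → ℝ := fun n k => k * (ℓ / (n + 1))
  let A : ℕ → Lp ℝ 2 (edgeVol ℓ) →L[ℝ] Lp ℝ 2 (edgeVol ℓ) := fun n =>
    ∑ k ∈ Finset.range (n + 1), (innerSL ℝ (χ 0 (q n k))).smulRight (χ (q n k) (q n (k + 1)))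
  have hA : ∀ n, IsCompactOperator (A n) := fun n =>
    isCompactOperator_sum _ _ fun k _ => isCompactOperator_rankOne _ _
  have hpos : ∀ n : ℕ, 0 < ℓ / (n + 1) := fun n => by positivity
  have hq1 : ∀ n k, q n (k + 1) = q n k + ℓ / (n + 1) := fun n k => by
    simp only [q]
    push_cast
    ring
  have hqmono : ∀ n, Monotone (q n) := fun n => monotone_nat_of_le_succ fun k => by
    rw [hq1]
    linarith [hpos n]
  have hq0 : ∀ n, q n 0 = 0 := fun n => by simp [q]
  have hqe : ∀ n, q n (n + 1) = ℓ := fun n => by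
    simp only [q]
    push_cast
    field_simp
  have hqm : ∀ n k, k ≤ n + 1 → q n k ∈ Icc 0 ℓ := fun n k hk =>
    ⟨hq0 n ▸ hqmono n (Nat.zero_le k), hqe n ▸ hqmono n hk⟩
  have hcell : ∀ n, ∀ t ∈ Ioc 0 ℓ, ∃ k ≤ n, t ∈ Ioc (q n k) (q n (k + 1)) := by
    intro n t ht
    have hex : ∃ k, t ≤ q n (k + 1) := ⟨n, by rw [hqe]; exact ht.2⟩
    classical
    refine ⟨Nat.find hex, Nat.find_min' hex (by rw [hqe]; exact ht.2), ?_, Nat.find_spec hex⟩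
    rcases Nat.eq_zero_or_pos (Nat.find hex) with h | h
    · rw [h, hq0]
      exact ht.1
    · obtain ⟨j, hj⟩ := Nat.exists_eq_add_of_lt h
      have := Nat.find_min hex (m := j) (by omega)
      rw [show Nat.find hex = j + 1 by omega]
      exact not_le.1 this
  have hdiff : ∀ n g, ‖(A n - J) g‖ ≤ √ℓ * √(ℓ / (n + 1)) * ‖g‖ := by
    intro n g
    rw [mul_assoc]
    refine norm_le_of_abs_le hℓ.le (by positivity) ?_
    have hAg : A n g = ∑ k ∈ Finset.range (n + 1),
        (⟪χ 0 (q n k), g⟫_ℝ • χ (q n k) (q n (k + 1))) := by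
      simp [A]
    have h1 : ∀ᵐ t ∂edgeVol ℓ, ∀ k, χ (q n k) (q n (k + 1)) t
        = (Ioc (q n k) (q n (k + 1))).indicator (fun _ => (1 : ℝ)) t :=
      ae_all_iff.2 fun k => indicatorConstLp_coeFn
    have h2 : ∀ᵐ t ∂edgeVol ℓ, ∀ k, (⟪χ 0 (q n k), g⟫_ℝ • χ (q n k) (q n (k + 1)) : Lp ℝ 2 _) t
        = ⟪χ 0 (q n k), g⟫_ℝ • χ (q n k) (q n (k + 1)) t :=
      ae_all_iff.2 fun k => Lp.coeFn_smul _ _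
    have h3 : ∀ᵐ t ∂edgeVol ℓ, t ∈ Ioc 0 ℓ := by
      rw [edgeVol, ← restrict_Ioc_eq_restrict_Icc]
      exact ae_restrict_mem measurableSet_Ioc
    filter_upwards [h1, h2, h3, hJ g, Lp.coeFn_sub (A n g) (J g), Lp.coeFn_finsetSum
      (Finset.range (n + 1)) (fun k => (⟪χ 0 (q n k), g⟫_ℝ • χ (q n k) (q n (k + 1)) : Lp ℝ 2 _))]
      with t h1 h2 h3 h4 h5 h6
    obtain ⟨k, hk, htk⟩ := hcell n t h3
    rw [sub_apply, h5, Pi.sub_apply, h4, hAg, h6, Finset.sum_apply]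
    have h7 : ∑ j ∈ Finset.range (n + 1), (⟪χ 0 (q n j), g⟫_ℝ • χ (q n j) (q n (j + 1)) : Lp ℝ 2 _) t
        = ⟪χ 0 (q n k), g⟫_ℝ := by
      rw [Finset.sum_eq_single_of_mem k (Finset.mem_range.2 (by omega))]
      · rw [h2, h1, indicator_of_mem htk, smul_eq_mul, mul_one]
      · intro j _ hj
        rw [h2, h1, indicator_of_notMem, smul_zero]
        rintro ⟨ha, hb⟩
        rcases lt_or_gt_of_ne hj with h | h
        · exact absurd (hqmono n (Nat.succ_le_of_lt h)) (not_le.2 (htk.1.trans_le hb))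
        · exact absurd (hqmono n (Nat.succ_le_of_lt h)) (not_le.2 (ha.trans_le htk.2))
    have hqk := hqm n k (by omega)
    have h0 : (0 : ℝ) ∈ Icc 0 ℓ := left_mem_Icc.2 hℓ.le
    have ht : t ∈ Icc 0 ℓ := Ioc_subset_Icc_self h3
    rw [h7, ← integral_eq_inner g h0 hqk hqk.1, abs_sub_comm,
      intervalIntegral.integral_interval_sub_left (intervalIntegrable_of_memLp (Lp.memLp g) h0 ht)
      (intervalIntegrable_of_memLp (Lp.memLp g) h0 hqk)]
    refine (abs_integral_le g hqk ht htk.1.le).trans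
      (mul_le_mul_of_nonneg_right (Real.sqrt_le_sqrt ?_) (norm_nonneg _))
    have := htk.2
    rw [hq1] at this
    linarith
  refine isCompactOperator_of_tendsto (l := atTop) (F := A) ?_ (Eventually.of_forall hA)
  rw [tendsto_iff_norm_sub_tendsto_zero]
  refine squeeze_zero (fun _ => norm_nonneg _)
    (fun n => ContinuousLinearMap.opNorm_le_bound _ (by positivity) (hdiff n)) ?_
  have h1 : Tendsto (fun n : ℕ => ℓ / ((n : ℝ) + 1)) atTop (𝓝 0) :=
    tendsto_const_nhds.div_atTop (tendsto_natCast_atTop_atTop.atTop_add tendsto_const_nhds)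
  have h2 := (h1.sqrt).const_mul √ℓ
  simpa using h2

end Volterra

/-! ### The operator `L^{-1/2}` -/

namespace MetricGraph

variable {V E : Type*} {Γ : MetricGraph V E} {α : ℕ} {a κ : E → ℝ → ℝ} [Fintype E]

open Classical in
/-- Extension by zero of a function on an edge to the graph. -/
def edgeExt (Γ : MetricGraph V E) (e : E) : Lp ℝ 2 (edgeVol (Γ.len e)) →L[ℝ] Γ.L2 :=
  LinearMap.mkContinuous
    { toFun := fun f => PiLp.single 2 e f
      map_add' := fun f g => PiLp.ext fun e' => by
        exact congrFun (Pi.single_add (f := fun e : E => Lp ℝ 2 (edgeVol (Γ.len e))) e f g) e'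
      map_smul' := fun r f => PiLp.ext fun e' => by
        exact congrFun (Pi.single_smul (f := fun e : E => Lp ℝ 2 (edgeVol (Γ.len e))) e r f) e' } 1 fun f => by
    rw [one_mul]
    exact (PiLp.norm_single (p := 2) (β := fun e : E => Lp ℝ 2 (edgeVol (Γ.len e))) e f).le

theorem edgeExt_apply_same (e : E) (f : Lp ℝ 2 (edgeVol (Γ.len e))) : Γ.edgeExt e f e = f := by
  classical
  exact Pi.single_eq_same (M := fun e : E => Lp ℝ 2 (edgeVol (Γ.len e))) e f

theorem edgeExt_apply_of_ne {e e' : E} (h : e' ≠ e) (f : Lp ℝ 2 (edgeVol (Γ.len e))) :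
    Γ.edgeExt e f e' = 0 := by
  classical
  exact Pi.single_eq_of_ne (M := fun e : E => Lp ℝ 2 (edgeVol (Γ.len e))) h f

theorem inner_edgeExt (e : E) (f : Lp ℝ 2 (edgeVol (Γ.len e))) (φ : Γ.L2) :
    ⟪Γ.edgeExt e f, φ⟫_ℝ = ⟪f, φ e⟫_ℝ := by
  rw [PiLp.inner_apply, Finset.sum_eq_single_of_mem e (Finset.mem_univ e), edgeExt_apply_same]
  intro e' _ h
  rw [edgeExt_apply_of_ne h, inner_zero_left]

theorem norm_edgeExt_le (e : E) (f : Lp ℝ 2 (edgeVol (Γ.len e))) : ‖Γ.edgeExt e f‖ ≤ ‖f‖ := by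
  classical
  exact (PiLp.norm_single (p := 2) (β := fun e : E => Lp ℝ 2 (edgeVol (Γ.len e))) e f).le

theorem sum_edgeExt (f : Γ.L2) : ∑ e, Γ.edgeExt e (f e) = f := by
  refine PiLp.ext fun e => ?_
  rw [WithLp.ofLp_sum, Finset.sum_apply, Finset.sum_eq_single_of_mem e (Finset.mem_univ e)]
  · exact edgeExt_apply_same e _
  · intro e' _ h
    exact edgeExt_apply_of_ne h.symm _

/-- Restriction to an edge. -/
def edgeProj (Γ : MetricGraph V E) (e : E) : Γ.L2 →L[ℝ] Lp ℝ 2 (edgeVol (Γ.len e)) :=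
  PiLp.proj 2 (fun e : E => Lp ℝ 2 (edgeVol (Γ.len e))) e

/-- The constants in `L_2` of an edge. -/
def constants (ℓ : ℝ) : Submodule ℝ (Lp ℝ 2 (edgeVol ℓ)) :=
  Submodule.span ℝ {Lp.const 2 (edgeVol ℓ) (1 : ℝ)}

theorem ae_eq_add_const_iff {ℓ : ℝ} {f g : Lp ℝ 2 (edgeVol ℓ)} :
    f - g ∈ constants ℓ ↔ ∃ c : ℝ, f =ᵐ[edgeVol ℓ] fun t => c + g t := by
  rw [constants, Submodule.mem_span_singleton]
  have h1 : ∀ c : ℝ, (c • Lp.const 2 (edgeVol ℓ) (1 : ℝ) : Lp ℝ 2 _) =ᵐ[edgeVol ℓ] fun _ => c :=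
    fun c => by
      filter_upwards [Lp.coeFn_smul c (Lp.const 2 (edgeVol ℓ) (1 : ℝ)),
        Lp.coeFn_const (p := 2) (μ := edgeVol ℓ) (1 : ℝ)] with t h1 h2
      rw [h1, Pi.smul_apply, h2]
      simp
  refine exists_congr fun c => ⟨fun h => ?_, fun h => Lp.ext ?_⟩
  · filter_upwards [h1 c, Lp.coeFn_sub f g] with t h2 h3
    rw [h, h3, Pi.sub_apply] at h2
    linarith
  · filter_upwards [h1 c, Lp.coeFn_sub f g, h] with t h2 h3 h4
    rw [h2, h3, Pi.sub_apply, h4]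
    ring

/-- The fundamental theorem of calculus on an edge, modulo the value at `0`. Stated as membership in
the line of constants, it is a closed condition and survives limits in `L_2`. -/
theorem IsResolvent.edge_sub_mem {K : Γ.L2 →L[ℝ] Γ.L2}
    {D : (e : E) → Γ.L2 →L[ℝ] Lp ℝ 2 (edgeVol (Γ.len e))} {C : ℝ} (h : Γ.IsResolvent a κ K D C)
    (e : E) {J : Lp ℝ 2 (edgeVol (Γ.len e)) →L[ℝ] Lp ℝ 2 (edgeVol (Γ.len e))}
    (hJ : ∀ g, J g =ᵐ[edgeVol (Γ.len e)] fun t => ∫ s in (0 : ℝ)..t, g s) (g : Γ.L2) :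
    K g e - J (D e g) ∈ constants (Γ.len e) := by
  obtain ⟨F, p, hr, hF, hp⟩ := h.rep g
  refine ae_eq_add_const_iff.2 ⟨F e 0, ?_⟩
  filter_upwards [hF e, hJ (D e g), ae_restrict_mem measurableSet_Icc] with t h1 h2 h3
  rw [← h1, h2, (hr.dF e).eq h3, integral_congr_edge (hp e) (Γ.left_mem e) h3]

/-- On each edge `K` is a bounded operator into the constants plus integration composed with `D e`;
both are compact. -/
theorem IsResolvent.isCompactOperator {K : Γ.L2 →L[ℝ] Γ.L2}
    {D : (e : E) → Γ.L2 →L[ℝ] Lp ℝ 2 (edgeVol (Γ.len e))} {C : ℝ} (h : Γ.IsResolvent a κ K D C) :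
    IsCompactOperator K := by
  have hK : K = ∑ e, (Γ.edgeExt e).comp ((Γ.edgeProj e).comp K) := by
    ext1 g
    rw [sum_apply]
    exact (sum_edgeExt (K g)).symm
  have hc : ∀ e, IsCompactOperator ((Γ.edgeProj e).comp K) := by
    intro e
    obtain ⟨J, hJ⟩ := exists_volterra (Γ.len_pos e).le
    let R : Γ.L2 →L[ℝ] Lp ℝ 2 (edgeVol (Γ.len e)) := (Γ.edgeProj e).comp K - J.comp (D e)
    let R' : Γ.L2 →L[ℝ] constants (Γ.len e) := R.codRestrict _ (h.edge_sub_mem e hJ)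
    have : FiniteDimensional ℝ (constants (Γ.len e)) := by
      unfold constants
      infer_instance
    have hR : IsCompactOperator R := (isCompactOperator_of_locallyCompactSpace_dom R').clm_comp
      (constants (Γ.len e)).subtypeL
    have h2 : IsCompactOperator (J.comp (D e)) :=
      (isCompactOperator_volterra (Γ.len_pos e) hJ).comp_clm (D e)
    have h3 := hR.add h2
    refine (congrArg IsCompactOperator (funext fun g => ?_)).mp h3
    change (Γ.edgeProj e (K g) - J (D e g)) + J (D e g) = _
    exact sub_add_cancel _ _
  rw [hK]
  exact isCompactOperator_sum _ _ fun e _ => (hc e).clm_comp (Γ.edgeExt e)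

/-- The operator `B = L^{-1/2}`, with the operators `D e` giving the derivative of `B φ` along the
edge `e`. -/
structure IsHalfResolvent (Γ : MetricGraph V E) (a κ : E → ℝ → ℝ) (B : Γ.L2 →L[ℝ] Γ.L2)
    (D : (e : E) → Γ.L2 →L[ℝ] Lp ℝ 2 (edgeVol (Γ.len e))) : Prop where
  symm : ∀ f g, ⟪B f, g⟫_ℝ = ⟪f, B g⟫_ℝ
  inj : ∀ f, B f = 0 → f = 0
  op_iff : ∀ f g, Γ.Op a κ f g ↔ f = B (B g)
  spectral : ∀ (n : ℕ) f g, Γ.SpectralPow a κ ((n : ℝ) / 2) f g ↔ f = (B ^ n) g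
  rep : ∀ φ e, ∃ F, HasL2Deriv (Γ.len e) F (D e φ) ∧ F =ᵐ[edgeVol (Γ.len e)] B φ e
  op_rep : ∀ g, ∃ F p : E → ℝ → ℝ, Γ.OpRep a κ F p (fun e => g e) ∧
    (∀ e, F e =ᵐ[edgeVol (Γ.len e)] B (B g) e) ∧
    ∀ e, (fun t => (a e t)⁻¹ * p e t) =ᵐ[edgeVol (Γ.len e)] D e (B g)

theorem symm_pow {H : Type*} [NormedAddCommGroup H] [InnerProductSpace ℝ H] {B : H →L[ℝ] H}
    (hB : ∀ f g, ⟪B f, g⟫_ℝ = ⟪f, B g⟫_ℝ) (n : ℕ) (f g : H) :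
    ⟪(B ^ n) f, g⟫_ℝ = ⟪f, (B ^ n) g⟫_ℝ := by
  induction n generalizing f with
  | zero => rfl
  | succ n ih =>
    have h1 : (B ^ (n + 1)) f = (B ^ n) (B f) := by rw [pow_succ]; rfl
    have h2 : (B ^ (n + 1)) g = B ((B ^ n) g) := by rw [pow_succ']; rfl
    rw [h1, h2, ih, hB]

theorem denseRange_of_symm {H : Type*} [NormedAddCommGroup H] [InnerProductSpace ℝ H]
    [CompleteSpace H] {B : H →L[ℝ] H} (hB : ∀ f g, ⟪B f, g⟫_ℝ = ⟪f, B g⟫_ℝ)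
    (hinj : ∀ f, B f = 0 → f = 0) : DenseRange (B : H →ₗ[ℝ] H) := by
  have h1 : (LinearMap.range (B : H →ₗ[ℝ] H))ᗮ = ⊥ := by
    rw [Submodule.eq_bot_iff]
    intro x hx
    refine hinj x (ext_inner_left ℝ fun y => ?_)
    rw [inner_zero_right, ← hB]
    exact (Submodule.mem_orthogonal _ _).1 hx _ (LinearMap.mem_range_self _ y)
  have h2 := (Submodule.topologicalClosure_eq_top_iff).2 h1
  rw [DenseRange, ← LinearMap.coe_range]
  exact Submodule.dense_iff_topologicalClosure_eq_top.2 h2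

/-- `L φ = λ φ` means `K φ = λ⁻¹ φ`, and there `B^n` multiplies by `λ^{-n/2}`. The spectral
relation, tested on all eigenpairs, thus reads `f = B^n g`. -/
theorem spectralPow_iff {K B : Γ.L2 →L[ℝ] Γ.L2} (hK : IsCompactOperator K)
    (hs : (K : Γ.L2 →ₗ[ℝ] Γ.L2).IsSymmetric) (hop : ∀ f g, Γ.Op a κ f g ↔ f = K g)
    (hinj : ∀ f, K f = 0 → f = 0) (hpos : ∀ f, 0 ≤ ⟪K f, f⟫_ℝ)
    (hB : ∀ f g, ⟪B f, g⟫_ℝ = ⟪f, B g⟫_ℝ) (hBv : ∀ (μ : ℝ) v, K v = μ • v → B v = √μ • v)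
    (n : ℕ) (f g : Γ.L2) : Γ.SpectralPow a κ ((n : ℝ) / 2) f g ↔ f = (B ^ n) g := by
  have hpow : ∀ (μ : ℝ) v, K v = μ • v → (B ^ n) v = √μ ^ n • v := by
    intro μ v hv
    induction n with
    | zero => simp
    | succ n ih =>
      have h2 : (B ^ (n + 1)) v = B ((B ^ n) v) := by rw [pow_succ']; rfl
      rw [h2, ih, map_smul, hBv μ v hv, smul_smul, pow_succ]
  have hμ : ∀ (μ : ℝ) v, v ≠ 0 → K v = μ • v → 0 < μ := fun μ v hv h => by
    have h1 := hpos v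
    rw [h, real_inner_smul_left, real_inner_self_eq_norm_sq] at h1
    refine lt_of_le_of_ne (nonneg_of_mul_nonneg_left h1 (by positivity)) ?_
    rintro rfl
    exact hv (hinj v (by rw [h, zero_smul]))
  have hcancel : ∀ μ : ℝ, 0 < μ → √μ ^ n * (μ⁻¹) ^ ((n : ℝ) / 2) = 1 := fun μ h => by
    rw [Real.rpow_div_two_eq_sqrt _ (inv_pos.2 h).le, Real.rpow_natCast, ← mul_pow, Real.sqrt_inv,
      mul_inv_cancel₀ (Real.sqrt_pos.2 h).ne', one_pow]
  constructor
  · intro h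
    rw [← sub_eq_zero]
    refine eq_zero_of_inner_eigenvector hK hs fun μ v hv => ?_
    rcases eq_or_ne v 0 with rfl | hv0
    · exact inner_zero_right _
    have h0 := hμ μ v hv0 hv
    have h1 := h μ⁻¹ v ((hop _ _).2 (by rw [map_smul, hv, smul_smul, inv_mul_cancel₀ h0.ne',
      one_smul]))
    rw [inner_sub_left, symm_pow hB, hpow μ v hv, real_inner_smul_right, h1, ← mul_assoc,
      hcancel μ h0, one_mul, sub_self]
  · rintro rfl lam φ hφ
    have h1 := (hop _ _).1 hφ
    rcases eq_or_ne φ 0 with rfl | hφ0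
    · simp
    have hl : lam ≠ 0 := by
      rintro rfl
      exact hφ0 (by rw [h1, zero_smul, map_zero])
    have h2 : K φ = lam⁻¹ • φ := by
      rw [map_smul] at h1
      rw [eq_inv_smul_iff₀ hl, ← h1]
    have h0 := hμ _ _ hφ0 h2
    have h3 := hcancel _ h0
    rw [inv_inv] at h3
    rw [symm_pow hB, hpow _ φ h2, real_inner_smul_right, ← mul_assoc, mul_comm (lam ^ _), h3,
      one_mul]

/-- From `‖D g‖ ≤ √C ‖B g‖`, the assignment `B g ↦ D g` extends continuously from the dense range of
`B` to all of `L_2(Γ)`. The extension gives the derivative of `B φ`, because being a primitive up to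
a constant is a closed condition. -/
theorem exists_halfResolvent [Finite V] (hco : Γ.Coeff α a κ) (e₀ : E) :
    ∃ B D, Γ.IsHalfResolvent a κ B D := by
  obtain ⟨K, D, C, h⟩ := exists_resolvent hco e₀
  have hK := h.isCompactOperator
  obtain ⟨B, hB, hBB, hBv⟩ := exists_sqrt hK h.symm h.nonneg
  have hB' : ∀ f g, ⟪B f, g⟫_ℝ = ⟪f, B g⟫_ℝ := hB
  have hinj : ∀ f, B f = 0 → f = 0 := fun f hf => h.inj f (by rw [← hBB, hf, map_zero])
  have hdense := denseRange_of_symm hB' hinj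
  have hle : ∀ e g, ‖D e g‖ ≤ √C * ‖B g‖ := fun e g => by
    have h1 : ‖B g‖ ^ 2 = ⟪K g, g⟫_ℝ := by
      rw [← real_inner_self_eq_norm_sq, hB', hBB, real_inner_comm]
    rw [← Real.sqrt_sq (norm_nonneg (B g)), ← Real.sqrt_mul h.const_nonneg,
      Real.le_sqrt (norm_nonneg _) (mul_nonneg h.const_nonneg (sq_nonneg _)), h1]
    exact h.bound e g
  let D' : (e : E) → Γ.L2 →L[ℝ] Lp ℝ 2 (edgeVol (Γ.len e)) := fun e =>
    (D e : Γ.L2 →ₗ[ℝ] Lp ℝ 2 (edgeVol (Γ.len e))).extendOfNorm (B : Γ.L2 →ₗ[ℝ] Γ.L2)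
  have hD' : ∀ e g, D' e (B g) = D e g := fun e g =>
    LinearMap.extendOfNorm_eq hdense ⟨√C, hle e⟩ g
  refine ⟨B, D', hB', hinj, fun f g => by rw [hBB, h.op_iff],
    spectralPow_iff hK h.symm h.op_iff h.inj h.nonneg hB' hBv, fun φ e => ?_, fun g => ?_⟩
  · obtain ⟨J, hJ⟩ := exists_volterra (Γ.len_pos e).le
    have hmem : B φ e - J (D' e φ) ∈ constants (Γ.len e) := by
      have : FiniteDimensional ℝ (constants (Γ.len e)) := by
        unfold constants
        infer_instance
      have hcl : IsClosed {φ : Γ.L2 | B φ e - J (D' e φ) ∈ constants (Γ.len e)} := by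
        have hc : Continuous fun φ : Γ.L2 => Γ.edgeProj e (B φ) - J (D' e φ) :=
          ((Γ.edgeProj e).continuous.comp B.continuous).sub
            (J.continuous.comp (D' e).continuous)
        exact (constants (Γ.len e)).closed_of_finiteDimensional.preimage hc
      refine isClosed_property hdense hcl (fun g => ?_) φ
      change B (B g) e - J (D' e (B g)) ∈ _
      rw [hBB, hD']
      exact h.edge_sub_mem e hJ g
    obtain ⟨c, hc⟩ := ae_eq_add_const_iff.1 hmem
    refine ⟨fun t => c + ∫ s in (0 : ℝ)..t, D' e φ s, ⟨Lp.memLp _, fun t _ => by simp⟩, ?_⟩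
    filter_upwards [hc, hJ (D' e φ)] with t h1 h2
    rw [h1, h2]
  · obtain ⟨F, p, hr, hF, hp⟩ := h.rep g
    exact ⟨F, p, hr, fun e => by rw [hBB]; exact hF e, fun e => by rw [hD']; exact hp e⟩

end MetricGraph

/-! ### Quasi-derivatives of the elements of `Ḣ^n_L(Γ)` and extension by zero -/

section Chain

variable {ℓ : ℝ} {a κ : ℝ → ℝ} {n : ℕ} {q : ℕ → ℝ → ℝ}

/-- Prepend two functions to a chain. -/
def consChain (F p : ℝ → ℝ) (q : ℕ → ℝ → ℝ) : ℕ → ℝ → ℝ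
  | 0 => F
  | 1 => p
  | k + 2 => q k

theorem IsQuasiChain.cons {F p : ℝ → ℝ} (hq : IsQuasiChain ℓ a κ n q)
    (hF : HasL2Deriv ℓ F (fun t => (a t)⁻¹ * p t))
    (hp : HasL2Deriv ℓ p (fun t => κ t ^ 2 * F t - q 0 t)) :
    IsQuasiChain ℓ a κ (n + 2) (consChain F p q) := by
  refine isQuasiChain_of_deriv hq.top (fun k hk => ?_) fun k hk => ?_
  · rcases k with - | k
    · exact hF
    · exact IsQuasiChain.deriv_even hq (k := k) (by omega)
  · rcases k with - | k
    · exact hp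
    · exact IsQuasiChain.deriv_odd hq (k := k) (by omega)

theorem IsQuasiChain.tail (hq : IsQuasiChain ℓ a κ (n + 2) q) :
    IsQuasiChain ℓ a κ n (fun k => q (k + 2)) := by
  refine isQuasiChain_of_deriv hq.top (fun k hk => ?_) fun k hk => ?_
  · exact IsQuasiChain.deriv_even hq (k := k + 1) (by omega)
  · exact IsQuasiChain.deriv_odd hq (k := k + 1) (by omega)

theorem chainNorm_tail_le (hℓ : 0 ≤ ℓ) :
    chainNorm ℓ n (fun k => q (k + 2)) ≤ chainNorm ℓ (n + 2) q := by
  refine Real.sqrt_le_sqrt ?_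
  rw [Finset.sum_range_succ' _ (n + 2), Finset.sum_range_succ' _ (n + 1), add_assoc]
  exact le_add_of_nonneg_right (add_nonneg (integral_sq_nonneg hℓ _) (integral_sq_nonneg hℓ _))

theorem norm_sq_eq_integral {f : Lp ℝ 2 (edgeVol ℓ)} {g : ℝ → ℝ} (hℓ : 0 ≤ ℓ)
    (h : f =ᵐ[edgeVol ℓ] g) : ‖f‖ ^ 2 = ∫ t in (0 : ℝ)..ℓ, g t ^ 2 := by
  rw [MetricGraph.norm_sq_edge hℓ]
  refine integral_congr_edge ?_ (left_mem_Icc.2 hℓ) (right_mem_Icc.2 hℓ)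
  filter_upwards [h] with t ht
  rw [ht]

theorem norm_le_chainNorm {f : Lp ℝ 2 (edgeVol ℓ)} (hℓ : 0 ≤ ℓ) {k : ℕ} (hk : k ≤ n)
    (h : f =ᵐ[edgeVol ℓ] q k) : ‖f‖ ≤ chainNorm ℓ n q := by
  refine le_of_sq_le_sq ?_ chainNorm_nonneg
  rw [norm_sq_eq_integral hℓ h]
  exact integral_sq_le_chainNorm hℓ hk

theorem norm_mul_le {f g : Lp ℝ 2 (edgeVol ℓ)} {m : ℝ → ℝ} {C : ℝ}
    (hC : ∀ᵐ t ∂edgeVol ℓ, |m t| ≤ C) (h : g =ᵐ[edgeVol ℓ] fun t => m t * f t) :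
    ‖g‖ ≤ C * ‖f‖ := by
  refine Lp.norm_le_mul_norm_of_ae_le_mul ?_
  filter_upwards [hC, h] with t h1 h2
  rw [h2, norm_mul]
  exact mul_le_mul_of_nonneg_right h1 (norm_nonneg _)

end Chain

/-! ### Powers of `B`: quasi-derivatives of their images, and preimages of extensions by zero -/

namespace MetricGraph

variable {V E : Type*} {Γ : MetricGraph V E} {α : ℕ} {a κ : E → ℝ → ℝ} [Fintype E]
  {B : Γ.L2 →L[ℝ] Γ.L2} {D : (e : E) → Γ.L2 →L[ℝ] Lp ℝ 2 (edgeVol (Γ.len e))}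

/-- `φ` is equal to `f` on the edge `e` and vanishes on the other edges. -/
def IsZeroExt (Γ : MetricGraph V E) (e : E) (φ : Γ.L2) (f : ℝ → ℝ) : Prop :=
  φ e =ᵐ[edgeVol (Γ.len e)] f ∧ ∀ e' ≠ e, φ e' = 0

theorem isZeroExt_edgeExt (e : E) {f : ℝ → ℝ} (hf : MemLp f 2 (edgeVol (Γ.len e))) :
    Γ.IsZeroExt e (Γ.edgeExt e (hf.toLp f)) f :=
  ⟨by rw [edgeExt_apply_same]; exact hf.coeFn_toLp, fun _ h => edgeExt_apply_of_ne h _⟩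

theorem IsZeroExt.unique {e : E} {φ ψ : Γ.L2} {f g : ℝ → ℝ} (hφ : Γ.IsZeroExt e φ f)
    (hψ : Γ.IsZeroExt e ψ g) (h : f =ᵐ[edgeVol (Γ.len e)] g) : φ = ψ := by
  refine PiLp.ext fun e' => ?_
  rcases eq_or_ne e' e with rfl | he
  · exact Lp.ext (hφ.1.trans (h.trans hψ.1.symm))
  · rw [hφ.2 e' he, hψ.2 e' he]

theorem IsZeroExt.congr {e : E} {φ : Γ.L2} {f g : ℝ → ℝ} (hφ : Γ.IsZeroExt e φ f)
    (h : f =ᵐ[edgeVol (Γ.len e)] g) : Γ.IsZeroExt e φ g :=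
  ⟨hφ.1.trans h, hφ.2⟩

theorem IsZeroExt.lincomb {e : E} {φ ψ : Γ.L2} {f g : ℝ → ℝ} (hφ : Γ.IsZeroExt e φ f)
    (hψ : Γ.IsZeroExt e ψ g) (r : ℝ) : Γ.IsZeroExt e (r • φ + ψ) (fun t => r * f t + g t) := by
  refine ⟨?_, fun e' he => ?_⟩
  · rw [PiLp.add_apply, PiLp.smul_apply]
    filter_upwards [Lp.coeFn_add (r • φ e) (ψ e), Lp.coeFn_smul r (φ e), hφ.1, hψ.1]
      with t h1 h2 h3 h4
    rw [h1, Pi.add_apply, h2, Pi.smul_apply, h3, h4, smul_eq_mul]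
  · rw [PiLp.add_apply, PiLp.smul_apply, hφ.2 e' he, hψ.2 e' he, smul_zero, add_zero]

theorem IsZeroExt.inner_eq {e : E} {φ : Γ.L2} {f g : ℝ → ℝ} (hφ : Γ.IsZeroExt e φ f)
    {ψ : Γ.L2} (hψ : ψ e =ᵐ[edgeVol (Γ.len e)] g) :
    ⟪φ, ψ⟫_ℝ = ∫ t in (0 : ℝ)..Γ.len e, f t * g t := by
  rw [MetricGraph.inner_eq, Finset.sum_eq_single_of_mem e (Finset.mem_univ e)]
  · refine integral_congr_edge ?_ (Γ.left_mem e) (Γ.right_mem e)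
    filter_upwards [hφ.1, hψ] with t h1 h2
    rw [h1, h2]
  · intro e' _ he
    rw [hφ.2 e' he, integral_congr_edge (g₂ := fun _ => 0) ?_ (Γ.left_mem e') (Γ.right_mem e'),
      intervalIntegral.integral_zero]
    filter_upwards [Lp.coeFn_zero ℝ 2 (edgeVol (Γ.len e'))] with t ht
    rw [ht, Pi.zero_apply, zero_mul]

namespace IsHalfResolvent

theorem pow_add_two_apply (n : ℕ) (φ : Γ.L2) : (B ^ (n + 2)) φ = B (B ((B ^ n) φ)) := by
  rw [pow_succ', pow_succ']
  rfl

/-- Elements of `Ḣ^n_L(Γ)` have quasi-derivatives up to order `n` along every edge. -/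
theorem exists_chain (h : Γ.IsHalfResolvent a κ B D) (hco : Γ.Coeff α a κ) (e : E) :
    ∀ n : ℕ, ∃ C, 0 ≤ C ∧ ∀ φ : Γ.L2, ∃ q, IsQuasiChain (Γ.len e) (a e) (κ e) n q ∧
      (q 0 =ᵐ[edgeVol (Γ.len e)] (B ^ n) φ e) ∧
      (∀ k ≤ n, ∃ f : Lp ℝ 2 (edgeVol (Γ.len e)), f =ᵐ[edgeVol (Γ.len e)] q k ∧
        ‖f‖ ≤ C * ‖φ‖) ∧ (Even n → q n =ᵐ[edgeVol (Γ.len e)] φ e) := by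
  obtain ⟨A, hA0, hA⟩ := exists_ae_bound (hco.2 e).wInf_one.memLp
  have hnorm : ∀ φ : Γ.L2, ‖φ e‖ ≤ ‖φ‖ := fun φ => PiLp.norm_apply_le φ e
  have hquasi : ∀ {p : ℝ → ℝ} {f : Lp ℝ 2 (edgeVol (Γ.len e))}, MemLp p 2 (edgeVol (Γ.len e)) →
      ((fun t => (a e t)⁻¹ * p t) =ᵐ[edgeVol (Γ.len e)] f) →
      ∃ f' : Lp ℝ 2 (edgeVol (Γ.len e)), f' =ᵐ[edgeVol (Γ.len e)] p ∧ ‖f'‖ ≤ A * ‖f‖ := by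
    intro p f hp hf
    refine ⟨hp.toLp p, hp.coeFn_toLp, norm_mul_le hA ?_⟩
    filter_upwards [hp.coeFn_toLp, hf, ae_restrict_mem measurableSet_Icc] with t h1 h2 h3
    rw [h1, ← h2, mul_inv_cancel_left₀ ((hco.2 e).a_pos t h3).ne']
  intro n
  -- As `B^{n+2} φ = L⁻¹ B^n φ`, one use of the resolvent prepends two quasi-derivatives. The case
  -- `n = 1` rests on `D e`. For even `n` the top quasi-derivative is `φ` itself.
  induction n using Nat.twoStepInduction with
  | zero =>
    refine ⟨1, zero_le_one, fun φ => ⟨fun _ => φ e, ⟨Lp.memLp _, by simp⟩, ae_eq_refl _,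
      fun k _ => ⟨φ e, ae_eq_refl _, ?_⟩, fun _ => ae_eq_refl _⟩⟩
    rw [one_mul]
    exact hnorm φ
  | one =>
    refine ⟨max ‖B‖ (A * ‖D e‖), le_max_of_le_left (norm_nonneg _), fun φ => ?_⟩
    obtain ⟨F, hF, hFB⟩ := h.rep φ e
    have hpm : MemLp (fun t => a e t * D e φ t) 2 (edgeVol (Γ.len e)) :=
      (Lp.memLp (D e φ)).mul (hco.2 e).wInf_one.memLp
    have hpd : (fun t => (a e t)⁻¹ * (a e t * D e φ t)) =ᵐ[edgeVol (Γ.len e)] D e φ := by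
      filter_upwards [ae_restrict_mem measurableSet_Icc] with t ht
      rw [inv_mul_cancel_left₀ ((hco.2 e).a_pos t ht).ne']
    refine ⟨fun k => if k = 0 then F else fun t => a e t * D e φ t,
      isQuasiChain_of_deriv (by simpa using hpm) (fun k hk => ?_) (fun k hk => by omega), ?_,
      fun k hk => ?_, fun h1 => by simp at h1⟩
    · obtain rfl : k = 0 := by omega
      simpa using hF.congr (fun _ _ => rfl) hpd.symm
    · simpa using hFB
    · obtain rfl | rfl : k = 0 ∨ k = 1 := by omega
      · refine ⟨B φ e, by simpa using hFB.symm, (hnorm _).trans ((B.le_opNorm φ).trans ?_)⟩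
        exact mul_le_mul_of_nonneg_right (le_max_left _ _) (norm_nonneg _)
      · obtain ⟨f, hf, hfn⟩ := hquasi hpm hpd
        refine ⟨f, by simpa using hf, hfn.trans ?_⟩
        calc A * ‖D e φ‖ ≤ A * (‖D e‖ * ‖φ‖) :=
              mul_le_mul_of_nonneg_left ((D e).le_opNorm φ) hA0
          _ = A * ‖D e‖ * ‖φ‖ := by ring
          _ ≤ _ := mul_le_mul_of_nonneg_right (le_max_right _ _) (norm_nonneg _)
  | more n ih _ =>
    obtain ⟨C, hC0, hC⟩ := ih
    refine ⟨max C (max ‖B ^ (n + 2)‖ (A * (‖D e‖ * (‖B‖ * ‖B ^ n‖)))), le_max_of_le_left hC0,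
      fun φ => ?_⟩
    obtain ⟨q, hq, hq0, hqn, hqe⟩ := hC φ
    obtain ⟨F, p, hr, hF, hp⟩ := h.op_rep ((B ^ n) φ)
    refine ⟨consChain (F e) (p e) q, IsQuasiChain.cons hq (hr.dF e)
      ((hr.dp e).congr (fun _ _ => rfl) ?_), ?_, fun k hk => ?_, fun h1 => ?_⟩
    · filter_upwards [hq0] with t ht
      rw [ht]
    · rw [pow_add_two_apply]
      exact hF e
    · rcases k with - | - | k
      · refine ⟨(B ^ (n + 2)) φ e, ?_, (hnorm _).trans (((B ^ (n + 2)).le_opNorm φ).trans ?_)⟩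
        · rw [pow_add_two_apply]
          exact (hF e).symm
        · exact mul_le_mul_of_nonneg_right ((le_max_left _ _).trans (le_max_right _ _))
            (norm_nonneg _)
      · obtain ⟨f, hf, hfn⟩ := hquasi (hr.memLp_p e) (hp e)
        refine ⟨f, hf, hfn.trans ?_⟩
        calc A * ‖D e (B ((B ^ n) φ))‖ ≤ A * (‖D e‖ * (‖B‖ * (‖B ^ n‖ * ‖φ‖))) := by
              gcongr
              exact ((D e).le_opNorm _).trans (mul_le_mul_of_nonneg_left ((B.le_opNorm _).trans
                (mul_le_mul_of_nonneg_left ((B ^ n).le_opNorm φ) (norm_nonneg _))) (norm_nonneg _))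
          _ = A * (‖D e‖ * (‖B‖ * ‖B ^ n‖)) * ‖φ‖ := by ring
          _ ≤ _ := mul_le_mul_of_nonneg_right ((le_max_right _ _).trans (le_max_right _ _))
            (norm_nonneg _)
      · obtain ⟨f, hf, hfn⟩ := hqn k (by omega)
        exact ⟨f, hf, hfn.trans (mul_le_mul_of_nonneg_right (le_max_left _ _) (norm_nonneg _))⟩
    · exact hqe (by simpa [Nat.even_add] using h1)

/-- Extension by zero maps functions in `H^1` vanishing at the end points to `Ḣ^1_L(Γ)`. -/
theorem exists_preimage_one [Finite V] (h : Γ.IsHalfResolvent a κ B D) (hco : Γ.Coeff α a κ)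
    (e : E) : ∃ C, 0 ≤ C ∧ ∀ q, IsQuasiChain (Γ.len e) (a e) (κ e) 1 q → q 0 0 = 0 →
      q 0 (Γ.len e) = 0 →
      ∃ φ, Γ.IsZeroExt e (B φ) (q 0) ∧ ‖φ‖ ≤ C * chainNorm (Γ.len e) 1 q := by
  classical
  have hκ : WInf 0 (Γ.len e) (κ e) := (hco.2 e).kappa_bdd
  obtain ⟨A, hA0, hA⟩ := exists_ae_bound (hκ.mul hκ).memLp
  refine ⟨‖D e‖ + ‖B‖ * A, by positivity, fun q hq h0 h1 => ?_⟩
  have hq' : HasL2Deriv (Γ.len e) (q 0) (fun t => (a e t)⁻¹ * q 1 t) := by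
    simpa using IsQuasiChain.deriv_even hq (k := 0) (by omega)
  have hm0 : MemLp (q 0) 2 (edgeVol (Γ.len e)) := hq.memLp (by omega)
  have hm1 : MemLp (q 1) 2 (edgeVol (Γ.len e)) := hq.memLp (by omega)
  have hmκ : MemLp (fun t => (κ e t * κ e t) * q 0 t) 2 (edgeVol (Γ.len e)) :=
    hm0.mul (hκ.mul hκ).memLp
  set ψ : Γ.L2 := Γ.edgeExt e (hmκ.toLp _) with hψ
  have hψe : Γ.IsZeroExt e ψ _ := isZeroExt_edgeExt e hmκ
  -- This is `L^{1/2} q_0` in weak form: `⟪φ, B g⟫` is the energy form of `q_0` and `L⁻¹ g`, which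
  -- the weak formulation turns into the integral of `q_0 g`.
  set φ : Γ.L2 := ContinuousLinearMap.adjoint (D e) (hm1.toLp (q 1)) + B ψ with hφ
  have key : ∀ g : Γ.L2, ⟪φ, B g⟫_ℝ = ∫ t in (0 : ℝ)..Γ.len e, q 0 t * (g e : ℝ → ℝ) t := by
    intro g
    obtain ⟨F, p, hr, hF, hp⟩ := h.op_rep g
    have hw := hr.weak hco (η := fun e' => if e' = e then q 0 else fun _ => 0)
      (η' := fun e' => if e' = e then fun t => (a e t)⁻¹ * q 1 t else fun _ => 0)
      (fun e' => by
        rcases eq_or_ne e' e with rfl | he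
        · simpa using hq'
        · simpa [he] using HasL2Deriv.const 0)
      ⟨fun _ => 0, fun e' => by
        rcases eq_or_ne e' e with rfl | he
        · simp [h0, h1]
        · simp [he]⟩
    rw [Finset.sum_eq_single_of_mem e (Finset.mem_univ e) (fun e' _ he => by simp [he]),
      Finset.sum_eq_single_of_mem e (Finset.mem_univ e) (fun e' _ he => by simp [he])] at hw
    simp only [if_true] at hw
    have i1 := MemLp.intervalIntegrable_mul (Γ.len_pos e).le hm1 (hr.dF e).memLp
    have i2 := MemLp.intervalIntegrable_mul (Γ.len_pos e).le hmκ (hr.dF e).memLp_two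
    have hD : ⟪hm1.toLp (q 1), D e (B g)⟫_ℝ
        = ∫ t in (0 : ℝ)..Γ.len e, q 1 t * ((a e t)⁻¹ * p e t) := by
      rw [L2.inner_def, ← integral_edgeVol (Γ.len_pos e).le]
      refine integral_congr_ae ?_
      filter_upwards [hm1.coeFn_toLp, hp e] with t e1 e2
      rw [e1, ← e2, RCLike.inner_apply, conj_trivial, mul_comm]
    rw [hw, hφ, inner_add_left, ContinuousLinearMap.adjoint_inner_left, hD, h.symm,
      hψe.inner_eq (hF e).symm, ← intervalIntegral.integral_add i1 i2]
    refine intervalIntegral.integral_congr fun t _ => ?_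
    ring
  refine ⟨φ, ?_, ?_⟩
  · have h2 : B φ = Γ.edgeExt e (hm0.toLp _) := ext_inner_right ℝ fun g => by
      rw [h.symm, key, (isZeroExt_edgeExt e hm0).inner_eq (ae_eq_refl (g e))]
    rw [h2]
    exact isZeroExt_edgeExt e hm0
  · have n1 : ‖hm1.toLp (q 1)‖ ≤ chainNorm (Γ.len e) 1 q :=
      norm_le_chainNorm (Γ.len_pos e).le le_rfl hm1.coeFn_toLp
    have n0 : ‖hm0.toLp (q 0)‖ ≤ chainNorm (Γ.len e) 1 q :=
      norm_le_chainNorm (Γ.len_pos e).le zero_le_one hm0.coeFn_toLp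
    have n2 : ‖ψ‖ ≤ A * chainNorm (Γ.len e) 1 q := by
      refine (norm_edgeExt_le e _).trans ((norm_mul_le hA (f := hm0.toLp (q 0)) ?_).trans
        (mul_le_mul_of_nonneg_left n0 hA0))
      filter_upwards [hmκ.coeFn_toLp, hm0.coeFn_toLp] with t e1 e2
      rw [e1, e2]
    calc ‖φ‖ ≤ ‖D e‖ * chainNorm (Γ.len e) 1 q + ‖B‖ * (A * chainNorm (Γ.len e) 1 q) := by
          refine (norm_add_le _ _).trans (add_le_add ?_ ?_)
          · refine (ContinuousLinearMap.le_opNorm _ _).trans ?_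
            rw [LinearIsometryEquiv.norm_map]
            exact mul_le_mul_of_nonneg_left n1 (norm_nonneg _)
          · exact (B.le_opNorm ψ).trans (mul_le_mul_of_nonneg_left n2 (norm_nonneg _))
      _ = _ := by ring

/-- Extension by zero of a function with vanishing boundary data. -/
theorem exists_preimage [Finite V] (h : Γ.IsHalfResolvent a κ B D) (hco : Γ.Coeff α a κ)
    (e : E) : ∀ n : ℕ, ∃ C, 0 ≤ C ∧ ∀ q, IsQuasiChain (Γ.len e) (a e) (κ e) n q →
      (∀ k < n, q k 0 = 0) → (∀ k < n, q k (Γ.len e) = 0) →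
      ∃ φ, Γ.IsZeroExt e ((B ^ n) φ) (q 0) ∧ ‖φ‖ ≤ C * chainNorm (Γ.len e) n q ∧
        (Even n → Γ.IsZeroExt e φ (q n)) := by
  classical
  intro n
  induction n using Nat.twoStepInduction with
  | zero =>
    refine ⟨1, zero_le_one, fun q hq _ _ => ⟨Γ.edgeExt e (MemLp.toLp _ hq.top),
      isZeroExt_edgeExt e hq.top, ?_, fun _ => isZeroExt_edgeExt e hq.top⟩⟩
    rw [one_mul]
    exact (norm_edgeExt_le e _).trans
      (norm_le_chainNorm (Γ.len_pos e).le le_rfl (MemLp.coeFn_toLp hq.top))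
  | one =>
    obtain ⟨C, hC0, hC⟩ := h.exists_preimage_one hco e
    refine ⟨C, hC0, fun q hq h0 h1 => ?_⟩
    obtain ⟨φ, hφ, hn⟩ := hC q hq (h0 0 one_pos) (h1 0 one_pos)
    exact ⟨φ, by rw [pow_one]; exact hφ, hn, fun h1 => by simp at h1⟩
  | more n ih _ =>
    obtain ⟨C, hC0, hC⟩ := ih
    refine ⟨C, hC0, fun q hq h0 h1 => ?_⟩
    obtain ⟨φ, hφ, hn, he⟩ := hC _ (IsQuasiChain.tail hq) (fun k hk => h0 (k + 2) (by omega))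
      (fun k hk => h1 (k + 2) (by omega))
    refine ⟨φ, ?_, hn.trans (mul_le_mul_of_nonneg_left (chainNorm_tail_le (Γ.len_pos e).le) hC0),
      fun h2 => he (by simpa [Nat.even_add] using h2)⟩
    have hm0 : MemLp (q 0) 2 (edgeVol (Γ.len e)) := hq.memLp (by omega)
    -- Vanishing of `q 0` at both ends gives continuity of the zero extension at the vertices, and
    -- vanishing of `q 1` gives flux balance. The remaining chain is that of `L q_0` and is covered
    -- by induction.
    have hrep : Γ.OpRep a κ (fun e' => if e' = e then q 0 else fun _ => 0)
        (fun e' => if e' = e then q 1 else fun _ => 0) (fun e' => (B ^ n) φ e') := by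
      have hz : ∀ e' ≠ e, (B ^ n) φ e' =ᵐ[edgeVol (Γ.len e')] fun _ => 0 := fun e' he' => by
        rw [hφ.2 e' he']
        exact Lp.coeFn_zero ℝ 2 _
      refine ⟨fun e' => ?_, fun e' => ?_, ⟨fun _ => 0, fun e' => ?_⟩, fun v => ?_⟩
      · rcases eq_or_ne e' e with rfl | he'
        · simpa using IsQuasiChain.deriv_even hq (k := 0) (by omega)
        · simpa [he'] using HasL2Deriv.const 0
      · rcases eq_or_ne e' e with rfl | he'
        · have := IsQuasiChain.deriv_odd hq (k := 0) (by omega)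
          simp only [if_true]
          refine this.congr (fun _ _ => rfl) ?_
          filter_upwards [hφ.1] with t ht
          rw [ht]
        · simp only [he', if_false]
          refine (HasL2Deriv.const 0).congr (fun _ _ => rfl) ?_
          filter_upwards [hz e' he'] with t ht
          rw [ht]
          ring
      · rcases eq_or_ne e' e with rfl | he'
        · simp [h0 0 (by omega), h1 0 (by omega)]
        · simp [he']
      · refine Finset.sum_eq_zero fun e' _ => ?_
        rcases eq_or_ne e' e with rfl | he'
        · simp [h0 1 (by omega), h1 1 (by omega)]
        · simp [he']
    have hop : Γ.Op a κ (Γ.edgeExt e (hm0.toLp _)) ((B ^ n) φ) := by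
      refine (MetricGraph.op_iff hco).2 ⟨_, _, hrep, fun e' => ?_⟩
      rcases eq_or_ne e' e with rfl | he'
      · simpa using (isZeroExt_edgeExt e' hm0).1.symm
      · rw [edgeExt_apply_of_ne he']
        simp only [he', if_false]
        exact (Lp.coeFn_zero ℝ 2 _).symm
    rw [pow_add_two_apply, ← (h.op_iff _ _).1 hop]
    exact isZeroExt_edgeExt e hm0

end IsHalfResolvent

end MetricGraph

/-! ### Point values of chains -/

section PointValues

variable {ℓ : ℝ} {c d : ℕ → ℝ → ℝ} {n : ℕ} {x : ℕ → ℝ → ℝ}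

/-- Where `x k` and `x (k - 1)` vanish identically, the equation leaves `c_k x_{k+1} = 0`. Compact
support of a function therefore passes to its chain. -/
theorem IsSys.eq_zero_of_subinterval (hx : IsSys ℓ c d n x)
    (hc : ∀ k < n, ∀ᵐ t ∂edgeVol ℓ, c k t ≠ 0) {s t : ℝ} (hs : 0 ≤ s) (hst : s < t) (ht : t ≤ ℓ)
    (h0 : ∀ u ∈ Icc s t, x 0 u = 0) : ∀ k < n, ∀ u ∈ Icc s t, x k u = 0 := by
  intro k
  induction k using Nat.strong_induction_on with
  | _ k ih =>
    intro hk
    rcases k with - | k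
    · exact h0
    have h1 := ae_edge_iff_Ioo.1 (hx.deriv k (by omega)).ae_hasDerivAt
    have h2 := ae_edge_iff_Ioo.1 (hc k (by omega))
    have hsub : Icc s t ⊆ Icc 0 ℓ := Icc_subset_Icc hs ht
    refine Measure.eqOn_Icc_of_ae_eq volume hst.ne ?_ ((hx.continuousOn hk).mono hsub)
      continuousOn_const
    rw [← restrict_Ioo_eq_restrict_Icc, EventuallyEq, ae_restrict_iff' measurableSet_Ioo]
    filter_upwards [h1, h2] with u hd hcu hu
    have huℓ : u ∈ Ioo 0 ℓ := ⟨hs.trans_lt hu.1, hu.2.trans_le ht⟩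
    have h3 : HasDerivAt (x k) 0 u := by
      refine (hasDerivAt_const u (0 : ℝ)).congr_of_eventuallyEq ?_
      filter_upwards [Icc_mem_nhds hu.1 hu.2] with v hv using ih k (by omega) (by omega) v hv
    have h4 := (hd huℓ).unique h3
    rw [ih (k - 1) (by omega) (by omega) u (Ioo_subset_Icc_self hu), mul_zero, add_zero] at h4
    exact (mul_eq_zero.1 h4).resolve_left (hcu huℓ)

/-- The Sobolev embedding in dimension one: bound `f t` by `f s` plus an integral of `g`, then
average over `s`. -/
theorem HasL2Deriv.sq_le {f g : ℝ → ℝ} (hℓ : 0 < ℓ) (h : HasL2Deriv ℓ f g) {t : ℝ}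
    (ht : t ∈ Icc 0 ℓ) :
    f t ^ 2 ≤ 2 / ℓ * (∫ s in (0 : ℝ)..ℓ, f s ^ 2) + 2 * ℓ * ∫ s in (0 : ℝ)..ℓ, g s ^ 2 := by
  have h0 : (0 : ℝ) ∈ Icc 0 ℓ := left_mem_Icc.2 hℓ.le
  have hn : ‖h.memLp.toLp g‖ ^ 2 = ∫ s in (0 : ℝ)..ℓ, g s ^ 2 :=
    norm_sq_eq_integral hℓ.le h.memLp.coeFn_toLp
  have hint : ∀ s ∈ Icc 0 ℓ, ∀ t ∈ Icc 0 ℓ, s ≤ t →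
      (∫ u in s..t, g u) ^ 2 ≤ ℓ * ∫ s in (0 : ℝ)..ℓ, g s ^ 2 := by
    intro s hs t ht hst
    have h1 := abs_integral_le (h.memLp.toLp g) hs ht hst
    rw [integral_congr_edge h.memLp.coeFn_toLp hs ht] at h1
    rw [← sq_abs, ← hn]
    calc |∫ u in s..t, g u| ^ 2 ≤ (√(t - s) * ‖h.memLp.toLp g‖) ^ 2 := by gcongr
      _ = (t - s) * ‖h.memLp.toLp g‖ ^ 2 := by rw [mul_pow, Real.sq_sqrt (by linarith)]
      _ ≤ ℓ * ‖h.memLp.toLp g‖ ^ 2 := by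
        gcongr
        linarith [hs.1, ht.2]
  have hpt : ∀ s ∈ Icc 0 ℓ, f t ^ 2 ≤ 2 * f s ^ 2 + 2 * (ℓ * ∫ s in (0 : ℝ)..ℓ, g s ^ 2) := by
    intro s hs
    have h1 : f t - f s = ∫ u in s..t, g u := by
      rw [h.eq ht, h.eq hs, ← intervalIntegral.integral_interval_sub_left
        (intervalIntegrable_of_memLp h.memLp h0 ht) (intervalIntegrable_of_memLp h.memLp h0 hs)]
      ring
    have h2 : (f t - f s) ^ 2 ≤ ℓ * ∫ s in (0 : ℝ)..ℓ, g s ^ 2 := by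
      rw [h1]
      rcases le_total s t with hst | hst
      · exact hint s hs t ht hst
      · rw [intervalIntegral.integral_symm, neg_sq]
        exact hint t ht s hs hst
    -- The inequality `f(t)² ≤ 2 f(s)² + 2 (f(t) - f(s))²` is the nonnegativity of `(f(t) - 2
    -- f(s))²`.
    nlinarith [sq_nonneg (f t - 2 * f s)]
  have hi := (MemLp.intervalIntegrable_sq hℓ.le h.memLp_two).const_mul 2
  have hm := intervalIntegral.integral_mono_on (a := (0 : ℝ)) (b := ℓ) hℓ.le
    (f := fun _ => f t ^ 2) (by simp) (hi.add (intervalIntegrable_const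
      (c := 2 * (ℓ * ∫ s in (0 : ℝ)..ℓ, g s ^ 2)))) hpt
  rw [intervalIntegral.integral_add hi (by simp), intervalIntegral.integral_const_mul] at hm
  simp only [intervalIntegral.integral_const, sub_zero, smul_eq_mul] at hm
  have h3 : 2 / ℓ * (∫ s in (0 : ℝ)..ℓ, f s ^ 2) + 2 * ℓ * (∫ s in (0 : ℝ)..ℓ, g s ^ 2)
      = (2 * (∫ s in (0 : ℝ)..ℓ, f s ^ 2) + ℓ * (2 * (ℓ * ∫ s in (0 : ℝ)..ℓ, g s ^ 2))) / ℓ := by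
    field_simp
  rw [h3, le_div_iff₀ hℓ]
  linarith

theorem IsSobChain.abs_le (hℓ : 0 < ℓ) (hx : IsSobChain ℓ n x) {k : ℕ} (hk : k < n) {t : ℝ}
    (ht : t ∈ Icc 0 ℓ) : |x k t| ≤ √(2 / ℓ + 2 * ℓ) * chainNorm ℓ n x := by
  have h1 : HasL2Deriv ℓ (x k) (x (k + 1)) := by simpa using hx.deriv k hk
  have h2 := h1.sq_le hℓ ht
  have h3 := integral_sq_le_chainNorm (x := x) hℓ.le hk.le
  have h4 := integral_sq_le_chainNorm (x := x) hℓ.le (Nat.succ_le_of_lt hk)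
  rw [← Real.sqrt_sq_eq_abs, ← Real.sqrt_sq (chainNorm_nonneg (ℓ := ℓ) (n := n) (x := x)),
    ← Real.sqrt_mul (by positivity)]
  refine Real.sqrt_le_sqrt (h2.trans ?_)
  rw [add_mul]
  exact add_le_add (mul_le_mul_of_nonneg_left h3 (by positivity))
    (mul_le_mul_of_nonneg_left h4 (by positivity))

theorem chainNorm_le_of_forall {C : ℝ} (hC : 0 ≤ C)
    (h : ∀ k ≤ n, ∫ t in (0 : ℝ)..ℓ, x k t ^ 2 ≤ C ^ 2) :
    chainNorm ℓ n x ≤ √(n + 1) * C := by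
  rw [← Real.sqrt_sq hC, ← Real.sqrt_mul (by positivity)]
  refine Real.sqrt_le_sqrt ((Finset.sum_le_card_nsmul _ _ (C ^ 2) fun k hk =>
    h k (Nat.lt_succ_iff.1 (Finset.mem_range.1 hk))).trans (le_of_eq ?_))
  simp

theorem MemSobolev.continuousOn {α : ℕ} {f : ℝ → ℝ} (hα : 1 ≤ α) (hf : MemSobolev α ℓ f) :
    ContinuousOn f (Icc 0 ℓ) := by
  obtain ⟨x, hx, rfl⟩ := memSobolev_iff.1 hf
  exact hx.continuousOn (by omega)

theorem MemSobolevZero.lincomb {α : ℕ} {f g : ℝ → ℝ} (hℓ : 0 < ℓ) (hf : MemSobolevZero α ℓ f)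
    (hg : MemSobolevZero α ℓ g) (r : ℝ) : MemSobolevZero α ℓ (fun t => r * f t + g t) := by
  refine ⟨hf.1.lincomb hg.1 r, ?_⟩
  rw [bdryData_lincomb hℓ hf.1 hg.1, hf.2, hg.2, smul_zero, add_zero]

/-- The boundary data are bounded by the Sobolev norm. -/
theorem abs_bdryData_le {α : ℕ} {f : ℝ → ℝ} (hℓ : 0 < ℓ) (hf : MemSobolev α ℓ f)
    (j : BdryIndex α) : |bdryData α ℓ f j| ≤ √(2 / ℓ + 2 * ℓ) * sobolevNorm α ℓ f := by
  obtain ⟨x, hx, rfl⟩ := memSobolev_iff.1 hf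
  rw [IsSobChain.sobolevNorm_eq hℓ hx]
  rcases j with k | k
  · rw [IsSobChain.bdryData_inl hℓ hx]
    exact IsSobChain.abs_le hℓ hx k.2 (left_mem_Icc.2 hℓ.le)
  · rw [IsSobChain.bdryData_inr hℓ hx]
    exact IsSobChain.abs_le hℓ hx k.2 (right_mem_Icc.2 hℓ.le)

theorem sobolevNorm_nonneg {α : ℕ} {f : ℝ → ℝ} : 0 ≤ sobolevNorm α ℓ f := Real.sqrt_nonneg _

theorem bdryData_eq_zero_of_support {α : ℕ} {f : ℝ → ℝ} (hℓ : 0 < ℓ)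
    (h : ∃ δ > 0, ∀ t ∈ Icc 0 ℓ, t < δ ∨ ℓ - δ < t → f t = 0) : bdryData α ℓ f = 0 := by
  obtain ⟨δ, hδ, h⟩ := h
  have hz : ∀ (k : ℕ) (t : ℝ), iteratedDerivWithin k (fun _ : ℝ => (0 : ℝ)) (Icc 0 ℓ) t = 0 :=
    fun k t => by
      rcases k with - | k
      · simp
      · simp
  funext j
  rcases j with k | k
  · have h1 : f =ᶠ[𝓝[Icc 0 ℓ] 0] fun _ => 0 := by
      filter_upwards [self_mem_nhdsWithin, mem_nhdsWithin_of_mem_nhds (Iio_mem_nhds hδ)] with t h1 h2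
      exact h t h1 (Or.inl h2)
    exact (h1.iteratedDerivWithin_eq (h 0 (left_mem_Icc.2 hℓ.le) (Or.inl hδ))).trans (hz _ _)
  · have h1 : f =ᶠ[𝓝[Icc 0 ℓ] ℓ] fun _ => 0 := by
      filter_upwards [self_mem_nhdsWithin,
        mem_nhdsWithin_of_mem_nhds (Ioi_mem_nhds (sub_lt_self ℓ hδ))] with t h1 h2
      exact h t h1 (Or.inr h2)
    exact (h1.iteratedDerivWithin_eq (h ℓ (right_mem_Icc.2 hℓ.le)
      (Or.inr (sub_lt_self ℓ hδ)))).trans (hz _ _)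

/-- A chain of length `2α` whose first component has compact support is a core chain. -/
theorem EdgeCoeff.isCoreChain {α : ℕ} {a κ : ℝ → ℝ} {q : ℕ → ℝ → ℝ} (hℓ : 0 < ℓ)
    (hco : EdgeCoeff α ℓ a κ) (hq : IsQuasiChain ℓ a κ (2 * α) q)
    (h : ∃ δ > 0, ∀ t ∈ Icc 0 ℓ, t < δ ∨ ℓ - δ < t → q 0 t = 0) : IsCoreChain ℓ a κ α q := by
  obtain ⟨δ, hδ, h⟩ := h
  -- Halving makes the closed end intervals fit inside the zero set, and the minimum with `ℓ` keeps
  -- them inside the edge.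
  have hη : 0 < min δ ℓ / 2 := by positivity
  have h1 : min δ ℓ / 2 < δ := by linarith [min_le_left δ ℓ]
  have h2 : min δ ℓ / 2 < ℓ := by linarith [min_le_right δ ℓ]
  have hc : ∀ k < 2 * α, ∀ᵐ t ∂edgeVol ℓ, quasiC a k t ≠ 0 := fun k _ => hco.quasiC_ne_zero k
  refine ⟨hq, min δ ℓ / 2, hη, fun t ht hor k hk => ?_⟩
  rcases hor with hor | hor
  · exact IsSys.eq_zero_of_subinterval hq hc le_rfl hη h2.le
      (fun u hu => h u ⟨hu.1, hu.2.trans h2.le⟩ (Or.inl (hu.2.trans_lt h1))) k hk t ⟨ht.1, hor.le⟩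
  · exact IsSys.eq_zero_of_subinterval hq hc (s := ℓ - min δ ℓ / 2) (by linarith) (by linarith)
      le_rfl (fun u hu => h u ⟨by linarith [hu.1], hu.2⟩ (Or.inr (by linarith [hu.1]))) k hk t
      ⟨hor.le, ht.2⟩

end PointValues

/-! ### The space `Ḣ^α_{0,L}(e)` and its form -/

namespace MetricGraph

variable {V E : Type*} {Γ : MetricGraph V E} {α : ℕ} {a κ : E → ℝ → ℝ} [Fintype E]
  {B : Γ.L2 →L[ℝ] Γ.L2} {D : (e : E) → Γ.L2 →L[ℝ] Lp ℝ 2 (edgeVol (Γ.len e))}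

namespace IsHalfResolvent

theorem pow_inj (h : Γ.IsHalfResolvent a κ B D) (n : ℕ) {φ : Γ.L2} (hφ : (B ^ n) φ = 0) :
    φ = 0 := by
  induction n with
  | zero => exact hφ
  | succ n ih =>
    refine ih (h.inj _ ?_)
    rw [pow_succ'] at hφ
    exact hφ

theorem pow_two_mul_apply (φ : Γ.L2) : (B ^ (2 * α)) φ = (B ^ α) ((B ^ α) φ) := by
  rw [two_mul, pow_add]
  rfl

theorem exists_sobChain (h : Γ.IsHalfResolvent a κ B D) (hco : Γ.Coeff α a κ) (e : E) :
    ∃ C, 0 ≤ C ∧ ∀ φ : Γ.L2, ∃ x, IsSobChain (Γ.len e) α x ∧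
      x 0 =ᵐ[edgeVol (Γ.len e)] (B ^ α) φ e ∧ chainNorm (Γ.len e) α x ≤ C * ‖φ‖ := by
  obtain ⟨C₁, hC₁, h₁⟩ := h.exists_chain hco e α
  obtain ⟨C₂, hC₂, h₂⟩ := (hco.2 e).exists_sob_of_quasi (Γ.len_pos e)
  refine ⟨C₂ * (√(α + 1) * C₁), by positivity, fun φ => ?_⟩
  obtain ⟨q, hq, hq0, hqn, -⟩ := h₁ φ
  obtain ⟨x, hx, hx0, -, hxn⟩ := h₂ q hq
  refine ⟨x, hx, by rw [hx0]; exact hq0, hxn.trans ?_⟩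
  rw [mul_assoc, mul_assoc]
  refine mul_le_mul_of_nonneg_left ?_ hC₂
  refine chainNorm_le_of_forall (by positivity) fun k hk => ?_
  obtain ⟨f, hf, hfn⟩ := hqn k hk
  rw [← norm_sq_eq_integral (Γ.len_pos e).le hf]
  gcongr

/-- The functionals giving the derivatives of `L^{-α/2} φ` at the points of an edge. -/
theorem exists_trace (h : Γ.IsHalfResolvent a κ B D) (hco : Γ.Coeff α a κ) (e : E) :
    ∃ T : ℕ → ℝ → Γ.L2, ∀ φ x, IsSobChain (Γ.len e) α x →
      x 0 =ᵐ[edgeVol (Γ.len e)] (B ^ α) φ e →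
      ∀ k < α, ∀ t ∈ Icc 0 (Γ.len e), ⟪T k t, φ⟫_ℝ = x k t := by
  obtain ⟨C, hC, hX⟩ := h.exists_sobChain hco e
  choose X hX hX0 hXn using hX
  have hℓ := Γ.len_pos e
  have key : ∀ k t, ∃ T : Γ.L2, k < α → t ∈ Icc 0 (Γ.len e) → ∀ φ, ⟪T, φ⟫_ℝ = X φ k t := by
    intro k t
    by_cases hkt : k < α ∧ t ∈ Icc 0 (Γ.len e)
    · obtain ⟨hk, ht⟩ := hkt
      -- The chosen chains depend linearly on `φ` because a Sobolev chain is determined by the class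
      -- of its first component. The Sobolev embedding then bounds the functional, and Riesz gives
      -- `T`.
      have hlin : ∀ (r : ℝ) (φ ψ : Γ.L2), X (r • φ + ψ) k t = r * X φ k t + X ψ k t := by
        intro r φ ψ
        refine (sob_unique hℓ (hX _) ((hX φ).lincomb (hX ψ) r) ?_).1 k hk ht
        refine (hX0 _).trans ?_
        rw [map_add, map_smul, PiLp.add_apply, PiLp.smul_apply]
        filter_upwards [Lp.coeFn_add (r • (B ^ α) φ e) ((B ^ α) ψ e),
          Lp.coeFn_smul r ((B ^ α) φ e), hX0 φ, hX0 ψ] with t h1 h2 h3 h4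
        rw [h1, Pi.add_apply, h2, Pi.smul_apply, h3, h4, smul_eq_mul]
      have h0 : X 0 k t = 0 := by
        have := hlin 1 0 0
        simp only [smul_zero, add_zero, one_mul] at this
        linarith
      let T₀ : Γ.L2 →ₗ[ℝ] ℝ :=
        { toFun := fun φ => X φ k t
          map_add' := fun φ ψ => by simpa using hlin 1 φ ψ
          map_smul' := fun r φ => by simpa [h0] using hlin r φ 0 }
      let T₁ : Γ.L2 →L[ℝ] ℝ := T₀.mkContinuous (√(2 / Γ.len e + 2 * Γ.len e) * C) fun φ => by
        rw [mul_assoc]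
        exact (IsSobChain.abs_le hℓ (hX φ) hk ht).trans
          (mul_le_mul_of_nonneg_left (hXn φ) (Real.sqrt_nonneg _))
      refine ⟨(InnerProductSpace.toDual ℝ Γ.L2).symm T₁, fun _ _ φ => ?_⟩
      rw [InnerProductSpace.toDual_symm_apply]
      rfl
    · exact ⟨0, fun h1 h2 => absurd ⟨h1, h2⟩ hkt⟩
  choose T hT using key
  refine ⟨T, fun φ x hx hx0 k hk t ht => ?_⟩
  rw [hT k t hk ht φ]
  exact (sob_unique hℓ (hX φ) hx ((hX0 φ).trans hx0.symm)).1 k hk ht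

theorem exists_memSobolev (h : Γ.IsHalfResolvent a κ B D) (hco : Γ.Coeff α a κ) (e : E) :
    ∃ C, 0 ≤ C ∧ ∀ φ : Γ.L2, ∃ f, MemSobolev α (Γ.len e) f ∧
      f =ᵐ[edgeVol (Γ.len e)] (B ^ α) φ e ∧ sobolevNorm α (Γ.len e) f ≤ C * ‖φ‖ := by
  obtain ⟨C, hC, hX⟩ := h.exists_sobChain hco e
  refine ⟨C, hC, fun φ => ?_⟩
  obtain ⟨x, hx, hx0, hxn⟩ := hX φ
  exact ⟨x 0, memSobolev_iff.2 ⟨x, hx, rfl⟩, hx0, by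
    rwa [IsSobChain.sobolevNorm_eq (Γ.len_pos e) hx]⟩

theorem exists_sobolevNorm_le (h : Γ.IsHalfResolvent a κ B D) (hco : Γ.Coeff α a κ) (hα : 1 ≤ α)
    (e : E) : ∃ C, 0 ≤ C ∧ ∀ (φ : Γ.L2) f, MemSobolev α (Γ.len e) f →
      f =ᵐ[edgeVol (Γ.len e)] (B ^ α) φ e → sobolevNorm α (Γ.len e) f ≤ C * ‖φ‖ := by
  obtain ⟨C, hC, hX⟩ := h.exists_memSobolev hco e
  refine ⟨C, hC, fun φ f hf hf0 => ?_⟩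
  obtain ⟨g, hg, hg0, hgn⟩ := hX φ
  rwa [sobolevNorm_congr (eqOn_of_ae_eq (Γ.len_pos e) (hf.continuousOn hα) (hg.continuousOn hα)
    (hf0.trans hg0.symm)) (Γ.len_pos e).le]

/-- Functions with vanishing boundary data are represented by elements of `L_2(Γ)`. -/
theorem exists_zeroExt [Finite V] (h : Γ.IsHalfResolvent a κ B D) (hco : Γ.Coeff α a κ) (e : E) :
    ∃ C, 0 ≤ C ∧ ∀ f, MemSobolevZero α (Γ.len e) f →
      ∃ φ, Γ.IsZeroExt e ((B ^ α) φ) f ∧ ‖φ‖ ≤ C * sobolevNorm α (Γ.len e) f := by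
  have hℓ := Γ.len_pos e
  obtain ⟨C₁, hC₁, h₁⟩ := h.exists_preimage hco e α
  obtain ⟨C₂, hC₂, h₂⟩ := (hco.2 e).exists_quasi_of_sob hℓ
  refine ⟨C₁ * C₂, by positivity, fun f hf => ?_⟩
  obtain ⟨x, hx, rfl⟩ := memSobolev_iff.1 hf.1
  obtain ⟨z0, z1⟩ := (IsSobChain.bdryData_eq_zero_iff hℓ hx).1 hf.2
  obtain ⟨q, hq, hq0, hz, hqn⟩ := h₂ x hx
  obtain ⟨φ, hφ, hn, -⟩ := h₁ q hq (hz 0 z0) (hz _ z1)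
  refine ⟨φ, by rwa [hq0] at hφ, hn.trans ?_⟩
  rw [IsSobChain.sobolevNorm_eq hℓ hx, mul_assoc]
  exact mul_le_mul_of_nonneg_left hqn hC₁

theorem zeroExt_unique (h : Γ.IsHalfResolvent a κ B D) {e : E} {φ ψ : Γ.L2} {f g : ℝ → ℝ}
    (hφ : Γ.IsZeroExt e ((B ^ α) φ) f) (hψ : Γ.IsZeroExt e ((B ^ α) ψ) g)
    (hfg : f =ᵐ[edgeVol (Γ.len e)] g) : φ = ψ := by
  rw [← sub_eq_zero]
  refine h.pow_inj α ?_
  rw [map_sub, hφ.unique hψ hfg, sub_self]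

/-- At the even order `2 α` the preimage of a zero extension is the zero extension of the top
quasi-derivative, that is, of `L^α q_0`. -/
theorem core_zeroExt [Finite V] (h : Γ.IsHalfResolvent a κ B D) (hco : Γ.Coeff α a κ) {e : E}
    {q : ℕ → ℝ → ℝ} (hq : IsCoreChain (Γ.len e) (a e) (κ e) α q) {η : Γ.L2}
    (hη : Γ.IsZeroExt e η (q (2 * α))) : Γ.IsZeroExt e ((B ^ α) ((B ^ α) η)) (q 0) := by
  obtain ⟨C, -, hC⟩ := h.exists_preimage hco e (2 * α)
  obtain ⟨φ, hφ, -, he⟩ := hC q hq.1 (hq.left (Γ.len_pos e)) (hq.right (Γ.len_pos e))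
  rw [hη.unique (he (even_two_mul α)) (ae_eq_refl _), ← pow_two_mul_apply]
  exact hφ

/-- Symmetry moves `B^α` onto `φ`, and `η` lives on `e` only. With `g = L^α q` this links the inner
product of `L_2(Γ)` to the edge form. -/
theorem inner_core (h : Γ.IsHalfResolvent a κ B D) {e : E} {η φ : Γ.L2} {f g : ℝ → ℝ}
    (hη : Γ.IsZeroExt e η g) (hf : f =ᵐ[edgeVol (Γ.len e)] (B ^ α) φ e) :
    ⟪φ, (B ^ α) η⟫_ℝ = ∫ t in (0 : ℝ)..Γ.len e, f t * g t := by
  rw [← symm_pow h.symm, real_inner_comm, hη.inner_eq hf.symm]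
  simp only [mul_comm]

end IsHalfResolvent

theorem isCoreChain_zero {ℓ : ℝ} {a κ : ℝ → ℝ} : IsCoreChain ℓ a κ α (fun _ _ => 0) :=
  ⟨isQuasiChain_of_deriv (by simp) (fun _ _ => by simpa using HasL2Deriv.const 0)
    (fun _ _ => by simpa using HasL2Deriv.const 0), 1, one_pos, fun _ _ _ _ _ => rfl⟩

theorem IsCoreChain.lincomb {ℓ : ℝ} {a κ : ℝ → ℝ} {q q' : ℕ → ℝ → ℝ} (h : IsCoreChain ℓ a κ α q)
    (h' : IsCoreChain ℓ a κ α q') (r : ℝ) :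
    IsCoreChain ℓ a κ α (fun k t => r * q k t + q' k t) := by
  obtain ⟨hq, δ, hδ, hz⟩ := h
  obtain ⟨hq', δ', hδ', hz'⟩ := h'
  refine ⟨IsSys.lincomb hq hq' r, min δ δ', lt_min hδ hδ', fun t ht hor k hk => ?_⟩
  have h1 := min_le_left δ δ'
  have h2 := min_le_right δ δ'
  dsimp only
  rw [hz t ht (hor.imp (fun h => by linarith) fun h => by linarith) k hk,
    hz' t ht (hor.imp (fun h => by linarith) fun h => by linarith) k hk, mul_zero, add_zero]

/-- The elements of `L_2(Γ)` which represent functions with compact support in the edge `e`. -/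
def coreSpace (Γ : MetricGraph V E) (a κ : E → ℝ → ℝ) (α : ℕ) (B : Γ.L2 →L[ℝ] Γ.L2) (e : E) :
    Submodule ℝ Γ.L2 where
  carrier := {ψ | ∃ q η, IsCoreChain (Γ.len e) (a e) (κ e) α q ∧ Γ.IsZeroExt e η (q (2 * α)) ∧
    ψ = (B ^ α) η}
  add_mem' := by
    rintro _ _ ⟨q, η, hq, hη, rfl⟩ ⟨q', η', hq', hη', rfl⟩
    exact ⟨_, _, IsCoreChain.lincomb hq hq' 1, hη.lincomb hη' 1, by simp⟩
  zero_mem' := ⟨_, 0, isCoreChain_zero, ⟨Lp.coeFn_zero _ _ _, fun _ _ => rfl⟩, by simp⟩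
  smul_mem' := by
    rintro r _ ⟨q, η, hq, hη, rfl⟩
    have h0 : Γ.IsZeroExt e 0 (fun _ => (0 : ℝ)) := ⟨Lp.coeFn_zero _ _ _, fun _ _ => rfl⟩
    exact ⟨_, _, IsCoreChain.lincomb hq isCoreChain_zero r, hη.lincomb h0 r, by simp⟩

namespace IsHalfResolvent

/-- The set is cut out by continuous conditions: `B^α φ` vanishes on the other edges, and so do the
`2 α` trace functionals at the ends of `e`. -/
theorem isClosed_zeroExt (h : Γ.IsHalfResolvent a κ B D) (hco : Γ.Coeff α a κ)
    (e : E) : IsClosed {φ : Γ.L2 | ∃ f, MemSobolevZero α (Γ.len e) f ∧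
      Γ.IsZeroExt e ((B ^ α) φ) f} := by
  have hℓ := Γ.len_pos e
  obtain ⟨T, hT⟩ := h.exists_trace hco e
  obtain ⟨C, -, hX⟩ := h.exists_sobChain hco e
  have heq : {φ : Γ.L2 | ∃ f, MemSobolevZero α (Γ.len e) f ∧ Γ.IsZeroExt e ((B ^ α) φ) f}
      = {φ : Γ.L2 | ∀ e', e' ≠ e → Γ.edgeProj e' ((B ^ α) φ) = 0} ∩
        ({φ : Γ.L2 | ∀ k, k < α → ⟪T k 0, φ⟫_ℝ = 0} ∩
          {φ : Γ.L2 | ∀ k, k < α → ⟪T k (Γ.len e), φ⟫_ℝ = 0}) := by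
    ext φ
    constructor
    · rintro ⟨f, ⟨hf, hb⟩, hφ⟩
      obtain ⟨x, hx, rfl⟩ := memSobolev_iff.1 hf
      obtain ⟨z0, z1⟩ := (IsSobChain.bdryData_eq_zero_iff hℓ hx).1 hb
      exact ⟨hφ.2, fun k hk => (hT φ x hx hφ.1.symm k hk 0 (Γ.left_mem e)).trans (z0 k hk),
        fun k hk => (hT φ x hx hφ.1.symm k hk _ (Γ.right_mem e)).trans (z1 k hk)⟩
    · rintro ⟨h1, h2, h3⟩
      obtain ⟨x, hx, hx0, -⟩ := hX φ
      refine ⟨x 0, ⟨memSobolev_iff.2 ⟨x, hx, rfl⟩, (IsSobChain.bdryData_eq_zero_iff hℓ hx).2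
        ⟨fun k hk => ?_, fun k hk => ?_⟩⟩, hx0.symm, h1⟩
      · rw [← hT φ x hx hx0 k hk 0 (Γ.left_mem e)]
        exact h2 k hk
      · rw [← hT φ x hx hx0 k hk _ (Γ.right_mem e)]
        exact h3 k hk
  rw [heq]
  simp only [ofPred_forall]
  refine IsClosed.inter (isClosed_iInter fun e' => isClosed_iInter fun _ => ?_)
    (IsClosed.inter (isClosed_iInter fun k => isClosed_iInter fun _ => ?_)
      (isClosed_iInter fun k => isClosed_iInter fun _ => ?_))
  · exact isClosed_eq ((Γ.edgeProj e').continuous.comp (B ^ α).continuous) continuous_const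
  · exact isClosed_eq (by fun_prop) continuous_const
  · exact isClosed_eq (by fun_prop) continuous_const

/-- Orthogonality says that `f` is a weak, hence genuine, solution of `L^α f = 0`. Its boundary data
vanish, so `f = 0`, and `B^α` is injective. -/
theorem eq_zero_of_orthogonal_core (h : Γ.IsHalfResolvent a κ B D) (hco : Γ.Coeff α a κ)
    (hα : 1 ≤ α) {e : E} {φ : Γ.L2} {f : ℝ → ℝ} (hf : MemSobolevZero α (Γ.len e) f)
    (hφ : Γ.IsZeroExt e ((B ^ α) φ) f) (horth : ∀ ψ ∈ Γ.coreSpace a κ α B e, ⟪φ, ψ⟫_ℝ = 0) :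
    φ = 0 := by
  have hℓ := Γ.len_pos e
  obtain ⟨S, hS⟩ := (hco.2 e).exists_fundamental hℓ
  have hfc := hf.1.continuousOn hα
  obtain ⟨r, hr⟩ := exists_homogeneous_of_orthogonal hℓ (hco.2 e) hS
    (ContinuousOn.memLp_two_edge hfc) fun q hq => by
      have hm : MemLp (q (2 * α)) 2 (edgeVol (Γ.len e)) := hq.1.top
      rw [← h.inner_core (isZeroExt_edgeExt e hm) hφ.1.symm]
      exact horth _ ⟨q, _, hq, isZeroExt_edgeExt e hm, rfl⟩
  have hchain := hS.comb r
  have heq := eqOn_of_ae_eq hℓ hfc (hchain.continuousOn (by omega)) hr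
  have hz := (hco.2 e).homogeneous_eq_zero_of_bdryData hα hℓ hchain
    (Eventually.of_forall fun t => hS.comb_top r t)
    (by rw [← bdryData_congr hℓ.le heq]; exact hf.2) 0 (by omega)
  refine h.pow_inj α (hφ.unique (ψ := 0) (g := fun _ => 0) ⟨Lp.coeFn_zero _ _ _, fun _ _ => rfl⟩ ?_)
  filter_upwards [ae_restrict_mem measurableSet_Icc] with t ht
  rw [heq ht]
  exact hz t ht

/-- Functions with compact support are dense. -/
theorem exists_core_approx [Finite V] (h : Γ.IsHalfResolvent a κ B D) (hco : Γ.Coeff α a κ)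
    (hα : 1 ≤ α) {e : E} {φ : Γ.L2} {f : ℝ → ℝ} (hf : MemSobolevZero α (Γ.len e) f)
    (hφ : Γ.IsZeroExt e ((B ^ α) φ) f) {ε : ℝ} (hε : 0 < ε) :
    ∃ q η, IsCoreChain (Γ.len e) (a e) (κ e) α q ∧ Γ.IsZeroExt e η (q (2 * α)) ∧
      ‖φ - (B ^ α) η‖ < ε := by
  have hℓ := Γ.len_pos e
  set M := Γ.coreSpace a κ α B e with hM
  have hcl : (M.topologicalClosure : Set Γ.L2) ⊆ {φ : Γ.L2 | ∃ f, MemSobolevZero α (Γ.len e) f ∧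
      Γ.IsZeroExt e ((B ^ α) φ) f} := by
    refine closure_minimal ?_ (h.isClosed_zeroExt hco e)
    rintro _ ⟨q, η, hq, hη, rfl⟩
    refine ⟨q 0, ((hco.2 e).memSobolevZero_iff hℓ).2 ⟨q, hq.1.truncate (by omega), rfl,
      fun k hk => hq.left hℓ k (by omega), fun k hk => hq.right hℓ k (by omega)⟩,
      h.core_zeroExt hco hq hη⟩
  have : CompleteSpace M.topologicalClosure :=
    M.isClosed_topologicalClosure.completeSpace_coe
  obtain ⟨m, hm, r, hr, rfl⟩ := M.topologicalClosure.exists_add_mem_mem_orthogonal φ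
  obtain ⟨g, hg, hmg⟩ := hcl hm
  -- Both `φ` and its projection `m` represent functions with zero data, the latter by closedness.
  -- Hence so does `r`, which is orthogonal to the core.
  have hr0 : r = 0 := by
    have h1 := hmg.lincomb hφ (-1)
    refine h.eq_zero_of_orthogonal_core hco hα (hg.lincomb hℓ hf (-1)) (φ := r) ?_ fun ψ hψ => ?_
    · convert h1 using 1
      rw [map_add, neg_one_smul, neg_add_cancel_left]
    · rw [real_inner_comm]
      exact (Submodule.mem_orthogonal _ _).1 hr ψ (M.le_topologicalClosure hψ)
  subst hr0
  rw [add_zero]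
  obtain ⟨ψ, ⟨q, η, hq, hη, rfl⟩, hψ⟩ := Metric.mem_closure_iff.1 hm ε hε
  exact ⟨q, η, hq, hη, by rwa [dist_eq_norm] at hψ⟩

end IsHalfResolvent

end MetricGraph

/-! ### Identification of `Ḣ^α_{0,L}(e)` and of its form -/

namespace MetricGraph

variable {V E : Type*} {Γ : MetricGraph V E} {α : ℕ} {a κ : E → ℝ → ℝ} [Fintype E]
  {B : Γ.L2 →L[ℝ] Γ.L2} {D : (e : E) → Γ.L2 →L[ℝ] Lp ℝ 2 (edgeVol (Γ.len e))}

namespace IsHalfResolvent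

theorem memHdot_iff (h : Γ.IsHalfResolvent a κ B D) (n : ℕ) (f : Γ.L2) :
    Γ.MemHdot a κ n f ↔ ∃ g, f = (B ^ n) g :=
  exists_congr fun g => h.spectral n f g

theorem core_memHdotCompact [Finite V] (h : Γ.IsHalfResolvent a κ B D) (hco : Γ.Coeff α a κ)
    (hα : 1 ≤ α) {e : E} {q : ℕ → ℝ → ℝ} (hq : IsCoreChain (Γ.len e) (a e) (κ e) α q) :
    Γ.MemHdotCompact a κ α e (q 0) ∧ Γ.MemHdotCompact a κ (2 * α) e (q 0) := by
  have hm : MemLp (q (2 * α)) 2 (edgeVol (Γ.len e)) := hq.1.top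
  have hη := isZeroExt_edgeExt e hm
  have h1 := h.core_zeroExt hco hq hη
  have hc : ContinuousOn (q 0) (Icc 0 (Γ.len e)) := hq.1.continuousOn (by omega)
  obtain ⟨-, δ, hδ, hz⟩ := hq
  have hs : ∃ δ > 0, ∀ t ∈ Icc 0 (Γ.len e), t < δ ∨ Γ.len e - δ < t → q 0 t = 0 :=
    ⟨δ, hδ, fun t ht hor => hz t ht hor 0 (by omega)⟩
  refine ⟨⟨hc, hs, _, (h.memHdot_iff α _).2 ⟨_, rfl⟩, h1.1.symm⟩, hc, hs,
    _, ?_, h1.1.symm⟩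
  have h2 := (h.memHdot_iff (2 * α) ((B ^ α) ((B ^ α) (Γ.edgeExt e (hm.toLp _))))).2
    ⟨_, (pow_two_mul_apply _).symm⟩
  rwa [Nat.cast_mul, Nat.cast_two] at h2

/-- Boundary data are continuous in the `H^α` norm and vanish on functions with compact support.
Conversely, approximation of preimages in `L_2(Γ)` becomes approximation in `H^α`, since `φ ↦ B^α φ`
is bounded into `H^α(e)`. In particular the space is independent of the rest of the graph. -/
theorem memHdotZero_iff [Finite V] (h : Γ.IsHalfResolvent a κ B D) (hco : Γ.Coeff α a κ)
    (hα : 1 ≤ α) (e : E) (f : ℝ → ℝ) :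
    Γ.MemHdotZero a κ α e f ↔ MemSobolevZero α (Γ.len e) f := by
  have hℓ := Γ.len_pos e
  constructor
  · rintro ⟨hf, happ⟩
    refine ⟨hf, funext fun j => abs_eq_zero.1 (le_antisymm (le_of_forall_pos_le_add fun ε hε => ?_)
      (abs_nonneg _))⟩
    set K := √(2 / Γ.len e + 2 * Γ.len e)
    have hK : 0 < K := Real.sqrt_pos.2 (by positivity)
    obtain ⟨φ, hφ, hφs, hφn⟩ := happ (ε / K) (by positivity)
    have hφ0 := bdryData_eq_zero_of_support (α := α) hℓ hφ.2.1
    have hsub : (fun t => f t - φ t) = fun t => (-1) * φ t + f t := by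
      funext t
      ring
    rw [hsub] at hφn
    have h1 := abs_bdryData_le hℓ (hφs.lincomb hf (-1)) j
    rw [bdryData_lincomb hℓ hφs hf, hφ0, smul_zero, zero_add] at h1
    rw [zero_add]
    refine h1.trans ?_
    rw [mul_comm, ← le_div_iff₀ hK]
    exact hφn.le
  · intro hf
    obtain ⟨C, hC, hle⟩ := h.exists_sobolevNorm_le hco hα e
    obtain ⟨_, -, hex⟩ := h.exists_zeroExt hco e
    obtain ⟨φ, hφ, -⟩ := hex f hf
    refine ⟨hf.1, fun ε hε => ?_⟩
    obtain ⟨q, η, hq, hη, hn⟩ := h.exists_core_approx hco hα hf hφ (ε := ε / (C + 1)) (by positivity)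
    have hqs : MemSobolev α (Γ.len e) (q 0) :=
      (hco.2 e).memSobolev_of_quasi hℓ (hq.1.truncate (by omega))
    refine ⟨q 0, (h.core_memHdotCompact hco hα hq).1, hqs, ?_⟩
    have hsub : (fun t => f t - q 0 t) = fun t => (-1) * q 0 t + f t := by
      funext t
      ring
    rw [hsub]
    have h1 := hle (φ - (B ^ α) η) _ (hqs.lincomb hf.1 (-1)) (by
      have h2 := (h.core_zeroExt hco hq hη).lincomb hφ (-1)
      refine h2.1.symm.trans (Eventually.of_forall fun t => ?_)
      rw [map_sub, neg_one_smul, neg_add_eq_sub])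
    have hC1 : 0 < C + 1 := by positivity
    calc _ ≤ C * ‖φ - (B ^ α) η‖ := h1
      _ ≤ (C + 1) * ‖φ - (B ^ α) η‖ := by
        have := norm_nonneg (φ - (B ^ α) η)
        linarith
      _ < (C + 1) * (ε / (C + 1)) := mul_lt_mul_of_pos_left hn hC1
      _ = ε := by field_simp

/-- The chain of a function with compact support in the domain of `L^α`. -/
theorem exists_coreChain [Finite V] (h : Γ.IsHalfResolvent a κ B D) (hco : Γ.Coeff α a κ)
    (hα : 1 ≤ α) {e : E} {g : ℝ → ℝ} (hg : Γ.MemHdotCompact a κ (2 * α) e g) :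
    ∃ q, IsCoreChain (Γ.len e) (a e) (κ e) α q ∧ q 0 = g := by
  have hℓ := Γ.len_pos e
  obtain ⟨hc, hs, γ, hγ, hgγ⟩ := hg
  have hγ' : Γ.MemHdot a κ ((2 * α : ℕ) : ℝ) γ := by
    push_cast
    exact hγ
  obtain ⟨χ, rfl⟩ := (h.memHdot_iff _ _).1 hγ'
  obtain ⟨_, -, hC⟩ := h.exists_chain hco e (2 * α)
  obtain ⟨q, hq, hq0, -, -⟩ := hC χ
  have heq := eqOn_of_ae_eq hℓ (hq.continuousOn (by omega)) hc (hq0.trans hgγ.symm)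
  have hq' : IsQuasiChain (Γ.len e) (a e) (κ e) (2 * α) (fun k => if k = 0 then g else q k) := by
    refine IsSys.congr hq (fun k _ => ?_) ?_
    · rcases Nat.eq_zero_or_pos k with rfl | hk
      · simpa using heq
      · simp only [hk.ne', if_false]
        exact fun _ _ => rfl
    · simp only [show 2 * α ≠ 0 by omega, if_false]
      exact ae_eq_refl _
  exact ⟨_, (hco.2 e).isCoreChain hℓ hq' (by simpa using hs), by simp⟩

/-- The value of the form on a function with compact support. -/
theorem edgeForm_core [Finite V] (h : Γ.IsHalfResolvent a κ B D) (hco : Γ.Coeff α a κ)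
    (hα : 1 ≤ α) {e : E} {b : (ℝ → ℝ) → (ℝ → ℝ) → ℝ} (hb : Γ.IsEdgeForm a κ α e b)
    {f : ℝ → ℝ} (hf : Γ.MemHdotZero a κ α e f) {q : ℕ → ℝ → ℝ}
    (hq : IsCoreChain (Γ.len e) (a e) (κ e) α q) :
    b f (q 0) = ∫ t in (0 : ℝ)..Γ.len e, f t * q (2 * α) t := by
  have hℓ := Γ.len_pos e
  obtain ⟨g, hg, hbg⟩ := hb.extends_core f (q 0) hf (h.core_memHdotCompact hco hα hq).2
  rw [hbg]
  obtain ⟨q', hq', hq0, hqt⟩ := ((hco.2 e).edgePow_iff hℓ (hq.1.memLp (by omega))).1 hg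
  have h1 := ((hco.2 e).quasi_unique hℓ hq' hq.1 (by rw [hq0])).2 (2 * α) le_rfl
  refine integral_congr_edge ?_ (Γ.left_mem e) (Γ.right_mem e)
  filter_upwards [hqt, h1] with t e1 e2
  rw [← e1, e2]

/-- Both sides are continuous in the second argument and agree when it lies in the core, which is
dense. Any admissible form is thus the inner product of preimages under `B^α`. -/
theorem edgeForm_eq [Finite V] (h : Γ.IsHalfResolvent a κ B D) (hco : Γ.Coeff α a κ)
    (hα : 1 ≤ α) {e : E} {b : (ℝ → ℝ) → (ℝ → ℝ) → ℝ} (hb : Γ.IsEdgeForm a κ α e b)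
    {f g : ℝ → ℝ} (hf : MemSobolevZero α (Γ.len e) f) (hg : MemSobolevZero α (Γ.len e) g)
    {φ ψ : Γ.L2} (hφ : Γ.IsZeroExt e ((B ^ α) φ) f) (hψ : Γ.IsZeroExt e ((B ^ α) ψ) g) :
    b f g = ⟪φ, ψ⟫_ℝ := by
  have hℓ := Γ.len_pos e
  have hiff := h.memHdotZero_iff hco hα e
  obtain ⟨C₁, hC₁⟩ := hb.bounded
  obtain ⟨C₂, hC₂, hle⟩ := h.exists_sobolevNorm_le hco hα e
  refine eq_of_forall_dist_le fun ε hε => ?_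
  rw [Real.dist_eq]
  set A := |C₁| * sobolevNorm α (Γ.len e) f * C₂ + ‖φ‖ + 1 with hA
  have hA0 : 0 < A := by
    have := sobolevNorm_nonneg (α := α) (ℓ := Γ.len e) (f := f)
    positivity
  obtain ⟨q, η, hq, hη, hn⟩ := h.exists_core_approx hco hα hg hψ (ε := ε / A) (by positivity)
  have hqz := h.core_zeroExt hco hq hη
  have hq0 : MemSobolevZero α (Γ.len e) (q 0) :=
    ((hco.2 e).memSobolevZero_iff hℓ).2 ⟨q, hq.1.truncate (by omega), rfl,
      fun k hk => hq.left hℓ k (by omega), fun k hk => hq.right hℓ k (by omega)⟩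
  have h1 : b f (q 0) = ⟪φ, (B ^ α) η⟫_ℝ := by
    rw [h.edgeForm_core hco hα hb ((hiff f).2 hf) hq, h.inner_core hη hφ.1.symm]
  have h2 := hb.lin_right f (q 0) g (-1) ((hiff f).2 hf) ((hiff _).2 hq0) ((hiff g).2 hg)
  have hd := hq0.lincomb hℓ hg (-1)
  have h3 := hC₁ f _ ((hiff f).2 hf) ((hiff _).2 hd)
  have h4 := hle (ψ - (B ^ α) η) _ hd.1 (by
    refine (hqz.lincomb hψ (-1)).1.symm.trans (Eventually.of_forall fun t => ?_)
    rw [map_sub, neg_one_smul, neg_add_eq_sub])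
  have h5 : b f g - ⟪φ, ψ⟫_ℝ = b f (fun t => -1 * q 0 t + g t) - ⟪φ, ψ - (B ^ α) η⟫_ℝ := by
    rw [h2, h1, inner_sub_right]
    ring
  rw [h5]
  have hf0 := sobolevNorm_nonneg (α := α) (ℓ := Γ.len e) (f := f)
  calc |b f (fun t => -1 * q 0 t + g t) - ⟪φ, ψ - (B ^ α) η⟫_ℝ|
      ≤ |b f (fun t => -1 * q 0 t + g t)| + |⟪φ, ψ - (B ^ α) η⟫_ℝ| := abs_sub _ _
    _ ≤ |C₁| * sobolevNorm α (Γ.len e) f * (C₂ * ‖ψ - (B ^ α) η‖) + ‖φ‖ * ‖ψ - (B ^ α) η‖ := by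
      refine add_le_add (h3.trans ?_) (abs_real_inner_le_norm _ _)
      exact mul_le_mul (mul_le_mul_of_nonneg_right (le_abs_self _) hf0) h4 sobolevNorm_nonneg
        (by positivity)
    _ = (|C₁| * sobolevNorm α (Γ.len e) f * C₂ + ‖φ‖) * ‖ψ - (B ^ α) η‖ := by ring
    _ ≤ A * (ε / A) := by
      refine mul_le_mul (by rw [hA]; linarith) hn.le (norm_nonneg _) hA0.le
    _ = ε := by field_simp

/-- The inner product of preimages is a form: preimages are unique, so they depend linearly on the
function. The value `0` for other functions is a placeholder. -/
theorem exists_edgeForm [Finite V] (h : Γ.IsHalfResolvent a κ B D) (hco : Γ.Coeff α a κ)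
    (hα : 1 ≤ α) (e : E) : ∃ b, Γ.IsEdgeForm a κ α e b := by
  classical
  have hℓ := Γ.len_pos e
  have hiff := h.memHdotZero_iff hco hα e
  obtain ⟨C, hC, hex⟩ := h.exists_zeroExt hco e
  let Φ : (ℝ → ℝ) → Γ.L2 := fun f => if hf : MemSobolevZero α (Γ.len e) f then
    (hex f hf).choose else 0
  have hΦ : ∀ f, MemSobolevZero α (Γ.len e) f → Γ.IsZeroExt e ((B ^ α) (Φ f)) f ∧
      ‖Φ f‖ ≤ C * sobolevNorm α (Γ.len e) f := fun f hf => by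
    simp only [Φ, hf, dif_pos]
    exact (hex f hf).choose_spec
  have hlin : ∀ f g r, MemSobolevZero α (Γ.len e) f → MemSobolevZero α (Γ.len e) g →
      Φ (fun t => r * f t + g t) = r • Φ f + Φ g := fun f g r hf hg => by
    refine h.zeroExt_unique (hΦ _ (hf.lincomb hℓ hg r)).1 ?_ (ae_eq_refl _)
    have := (hΦ f hf).1.lincomb (hΦ g hg).1 r
    rwa [← map_smul, ← map_add] at this
  refine ⟨fun f g => ⟪Φ f, Φ g⟫_ℝ, ⟨fun f₁ f₂ g r h₁ h₂ _ => ?_, fun f g₁ g₂ r _ h₁ h₂ => ?_,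
    ⟨C * C, fun f g hf hg => ?_⟩, fun f g hf hg => ?_⟩⟩
  · rw [hlin f₁ f₂ r ((hiff _).1 h₁) ((hiff _).1 h₂), inner_add_left, real_inner_smul_left]
  · rw [hlin g₁ g₂ r ((hiff _).1 h₁) ((hiff _).1 h₂), inner_add_right, real_inner_smul_right]
  · refine (abs_real_inner_le_norm _ _).trans ?_
    calc ‖Φ f‖ * ‖Φ g‖ ≤ (C * sobolevNorm α (Γ.len e) f) * (C * sobolevNorm α (Γ.len e) g) :=
          mul_le_mul (hΦ f ((hiff f).1 hf)).2 (hΦ g ((hiff g).1 hg)).2 (norm_nonneg _)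
            (mul_nonneg hC sobolevNorm_nonneg)
      _ = _ := by ring
  · obtain ⟨q, hq, rfl⟩ := h.exists_coreChain hco hα hg
    have hm : MemLp (q (2 * α)) 2 (edgeVol (Γ.len e)) := hq.1.top
    have hη := isZeroExt_edgeExt e hm
    have hqz := h.core_zeroExt hco hq hη
    have hq0 : MemSobolevZero α (Γ.len e) (q 0) :=
      ((hco.2 e).memSobolevZero_iff hℓ).2 ⟨q, hq.1.truncate (by omega), rfl,
        fun k hk => hq.left hℓ k (by omega), fun k hk => hq.right hℓ k (by omega)⟩
    refine ⟨q (2 * α), ((hco.2 e).edgePow_iff hℓ (hq.1.memLp (by omega))).2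
      ⟨q, hq.1, rfl, ae_eq_refl _⟩, ?_⟩
    have h1 : Φ (q 0) = (B ^ α) (Γ.edgeExt e (hm.toLp _)) :=
      h.zeroExt_unique (hΦ _ hq0).1 hqz (ae_eq_refl _)
    rw [h1]
    exact h.inner_core hη (hΦ f ((hiff f).1 hf)).1.1.symm

end IsHalfResolvent

end MetricGraph

/-! ### White noise as an isometry -/

section WhiteNoise

variable {Ω : Type*} [MeasurableSpace Ω] {P : Measure Ω}

theorem toL2_eq {X : Ω → ℝ} (h : MemLp X 2 P) : toL2 P X = h.toLp X := dif_pos h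

theorem coeFn_toL2 {X : Ω → ℝ} (h : MemLp X 2 P) : toL2 P X =ᵐ[P] X := by
  rw [toL2_eq h]
  exact h.coeFn_toLp

theorem inner_lp_eq (x y : Lp ℝ 2 P) : ⟪x, y⟫_ℝ = ∫ ω, x ω * y ω ∂P := by
  rw [L2.inner_def]
  simp [mul_comm]

/-- A map between Hilbert spaces which preserves inner products is linear. -/
theorem exists_linearIsometry_of_inner {H K : Type*} [NormedAddCommGroup H] [InnerProductSpace ℝ H]
    [NormedAddCommGroup K] [InnerProductSpace ℝ K] (f : H → K)
    (hf : ∀ x y, ⟪f x, f y⟫_ℝ = ⟪x, y⟫_ℝ) : ∃ J : H →ₗᵢ[ℝ] K, ∀ x, J x = f x := by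
  have hz : ∀ z : K, ⟪z, z⟫_ℝ = 0 → z = 0 := fun z => inner_self_eq_zero.1
  refine ⟨{ toFun := f, map_add' := fun x y => ?_, map_smul' := fun r x => ?_,
            norm_map' := fun x => ?_ }, fun _ => rfl⟩
  · rw [← sub_eq_zero]
    refine hz _ ?_
    simp only [inner_sub_left, inner_sub_right, inner_add_left, inner_add_right, hf]
    ring
  · rw [← sub_eq_zero]
    refine hz _ ?_
    simp only [inner_sub_left, inner_sub_right, inner_smul_left, inner_smul_right, hf,
      RingHom.id_apply, conj_trivial]
    ring
  · have h := hf x x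
    rw [real_inner_self_eq_norm_sq, real_inner_self_eq_norm_sq] at h
    exact (sq_eq_sq₀ (norm_nonneg _) (norm_nonneg _)).1 h

/-- An isometry of a Hilbert space onto a space of centred Gaussian variables. -/
structure IsGaussianIsometry {H : Type*} [NormedAddCommGroup H] [InnerProductSpace ℝ H]
    (J : H →ₗᵢ[ℝ] Lp ℝ 2 P) : Prop where
  gaussian : ∀ x, HasGaussianLaw (J x : Ω → ℝ) P
  mean : ∀ x, ∫ ω, J x ω ∂P = 0

/-- White noise is not assumed linear; linearity follows from the covariance identity, which says
that inner products are preserved. -/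
theorem MetricGraph.IsWhiteNoise.exists_isometry {V E : Type*} [Fintype E] {Γ : MetricGraph V E}
    {W : Γ.L2 → Ω → ℝ} (hW : Γ.IsWhiteNoise P W) :
    ∃ J : Γ.L2 →ₗᵢ[ℝ] Lp ℝ 2 P, IsGaussianIsometry J ∧ ∀ φ, J φ =ᵐ[P] W φ := by
  have hm : ∀ φ, MemLp (W φ) 2 P := fun φ => (hW.gaussian φ).memLp_two
  obtain ⟨J, hJ⟩ := exists_linearIsometry_of_inner (fun φ => (hm φ).toLp (W φ)) fun φ ψ => by
    rw [inner_lp_eq, ← hW.cov]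
    refine integral_congr_ae ?_
    filter_upwards [(hm φ).coeFn_toLp, (hm ψ).coeFn_toLp] with ω h1 h2
    rw [h1, h2]
  have hJW : ∀ φ, J φ =ᵐ[P] W φ := fun φ => by
    rw [hJ]
    exact (hm φ).coeFn_toLp
  exact ⟨J, ⟨fun φ => (hW.gaussian φ).congr (hJW φ).symm,
    fun φ => (integral_congr_ae (hJW φ)).trans (hW.mean φ)⟩, hJW⟩

namespace IsGaussianIsometry

variable {H : Type*} [NormedAddCommGroup H] [InnerProductSpace ℝ H] {J : H →ₗᵢ[ℝ] Lp ℝ 2 P}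

/-- A linear functional of finitely many `J (f i)` is `J` of a linear combination of the `f i`, and
so Gaussian. -/
theorem isGaussianProcess (hJ : IsGaussianIsometry J) {ι : Type*} (f : ι → H) :
    IsGaussianProcess (fun i => (J (f i) : Ω → ℝ)) P where
  hasGaussianLaw I := by
    classical
    have hX : AEMeasurable (fun ω => I.restrict fun i => J (f i) ω) P :=
      aemeasurable_pi_lambda _ fun i => (Lp.aestronglyMeasurable _).aemeasurable
    refine ⟨isGaussian_of_isGaussian_map fun L => ?_⟩
    rw [AEMeasurable.map_map_of_aemeasurable L.continuous.aemeasurable hX]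
    refine (HasGaussianLaw.congr (hJ.gaussian (∑ i : I, L (Pi.single i 1) • f i)) ?_).isGaussian_map
    have h1 : ∀ᵐ ω ∂P, ∀ i : I, (J (L (Pi.single i 1) • f i) : Ω → ℝ) ω
        = L (Pi.single i 1) * J (f i) ω := by
      refine ae_all_iff.2 fun i => ?_
      rw [map_smul]
      filter_upwards [Lp.coeFn_smul (L (Pi.single i 1)) (J (f i))] with ω h
      rw [h, Pi.smul_apply, smul_eq_mul]
    filter_upwards [h1, (Lp.coeFn_finsetSum Finset.univ
      fun i : I => J (L (Pi.single i 1) • f i))] with ω h h2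
    rw [map_sum, h2, Finset.sum_apply, Finset.sum_congr rfl fun i _ => h i]
    have h3 := L.toLinearMap.pi_apply_eq_sum_univ (I.restrict fun i => J (f i) ω)
    simp only [Finset.restrict, ContinuousLinearMap.coe_coe, smul_eq_mul] at h3
    simp only [Function.comp_apply]
    refine Eq.trans ?_ h3.symm
    refine Finset.sum_congr rfl fun i _ => ?_
    rw [mul_comm]
    congr 3
    ext j
    simp [Pi.single_apply, eq_comm]

theorem covariance_eq (hJ : IsGaussianIsometry J) (x y : H) :
    cov[(J x : Ω → ℝ), (J y : Ω → ℝ); P] = ⟪x, y⟫_ℝ := by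
  have := (hJ.gaussian x).isProbabilityMeasure
  rw [covariance_eq_sub (Lp.memLp _) (Lp.memLp _), hJ.mean, zero_mul, sub_zero,
    ← J.inner_map_map, inner_lp_eq]
  rfl

theorem indepFun (hJ : IsGaussianIsometry J) {S T : Type*} {f : S → H} {g : T → H}
    (h : ∀ s t, ⟪f s, g t⟫_ℝ = 0) :
    IndepFun (fun ω s => (J (f s) : Ω → ℝ) ω) (fun ω t => (J (g t) : Ω → ℝ) ω) P := by
  refine IsGaussianProcess.indepFun_of_covariance_eq_zero (X := fun s => (J (f s) : Ω → ℝ))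
    (Y := fun t => (J (g t) : Ω → ℝ)) ?_ (fun s => (Lp.aestronglyMeasurable _).aemeasurable)
    (fun t => (Lp.aestronglyMeasurable _).aemeasurable) fun s t => by
      rw [hJ.covariance_eq, h]
  refine (hJ.isGaussianProcess (Sum.elim f g)).congr fun i => ?_
  cases i <;> rfl

end IsGaussianIsometry

/-- Fubini's theorem for a bounded curve of square integrable variables. -/
theorem integral_inner_toL2 {μ : Measure ℝ} [IsFiniteMeasure μ] [IsProbabilityMeasure P]
    {u : ℝ → Ω → ℝ} (hm : AEMeasurable (fun p : ℝ × Ω => u p.1 p.2) (μ.prod P)) {C : ℝ}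
    (hu : ∀ᵐ t ∂μ, MemLp (u t) 2 P ∧ ‖toL2 P (u t)‖ ≤ C) {g : ℝ → ℝ} (hg : MemLp g 2 μ)
    (z : Lp ℝ 2 P) :
    ∫ t, ⟪z, toL2 P (u t)⟫_ℝ * g t ∂μ = ∫ ω, z ω * ∫ t, u t ω * g t ∂μ ∂P := by
  have hF : AEStronglyMeasurable (fun p : ℝ × Ω => z p.2 * (u p.1 p.2 * g p.1)) (μ.prod P) :=
    (Lp.aestronglyMeasurable z).comp_snd.mul
      (hm.aestronglyMeasurable.mul hg.1.comp_fst)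
  have hint : Integrable (fun p : ℝ × Ω => z p.2 * (u p.1 p.2 * g p.1)) (μ.prod P) := by
    rw [integrable_prod_iff hF]
    constructor
    · filter_upwards [hu] with t ht
      have h1 := ((Lp.memLp z).integrable_mul ht.1).mul_const (g t)
      exact h1.congr (Eventually.of_forall fun ω => by simp [mul_assoc])
    · refine ((hg.integrable (by norm_num)).norm.const_mul (‖z‖ * C)).mono'
        hF.norm.integral_prod_right' ?_
      filter_upwards [hu] with t ht
      have h1 : ∫ ω, ‖z ω * (u t ω * g t)‖ ∂P = ⟪(Lp.memLp z).norm.toLp _, ht.1.norm.toLp _⟫_ℝ * ‖g t‖ := by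
        rw [inner_lp_eq, ← integral_mul_const]
        refine integral_congr_ae ?_
        filter_upwards [(Lp.memLp z).norm.coeFn_toLp, ht.1.norm.coeFn_toLp] with ω h1 h2
        rw [h1, h2, norm_mul, norm_mul, mul_assoc]
      have hn1 : ‖(Lp.memLp z).norm.toLp _‖ = ‖z‖ := by
        rw [Lp.norm_toLp, eLpNorm_norm, Lp.norm_def]
      have hn2 : ‖ht.1.norm.toLp _‖ = ‖toL2 P (u t)‖ := by
        rw [Lp.norm_toLp, eLpNorm_norm, toL2_eq ht.1, Lp.norm_toLp]
      rw [Real.norm_of_nonneg (integral_nonneg fun _ => norm_nonneg _), h1]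
      refine mul_le_mul_of_nonneg_right ((real_inner_le_norm _ _).trans ?_) (norm_nonneg _)
      rw [hn1, hn2]
      exact mul_le_mul_of_nonneg_left ht.2 (norm_nonneg _)
  calc ∫ t, ⟪z, toL2 P (u t)⟫_ℝ * g t ∂μ = ∫ t, ∫ ω, z ω * (u t ω * g t) ∂P ∂μ := by
        refine integral_congr_ae ?_
        filter_upwards [hu] with t ht
        rw [inner_lp_eq, ← integral_mul_const]
        refine integral_congr_ae ?_
        filter_upwards [coeFn_toL2 ht.1] with ω h
        rw [h, mul_assoc]
    _ = ∫ ω, ∫ t, z ω * (u t ω * g t) ∂μ ∂P := integral_integral_swap hint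
    _ = _ := by simp only [integral_const_mul]

end WhiteNoise

/-! ### The field as an image of the white noise -/

section WeakDerivatives

variable {Ω : Type*} [MeasurableSpace Ω] {P : Measure Ω}
  {H : Type*} [NormedAddCommGroup H] [InnerProductSpace ℝ H] [CompleteSpace H]

/-- The adjoint of an isometry into `L_2(Ω)`. -/
theorem exists_adjoint (J : H →ₗᵢ[ℝ] Lp ℝ 2 P) (z : Lp ℝ 2 P) :
    ∃ ζ : H, ∀ φ, ⟪z, J φ⟫_ℝ = ⟪ζ, φ⟫_ℝ :=
  ⟨J.toContinuousLinearMap.adjoint z, fun φ =>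
    (ContinuousLinearMap.adjoint_inner_left J.toContinuousLinearMap φ z).symm⟩

/-- Tested against `w`, the curve `J (R k t)` becomes the `k`-th component of the Sobolev chain
belonging to the adjoint image of `w`. Components of order below `α` are continuous, so these
derivatives are classical. -/
theorem hasWeakDerivs_of_chain (J : H →ₗᵢ[ℝ] Lp ℝ 2 P) {S : Submodule ℝ (Lp ℝ 2 P)}
    (hS : ∀ φ, J φ ∈ S) {ℓ : ℝ} {α : ℕ} (hα : 1 ≤ α) {R : ℕ → ℝ → H}
    (hR : ∀ φ, ∃ x, IsSobChain ℓ α x ∧ ∀ k < α, ∀ t ∈ Icc 0 ℓ, ⟪R k t, φ⟫_ℝ = x k t)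
    {X : ℝ → Lp ℝ 2 P} (hX : ∀ t ∈ Icc 0 ℓ, J (R 0 t) = X t) :
    HasWeakDerivs S ℓ (α - 1) X (fun k t => J (R k t)) := by
  have key : ∀ w : Lp ℝ 2 P, ∃ x, IsSobChain ℓ α x ∧
      ∀ k < α, ∀ t ∈ Icc 0 ℓ, ⟪w, J (R k t)⟫_ℝ = x k t := fun w => by
    obtain ⟨ζ, hζ⟩ := exists_adjoint J w
    obtain ⟨x, hx, h⟩ := hR ζ
    exact ⟨x, hx, fun k hk t ht => by rw [hζ, real_inner_comm, h k hk t ht]⟩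
  refine ⟨hX, fun _ _ _ _ => hS _, fun k hk t ht w _ => ?_, fun k hk w _ => ?_⟩
  · obtain ⟨x, hx, h⟩ := key w
    have hd : HasL2Deriv ℓ (x k) (x (k + 1)) := by simpa using hx.deriv k (by omega)
    rw [h (k + 1) (by omega) t ht]
    exact (hd.hasDerivWithinAt (hx.continuousOn (by omega)) ht).congr (h k (by omega))
      (h k (by omega) t ht)
  · obtain ⟨x, hx, h⟩ := key w
    exact (hx.continuousOn (by omega)).congr (h k (by omega))

end WeakDerivatives

/-! ### The Whittle–Matérn field through traces -/

namespace MetricGraph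

variable {V E : Type*} {Γ : MetricGraph V E} {α : ℕ} {a κ : E → ℝ → ℝ} [Fintype E]
  {B : Γ.L2 →L[ℝ] Γ.L2} {D : (e : E) → Γ.L2 →L[ℝ] Lp ℝ 2 (edgeVol (Γ.len e))}

/-- The elements `T k t` represent the functionals `φ ↦ (L^{-α/2} φ)^{(k)}(t)`. -/
def IsTrace (Γ : MetricGraph V E) (α : ℕ) (B : Γ.L2 →L[ℝ] Γ.L2) (e : E) (T : ℕ → ℝ → Γ.L2) : Prop :=
  ∀ φ x, IsSobChain (Γ.len e) α x → x 0 =ᵐ[edgeVol (Γ.len e)] (B ^ α) φ e →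
    ∀ k < α, ∀ t ∈ Icc 0 (Γ.len e), ⟪T k t, φ⟫_ℝ = x k t

variable {Ω : Type*} [MeasurableSpace Ω] {P : Measure Ω} {τ : ℝ} {W : Γ.L2 → Ω → ℝ}
  {u : E → ℝ → Ω → ℝ} {J : Γ.L2 →ₗᵢ[ℝ] Lp ℝ 2 P}

/-- The defining equation is used with `ψ` the zero extension of `g` and `φ = B^α ψ`, then averaged
against `z` by Fubini. -/
theorem IsWhittleMatern.integral_eq [IsProbabilityMeasure P] (h : Γ.IsHalfResolvent a κ B D)
    (hτ : 0 < τ)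
    (hu : Γ.IsWhittleMatern a κ τ α P W u) (hJ : ∀ φ, J φ =ᵐ[P] W φ) (e : E)
    (g : Lp ℝ 2 (edgeVol (Γ.len e))) (z : Lp ℝ 2 P) :
    ∫ t, ⟪z, toL2 P (u e t)⟫_ℝ * g t ∂edgeVol (Γ.len e) =
      τ⁻¹ * ⟪z, J ((B ^ α) (Γ.edgeExt e g))⟫_ℝ := by
  obtain ⟨C, hC⟩ := isCompact_Icc.exists_bound_of_continuousOn (hu.cont e)
  rw [integral_inner_toL2 (hu.meas e) (C := C) ((ae_restrict_iff' measurableSet_Icc).2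
    (Eventually.of_forall fun t ht => ⟨hu.memLp e t ht, hC t ht⟩)) (Lp.memLp g)]
  have hs := hu.solves _ _ ((h.spectral α _ (Γ.edgeExt e g)).2 rfl)
  rw [inner_lp_eq, ← integral_const_mul]
  refine integral_congr_ae ?_
  filter_upwards [hs, hJ ((B ^ α) (Γ.edgeExt e g))] with ω h1 h2
  rw [h2, ← h1, Finset.sum_eq_single_of_mem e (Finset.mem_univ e), edgeExt_apply_same,
    integral_edgeVol (Γ.len_pos e).le]
  · simp only [mul_assoc, intervalIntegral.integral_const_mul]
    field_simp
  · intro e' _ he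
    have h3 : (fun t => τ * u e' t ω * (Γ.edgeExt e g e' : ℝ → ℝ) t) =ᵐ[edgeVol (Γ.len e')]
        fun _ => 0 := by
      rw [edgeExt_apply_of_ne he]
      filter_upwards [Lp.coeFn_zero ℝ 2 (edgeVol (Γ.len e'))] with t ht
      rw [ht, Pi.zero_apply, mul_zero]
    rw [integral_congr_edge h3 (Γ.left_mem e') (Γ.right_mem e'), intervalIntegral.integral_zero]

/-- For fixed `z` with adjoint image `ζ`, the function `t ↦ E[z u(t)]` and the representative of
`τ⁻¹ B^α ζ` have equal integrals against every `g`, so they agree almost everywhere. Mean-square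
continuity of `u` upgrades this to every `t`, end points included. -/
theorem IsWhittleMatern.toL2_eq [IsProbabilityMeasure P] (h : Γ.IsHalfResolvent a κ B D)
    (hco : Γ.Coeff α a κ) (hα : 1 ≤ α) (hτ : 0 < τ)
    (hu : Γ.IsWhittleMatern a κ τ α P W u) (hJ : ∀ φ, J φ =ᵐ[P] W φ) {e : E}
    {T : ℕ → ℝ → Γ.L2} (hT : Γ.IsTrace α B e T) {t : ℝ} (ht : t ∈ Icc 0 (Γ.len e)) :
    toL2 P (u e t) = J (τ⁻¹ • T 0 t) := by
  have hℓ := Γ.len_pos e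
  refine ext_inner_left ℝ fun z => ?_
  obtain ⟨ζ, hζ⟩ := exists_adjoint J z
  obtain ⟨_, -, hx⟩ := h.exists_sobChain hco e
  obtain ⟨x, hx, hx0, -⟩ := hx ζ
  have hc : ContinuousOn (fun t => ⟪z, toL2 P (u e t)⟫_ℝ) (Icc 0 (Γ.len e)) :=
    continuousOn_const.inner (hu.cont e)
  have hm := ContinuousOn.memLp_two_edge hc
  have h1 : hm.toLp _ = τ⁻¹ • (B ^ α) ζ e := ext_inner_right ℝ fun g => by
    rw [inner_lp_eq, inner_smul_left, conj_trivial, real_inner_comm, ← inner_edgeExt,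
      ← symm_pow h.symm, real_inner_comm, ← hζ, ← hu.integral_eq h hτ hJ]
    refine integral_congr_ae ?_
    filter_upwards [hm.coeFn_toLp] with t ht
    rw [ht]
  have h2 := eqOn_of_ae_eq hℓ hc ((hx.continuousOn (k := 0) (by omega)).const_smul τ⁻¹)
    (hm.coeFn_toLp.symm.trans (by
      rw [h1]
      filter_upwards [Lp.coeFn_smul τ⁻¹ ((B ^ α) ζ e), hx0] with t e1 e2
      rw [e1, Pi.smul_apply, ← e2]
      rfl))
  rw [hζ, inner_smul_right, real_inner_comm (T 0 t) ζ, hT ζ x hx hx0 0 (by omega) t ht]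
  exact h2 ht

/-- If `ψ` is orthogonal to all traces `T 0 t` on all edges, then `B^α ψ = 0` and `ψ = 0`. The
variables `u(s)` therefore span all of the noise. -/
theorem IsWhittleMatern.mem_fieldSpace [IsProbabilityMeasure P] (h : Γ.IsHalfResolvent a κ B D)
    (hco : Γ.Coeff α a κ) (hα : 1 ≤ α) (hτ : 0 < τ)
    (hu : Γ.IsWhittleMatern a κ τ α P W u) (hJ : ∀ φ, J φ =ᵐ[P] W φ) (φ : Γ.L2) :
    J φ ∈ Γ.fieldSpace P u := by
  set S := Γ.fieldSpace P u with hSdef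
  have hScl : IsClosed (S : Set (Lp ℝ 2 P)) := Submodule.isClosed_topologicalClosure _
  set M : Submodule ℝ Γ.L2 := S.comap J.toLinearMap with hM
  have hMcl : IsClosed (M : Set Γ.L2) := hScl.preimage J.continuous
  have hMc : CompleteSpace M := hMcl.completeSpace_coe
  have hbot : Mᗮ = ⊥ := by
    refine (Submodule.eq_bot_iff _).2 fun ψ hψ => h.pow_inj α (PiLp.ext fun e => Lp.ext ?_)
    obtain ⟨T, hT⟩ := h.exists_trace hco e
    obtain ⟨_, -, hx⟩ := h.exists_sobChain hco e
    obtain ⟨x, hx, hx0, -⟩ := hx ψ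
    have hz : ∀ t ∈ Icc 0 (Γ.len e), x 0 t = 0 := fun t ht => by
      rw [← hT ψ x hx hx0 0 (by omega) t ht]
      refine (Submodule.mem_orthogonal _ _).1 hψ _ ?_
      have h1 := hu.toL2_eq h hco hα hτ hJ hT ht
      have h2 : J (T 0 t) = τ • toL2 P (u e t) := by
        rw [h1, map_smul, smul_inv_smul₀ hτ.ne']
      change J (T 0 t) ∈ S
      rw [h2]
      exact S.smul_mem _ (Submodule.le_topologicalClosure _ (Submodule.subset_span ⟨⟨e, t, ht⟩, rfl⟩))
    refine hx0.symm.trans (EventuallyEq.trans ?_ (Lp.coeFn_zero _ _ _).symm)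
    exact (ae_restrict_iff' measurableSet_Icc).2 (Eventually.of_forall hz)
  have htop := Submodule.orthogonal_eq_bot_iff.1 hbot
  have : φ ∈ M := by rw [htop]; trivial
  exact this

end MetricGraph

/-! ### The representing elements of the bridge field -/

/-- `G` lists the Sobolev chains of the solutions `G j 0 = Q j 0` of `L^α g = 0` with canonical
boundary data. -/
structure IsBdryBasis (α : ℕ) (ℓ : ℝ) (a κ : ℝ → ℝ) (Q G : BdryIndex α → ℕ → ℝ → ℝ) : Prop where
  quasi : ∀ j, IsQuasiChain ℓ a κ (2 * α) (Q j)
  top : ∀ j, Q j (2 * α) = 0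
  sob : ∀ j, IsSobChain ℓ α (G j)
  zero : ∀ j, G j 0 = Q j 0
  data : ∀ j, bdryData α ℓ (G j 0) = Pi.single j 1

theorem EdgeCoeff.exists_isBdryBasis {α : ℕ} {ℓ : ℝ} {a κ : ℝ → ℝ} (hα : 1 ≤ α) (hℓ : 0 < ℓ)
    (h : EdgeCoeff α ℓ a κ) : ∃ Q G, IsBdryBasis α ℓ a κ Q G := by
  obtain ⟨Q, hQ⟩ := h.exists_bdryBasis hα hℓ
  choose G hG hG0 using fun j =>
    memSobolev_iff.1 (h.memSobolev_of_quasi hℓ ((hQ j).1.truncate (j := α) (by omega)))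
  exact ⟨Q, G, fun j => (hQ j).1, fun j => (hQ j).2.1, hG, hG0, fun j => by
    rw [hG0, (hQ j).2.2]⟩

section Subtract

variable {α : ℕ} {ℓ : ℝ} {a κ : ℝ → ℝ} {Q G : BdryIndex α → ℕ → ℝ → ℝ} {x : ℕ → ℝ → ℝ}

/-- The chain of `f - ∑ (B^α f)_j G_j`. -/
def bridgeChain (α : ℕ) (ℓ : ℝ) (G : BdryIndex α → ℕ → ℝ → ℝ) (x : ℕ → ℝ → ℝ) (k : ℕ) (t : ℝ) : ℝ :=
  (-1) * ∑ j, bdryData α ℓ (x 0) j * G j k t + x k t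

theorem IsBdryBasis.bridgeChain (hG : IsBdryBasis α ℓ a κ Q G) (hx : IsSobChain ℓ α x) :
    IsSobChain ℓ α (bridgeChain α ℓ G x) :=
  (IsSys.sum_smul Finset.univ _ fun j _ => hG.sob j).lincomb hx (-1)

theorem IsBdryBasis.memSobolevZero (hℓ : 0 < ℓ) (hG : IsBdryBasis α ℓ a κ Q G)
    (hx : IsSobChain ℓ α x) : MemSobolevZero α ℓ (GraphField.bridgeChain α ℓ G x 0) := by
  refine ⟨memSobolev_iff.2 ⟨_, hG.bridgeChain hx, rfl⟩, ?_⟩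
  have hm : ∀ j, MemSobolev α ℓ (G j 0) := fun j => memSobolev_iff.2 ⟨_, hG.sob j, rfl⟩
  have h1 := bdryData_lincomb hℓ (MemSobolev.sum_smul Finset.univ (bdryData α ℓ (x 0))
    fun j _ => hm j) (memSobolev_iff.2 ⟨x, hx, rfl⟩) (-1)
  refine h1.trans ?_
  rw [bdryData_sum_smul hℓ _ _ fun j _ => hm j]
  ext j
  simp [hG.data, Pi.single_apply]

end Subtract

namespace MetricGraph

variable {V E : Type*} {Γ : MetricGraph V E} {α : ℕ} {a κ : E → ℝ → ℝ} [Fintype E]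
  {B : Γ.L2 →L[ℝ] Γ.L2} {D : (e : E) → Γ.L2 →L[ℝ] Lp ℝ 2 (edgeVol (Γ.len e))}

/-- The elements of `L_2(Γ)` representing the boundary data at the ends of an edge. -/
def bdryElt (Γ : MetricGraph V E) (α : ℕ) (e : E) (T : ℕ → ℝ → Γ.L2) : BdryIndex α → Γ.L2
  | Sum.inl k => T k 0
  | Sum.inr k => T k (Γ.len e)

/-- The elements of `L_2(Γ)` representing the bridge field and its derivatives. -/
def bridgeElt (Γ : MetricGraph V E) (α : ℕ) (e : E) (T : ℕ → ℝ → Γ.L2)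
    (G : BdryIndex α → ℕ → ℝ → ℝ) (k : ℕ) (t : ℝ) : Γ.L2 :=
  T k t - ∑ j, G j k t • Γ.bdryElt α e T j

/-- The elements of `L_2(Γ)` representing functions in `H^α` of an edge with zero boundary data. -/
def bridgeSpace (Γ : MetricGraph V E) (α : ℕ) (B : Γ.L2 →L[ℝ] Γ.L2) (e : E) :
    Submodule ℝ Γ.L2 where
  carrier := {φ | ∃ f, MemSobolevZero α (Γ.len e) f ∧ Γ.IsZeroExt e ((B ^ α) φ) f}
  add_mem' := by
    rintro φ ψ ⟨f, hf, hφ⟩ ⟨g, hg, hψ⟩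
    refine ⟨_, hf.lincomb (Γ.len_pos e) hg 1, ?_⟩
    have := hφ.lincomb hψ 1
    rwa [one_smul, ← map_add] at this
  zero_mem' := by
    refine ⟨fun _ => 0, ⟨memSobolev_iff.2 ⟨fun _ _ => 0, ⟨by simp, fun k _ => ?_⟩, rfl⟩, ?_⟩, ?_⟩
    · simpa using HasL2Deriv.const 0
    · exact bdryData_eq_zero_of_support (Γ.len_pos e) ⟨1, one_pos, fun _ _ _ => rfl⟩
    · rw [map_zero]
      exact ⟨Lp.coeFn_zero _ _ _, fun _ _ => rfl⟩
  smul_mem' := by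
    rintro r φ ⟨f, hf, hφ⟩
    refine ⟨_, hf.lincomb (Γ.len_pos e) hf (r - 1), ?_⟩
    have := hφ.lincomb hφ (r - 1)
    rwa [sub_smul, one_smul, sub_add_cancel, ← map_smul] at this

namespace IsTrace

variable {e : E} {T : ℕ → ℝ → Γ.L2} {Q G : BdryIndex α → ℕ → ℝ → ℝ}

theorem inner_bdryElt (hT : Γ.IsTrace α B e T) {φ : Γ.L2} {x : ℕ → ℝ → ℝ}
    (hx : IsSobChain (Γ.len e) α x) (hx0 : x 0 =ᵐ[edgeVol (Γ.len e)] (B ^ α) φ e)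
    (j : BdryIndex α) : ⟪Γ.bdryElt α e T j, φ⟫_ℝ = bdryData α (Γ.len e) (x 0) j := by
  rcases j with k | k
  · rw [IsSobChain.bdryData_inl (Γ.len_pos e) hx]
    exact hT φ x hx hx0 k k.2 0 (Γ.left_mem e)
  · rw [IsSobChain.bdryData_inr (Γ.len_pos e) hx]
    exact hT φ x hx hx0 k k.2 _ (Γ.right_mem e)

theorem inner_bridgeElt (hT : Γ.IsTrace α B e T) {φ : Γ.L2} {x : ℕ → ℝ → ℝ}
    (hx : IsSobChain (Γ.len e) α x) (hx0 : x 0 =ᵐ[edgeVol (Γ.len e)] (B ^ α) φ e)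
    {k : ℕ} (hk : k < α) {t : ℝ} (ht : t ∈ Icc 0 (Γ.len e)) :
    ⟪Γ.bridgeElt α e T G k t, φ⟫_ℝ = bridgeChain α (Γ.len e) G x k t := by
  rw [bridgeElt, inner_sub_left, sum_inner, hT φ x hx hx0 k hk t ht, bridgeChain]
  simp only [inner_smul_left, conj_trivial, hT.inner_bdryElt hx hx0]
  rw [neg_one_mul, neg_add_eq_sub]
  simp only [mul_comm]

/-- The inner product reads off a boundary datum, which is zero on this space. This orthogonality is
the source of the independence claim. -/
theorem inner_bdryElt_eq_zero (hT : Γ.IsTrace α B e T) {φ : Γ.L2} (hφ : φ ∈ Γ.bridgeSpace α B e)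
    (j : BdryIndex α) : ⟪Γ.bdryElt α e T j, φ⟫_ℝ = 0 := by
  obtain ⟨f, hf, hφ⟩ := hφ
  obtain ⟨x, hx, rfl⟩ := memSobolev_iff.1 hf.1
  rw [hT.inner_bdryElt hx hφ.1.symm, hf.2, Pi.zero_apply]

theorem inner_bridgeElt_of_zeroExt (hα : 1 ≤ α) (hT : Γ.IsTrace α B e T) {φ : Γ.L2} {f : ℝ → ℝ}
    (hf : MemSobolevZero α (Γ.len e) f) (hφ : Γ.IsZeroExt e ((B ^ α) φ) f)
    {t : ℝ} (ht : t ∈ Icc 0 (Γ.len e)) : ⟪Γ.bridgeElt α e T G 0 t, φ⟫_ℝ = f t := by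
  obtain ⟨x, hx, rfl⟩ := memSobolev_iff.1 hf.1
  rw [hT.inner_bridgeElt hx hφ.1.symm hα ht, bridgeChain, hf.2]
  simp

variable [Finite V]

/-- The bridge space is closed, so orthogonality to its complement suffices. For `ψ` in the
complement, `B^α ψ` on `e` annihilates all `L^α q` with `q` in the core and so solves the
homogeneous equation. Subtracting the `G_j` with the same boundary data leaves a homogeneous
solution with zero data, whose value at `t` is the inner product in question. -/
theorem bridgeElt_mem (h : Γ.IsHalfResolvent a κ B D) (hco : Γ.Coeff α a κ) (hα : 1 ≤ α)
    (hT : Γ.IsTrace α B e T) (hG : IsBdryBasis α (Γ.len e) (a e) (κ e) Q G) {t : ℝ}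
    (ht : t ∈ Icc 0 (Γ.len e)) : Γ.bridgeElt α e T G 0 t ∈ Γ.bridgeSpace α B e := by
  have hℓ := Γ.len_pos e
  have hc : CompleteSpace (Γ.bridgeSpace α B e) := (h.isClosed_zeroExt hco e).completeSpace_coe
  rw [← Submodule.orthogonal_orthogonal (Γ.bridgeSpace α B e), Submodule.mem_orthogonal']
  intro ψ hψ
  obtain ⟨_, -, hX⟩ := h.exists_sobChain hco e
  obtain ⟨x, hx, hx0, -⟩ := hX ψ
  rw [hT.inner_bridgeElt hx hx0 hα ht]
  obtain ⟨S, hS⟩ := (hco.2 e).exists_fundamental hℓ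
  have hxc : ContinuousOn (x 0) (Icc 0 (Γ.len e)) := hx.continuousOn (by omega)
  obtain ⟨r, hr⟩ := exists_homogeneous_of_orthogonal hℓ (hco.2 e) hS
    (ContinuousOn.memLp_two_edge hxc) fun q hq => by
      have hm : MemLp (q (2 * α)) 2 (edgeVol (Γ.len e)) := hq.1.top
      have hη := isZeroExt_edgeExt e hm
      rw [← h.inner_core hη hx0]
      refine (Submodule.mem_orthogonal' _ _).1 hψ _ ⟨q 0, ?_, h.core_zeroExt hco hq hη⟩
      exact ((hco.2 e).memSobolevZero_iff hℓ).2 ⟨q, hq.1.truncate (by omega), rfl,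
        fun k hk => hq.left hℓ k (by omega), fun k hk => hq.right hℓ k (by omega)⟩
  have hchain := (IsSys.sum_smul Finset.univ (bdryData α (Γ.len e) (x 0))
    fun j _ => hG.quasi j).lincomb (hS.comb r) (-1)
  have heq := eqOn_of_ae_eq hℓ hxc ((hS.comb r).continuousOn (by omega)) hr
  have heq' : EqOn (bridgeChain α (Γ.len e) G x 0)
      (fun t => (-1) * (∑ j, bdryData α (Γ.len e) (x 0) j * Q j 0 t) + ∑ i, r i * S i 0 t)
      (Icc 0 (Γ.len e)) := fun s hs => by
    have h1 : x 0 s = ∑ i, r i * S i 0 s := heq hs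
    simp only [bridgeChain, hG.zero, h1]
  rw [heq' ht]
  refine (hco.2 e).homogeneous_eq_zero_of_bdryData hα hℓ hchain
    (Eventually.of_forall fun t => ?_) ?_ 0 (by omega) t ht
  · simp [hG.top, hS.top]
  · rw [← bdryData_congr hℓ.le heq']
    exact (hG.memSobolevZero hℓ hx).2

/-- The bridge field spans the space of functions with zero boundary data. -/
theorem span_bridgeElt (h : Γ.IsHalfResolvent a κ B D) (hco : Γ.Coeff α a κ) (hα : 1 ≤ α)
    (hT : Γ.IsTrace α B e T) (hG : IsBdryBasis α (Γ.len e) (a e) (κ e) Q G) {r : ℝ} (hr : r ≠ 0) :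
    (Submodule.span ℝ (range fun t : Icc 0 (Γ.len e) =>
      r • Γ.bridgeElt α e T G 0 t)).topologicalClosure = Γ.bridgeSpace α B e := by
  set K := (Submodule.span ℝ (range fun t : Icc 0 (Γ.len e) =>
      r • Γ.bridgeElt α e T G 0 t)).topologicalClosure
  have hle : K ≤ Γ.bridgeSpace α B e := by
    refine Submodule.topologicalClosure_minimal _ (Submodule.span_le.2 ?_)
      (h.isClosed_zeroExt hco e)
    rintro _ ⟨t, rfl⟩
    exact Submodule.smul_mem _ _ (hT.bridgeElt_mem h hco hα hG t.2)
  have hc : CompleteSpace K := (Submodule.isClosed_topologicalClosure _).completeSpace_coe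
  refine le_antisymm hle fun φ hφ => ?_
  obtain ⟨p, hp, q, hq, rfl⟩ := K.exists_add_mem_mem_orthogonal φ
  have hqm : q ∈ Γ.bridgeSpace α B e := by
    have := Submodule.sub_mem _ hφ (hle hp)
    rwa [add_sub_cancel_left] at this
  obtain ⟨f, hf, hqf⟩ := hqm
  -- On the bridge space the bridge elements act as point evaluations, so an element orthogonal to
  -- all of them represents the zero function.
  have hz : q = 0 := by
    refine h.pow_inj α (hqf.unique (ψ := 0) (g := fun _ => 0)
      ⟨Lp.coeFn_zero _ _ _, fun _ _ => rfl⟩ ?_)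
    filter_upwards [ae_restrict_mem measurableSet_Icc] with t ht
    rw [← hT.inner_bridgeElt_of_zeroExt (G := G) hα hf hqf ht]
    have := (Submodule.mem_orthogonal _ _).1 hq _
      (Submodule.le_topologicalClosure _ (Submodule.subset_span ⟨⟨t, ht⟩, rfl⟩))
    rw [inner_smul_left, conj_trivial] at this
    exact (mul_eq_zero.1 this).resolve_left hr
  rw [hz, add_zero]
  exact hp

end IsTrace

end MetricGraph

/-! ### The law of the bridge field -/

section GaussianLaws

theorem isGaussianProcess_map {Ω T : Type*} [MeasurableSpace Ω] {P : Measure Ω} {X : T → Ω → ℝ}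
    (hX : IsGaussianProcess X P) (hm : ∀ t, Measurable (X t)) :
    IsGaussianProcess (fun (t : T) (x : T → ℝ) => x t) (P.map fun ω t => X t ω) where
  hasGaussianLaw I := by
    have h1 : Measurable fun ω t => X t ω := measurable_pi_lambda _ hm
    have h2 : Measurable fun x : T → ℝ => I.restrict x := Finset.measurable_restrict I
    refine ⟨?_⟩
    change IsGaussian ((P.map fun ω t => X t ω).map fun x => I.restrict x)
    rw [Measure.map_map h2 h1]
    exact (hX.hasGaussianLaw I).isGaussian_map

/-- The law of a centred Gaussian process is determined by its covariance. -/
theorem eq_of_isGaussianProcess {T : Type*} {μ ν : Measure (T → ℝ)}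
    (hμ : IsGaussianProcess (fun (t : T) (x : T → ℝ) => x t) μ)
    (hν : IsGaussianProcess (fun (t : T) (x : T → ℝ) => x t) ν)
    (mμ : ∀ t, ∫ x, x t ∂μ = 0) (mν : ∀ t, ∫ x, x t ∂ν = 0)
    (h : ∀ s t, ∫ x, x s * x t ∂μ = ∫ x, x s * x t ∂ν) : μ = ν := by
  classical
  have hpμ := hμ.isProbabilityMeasure
  have hpν := hν.isProbabilityMeasure
  have hLμ : ∀ t, MemLp (fun x : T → ℝ => x t) 2 μ := fun t => (hμ.hasGaussianLaw_eval t).memLp_two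
  have hLν : ∀ t, MemLp (fun x : T → ℝ => x t) 2 ν := fun t => (hν.hasGaussianLaw_eval t).memLp_two
  -- Finite-dimensional Gaussian laws agree once every linear functional has the same mean and
  -- variance. The projective limit is then unique.
  have key : ∀ I : Finset T, μ.map I.restrict = ν.map I.restrict := fun I => by
    have := (hμ.hasGaussianLaw I).isGaussian_map
    have := (hν.hasGaussianLaw I).isGaussian_map
    refine Measure.ext_of_charFunDual (funext fun L => ?_)
    have hL : L ∘ (fun x : T → ℝ => I.restrict fun t => x t) =
        fun x => ∑ i : I, L (Pi.single i 1) * x i := by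
      funext x
      have h3 := L.toLinearMap.pi_apply_eq_sum_univ (I.restrict x)
      simp only [Finset.restrict, ContinuousLinearMap.coe_coe, smul_eq_mul] at h3
      refine h3.trans (Finset.sum_congr rfl fun i _ => ?_)
      rw [mul_comm]
      congr 2
      ext j
      simp [Pi.single_apply, eq_comm]
    have e1 : ∀ ρ : Measure (T → ℝ), IsProbabilityMeasure ρ →
        (∀ t, MemLp (fun x : T → ℝ => x t) 2 ρ) → (∀ t, ∫ x, x t ∂ρ = 0) →
        ρ[L ∘ (fun x : T → ℝ => I.restrict fun t => x t)] = 0 ∧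
        Var[L ∘ (fun x : T → ℝ => I.restrict fun t => x t); ρ] =
          ∑ i : I, ∑ j : I, L (Pi.single i 1) * (L (Pi.single j 1) * ∫ x, x i * x j ∂ρ) := by
      intro ρ _ hl hm
      rw [hL]
      constructor
      · beta_reduce
        rw [integral_finsetSum _ fun (i : I) _ => ((hl i).integrable one_le_two).const_mul _]
        simp [integral_const_mul, hm]
      · rw [variance_fun_sum fun i : I => (hl i).const_mul _]
        refine Finset.sum_congr rfl fun i _ => Finset.sum_congr rfl fun j _ => ?_
        rw [covariance_const_mul_left, covariance_const_mul_right,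
          covariance_eq_sub (hl i) (hl j), hm, zero_mul, sub_zero]
        rfl
    have a1 := (hμ.hasGaussianLaw I).charFunDual_map_eq L
    have a2 := (hν.hasGaussianLaw I).charFunDual_map_eq L
    rw [(e1 μ hpμ hLμ mμ).1, (e1 μ hpμ hLμ mμ).2] at a1
    rw [(e1 ν hpν hLν mν).1, (e1 ν hpν hLν mν).2] at a2
    refine a1.trans (Eq.trans ?_ a2.symm)
    simp only [h]
  have hfin : ∀ I : Finset T, IsFiniteMeasure (ν.map I.restrict) := fun I => inferInstance
  exact IsProjectiveLimit.unique (P := fun I : Finset T => ν.map I.restrict) key fun _ => rfl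

/-- The conditional law of a function of independent variables given one of them. -/
theorem condDistrib_of_indepFun {Ω α β γ : Type*} [MeasurableSpace Ω] [MeasurableSpace α]
    [MeasurableSpace β] [MeasurableSpace γ] [StandardBorelSpace γ] [Nonempty γ] {P : Measure Ω}
    [IsProbabilityMeasure P] {X : Ω → α} {Y : Ω → β} (hX : Measurable X) (hY : Measurable Y)
    (h : IndepFun X Y P) {F : β × α → γ} (hF : Measurable F) :
    ∀ᵐ y ∂P.map Y, condDistrib (fun ω => F (Y ω, X ω)) Y P y = (P.map X).map fun x => F (y, x) := by
  have := Measure.isProbabilityMeasure_map (μ := P) hX.aemeasurable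
  have := Measure.isProbabilityMeasure_map (μ := P) hY.aemeasurable
  set κ : Kernel β γ := (Kernel.id ×ₖ Kernel.const β (P.map X)).map F with hκ
  have hκy : ∀ y, κ y = (P.map X).map fun x => F (y, x) := fun y => by
    rw [hκ, Kernel.map_apply _ hF, Kernel.prod_apply, Kernel.id_apply, Kernel.const_apply,
      Measure.dirac_prod, Measure.map_map hF measurable_prodMk_left]
    rfl
  have : IsMarkovKernel κ := Kernel.IsMarkovKernel.map _ hF
  have hFm : Measurable fun ω => F (Y ω, X ω) := hF.comp (hY.prodMk hX)
  have key : P.map (fun ω => (Y ω, F (Y ω, X ω))) = P.map Y ⊗ₘ κ := by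
    have h1 : P.map (fun ω => (Y ω, X ω)) = (P.map Y).prod (P.map X) :=
      (indepFun_iff_map_prod_eq_prod_map_map hY.aemeasurable hX.aemeasurable).1 h.symm
    have hG : Measurable fun p : β × α => (p.1, F p) := measurable_fst.prodMk hF
    have h2 : P.map (fun ω => (Y ω, F (Y ω, X ω))) =
        (P.map (fun ω => (Y ω, X ω))).map fun p => (p.1, F p) :=
      (Measure.map_map hG (hY.prodMk hX)).symm
    rw [h2, h1]
    ext s hs
    rw [Measure.map_apply hG hs, Measure.prod_apply (hG hs), Measure.compProd_apply hs]
    refine lintegral_congr fun y => ?_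
    rw [hκy, Measure.map_apply (by fun_prop) (measurable_prodMk_left hs)]
    rfl
  filter_upwards [condDistrib_ae_eq_of_measure_eq_compProd Y hFm.aemeasurable key] with y hy
  rw [hy, hκy]

end GaussianLaws

/-! ### A characterisation of the bridge law by the edge alone -/

section BridgeLaw

variable {α : ℕ} {τ ℓ : ℝ} {a κ : ℝ → ℝ}

/-- `K` is the reproducing kernel of `H^α_0(0, ℓ)` with the inner product `τ² (f, L^α g)`. -/
def IsBridgeKernel (α : ℕ) (τ ℓ : ℝ) (a κ : ℝ → ℝ) (K : Icc 0 ℓ → Icc 0 ℓ → ℝ) : Prop :=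
  ∀ s : Icc 0 ℓ, ∃ f, MemSobolevZero α ℓ f ∧ (∀ t : Icc 0 ℓ, K s t = f t) ∧
    ∀ q, IsCoreChain ℓ a κ α q → ∫ t in (0 : ℝ)..ℓ, f t * q (2 * α) t = (τ⁻¹) ^ 2 * q 0 s

/-- The difference annihilates every `L^α q`, so it is a homogeneous solution, and its boundary data
vanish. No graph enters, which makes this uniqueness usable across different graphs. -/
theorem EdgeCoeff.eqOn_of_forall_coreChain (hα : 1 ≤ α) (hℓ : 0 < ℓ) (hco : EdgeCoeff α ℓ a κ)
    {f g : ℝ → ℝ} (hf : MemSobolevZero α ℓ f) (hg : MemSobolevZero α ℓ g)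
    (h : ∀ q, IsCoreChain ℓ a κ α q →
      ∫ t in (0 : ℝ)..ℓ, f t * q (2 * α) t = ∫ t in (0 : ℝ)..ℓ, g t * q (2 * α) t) :
    EqOn f g (Icc 0 ℓ) := by
  obtain ⟨S, hS⟩ := hco.exists_fundamental hℓ
  have hd := hg.lincomb hℓ hf (-1)
  have hdc := hd.1.continuousOn hα
  obtain ⟨r, hr⟩ := exists_homogeneous_of_orthogonal hℓ hco hS
    (ContinuousOn.memLp_two_edge hdc) fun q hq => by
      have hm : MemLp (q (2 * α)) 2 (edgeVol ℓ) := hq.1.top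
      have hi : ∀ {f}, MemSobolevZero α ℓ f →
          IntervalIntegrable (fun t => f t * q (2 * α) t) volume 0 ℓ := fun hf => by
        have := (ContinuousOn.memLp_two_edge (hf.1.continuousOn hα)).integrable_mul hm
        rw [intervalIntegrable_iff_integrableOn_Icc_of_le hℓ.le]
        exact this
      simp only [add_mul, mul_assoc]
      rw [intervalIntegral.integral_add ((hi hg).const_mul _) (hi hf),
        intervalIntegral.integral_const_mul, h q hq]
      ring
  have hchain := hS.comb r
  have heq := eqOn_of_ae_eq hℓ hdc (hchain.continuousOn (by omega)) hr
  have hz := hco.homogeneous_eq_zero_of_bdryData hα hℓ hchain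
    (Eventually.of_forall fun t => hS.comb_top r t)
    (by rw [← bdryData_congr hℓ.le heq]; exact hd.2) 0 (by omega)
  intro t ht
  have h1 : (-1) * g t + f t = 0 := (heq ht).trans (hz t ht)
  linarith

theorem IsBridgeKernel.unique (hα : 1 ≤ α) (hℓ : 0 < ℓ) (hco : EdgeCoeff α ℓ a κ)
    {K K' : Icc 0 ℓ → Icc 0 ℓ → ℝ} (h : IsBridgeKernel α τ ℓ a κ K)
    (h' : IsBridgeKernel α τ ℓ a κ K') (s t : Icc 0 ℓ) : K s t = K' s t := by
  obtain ⟨f, hf, hK, hq⟩ := h s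
  obtain ⟨f', hf', hK', hq'⟩ := h' s
  rw [hK, hK']
  exact hco.eqOn_of_forall_coreChain hα hℓ hf hf' (fun q hc => by rw [hq q hc, hq' q hc]) t.2

/-- `ν` is the law of the bridge field of the edge. -/
structure IsBridgeLaw (α : ℕ) (τ ℓ : ℝ) (a κ : ℝ → ℝ) (ν : Measure (Icc (0 : ℝ) ℓ → ℝ)) : Prop where
  gaussian : IsGaussianProcess (fun (t : Icc (0 : ℝ) ℓ) (x : Icc (0 : ℝ) ℓ → ℝ) => x t) ν
  mean : ∀ t, ∫ x, x t ∂ν = 0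
  kernel : IsBridgeKernel α τ ℓ a κ fun s t => ∫ x, x s * x t ∂ν

theorem IsBridgeLaw.unique (hα : 1 ≤ α) (hℓ : 0 < ℓ) (hco : EdgeCoeff α ℓ a κ)
    {μ ν : Measure (Icc (0 : ℝ) ℓ → ℝ)} (hμ : IsBridgeLaw α τ ℓ a κ μ)
    (hν : IsBridgeLaw α τ ℓ a κ ν) : μ = ν :=
  eq_of_isGaussianProcess hμ.gaussian hν.gaussian hμ.mean hν.mean
    (hμ.kernel.unique hα hℓ hco hν.kernel)

end BridgeLaw

/-! ### The bridge field -/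

theorem MemSobolevZero.const_mul {α : ℕ} {ℓ : ℝ} {f : ℝ → ℝ} (hℓ : 0 < ℓ)
    (hf : MemSobolevZero α ℓ f) (r : ℝ) : MemSobolevZero α ℓ (fun t => r * f t) := by
  have h : (fun t => r * f t) = fun t => (r - 1) * f t + f t := by
    funext t
    ring
  rw [h]
  exact hf.lincomb hℓ hf (r - 1)

theorem EdgeCoeff.memSobolevZero_of_coreChain {α : ℕ} {ℓ : ℝ} {a κ : ℝ → ℝ} {q : ℕ → ℝ → ℝ}
    (hℓ : 0 < ℓ) (h : EdgeCoeff α ℓ a κ) (hq : IsCoreChain ℓ a κ α q) :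
    MemSobolevZero α ℓ (q 0) :=
  (h.memSobolevZero_iff hℓ).2 ⟨q, hq.1.truncate (by omega), rfl,
    fun k hk => hq.left hℓ k (by omega), fun k hk => hq.right hℓ k (by omega)⟩

/-- An isometry of a complete space is a closed embedding, so it commutes with closures of spans. -/
theorem mem_gaussianSpace_isometry {Ω : Type*} [MeasurableSpace Ω] {P : Measure Ω}
    {H : Type*} [NormedAddCommGroup H] [InnerProductSpace ℝ H] [CompleteSpace H]
    (J : H →ₗᵢ[ℝ] Lp ℝ 2 P) {ι : Type*} (r : ι → H) (w : Lp ℝ 2 P) :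
    w ∈ gaussianSpace (fun i => J (r i)) ↔
      ∃ φ ∈ (Submodule.span ℝ (range r)).topologicalClosure, J φ = w := by
  have h1 : Submodule.span ℝ (range fun i => J (r i)) =
      (Submodule.span ℝ (range r)).map J.toLinearMap := by
    rw [Submodule.map_span, ← range_comp]
    rfl
  have h2 := J.isometry.isClosedEmbedding.closure_image_eq (s := (Submodule.span ℝ (range r) : Set H))
  rw [gaussianSpace, h1]
  exact (Set.ext_iff.1 h2 w)

theorem comap_apply_le {Ω ι : Type*} (X : ι → Ω → ℝ) (i : ι) :
    MeasurableSpace.comap (X i) inferInstance ≤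
      MeasurableSpace.comap (fun ω i => X i ω) inferInstance := by
  have h1 : MeasurableSpace.comap (X i) inferInstance = MeasurableSpace.comap (fun ω i => X i ω)
      (MeasurableSpace.comap (fun x : ι → ℝ => x i) inferInstance) := by
    rw [MeasurableSpace.comap_comp]
    rfl
  rw [h1]
  exact MeasurableSpace.comap_mono (measurable_pi_apply i).comap_le

/-! ### Gaussian properties of the bridge field -/

namespace MetricGraph

variable {V E : Type*} {Γ : MetricGraph V E} {α : ℕ} {a κ : E → ℝ → ℝ} [Fintype E]
  {B : Γ.L2 →L[ℝ] Γ.L2} {D : (e : E) → Γ.L2 →L[ℝ] Lp ℝ 2 (edgeVol (Γ.len e))}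

theorem IsZeroExt.const_smul {e : E} {φ : Γ.L2} {f : ℝ → ℝ} (h : Γ.IsZeroExt e φ f) (r : ℝ) :
    Γ.IsZeroExt e (r • φ) (fun t => r * f t) := by
  have := h.lincomb h (r - 1)
  rw [sub_smul, one_smul, sub_add_cancel] at this
  refine this.congr (Eventually.of_forall fun t => ?_)
  ring

variable {Ω : Type*} [MeasurableSpace Ω] {P : Measure Ω} {τ : ℝ} {W : Γ.L2 → Ω → ℝ}
  {u : E → ℝ → Ω → ℝ} {J : Γ.L2 →ₗᵢ[ℝ] Lp ℝ 2 P} {e : E} {T : ℕ → ℝ → Γ.L2}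
  {Q G : BdryIndex α → ℕ → ℝ → ℝ}

/-- The derivatives of the field on an edge. -/
def fieldDeriv (J : Γ.L2 →ₗᵢ[ℝ] Lp ℝ 2 P) (τ : ℝ) (T : ℕ → ℝ → Γ.L2) (k : ℕ) (t : ℝ) : Lp ℝ 2 P :=
  J (τ⁻¹ • T k t)

/-- The derivatives of the bridge field on an edge. -/
def bridgeDeriv (J : Γ.L2 →ₗᵢ[ℝ] Lp ℝ 2 P) (τ : ℝ) (α : ℕ) (e : E) (T : ℕ → ℝ → Γ.L2)
    (G : BdryIndex α → ℕ → ℝ → ℝ) : ℕ → ℝ → Lp ℝ 2 P :=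
  fieldDeriv J τ (Γ.bridgeElt α e T G)

theorem bdryVec_fieldDeriv (j : BdryIndex α) :
    bdryVec α (Γ.len e) (fieldDeriv J τ T) j = J (τ⁻¹ • Γ.bdryElt α e T j) := by
  cases j <;> rfl

theorem fieldDeriv_zero_ae_eq (t : ℝ) :
    fieldDeriv J τ T 0 t =ᵐ[P] fun ω => bridgeDeriv J τ α e T G 0 t ω +
      ∑ j, G j 0 t * (bdryVec α (Γ.len e) (fieldDeriv J τ T) j : Ω → ℝ) ω := by
  have h1 : fieldDeriv J τ T 0 t = bridgeDeriv J τ α e T G 0 t +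
      ∑ j, G j 0 t • bdryVec α (Γ.len e) (fieldDeriv J τ T) j := by
    simp only [bdryVec_fieldDeriv, bridgeDeriv, fieldDeriv, bridgeElt, map_smul, map_sub, map_sum,
      smul_sub, Finset.smul_sum]
    rw [sub_add_eq_add_sub, eq_sub_iff_add_eq]
    simp only [smul_comm τ⁻¹]
  have h2 : ∀ᵐ ω ∂P, ∀ j, (G j 0 t • bdryVec α (Γ.len e) (fieldDeriv J τ T) j : Lp ℝ 2 P) ω =
      G j 0 t * (bdryVec α (Γ.len e) (fieldDeriv J τ T) j : Ω → ℝ) ω :=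
    ae_all_iff.2 fun j => by
      filter_upwards [Lp.coeFn_smul (G j 0 t) (bdryVec α (Γ.len e) (fieldDeriv J τ T) j)] with ω h
      rw [h, Pi.smul_apply, smul_eq_mul]
  rw [h1]
  filter_upwards [Lp.coeFn_add (bridgeDeriv J τ α e T G 0 t)
    (∑ j, G j 0 t • bdryVec α (Γ.len e) (fieldDeriv J τ T) j), h2, Lp.coeFn_finsetSum Finset.univ
    fun j => G j 0 t • bdryVec α (Γ.len e) (fieldDeriv J τ T) j] with ω e1 e2 e3
  rw [e1, Pi.add_apply, e3, Finset.sum_apply, Finset.sum_congr rfl fun j _ => e2 j]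

theorem measurable_bdryVec (Dt : ℕ → ℝ → Lp ℝ 2 P) (ℓ : ℝ) (j : BdryIndex α) :
    Measurable[innerSigma α ℓ Dt] (bdryVec α ℓ Dt j : Ω → ℝ) := by
  rcases j with k | k
  · exact (comap_measurable (Dt k 0 : Ω → ℝ)).mono
      (le_iSup_of_le k (le_iSup₂_of_le 0 (by simp) le_rfl)) le_rfl
  · exact (comap_measurable (Dt k ℓ : Ω → ℝ)).mono
      (le_iSup_of_le k (le_iSup₂_of_le ℓ (by simp) le_rfl)) le_rfl

theorem innerSigma_le (Dt : ℕ → ℝ → Lp ℝ 2 P) (ℓ : ℝ) :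
    innerSigma α ℓ Dt ≤ MeasurableSpace.comap
      (fun ω (j : BdryIndex α) => (bdryVec α ℓ Dt j : Ω → ℝ) ω) inferInstance := by
  have key : ∀ j : BdryIndex α, MeasurableSpace.comap (bdryVec α ℓ Dt j : Ω → ℝ) inferInstance ≤
      MeasurableSpace.comap (fun ω (j : BdryIndex α) => (bdryVec α ℓ Dt j : Ω → ℝ) ω)
        inferInstance := fun j => comap_apply_le (fun j => (bdryVec α ℓ Dt j : Ω → ℝ)) j
  refine iSup_le fun k => iSup₂_le fun s hs => ?_
  rcases hs with rfl | hs
  · exact key (Sum.inl k)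
  · rw [mem_singleton_iff.1 hs]
    exact key (Sum.inr k)

namespace IsTrace

theorem hasWeakDerivs_fieldDeriv (h : Γ.IsHalfResolvent a κ B D) (hco : Γ.Coeff α a κ)
    (hα : 1 ≤ α) (hT : Γ.IsTrace α B e T) {S : Submodule ℝ (Lp ℝ 2 P)} (hS : ∀ φ, J φ ∈ S)
    {X : ℝ → Lp ℝ 2 P} (hX : ∀ t ∈ Icc 0 (Γ.len e), fieldDeriv J τ T 0 t = X t) :
    HasWeakDerivs S (Γ.len e) (α - 1) X (fieldDeriv J τ T) := by
  obtain ⟨_, -, hx⟩ := h.exists_sobChain hco e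
  refine hasWeakDerivs_of_chain J hS hα (R := fun k t => τ⁻¹ • T k t) (fun φ => ?_) hX
  obtain ⟨x, hx, hx0, -⟩ := hx (τ⁻¹ • φ)
  refine ⟨x, hx, fun k hk t ht => ?_⟩
  rw [inner_smul_left, conj_trivial, ← real_inner_smul_right, hT _ x hx hx0 k hk t ht]

theorem hasWeakDerivs_bridgeDeriv (h : Γ.IsHalfResolvent a κ B D) (hco : Γ.Coeff α a κ)
    (hα : 1 ≤ α) (hT : Γ.IsTrace α B e T) (hG : IsBdryBasis α (Γ.len e) (a e) (κ e) Q G)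
    {S : Submodule ℝ (Lp ℝ 2 P)} (hS : ∀ φ, J φ ∈ S) :
    HasWeakDerivs S (Γ.len e) (α - 1) (bridgeDeriv J τ α e T G 0) (bridgeDeriv J τ α e T G) := by
  obtain ⟨_, -, hx⟩ := h.exists_sobChain hco e
  refine hasWeakDerivs_of_chain J hS hα (R := fun k t => τ⁻¹ • Γ.bridgeElt α e T G k t)
    (fun φ => ?_) fun _ _ => rfl
  obtain ⟨x, hx, hx0, -⟩ := hx (τ⁻¹ • φ)
  refine ⟨_, hG.bridgeChain hx, fun k hk t ht => ?_⟩
  rw [inner_smul_left, conj_trivial, ← real_inner_smul_right, hT.inner_bridgeElt hx hx0 hk ht]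

/-- Tested against any `φ`, the bridge elements give the derivatives of `B^α φ` minus its
interpolation by the `G_j`, and these vanish at both ends. -/
theorem bdryVec_bridgeDeriv (h : Γ.IsHalfResolvent a κ B D) (hco : Γ.Coeff α a κ)
    (hT : Γ.IsTrace α B e T) (hG : IsBdryBasis α (Γ.len e) (a e) (κ e) Q G) (j : BdryIndex α) :
    bdryVec α (Γ.len e) (bridgeDeriv J τ α e T G) j = 0 := by
  have hℓ := Γ.len_pos e
  obtain ⟨_, -, hx⟩ := h.exists_sobChain hco e
  have key : ∀ k < α, ∀ t, t = 0 ∨ t = Γ.len e → bridgeDeriv J τ α e T G k t = 0 := by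
    intro k hk t ht
    have hz : Γ.bridgeElt α e T G k t = 0 := ext_inner_right ℝ fun φ => by
      obtain ⟨x, hx, hx0, -⟩ := hx φ
      have hb := (IsSobChain.bdryData_eq_zero_iff hℓ (hG.bridgeChain hx)).1
        (hG.memSobolevZero hℓ hx).2
      rcases ht with rfl | rfl
      · rw [hT.inner_bridgeElt hx hx0 hk (Γ.left_mem e), hb.1 k hk, inner_zero_left]
      · rw [hT.inner_bridgeElt hx hx0 hk (Γ.right_mem e), hb.2 k hk, inner_zero_left]
    rw [bridgeDeriv, fieldDeriv, hz, smul_zero, map_zero]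
  rcases j with k | k
  · exact key k k.2 0 (Or.inl rfl)
  · exact key k k.2 _ (Or.inr rfl)

theorem cmFun_bridge (hα : 1 ≤ α) (hT : Γ.IsTrace α B e T) {φ : Γ.L2} {f : ℝ → ℝ}
    (hf : MemSobolevZero α (Γ.len e) f) (hφ : Γ.IsZeroExt e ((B ^ α) φ) f) :
    cmFun (fun t : Icc 0 (Γ.len e) => bridgeDeriv J τ α e T G 0 t) (J φ) =
      (Icc 0 (Γ.len e)).domRestrict fun t => τ⁻¹ * f t := by
  funext t
  rw [cmFun, bridgeDeriv, fieldDeriv, J.inner_map_map, inner_smul_left, conj_trivial,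
    hT.inner_bridgeElt_of_zeroExt hα hf hφ t.2]
  rfl

variable [Finite V]

theorem indepFun_bridge (hJ : IsGaussianIsometry J) (h : Γ.IsHalfResolvent a κ B D)
    (hco : Γ.Coeff α a κ) (hα : 1 ≤ α) (hT : Γ.IsTrace α B e T)
    (hG : IsBdryBasis α (Γ.len e) (a e) (κ e) Q G) :
    IndepFun (fun ω (t : Icc 0 (Γ.len e)) => (bridgeDeriv J τ α e T G 0 t : Ω → ℝ) ω)
      (fun ω (j : BdryIndex α) => (bdryVec α (Γ.len e) (fieldDeriv J τ T) j : Ω → ℝ) ω) P := by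
  simp only [bdryVec_fieldDeriv]
  refine hJ.indepFun (f := fun t : Icc 0 (Γ.len e) => τ⁻¹ • Γ.bridgeElt α e T G 0 t) fun t j => ?_
  rw [inner_smul_left, inner_smul_right, real_inner_comm,
    hT.inner_bdryElt_eq_zero (hT.bridgeElt_mem h hco hα hG t.2), mul_zero, mul_zero]

theorem mem_gaussianSpace_bridge (h : Γ.IsHalfResolvent a κ B D) (hco : Γ.Coeff α a κ)
    (hα : 1 ≤ α) (hτ : 0 < τ) (hT : Γ.IsTrace α B e T)
    (hG : IsBdryBasis α (Γ.len e) (a e) (κ e) Q G) (w : Lp ℝ 2 P) :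
    w ∈ gaussianSpace (fun t : Icc 0 (Γ.len e) => bridgeDeriv J τ α e T G 0 t) ↔
      ∃ φ ∈ Γ.bridgeSpace α B e, J φ = w := by
  rw [← hT.span_bridgeElt h hco hα hG (inv_ne_zero hτ.ne')]
  exact mem_gaussianSpace_isometry J _ w

theorem cameronMartin_bridge (h : Γ.IsHalfResolvent a κ B D) (hco : Γ.Coeff α a κ)
    (hα : 1 ≤ α) (hτ : 0 < τ) (hT : Γ.IsTrace α B e T)
    (hG : IsBdryBasis α (Γ.len e) (a e) (κ e) Q G) :
    cameronMartin (fun t : Icc 0 (Γ.len e) => bridgeDeriv J τ α e T G 0 t) =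
      (Icc 0 (Γ.len e)).domRestrict '' {f | Γ.MemHdotZero a κ α e f} := by
  have hℓ := Γ.len_pos e
  simp only [h.memHdotZero_iff hco hα e]
  ext F
  constructor
  · rintro ⟨w, hw, rfl⟩
    obtain ⟨φ, ⟨f, hf, hφ⟩, rfl⟩ := (hT.mem_gaussianSpace_bridge h hco hα hτ hG w).1 hw
    exact ⟨_, hf.const_mul hℓ τ⁻¹, (hT.cmFun_bridge hα hf hφ).symm⟩
  · rintro ⟨f, hf, rfl⟩
    obtain ⟨_, -, hz⟩ := h.exists_zeroExt hco e
    have hf' := hf.const_mul hℓ τ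
    obtain ⟨φ, hφ, -⟩ := hz _ hf'
    refine ⟨J φ, (hT.mem_gaussianSpace_bridge h hco hα hτ hG _).2 ⟨φ, ⟨_, hf', hφ⟩, rfl⟩, ?_⟩
    rw [hT.cmFun_bridge hα hf' hφ]
    simp only [inv_mul_cancel_left₀ hτ.ne']

/-- A variable `J φ` has Cameron–Martin function `τ⁻¹ B^α φ`. Its preimage is `τ⁻¹ φ`, and the
factor `τ²` compensates for the two scalings. -/
theorem inner_eq_edgeForm (h : Γ.IsHalfResolvent a κ B D) (hco : Γ.Coeff α a κ)
    (hα : 1 ≤ α) (hτ : 0 < τ) (hT : Γ.IsTrace α B e T)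
    (hG : IsBdryBasis α (Γ.len e) (a e) (κ e) Q G) {b : (ℝ → ℝ) → (ℝ → ℝ) → ℝ}
    (hb : Γ.IsEdgeForm a κ α e b) {w₁ w₂ : Lp ℝ 2 P}
    (hw₁ : w₁ ∈ gaussianSpace (fun t : Icc 0 (Γ.len e) => bridgeDeriv J τ α e T G 0 t))
    (hw₂ : w₂ ∈ gaussianSpace (fun t : Icc 0 (Γ.len e) => bridgeDeriv J τ α e T G 0 t))
    {f₁ f₂ : ℝ → ℝ} (hf₁ : Γ.MemHdotZero a κ α e f₁) (hf₂ : Γ.MemHdotZero a κ α e f₂)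
    (h₁ : (Icc 0 (Γ.len e)).domRestrict f₁ =
      cmFun (fun t : Icc 0 (Γ.len e) => bridgeDeriv J τ α e T G 0 t) w₁)
    (h₂ : (Icc 0 (Γ.len e)).domRestrict f₂ =
      cmFun (fun t : Icc 0 (Γ.len e) => bridgeDeriv J τ α e T G 0 t) w₂) :
    ⟪w₁, w₂⟫_ℝ = τ ^ 2 * b f₁ f₂ := by
  have key : ∀ {w : Lp ℝ 2 P} {f : ℝ → ℝ},
      w ∈ gaussianSpace (fun t : Icc 0 (Γ.len e) => bridgeDeriv J τ α e T G 0 t) →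
      (Icc 0 (Γ.len e)).domRestrict f =
        cmFun (fun t : Icc 0 (Γ.len e) => bridgeDeriv J τ α e T G 0 t) w →
      ∃ φ, J φ = w ∧ Γ.IsZeroExt e ((B ^ α) (τ⁻¹ • φ)) f := by
    intro w f hw hf
    obtain ⟨φ, ⟨g, hg, hφ⟩, rfl⟩ := (hT.mem_gaussianSpace_bridge h hco hα hτ hG w).1 hw
    refine ⟨φ, rfl, ?_⟩
    rw [hT.cmFun_bridge hα hg hφ] at hf
    rw [map_smul]
    refine (hφ.const_smul τ⁻¹).congr ?_
    filter_upwards [ae_restrict_mem measurableSet_Icc] with t ht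
    exact (congrFun hf ⟨t, ht⟩).symm
  obtain ⟨φ₁, rfl, hφ₁⟩ := key hw₁ h₁
  obtain ⟨φ₂, rfl, hφ₂⟩ := key hw₂ h₂
  rw [h.memHdotZero_iff hco hα e] at hf₁ hf₂
  rw [h.edgeForm_eq hco hα hb hf₁ hf₂ hφ₁ hφ₂, J.inner_map_map, inner_smul_left, inner_smul_right,
    conj_trivial]
  field_simp

/-- The law of the bridge field depends on the edge only. -/
theorem isBridgeLaw (hJ : IsGaussianIsometry J) (h : Γ.IsHalfResolvent a κ B D)
    (hco : Γ.Coeff α a κ) (hα : 1 ≤ α) (hT : Γ.IsTrace α B e T)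
    (hG : IsBdryBasis α (Γ.len e) (a e) (κ e) Q G) :
    IsBridgeLaw α τ (Γ.len e) (a e) (κ e)
      (P.map fun ω (t : Icc 0 (Γ.len e)) => (bridgeDeriv J τ α e T G 0 t : Ω → ℝ) ω) := by
  have hℓ := Γ.len_pos e
  have hm : ∀ t, Measurable (bridgeDeriv J τ α e T G 0 t : Ω → ℝ) := fun t =>
    (Lp.stronglyMeasurable _).measurable
  have hmp : Measurable fun ω (t : Icc 0 (Γ.len e)) => (bridgeDeriv J τ α e T G 0 t : Ω → ℝ) ω :=
    measurable_pi_lambda _ fun t => hm t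
  refine ⟨isGaussianProcess_map (hJ.isGaussianProcess fun t : Icc 0 (Γ.len e) =>
    τ⁻¹ • Γ.bridgeElt α e T G 0 t) fun t => hm t, fun t => ?_, fun s => ?_⟩
  · rw [integral_map hmp.aemeasurable (measurable_pi_apply t).aestronglyMeasurable]
    exact hJ.mean _
  · obtain ⟨f, hf, hφ⟩ := hT.bridgeElt_mem h hco hα hG s.2
    -- The covariance section at `s` is `τ⁻²` times the function `f` represented by the bridge
    -- element at `s`. Pairing that element with the preimage of `q_0` evaluates `q_0` at `s`, which
    -- is the reproducing property.
    refine ⟨_, hf.const_mul hℓ (τ⁻¹ ^ 2), fun t => ?_, fun q hq => ?_⟩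
    · have hst : Measurable fun x : Icc 0 (Γ.len e) → ℝ => x s * x t :=
        (measurable_pi_apply s).mul (measurable_pi_apply t)
      refine (integral_map hmp.aemeasurable hst.aestronglyMeasurable).trans ?_
      refine (inner_lp_eq (bridgeDeriv J τ α e T G 0 s) (bridgeDeriv J τ α e T G 0 t)).symm.trans ?_
      rw [bridgeDeriv, fieldDeriv, fieldDeriv, J.inner_map_map, inner_smul_left, inner_smul_right,
        conj_trivial, real_inner_comm, hT.inner_bridgeElt_of_zeroExt hα hf hφ t.2]
      ring
    · have hη := isZeroExt_edgeExt e (f := q (2 * α)) hq.1.top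
      simp only [mul_assoc]
      rw [intervalIntegral.integral_const_mul, ← h.inner_core hη hφ.1.symm,
        hT.inner_bridgeElt_of_zeroExt hα ((hco.2 e).memSobolevZero_of_coreChain hℓ hq)
          (h.core_zeroExt hco hq hη) s.2]

end IsTrace

end MetricGraph

/-! ### Coefficients equal on the edge up to null sets, and the choice of `ν` -/

section CoefficientChange

variable {α : ℕ} {τ ℓ : ℝ} {a κ a' κ' : ℝ → ℝ}

theorem IsBdryBasis.congr_coeff {Q G : BdryIndex α → ℕ → ℝ → ℝ} (ha : EqOn a a' (Icc 0 ℓ))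
    (hκ : κ =ᵐ[edgeVol ℓ] κ') (h : IsBdryBasis α ℓ a κ Q G) : IsBdryBasis α ℓ a' κ' Q G :=
  ⟨fun j => (h.quasi j).congr_coeff ha hκ, h.top, h.sob, h.zero, h.data⟩

theorem IsBridgeLaw.congr_coeff {ν : Measure (Icc (0 : ℝ) ℓ → ℝ)} (ha : EqOn a a' (Icc 0 ℓ))
    (hκ : κ =ᵐ[edgeVol ℓ] κ') (h : IsBridgeLaw α τ ℓ a κ ν) : IsBridgeLaw α τ ℓ a' κ' ν :=
  ⟨h.gaussian, h.mean, fun s => by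
    obtain ⟨f, hf, hK, hq⟩ := h.kernel s
    exact ⟨f, hf, hK, fun q hc => hq q ⟨hc.1.congr_coeff ha.symm hκ.symm, hc.2⟩⟩⟩

/-- There is a measure which is the law of the bridge field as soon as this law exists. -/
theorem exists_bridgeLaw (hα : 1 ≤ α) (hℓ : 0 < ℓ) (hco : EdgeCoeff α ℓ a κ) :
    ∃ ν : Measure (Icc (0 : ℝ) ℓ → ℝ), ∀ μ, IsBridgeLaw α τ ℓ a κ μ → μ = ν := by
  by_cases h : ∃ ν, IsBridgeLaw α τ ℓ a κ ν
  · exact ⟨h.choose, fun μ hμ => hμ.unique hα hℓ hco h.choose_spec⟩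
  · exact ⟨0, fun μ hμ => (h ⟨μ, hμ⟩).elim⟩

end CoefficientChange

/-! ### Decomposition, independence and conditional law -/

namespace MetricGraph

variable {V E : Type*} {Γ : MetricGraph V E} {α : ℕ} {a κ : E → ℝ → ℝ} [Fintype E]
  {B : Γ.L2 →L[ℝ] Γ.L2} {D : (e : E) → Γ.L2 →L[ℝ] Lp ℝ 2 (edgeVol (Γ.len e))}
  {Ω : Type*} [MeasurableSpace Ω] {P : Measure Ω} {τ : ℝ} {W : Γ.L2 → Ω → ℝ}
  {u : E → ℝ → Ω → ℝ} {J : Γ.L2 →ₗᵢ[ℝ] Lp ℝ 2 P} {e : E} {T : ℕ → ℝ → Γ.L2}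
  {Q G : BdryIndex α → ℕ → ℝ → ℝ}

/-- The decomposition of the field into the bridge field and the boundary data. -/
theorem IsWhittleMatern.ae_eq_bridge_add [IsProbabilityMeasure P] (h : Γ.IsHalfResolvent a κ B D)
    (hco : Γ.Coeff α a κ) (hα : 1 ≤ α) (hτ : 0 < τ) (hu : Γ.IsWhittleMatern a κ τ α P W u)
    (hJ : ∀ φ, J φ =ᵐ[P] W φ) (hT : Γ.IsTrace α B e T) {t : ℝ} (ht : t ∈ Icc 0 (Γ.len e)) :
    u e t =ᵐ[P] fun ω => bridgeDeriv J τ α e T G 0 t ω +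
      ∑ j, G j 0 t * (bdryVec α (Γ.len e) (fieldDeriv J τ T) j : Ω → ℝ) ω := by
  refine (coeFn_toL2 (hu.memLp e t ht)).symm.trans ?_
  rw [hu.toL2_eq h hco hα hτ hJ hT ht]
  exact fieldDeriv_zero_ae_eq t

theorem indep_bridge [Finite V] (hJ : IsGaussianIsometry J) (h : Γ.IsHalfResolvent a κ B D)
    (hco : Γ.Coeff α a κ) (hα : 1 ≤ α) (hT : Γ.IsTrace α B e T)
    (hG : IsBdryBasis α (Γ.len e) (a e) (κ e) Q G) :
    Indep (⨆ t : Icc 0 (Γ.len e),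
        MeasurableSpace.comap (bridgeDeriv J τ α e T G 0 t : Ω → ℝ) inferInstance)
      (innerSigma α (Γ.len e) (fieldDeriv J τ T)) P := by
  have h1 := (IndepFun_iff_Indep _ _ _).1 (hT.indepFun_bridge (τ := τ) hJ h hco hα hG)
  refine indep_of_indep_of_le_right (indep_of_indep_of_le_left h1 (iSup_le fun t => ?_))
    (innerSigma_le _ _)
  exact comap_apply_le (fun t : Icc 0 (Γ.len e) => (bridgeDeriv J τ α e T G 0 t : Ω → ℝ)) t

/-- The conditional law of the field given the boundary data. -/
theorem condDistrib_eq [Finite V] [IsProbabilityMeasure P] (hJ : IsGaussianIsometry J)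
    (h : Γ.IsHalfResolvent a κ B D) (hco : Γ.Coeff α a κ) (hα : 1 ≤ α) (hτ : 0 < τ)
    (hu : Γ.IsWhittleMatern a κ τ α P W u) (hJW : ∀ φ, J φ =ᵐ[P] W φ)
    (hT : Γ.IsTrace α B e T) (hG : IsBdryBasis α (Γ.len e) (a e) (κ e) Q G)
    {n : ℕ} (t : Fin n → Icc 0 (Γ.len e)) :
    ∀ᵐ y ∂(P.map (fun ω j => (bdryVec α (Γ.len e) (fieldDeriv J τ T) j : Ω → ℝ) ω)),
      condDistrib (fun ω i => u e (t i) ω)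
        (fun ω j => (bdryVec α (Γ.len e) (fieldDeriv J τ T) j : Ω → ℝ) ω) P y =
      (P.map fun ω (t : Icc 0 (Γ.len e)) => (bridgeDeriv J τ α e T G 0 t : Ω → ℝ) ω).map
        (fun x i => x (t i) + ∑ j, G j 0 (t i) * y j) := by
  have hX : Measurable fun ω (t : Icc 0 (Γ.len e)) => (bridgeDeriv J τ α e T G 0 t : Ω → ℝ) ω :=
    measurable_pi_lambda _ fun t => (Lp.stronglyMeasurable _).measurable
  have hY : Measurable fun ω (j : BdryIndex α) =>
      (bdryVec α (Γ.len e) (fieldDeriv J τ T) j : Ω → ℝ) ω :=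
    measurable_pi_lambda _ fun t => (Lp.stronglyMeasurable _).measurable
  have hF : Measurable fun (p : (BdryIndex α → ℝ) × (Icc 0 (Γ.len e) → ℝ)) (i : Fin n) =>
      p.2 (t i) + ∑ j, G j 0 (t i) * p.1 j := by
    fun_prop
  rw [condDistrib_congr_left (Y' := fun ω i => (bridgeDeriv J τ α e T G 0 (t i) : Ω → ℝ) ω +
    ∑ j, G j 0 (t i) * (bdryVec α (Γ.len e) (fieldDeriv J τ T) j : Ω → ℝ) ω)]
  · exact condDistrib_of_indepFun hX hY (hT.indepFun_bridge hJ h hco hα hG) hF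
  · have h1 := ae_all_iff.2 fun i => hu.ae_eq_bridge_add (G := G) h hco hα hτ hJW hT (t i).2
    filter_upwards [h1] with ω hω
    exact funext hω

end MetricGraph

end GraphField

end

/-! ### The theorem -/

open GraphField in
theorem mainTheorem5 (α : ℕ) (hα : 1 ≤ α) (τ : ℝ) (hτ : 0 < τ) (ℓ : ℝ) (hℓ : 0 < ℓ)
    (a₀ κ₀ : ℝ → ℝ) (hcoeff₀ : EdgeCoeff α ℓ a₀ κ₀) :
    -- `G` and the law `ν` of the bridge field depend only on `α`, `τ` and the data of the edge
    ∃ (G : BdryIndex α → ℝ → ℝ) (ν : Measure (Icc (0 : ℝ) ℓ → ℝ)),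
      (∀ j, MemSobolev α ℓ (G j) ∧ EdgePow ℓ a₀ κ₀ α (G j) (fun _ => 0) ∧
        bdryData α ℓ (G j) = Pi.single j 1) ∧
      LinearIndependent ℝ (fun j => (Icc (0 : ℝ) ℓ).domRestrict (G j)) ∧
      ∀ (V E : Type*) [Finite V] [Fintype E] (Γ : MetricGraph V E) (a κ : E → ℝ → ℝ)
        (_ : Γ.Coeff α a κ) (e : E) (_ : Γ.len e = ℓ) (_ : EqOn (a e) a₀ (Icc 0 ℓ))
        (_ : κ e =ᵐ[volume.restrict (Icc 0 ℓ)] κ₀)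
        (Ω : Type*) [MeasurableSpace Ω] (P : Measure Ω) [IsProbabilityMeasure P]
        (W : Γ.L2 → Ω → ℝ) (_ : Γ.IsWhiteNoise P W)
        (u : E → ℝ → Ω → ℝ) (_ : Γ.IsWhittleMatern a κ τ α P W u),
        -- `D` are the weak derivatives of `u` along `e`; `v` is the bridge field
        ∃ (D : ℕ → ℝ → Lp ℝ 2 P) (v : ℝ → Lp ℝ 2 P) (Dv : ℕ → ℝ → Lp ℝ 2 P),
          HasWeakDerivs (Γ.fieldSpace P u) ℓ (α - 1) (fun t => toL2 P (u e t)) D ∧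
          -- the representation
          (∀ t ∈ Icc 0 ℓ, ∀ᵐ ω ∂P,
            u e t ω = v t ω + ∑ j, G j t * (bdryVec α ℓ D j : Ω → ℝ) ω) ∧
          -- the boundary vector is measurable for the inner boundary `σ`-algebra
          (∀ j, Measurable[innerSigma α ℓ D] (bdryVec α ℓ D j : Ω → ℝ)) ∧
          -- `v` is a centred Gaussian field with law `ν`
          IsGaussianProcess (fun (t : Icc (0 : ℝ) ℓ) => (v t : Ω → ℝ)) P ∧
          (∀ t ∈ Icc 0 ℓ, ∫ ω, v t ω ∂P = 0) ∧
          P.map (fun ω (t : Icc (0 : ℝ) ℓ) => v t ω) = ν ∧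
          -- its Cameron–Martin space, as a set and with its inner product
          cameronMartin (fun t : Icc (0 : ℝ) ℓ => v t) =
            (Icc (0 : ℝ) ℓ).domRestrict '' {f | Γ.MemHdotZero a κ α e f} ∧
          (∃ b, Γ.IsEdgeForm a κ α e b) ∧
          (∀ b, Γ.IsEdgeForm a κ α e b →
            ∀ w₁ ∈ gaussianSpace (fun t : Icc (0 : ℝ) ℓ => v t),
            ∀ w₂ ∈ gaussianSpace (fun t : Icc (0 : ℝ) ℓ => v t),
            ∀ f₁ f₂ : ℝ → ℝ, Γ.MemHdotZero a κ α e f₁ → Γ.MemHdotZero a κ α e f₂ →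
              (Icc (0 : ℝ) ℓ).domRestrict f₁ = cmFun (fun t : Icc (0 : ℝ) ℓ => v t) w₁ →
              (Icc (0 : ℝ) ℓ).domRestrict f₂ = cmFun (fun t : Icc (0 : ℝ) ℓ => v t) w₂ →
              inner ℝ w₁ w₂ = τ ^ 2 * b f₁ f₂) ∧
          -- independence of the inner boundary data
          Indep (⨆ t : Icc (0 : ℝ) ℓ, MeasurableSpace.comap (v t : Ω → ℝ) inferInstance)
            (innerSigma α ℓ D) P ∧
          -- weak differentiability and zero boundary data
          HasWeakDerivs (Γ.fieldSpace P u) ℓ (α - 1) v Dv ∧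
          (∀ j, bdryVec α ℓ Dv j = 0) ∧
          -- the conditional law of `u` on the edge given the inner boundary data
          (∀ (n : ℕ) (t : Fin n → Icc (0 : ℝ) ℓ),
            ∀ᵐ y ∂(P.map (fun ω j => (bdryVec α ℓ D j : Ω → ℝ) ω)),
              condDistrib (fun ω i => u e (t i) ω)
                  (fun ω j => (bdryVec α ℓ D j : Ω → ℝ) ω) P y =
                ν.map (fun x i => x (t i) + ∑ j, G j (t i) * y j)) := by
  obtain ⟨Q, G, hG⟩ := hcoeff₀.exists_isBdryBasis hα hℓ
  -- `ν` is fixed before any graph or field is given. Uniqueness of the bridge law is enough: if no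
  -- such law existed, no field could contradict the default value.
  obtain ⟨ν, hν⟩ := exists_bridgeLaw (τ := τ) hα hℓ hcoeff₀
  have hGs : ∀ j, MemSobolev α ℓ (G j 0) := fun j => memSobolev_iff.2 ⟨_, hG.sob j, rfl⟩
  refine ⟨fun j => G j 0, ν, fun j => ⟨hGs j, ?_, hG.data j⟩,
    linearIndependent_of_bdryData hℓ hGs hG.data, ?_⟩
  · rw [hcoeff₀.edgePow_iff hℓ ((hGs j).continuousOn hα |> ContinuousOn.memLp_two_edge)]
    exact ⟨Q j, hG.quasi j, (hG.zero j).symm, Eventually.of_forall (congrFun (hG.top j))⟩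
  intro V E _ _ Γ a κ hco e hlen ha hκ Ω _ P _ W hW u hu
  subst hlen
  -- The basis was chosen for `a₀` and `κ₀`; the coefficients on the graph agree with them on the
  -- interval, for `κ` almost everywhere, so it serves there too.
  have hGe := hG.congr_coeff ha.symm hκ.symm
  obtain ⟨J, hJ, hJW⟩ := hW.exists_isometry
  obtain ⟨B, D, h⟩ := MetricGraph.exists_halfResolvent hco e
  obtain ⟨T, hT⟩ := h.exists_trace hco e
  have hT : Γ.IsTrace α B e T := hT
  have hS := hu.mem_fieldSpace h hco hα hτ hJW
  -- The law obtained on this graph is a bridge law for the reference coefficients as well, and is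
  -- therefore the measure chosen beforehand.
  have hlaw : P.map (fun ω (t : Icc 0 (Γ.len e)) =>
      (MetricGraph.bridgeDeriv J τ α e T G 0 t : Ω → ℝ) ω) = ν :=
    hν _ ((hT.isBridgeLaw hJ h hco hα hGe).congr_coeff ha hκ)
  refine ⟨MetricGraph.fieldDeriv J τ T, MetricGraph.bridgeDeriv J τ α e T G 0,
    MetricGraph.bridgeDeriv J τ α e T G,
    hT.hasWeakDerivs_fieldDeriv h hco hα hS fun t ht => (hu.toL2_eq h hco hα hτ hJW hT ht).symm,
    fun t ht => hu.ae_eq_bridge_add h hco hα hτ hJW hT ht,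
    fun j => MetricGraph.measurable_bdryVec _ _ j,
    hJ.isGaussianProcess _, fun t _ => hJ.mean _, hlaw,
    hT.cameronMartin_bridge h hco hα hτ hGe, h.exists_edgeForm hco hα e,
    fun b hb w₁ hw₁ w₂ hw₂ f₁ f₂ hf₁ hf₂ h₁ h₂ =>
      hT.inner_eq_edgeForm h hco hα hτ hGe hb hw₁ hw₂ hf₁ hf₂ h₁ h₂,
    MetricGraph.indep_bridge hJ h hco hα hT hGe, hT.hasWeakDerivs_bridgeDeriv h hco hα hGe hS,
    hT.bdryVec_bridgeDeriv h hco hGe, fun n t => ?_⟩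
  rw [← hlaw]
  exact MetricGraph.condDistrib_eq hJ h hco hα hτ hu hJW hT hGe t
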